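/- **Setting.** Let $T$ be a string of length $n$ over a linearly ordered alphabet whose smallest character $\$$ occurs in $T$ exactly once, at the end. For $1\le\delta\le n$ let $T_\delta$ be the suffix of $T$ of length $\delta$, let $x_1,\dots,x_\delta$ be the starting positions of the suffixes of $T_\delta$ in lexicographic order, and let $L_\delta[i]=T_\delta[x_i-1]$ (the BWT, with $T_\delta[0]:=T_\delta[\delta]=\$$) and $F_\delta[i]=T_\delta[x_i]$. The function $\mathsf{LF}_\delta$ is given by $\mathsf{LF}_\delta(i)=j$ iff $x_j=x_i-1$, or $x_i=1$ and $x_j=\delta$. A *DBWT* $D$ of $L_\delta$ is a division of $L_\delta$ into $k$ nonempty substrings $L_\delta[p_i..p_{i+1}-1]$, $1=p_1<\dots<p_{k+1}=\delta+1$ (the DBWT-repetitions), each consisting of equal characters. The $i$-th *F-interval* is $[\mathsf{LF}_\delta(p_i),\mathsf{LF}_\delta(p_{i+1}-1)]$. A DBWT-repetition is *$\alpha$-heavy* if $[p_i,p_{i+1}-1]$ contains at least $\alpha$ starting positions of F-intervals; an F-interval is *$\alpha$-heavy* if it contains at least $\alpha$ of the positions $p_1,\dots,p_k$. $D$ is *$\alpha$-balanced*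 if it has neither $\alpha$-heavy DBWT-repetitions nor $\alpha$-heavy F-intervals. The *LF-interval graph* of $D$ has nodes $u_1,\dots,u_k$ (the repetitions) and $v_1,\dots,v_k$ (the F-intervals), both $u_i$ and $v_i$ being labelled with the character and the length of the repetition and of the corresponding interval of $F_\delta$; undirected edges $\{u_i,v_i\}$; a directed edge from $u_i$ to $v_j$, labelled $p_i-\mathsf{LF}_\delta(p_j)$, whenever the $j$-th F-interval contains $p_i$; and a directed edge from $v_j$ to $u_i$, labelled $\mathsf{LF}_\delta(p_j)-p_i$, whenever the $i$-th repetition contains $\mathsf{LF}_\delta(p_j)$. It is stored, for a parameter $\alpha$, by node records (label, undirected edge, outgoing directed edge with its label, list of incoming directed edges), a doubly linked list of the $u_i$ in the order of $p_i$ and one of the $v_i$ in the order of $\mathsf{LF}_\delta(p_i)$, a pointer to the node labelled $(\$,1)$, an order maintenance structure for the list of the $u_i$, a B-tree of the $v_i$ with keys (character of $u_i$, place of $u_i$ in the list), and two arrays with the $\alpha$-heavy DBWT-repetitions and the $\alpha$-heavy F-intervals. **The update operation** with input character $c$ acts on such a store as follows. (I) Replace node: the node $u_i$ labelled $(\$,1)$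 is replaced in its list by $u_{i'}$ labelled $(c,1)$; $v_i$ is removed, and $v_{i'}$ labelled $(c,1)$ is inserted next to the last node $v_g$ whose key is smaller than $(c,u_i)$, which is found with the B-tree. (II) Split node: if the node $v_{\mathsf{gnext}}$ that was next to $v_g$ exists and its directed edge, to $u_j$ say, has label $e>0$, then $u_j$ is replaced by two consecutive nodes of lengths $e$ and $|u_j|-e$ with the same character, and $v_j$ likewise. (III) Insert node: a node labelled $(\$,1)$ is inserted into the list of the $u$'s, between the two parts of $u_j$ if there was a split, else at the end if $v_{\mathsf{gnext}}$ does not exist, else just before the head of the edge of $v_{\mathsf{gnext}}$; its partner, labelled $(\$,1)$, is inserted at the front of the list of the $v$'s. (IV) Update edge: the edges at removed nodes are removed, and the directed edges starting at new nodes and at the tails of removed edges are created with their labels. Finally the order maintenance structure, the B-tree and the two arrays are updated. Time is counted in elementary steps (access to a component of the store or to a field of a record, a step along a list of incoming edges, a comparison of two characters, the visit of a node of the B-tree, and each of the order, insertion and deletion operations of the order maintenance structure being one step). **Theorem.** There is an absolute constant $C$ such that the following holds. Let $\alpha\ge 2$ be an integer and $1\le\delta<n$, let $c=T[n-\delta]$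 be the first character of $T_{\delta+1}$, and suppose that the store holds the LF-interval graph of an $\alpha$-balanced DBWT of $L_\delta$ with $k$ DBWT-repetitions. Then (i) the update operation with character $c$ takes at most $C(\alpha+\log_2 k)$ steps, i.e. $O(\alpha+\log k)$ time; (ii) afterwards the store holds the LF-interval graph of a $(2\alpha+1)$-balanced DBWT of $L_{\delta+1}$ that has at most two $\alpha$-heavy DBWT-repetitions and at most two $\alpha$-heavy F-intervals. -/

import Mathlib

/-! ## Strings, suffixes, BWT and LF function

The alphabet is a linearly ordered type `A` with a least element `⊥`, the special character `$`.
All positions are counted from `0` (so position `i` here is position `i + 1` in 1-based counting);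
differences of positions, which are what the labels of the graph store, are unaffected. -/

/-- `$` occurs at the end of `T` and nowhere else. -/
def EndMarked {A : Type} [LinearOrder A] [OrderBot A] (T : List A) : Prop :=
  ∃ w : List A, T = w ++ [⊥] ∧ ⊥ ∉ w

/-- The suffix `T_δ` of length `δ` (for `δ ≤ |T|`). -/
def sufOf {A : Type} (T : List A) (δ : ℕ) : List A := T.drop (T.length - δ)

/-- The starting positions `x₁, x₂, …` of the suffixes of `S` in lexicographic order. -/
def sufArr {A : Type} [LinearOrder A] (S : List A) : List ℕ :=
  (List.range S.length).insertionSort (fun i j => S.drop i ≤ S.drop j)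

/-- The BWT `L` of `S`: the characters preceding the sorted suffixes, the last character of `S`
preceding the whole of `S`. -/
def bwt {A : Type} [LinearOrder A] [OrderBot A] (S : List A) : List A :=
  (sufArr S).map fun x => if x = 0 then S.getD (S.length - 1) ⊥ else S.getD (x - 1) ⊥

/-- The string `F` of the first characters of the sorted suffixes of `S`. -/
def firstCol {A : Type} [LinearOrder A] [OrderBot A] (S : List A) : List A :=
  (sufArr S).map fun x => S.getD x ⊥

/-- The LF function: `LF i = j` iff `x_i - 1 = x_j`, or `x_i` is the first and `x_j` the last
position of `S`. -/
def LF {A : Type} [LinearOrder A] (S : List A) (i : ℕ) : ℕ :=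
  let x := (sufArr S).getD i 0
  (sufArr S).idxOf (if x = 0 then S.length - 1 else x - 1)

/-! ## DBWT -/

/-- `D` is a DBWT of the string `L`: a division of `L` into nonempty repetitions of one
character. -/
def IsDBWT {A : Type} (L : List A) (D : List (List A)) : Prop :=
  D.flatten = L ∧ ∀ P ∈ D, P ≠ [] ∧ ∃ a, ∀ b ∈ P, b = a

/-- The starting position `p_i` of the `i`-th repetition of `D`; `posOf D D.length` is the
position after the last character. -/
def posOf {A : Type} (D : List (List A)) (i : ℕ) : ℕ := (D.take i).flatten.length

/-- The set of positions of the `i`-th DBWT-repetition, `[p_i, p_{i+1} - 1]`. -/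
def repInt {A : Type} (D : List (List A)) (i : ℕ) : Finset ℕ :=
  Finset.Icc (posOf D i) (posOf D (i + 1) - 1)

/-- The `i`-th F-interval `[LF(p_i), LF(p_{i+1} - 1)]`. -/
def fInt {A : Type} [LinearOrder A] (S : List A) (D : List (List A)) (i : ℕ) : Finset ℕ :=
  Finset.Icc (LF S (posOf D i)) (LF S (posOf D (i + 1) - 1))

/-- The `i`-th DBWT-repetition covers at least `α` starting positions of F-intervals. -/
def HeavyRep {A : Type} [LinearOrder A] (α : ℕ) (S : List A) (D : List (List A))
    (i : Fin D.length) : Prop :=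
  α ≤ (Finset.univ.filter fun j : Fin D.length => LF S (posOf D j) ∈ repInt D i).card

/-- The `i`-th F-interval covers at least `α` starting positions of DBWT-repetitions. -/
def HeavyFInt {A : Type} [LinearOrder A] (α : ℕ) (S : List A) (D : List (List A))
    (i : Fin D.length) : Prop :=
  α ≤ (Finset.univ.filter fun j : Fin D.length => posOf D j ∈ fInt S D i).card

/-- The DBWT `D` of the BWT of `S` is `α`-balanced. -/
def IsBalanced {A : Type} [LinearOrder A] (α : ℕ) (S : List A) (D : List (List A)) : Prop :=
  ∀ i : Fin D.length, ¬ HeavyRep α S D i ∧ ¬ HeavyFInt α S D i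

/-! ## The LF-interval graph -/

/-- A bipartite labelled graph on `U = {u_i}` and `V = {v_i}`, `i : Fin k`. The labels `BL i j` and
`BF j i` matter only where `EL i j` and `EF j i` hold, respectively. -/
structure LFIntervalGraph (A : Type) (k : ℕ) where
  /-- undirected edges between `u_i` and `v_j` -/
  ELF : Fin k → Fin k → Prop
  /-- directed edges from `u_i` to `v_j` -/
  EL : Fin k → Fin k → Prop
  /-- directed edges from `v_j` to `u_i` (first argument `j`) -/
  EF : Fin k → Fin k → Prop
  BU : Fin k → A × ℕ
  BV : Fin k → A × ℕ
  BL : Fin k → Fin k → ℕ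
  BF : Fin k → Fin k → ℕ

/-- The LF-interval graph of the DBWT `D` of the BWT of `S`. -/
def Grp {A : Type} [LinearOrder A] [OrderBot A] (S : List A) (D : List (List A)) :
    LFIntervalGraph A D.length where
  ELF i j := i = j
  EL i j := posOf D i ∈ fInt S D j
  EF j i := LF S (posOf D j) ∈ repInt D i
  BU i := ((bwt S).getD (posOf D i) ⊥, posOf D (i + 1) - posOf D i)
  BV i := ((firstCol S).getD (LF S (posOf D i)) ⊥,
    LF S (posOf D (i + 1) - 1) - LF S (posOf D i) + 1)
  BL i j := posOf D i - LF S (posOf D j)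
  BF j i := LF S (posOf D j) - posOf D i

/-! ## The store: dynamic data structures holding an LF-interval graph -/

/-- The two sides of the bipartite graph. -/
inductive Side where
  | U
  | V
  deriving DecidableEq

/-- The opposite side. -/
def Side.other : Side → Side
  | .U => .V
  | .V => .U

/-- The record of a node: its label, its neighbours in the doubly linked list of its side, the node
joined to it by an undirected edge, the head and the label of the directed edge starting at it, and
the list of the tails of the directed edges pointing to it. -/
structure Cell (A : Type) where
  chr : A
  len : ℕ
  prev : Option ℕ
  next : Option ℕ
  lf : ℕ
  head : ℕ
  off : ℕ
  inn : List ℕ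

/-- The content of an unused record. -/
def Cell.blank {A : Type} [LinearOrder A] [OrderBot A] : Cell A := ⟨⊥, 0, none, none, 0, 0, 0, []⟩

/-- The B-tree of order 3, i.e. 2-3 trees. -/
inductive BTree (β : Type) where
  | leaf : BTree β
  | n2 : BTree β → β → BTree β → BTree β
  | n3 : BTree β → β → BTree β → β → BTree β → BTree β

/-- The entries of a tree from left to right. -/
def BTree.inorder {β : Type} : BTree β → List β
  | .leaf => []
  | .n2 l a r => l.inorder ++ a :: r.inorder
  | .n3 l a m b r => l.inorder ++ a :: (m.inorder ++ b :: r.inorder)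

/-- All leaves of the tree have the given depth. -/
def BTree.Uniform {β : Type} : ℕ → BTree β → Prop
  | 0, .leaf => True
  | h + 1, .n2 l _ r => l.Uniform h ∧ r.Uniform h
  | h + 1, .n3 l _ m _ r => l.Uniform h ∧ m.Uniform h ∧ r.Uniform h
  | _, _ => False

/-- An entry of the B-tree of `V`: the node `v` together with its key `(u, chr)`. -/
structure Entry (A : Type) where
  v : ℕ
  u : ℕ
  chr : A

/-- A store: the records of the nodes, addressed by natural numbers, separately for `U` and `V`; the
first and last elements of the two doubly linked lists; the node labelled `($, 1)`; the next unused
address; the order maintenance structure for `U`, given by the list whose order it maintains; the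
B-tree of `V`; and the two arrays of heavy nodes. -/
structure Store (A : Type) where
  mem : Side → ℕ → Cell A
  first : Side → Option ℕ
  last : Side → Option ℕ
  dollar : ℕ
  fresh : ℕ
  om : List ℕ
  tree : BTree (Entry A)
  heavy : Side → List ℕ

/-- On side `s`, the doubly linked list runs through the addresses `x 0, x 1, …, x (k - 1)`. -/
def Linked {A : Type} (σ : Store A) (s : Side) {k : ℕ} (x : Fin k → ℕ) : Prop :=
  σ.first s = (List.ofFn x)[0]? ∧
  σ.last s = (List.ofFn x).getLast? ∧
  ∀ i : Fin k,
    (σ.mem s (x i)).next = (List.ofFn x)[(i : ℕ) + 1]? ∧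
    (σ.mem s (x i)).prev = if (i : ℕ) = 0 then none else (List.ofFn x)[(i : ℕ) - 1]?

/-- The store `σ` holds the LF-interval graph of the DBWT `D` of the BWT of `S`, with its data
structures for the parameter `α`: the node `u_i` has address `u i`, the node `v_i` has address `v i`,
and `π` is the order of the F-intervals by starting position. -/
structure HoldsAt {A : Type} [LinearOrder A] [OrderBot A] (α : ℕ) (S : List A) (D : List (List A))
    (σ : Store A) (u v : Fin D.length → ℕ) (π : Equiv.Perm (Fin D.length)) : Prop where
  inj_u : Function.Injective u
  inj_v : Function.Injective v
  lt_fresh : ∀ i, u i < σ.fresh ∧ v i < σ.fresh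
  blank_u : ∀ x, (∀ i, u i ≠ x) → σ.mem .U x = Cell.blank
  blank_v : ∀ x, (∀ i, v i ≠ x) → σ.mem .V x = Cell.blank
  -- the node labels
  label_u : ∀ i, ((σ.mem .U (u i)).chr, (σ.mem .U (u i)).len) = (Grp S D).BU i
  label_v : ∀ i, ((σ.mem .V (v i)).chr, (σ.mem .V (v i)).len) = (Grp S D).BV i
  -- the undirected edges
  lf_u : ∀ i j, (Grp S D).ELF i j ↔ (σ.mem .U (u i)).lf = v j
  lf_v : ∀ i j, (Grp S D).ELF i j ↔ (σ.mem .V (v j)).lf = u i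
  -- the directed edges from `U` to `V`, stored at the tail and at the head, and their labels
  el_tail : ∀ i, ∃ j, (σ.mem .U (u i)).head = v j
  el : ∀ i j, (Grp S D).EL i j ↔ (σ.mem .U (u i)).head = v j
  bl : ∀ i j, (Grp S D).EL i j → (σ.mem .U (u i)).off = (Grp S D).BL i j
  el_nodup : ∀ j, (σ.mem .V (v j)).inn.Nodup
  el_head : ∀ j x, x ∈ (σ.mem .V (v j)).inn ↔ ∃ i, u i = x ∧ (Grp S D).EL i j
  -- the directed edges from `V` to `U`, stored at the tail and at the head, and their labels
  ef_tail : ∀ j, ∃ i, (σ.mem .V (v j)).head = u i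
  ef : ∀ j i, (Grp S D).EF j i ↔ (σ.mem .V (v j)).head = u i
  bf : ∀ j i, (Grp S D).EF j i → (σ.mem .V (v j)).off = (Grp S D).BF j i
  ef_nodup : ∀ i, (σ.mem .U (u i)).inn.Nodup
  ef_head : ∀ i x, x ∈ (σ.mem .U (u i)).inn ↔ ∃ j, v j = x ∧ (Grp S D).EF j i
  -- the doubly linked lists
  sorted : StrictMono fun i => LF S (posOf D (π i))
  list_u : Linked σ .U u
  list_v : Linked σ .V (v ∘ π)
  -- the node labelled with the special character
  dollar : ∃ i, u i = σ.dollar ∧ (Grp S D).BU i = (⊥, 1)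
  -- the order maintenance structure and the B-tree
  om : σ.om = List.ofFn u
  tree_shape : ∃ h, σ.tree.Uniform h
  tree_entries : σ.tree.inorder =
    List.ofFn fun i => ⟨v (π i), u (π i), ((Grp S D).BU (π i)).1⟩
  -- the arrays of the heavy nodes
  heavy_u_nodup : (σ.heavy .U).Nodup
  heavy_u : ∀ x, x ∈ σ.heavy .U ↔ ∃ i, u i = x ∧ HeavyRep α S D i
  heavy_v_nodup : (σ.heavy .V).Nodup
  heavy_v : ∀ x, x ∈ σ.heavy .V ↔ ∃ i, v i = x ∧ HeavyFInt α S D i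

/-- The store `σ` holds the LF-interval graph of the DBWT `D` of the BWT of `S`. -/
def Holds {A : Type} [LinearOrder A] [OrderBot A] (α : ℕ) (S : List A) (D : List (List A))
    (σ : Store A) : Prop :=
  ∃ (u v : Fin D.length → ℕ) (π : Equiv.Perm (Fin D.length)), HoldsAt α S D σ u v π

/-! ## Programs with a step count

A program transforms a store together with a step counter. The elementary operations below are the
only ones that access the store, and each of them is charged; between two of them a program performs
a bounded number of tests and arithmetic operations on values already read. In the B-tree every visited
node is charged. -/

/-- Programs that return a value of type `β`. -/
abbrev Prog (A : Type) (β : Type) : Type := StateM (Store A × ℕ) β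

/-- Charge `n` steps. -/
def tick {A : Type} (n : ℕ) : Prog A Unit := modify fun s => (s.1, s.2 + n)

/-- Read a component of the store (one step). -/
def readS {A : Type} {β : Type} (f : Store A → β) : Prog A β := do
  tick 1
  return f (← get).1

/-- Change a component of the store (one step). -/
def writeS {A : Type} (f : Store A → Store A) : Prog A Unit := do
  tick 1
  modify fun s => (f s.1, s.2)

/-- Read the record of a node. -/
def look {A : Type} (s : Side) (x : ℕ) : Prog A (Cell A) := readS fun σ => σ.mem s x

/-- Change the record of a node. -/
def change {A : Type} (s : Side) (x : ℕ) (f : Cell A → Cell A) : Prog A Unit :=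
  writeS fun σ =>
    { σ with mem := fun s' y => if s' = s ∧ y = x then f (σ.mem s x) else σ.mem s' y }

/-- Set the pointer to the first element of a list. -/
def setFirst {A : Type} (s : Side) (x : Option ℕ) : Prog A Unit :=
  writeS fun σ => { σ with first := Function.update σ.first s x }

/-- Set the pointer to the last element of a list. -/
def setLast {A : Type} (s : Side) (x : Option ℕ) : Prog A Unit :=
  writeS fun σ => { σ with last := Function.update σ.last s x }

/-- Take an unused address. -/
def newAddr {A : Type} : Prog A ℕ := do
  let x ← readS Store.fresh
  writeS fun σ => { σ with fresh := x + 1 }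
  return x

/-- Append a node to the array of heavy nodes. -/
def pushHeavy {A : Type} (s : Side) (x : ℕ) : Prog A Unit :=
  writeS fun σ => { σ with heavy := Function.update σ.heavy s (x :: σ.heavy s) }

/-- Delete `y` from the list of the tails of the edges pointing to `x`; this traverses the list. -/
def eraseIn {A : Type} (s : Side) (x y : ℕ) : Prog A Unit := do
  let c ← look s x
  tick c.inn.length
  change s x fun c => { c with inn := c.inn.erase y }

/-! ### Order maintenance: three operations, one step each -/

/-- The order operation: does `x` precede `y`? -/
def omLess {A : Type} (x y : ℕ) : Prog A Bool :=
  readS fun σ => decide (σ.om.idxOf x < σ.om.idxOf y)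

/-- The insertion operation: insert `x` right after `y`. -/
def omInsertAfter {A : Type} (y x : ℕ) : Prog A Unit :=
  writeS fun σ => { σ with om := σ.om.insertIdx (σ.om.idxOf y + 1) x }

/-- The deletion operation. -/
def omDelete {A : Type} (x : ℕ) : Prog A Unit :=
  writeS fun σ => { σ with om := σ.om.erase x }

/-! ### Doubly linked lists -/

/-- Insert `x` next to `y`. -/
def insertAfter {A : Type} (s : Side) (y x : ℕ) : Prog A Unit := do
  let c ← look s y
  change s x fun d => { d with prev := some y, next := c.next }
  change s y fun d => { d with next := some x }
  match c.next with
  | some z => change s z fun d => { d with prev := some x }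
  | none => setLast s (some x)

/-- Insert `x` previous to `y`. -/
def insertBefore {A : Type} (s : Side) (y x : ℕ) : Prog A Unit := do
  let c ← look s y
  change s x fun d => { d with prev := c.prev, next := some y }
  change s y fun d => { d with prev := some x }
  match c.prev with
  | some z => change s z fun d => { d with next := some x }
  | none => setFirst s (some x)

/-- Unlink `x` from its list. -/
def unlink {A : Type} (s : Side) (x : ℕ) : Prog A Unit := do
  let c ← look s x
  match c.prev with
  | some z => change s z fun d => { d with next := c.next }
  | none => setFirst s c.next
  match c.next with
  | some z => change s z fun d => { d with prev := c.prev }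
  | none => setLast s c.prev

/-! ### The B-tree of `V`: search, insertion and deletion -/

/-- Compare two keys: by character, then by the order of `U`. -/
def keyLess {A : Type} [LinearOrder A] (x y : Entry A) : Prog A Bool := do
  tick 1
  if x.chr < y.chr then return true
  else if y.chr < x.chr then return false
  else omLess x.u y.u

/-- The last entry whose key is smaller than that of `q` (`acc` if there is none). -/
def BTree.pred {A : Type} [LinearOrder A] (q : Entry A) :
    BTree (Entry A) → Option (Entry A) → Prog A (Option (Entry A))
  | .leaf, acc => do
    tick 1
    return acc
  | .n2 l a r, acc => do
    if ← keyLess a q then r.pred q (some a) else l.pred q acc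
  | .n3 l a m b r, acc => do
    if ← keyLess b q then r.pred q (some b)
    else if ← keyLess a q then m.pred q (some a)
    else l.pred q acc

/-- Result of an insertion into a subtree: a tree of the same height, or an overflow. -/
inductive InsRes (β : Type) where
  | same : BTree β → InsRes β
  | over : BTree β → β → BTree β → InsRes β

/-- Insertion into a subtree. -/
def BTree.ins {A : Type} [LinearOrder A] (x : Entry A) :
    BTree (Entry A) → Prog A (InsRes (Entry A))
  | .leaf => do
    tick 1
    return .over .leaf x .leaf
  | .n2 l a r => do
    if ← keyLess x a then
      match ← l.ins x with
      | .same l' => return .same (.n2 l' a r)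
      | .over l₁ b l₂ => return .same (.n3 l₁ b l₂ a r)
    else
      match ← r.ins x with
      | .same r' => return .same (.n2 l a r')
      | .over r₁ b r₂ => return .same (.n3 l a r₁ b r₂)
  | .n3 l a m b r => do
    if ← keyLess x a then
      match ← l.ins x with
      | .same l' => return .same (.n3 l' a m b r)
      | .over l₁ e l₂ => return .over (.n2 l₁ e l₂) a (.n2 m b r)
    else if ← keyLess x b then
      match ← m.ins x with
      | .same m' => return .same (.n3 l a m' b r)
      | .over m₁ e m₂ => return .over (.n2 l a m₁) e (.n2 m₂ b r)
    else
      match ← r.ins x with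
      | .same r' => return .same (.n3 l a m b r')
      | .over r₁ e r₂ => return .over (.n2 l a m) b (.n2 r₁ e r₂)

/-- Result of a deletion from a subtree: a tree of the same height, or of height one less. -/
inductive DelRes (β : Type) where
  | same : BTree β → DelRes β
  | under : BTree β → DelRes β

/-- The tree of a deletion result. -/
def DelRes.tree {β : Type} : DelRes β → BTree β
  | .same t => t
  | .under t => t

/-- Rebuild a 2-node whose left subtree had a deletion. -/
def node21 {β : Type} : DelRes β → β → BTree β → DelRes β
  | .same l, a, r => .same (.n2 l a r)
  | .under l, a, .n2 m b r => .under (.n3 l a m b r)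
  | .under l, a, .n3 m b m' c r => .same (.n2 (.n2 l a m) b (.n2 m' c r))
  | .under l, a, .leaf => .same (.n2 l a .leaf)

/-- Rebuild a 2-node whose right subtree had a deletion. -/
def node22 {β : Type} : BTree β → β → DelRes β → DelRes β
  | l, a, .same r => .same (.n2 l a r)
  | .n2 l b m, a, .under r => .under (.n3 l b m a r)
  | .n3 l b m c m', a, .under r => .same (.n2 (.n2 l b m) c (.n2 m' a r))
  | .leaf, a, .under r => .same (.n2 .leaf a r)

/-- Rebuild a 3-node whose left subtree had a deletion. -/
def node31 {β : Type} : DelRes β → β → BTree β → β → BTree β → DelRes β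
  | .same l, a, m, b, r => .same (.n3 l a m b r)
  | .under l, a, .n2 m b m', c, r => .same (.n2 (.n3 l a m b m') c r)
  | .under l, a, .n3 m b m' c m'', d, r => .same (.n3 (.n2 l a m) b (.n2 m' c m'') d r)
  | .under l, a, .leaf, b, r => .same (.n3 l a .leaf b r)

/-- Rebuild a 3-node whose middle subtree had a deletion. -/
def node32 {β : Type} : BTree β → β → DelRes β → β → BTree β → DelRes β
  | l, a, .same m, b, r => .same (.n3 l a m b r)
  | l, a, .under m, b, .n2 r c r' => .same (.n2 l a (.n3 m b r c r'))
  | l, a, .under m, b, .n3 r c r' d r'' => .same (.n3 l a (.n2 m b r) c (.n2 r' d r''))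
  | l, a, .under m, b, .leaf => .same (.n3 l a m b .leaf)

/-- Rebuild a 3-node whose right subtree had a deletion. -/
def node33 {β : Type} : BTree β → β → BTree β → β → DelRes β → DelRes β
  | l, a, m, b, .same r => .same (.n3 l a m b r)
  | l, a, .n2 m b m', c, .under r => .same (.n2 l a (.n3 m b m' c r))
  | l, a, .n3 m b m' c m'', d, .under r => .same (.n3 l a (.n2 m b m') c (.n2 m'' d r))
  | l, a, .leaf, b, .under r => .same (.n3 l a .leaf b r)

/-- Remove the first entry of a nonempty subtree. -/
def BTree.splitMin {A : Type} :
    BTree (Entry A) → Prog A (Option (Entry A) × DelRes (Entry A))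
  | .leaf => do
    tick 1
    return (none, .same .leaf)
  | .n2 l a r => do
    tick 1
    match ← l.splitMin with
    | (none, _) => return (some a, .under r)
    | (some x, l') => return (some x, node21 l' a r)
  | .n3 l a m b r => do
    tick 1
    match ← l.splitMin with
    | (none, _) => return (some a, .same (.n2 m b r))
    | (some x, l') => return (some x, node31 l' a m b r)

/-- Deletion of the entry `x` from a subtree. -/
def BTree.del {A : Type} [LinearOrder A] (x : Entry A) :
    BTree (Entry A) → Prog A (DelRes (Entry A))
  | .leaf => do
    tick 1
    return .same .leaf
  | .n2 l a r => do
    tick 1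
    if x.v = a.v then
      match ← r.splitMin with
      | (none, _) => return .under l
      | (some a', r') => return node22 l a' r'
    else if ← keyLess x a then
      return node21 (← l.del x) a r
    else
      return node22 l a (← r.del x)
  | .n3 l a m b r => do
    tick 1
    if x.v = a.v then
      match ← m.splitMin with
      | (none, _) => return .same (.n2 l b r)
      | (some a', m') => return node32 l a' m' b r
    else if x.v = b.v then
      match ← r.splitMin with
      | (none, _) => return .same (.n2 l a m)
      | (some b', r') => return node33 l a m b' r'
    else if ← keyLess x a then
      return node31 (← l.del x) a m b r
    else if ← keyLess x b then
      return node32 l a (← m.del x) b r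
    else
      return node33 l a m b (← r.del x)

/-- Search in the B-tree of `V` for the last node whose key is smaller than `(u, c)`. -/
def treeSearch {A : Type} [LinearOrder A] (u : ℕ) (c : A) : Prog A (Option ℕ) := do
  let t ← readS Store.tree
  let e ← t.pred ⟨0, u, c⟩ none
  return e.map Entry.v

/-- Insert a node into the B-tree of `V`. -/
def treeInsert {A : Type} [LinearOrder A] (x : Entry A) : Prog A Unit := do
  let t ← readS Store.tree
  let t' ← t.ins x
  match t' with
  | .same t' => writeS fun σ => { σ with tree := t' }
  | .over l a r => writeS fun σ => { σ with tree := .n2 l a r }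

/-- Delete a node from the B-tree of `V`. -/
def treeDelete {A : Type} [LinearOrder A] (x : Entry A) : Prog A Unit := do
  let t ← readS Store.tree
  let t' ← t.del x
  writeS fun σ => { σ with tree := t'.tree }

/-! ## The update operation -/

/-- Create a node at address `x` on side `s` with label `(c, n)`, joined by an undirected edge to the
node at the same address on the other side. -/
def newNode {A : Type} [LinearOrder A] [OrderBot A] (s : Side) (x : ℕ) (c : A) (n : ℕ) :
    Prog A Unit :=
  change s x fun _ => { (Cell.blank : Cell A) with chr := c, len := n, lf := x }

/-- Erase the record of a node. -/
def freeNode {A : Type} [LinearOrder A] [OrderBot A] (s : Side) (x : ℕ) : Prog A Unit :=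
  change s x fun _ => Cell.blank

/-- Add the directed edge with label `e.2` from node `x` of side `s` to node `e.1` of the other
side. -/
def addEdge {A : Type} (s : Side) (x : ℕ) (e : ℕ × ℕ) : Prog A Unit := do
  change s x fun d => { d with head := e.1, off := e.2 }
  change s.other e.1 fun d => { d with inn := x :: d.inn }

/-- The outcome of the split-node step: the nodes `u_j`, `v_j` are replaced by the pairs of nodes at
the addresses `lo`, `hi`, the first of length `cut`. The node `gnext` is the one next to `v_g`. -/
structure Split where
  uj : ℕ
  vj : ℕ
  cut : ℕ
  lo : ℕ
  hi : ℕ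
  gnext : ℕ

/-- The new head and label of a directed edge that had head `e.1` and label `e.2`, when node `old` is
replaced by `new`, and node `oj`, if any, is split. -/
def redirect (old new : ℕ) (sp : Option Split) (oj : Split → ℕ) (e : ℕ × ℕ) : ℕ × ℕ :=
  if e.1 = old then (new, e.2)
  else match sp with
    | none => e
    | some p =>
      if e.1 = oj p then
        if e.2 < p.cut then (p.lo, e.2) else (p.hi, e.2 - p.cut)
      else e

/-- (I) Replace node: returns the address of the new nodes `u_{i'}`, `v_{i'}` and the node next to
`v_g` in the list of `V` before the step. -/
def replaceNode {A : Type} [LinearOrder A] [OrderBot A] (c : A) (ui vi : ℕ) :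
    Prog A (ℕ × Option ℕ) := do
  let vg := (← treeSearch ui c).getD vi
  let g ← look .V vg
  let a ← newAddr
  newNode .U a c 1
  insertAfter .U ui a
  unlink .U ui
  newNode .V a c 1
  insertAfter .V vg a
  unlink .V vi
  return (a, g.next)

/-- Replace node `x` of side `s` by two nodes with labels `(c, n)` and `(c, m)` at the addresses `lo`
and `hi`. -/
def splitOne {A : Type} [LinearOrder A] [OrderBot A] (s : Side) (x lo hi : ℕ) (c : A) (n m : ℕ) :
    Prog A Unit := do
  newNode s lo c n
  newNode s hi c m
  insertAfter s x lo
  insertAfter s lo hi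
  unlink s x

/-- (II) Split node. -/
def splitNode {A : Type} [LinearOrder A] [OrderBot A] (gnext : Option ℕ) :
    Prog A (Option Split) := do
  match gnext with
  | none => return none
  | some w =>
    let g ← look .V w
    if g.off = 0 then return none
    else
      let uj := g.head
      let d ← look .U uj
      let lo ← newAddr
      let hi ← newAddr
      splitOne .U uj lo hi d.chr g.off (d.len - g.off)
      splitOne .V d.lf lo hi d.chr g.off (d.len - g.off)
      return some ⟨uj, d.lf, g.off, lo, hi, w⟩

/-- (III) Insert node: returns the address of the new nodes `u_{x'}`, `v_{x'}`. -/
def insertNode {A : Type} [LinearOrder A] [OrderBot A] (ui a : ℕ) (gnext : Option ℕ)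
    (sp : Option Split) : Prog A ℕ := do
  let x ← newAddr
  newNode .U x ⊥ 1
  match sp, gnext with
  | some p, _ => insertAfter .U p.lo x
  | none, none =>
    match ← readS fun σ => σ.last .U with
    | some y => insertAfter .U y x
    | none => return x
  | none, some w =>
    let g ← look .V w
    insertBefore .U (if g.head = ui then a else g.head) x
  newNode .V x ⊥ 1
  match ← readS fun σ => σ.first .V with
  | some y => insertBefore .V y x
  | none => return x
  writeS fun σ => { σ with dollar := x }
  return x

/-- The first node `u_m` in the list with `B_L(u_m, v_j) ≤ cut < B_L(u_m, v_j) + |u_m|`, and the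
difference `cut - B_L(u_m, v_j)`. -/
def scanTails {A : Type} (cut : ℕ) : List ℕ → Prog A (ℕ × ℕ)
  | [] => return (0, 0)
  | m :: ms => do
    let d ← look .U m
    if d.off ≤ cut ∧ cut < d.off + d.len then return (m, cut - d.off) else scanTails cut ms

/-- The node `u` of the graph before the update whose repetition contains the position at distance
`cut` behind the starting position of the F-interval of `v_j`, and the distance of this position from
the starting position of the repetition. -/
def locateCut {A : Type} (vj cut : ℕ) : Prog A (ℕ × ℕ) := do
  let d ← look .V vj
  let s ← look .U d.head
  if d.off + cut < s.len then return (d.head, d.off + cut)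
  else scanTails cut d.inn

/-- Redirect the edges starting at the nodes of side `s` in the list, except for removed nodes. -/
def redirectTails {A : Type} (s : Side) (removed : ℕ → Bool) (f : ℕ × ℕ → ℕ × ℕ) :
    List ℕ → Prog A Unit
  | [] => return ()
  | x :: xs => do
    let d ← look s x
    if removed x then redirectTails s removed f xs
    else
      addEdge s x (f (d.head, d.off))
      redirectTails s removed f xs

/-- Is `x` one of the removed nodes of a side? -/
def isRemoved (old : ℕ) (sp : Option Split) (oj : Split → ℕ) (x : ℕ) : Bool :=
  decide (x = old) || (sp.map oj == some x)

/-- (IV) Update edge. The undirected edges have been set when the new nodes were created, and those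
of the removed nodes disappear with their records. -/
def updateEdges {A : Type} [LinearOrder A] [OrderBot A] (ui vi a x : ℕ) (sp : Option Split) :
    Prog A Unit := do
  let toV := redirect vi x sp Split.vj
  let toU := redirect ui a sp Split.uj
  let remU := isRemoved ui sp Split.uj
  let remV := isRemoved vi sp Split.vj
  let cu ← look .U ui
  let cv ← look .V vi
  match sp with
  | none =>
    -- remove the edges that start at removed nodes
    eraseIn .V cu.head ui
    eraseIn .U cv.head vi
    -- replace the edges that pointed to removed nodes
    redirectTails .U remU toV cv.inn
    redirectTails .V remV toU cu.inn
  | some p =>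
    let du ← look .U p.uj
    let dv ← look .V p.vj
    let loc ← locateCut p.vj p.cut
    eraseIn .V cu.head ui
    eraseIn .U cv.head vi
    eraseIn .V du.head p.uj
    eraseIn .U dv.head p.vj
    redirectTails .U remU toV cv.inn
    redirectTails .V remV toU cu.inn
    redirectTails .U remU toV dv.inn
    redirectTails .V remV toU du.inn
    -- edges that start at the nodes created by the split
    addEdge .U p.lo (toV (du.head, du.off))
    addEdge .U p.hi (if p.gnext = p.vj then p.lo else p.gnext, 0)
    addEdge .V p.lo (toU (dv.head, dv.off))
    addEdge .V p.hi (toU loc)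
  -- edges that start at the other new nodes
  addEdge .U a (toV (cu.head, cu.off))
  addEdge .V a (x, 0)
  addEdge .U x (a, 0)
  addEdge .V x (toU (cv.head, cv.off))

/-- Update of the order maintenance structure and of the B-tree. -/
def updateOrders {A : Type} [LinearOrder A] [OrderBot A] (c : A) (ui vi a x : ℕ)
    (sp : Option Split) : Prog A Unit := do
  omInsertAfter ui a
  match sp with
  | none => pure ()
  | some p =>
    omInsertAfter p.uj p.lo
    omInsertAfter p.lo p.hi
  let d ← look .U x
  match d.prev with
  | none => pure ()
  | some y => omInsertAfter y x
  treeDelete ⟨vi, ui, ⊥⟩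
  treeInsert ⟨a, a, c⟩
  treeInsert ⟨x, x, ⊥⟩
  match sp with
  | none => pure ()
  | some p =>
    let e ← look .U p.uj
    treeDelete ⟨p.vj, p.uj, e.chr⟩
    treeInsert ⟨p.lo, p.lo, e.chr⟩
    treeInsert ⟨p.hi, p.hi, e.chr⟩
    omDelete p.uj
  omDelete ui

/-- Put node `x` into the array of heavy nodes if at least `α` edges point to it; this traverses at
most `α` of these edges. -/
def checkHeavy {A : Type} (α : ℕ) (s : Side) (x : ℕ) : Prog A Unit := do
  let d ← look s x
  tick (min α d.inn.length)
  if α ≤ d.inn.length then pushHeavy s x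

/-- Update of the two arrays of heavy nodes: only the heads of the edges starting at the second of
the two nodes created by the split can have become heavy. -/
def updateHeavy {A : Type} (α : ℕ) (sp : Option Split) : Prog A Unit := do
  match sp with
  | none => pure ()
  | some p =>
    let dv ← look .V p.hi
    checkHeavy α .U dv.head
    let du ← look .U p.hi
    checkHeavy α .V du.head

/-- Erase the records of the removed nodes. -/
def freeNodes {A : Type} [LinearOrder A] [OrderBot A] (ui vi : ℕ) (sp : Option Split) :
    Prog A Unit := do
  freeNode .U ui
  freeNode .V vi
  match sp with
  | none => pure ()
  | some p =>
    freeNode .U p.uj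
    freeNode .V p.vj

/-- The update operation for the next character `c`. -/
def updateOp {A : Type} [LinearOrder A] [OrderBot A] (α : ℕ) (c : A) : Prog A Unit := do
  let ui ← readS Store.dollar
  let d ← look .U ui
  let vi := d.lf
  let (a, gnext) ← replaceNode c ui vi
  let sp ← splitNode gnext
  let x ← insertNode ui a gnext sp
  updateEdges ui vi a x sp
  updateOrders c ui vi a x sp
  updateHeavy α sp
  freeNodes ui vi sp

/-- The store after the update operation has been run on the store `σ`. -/
def updateStore {A : Type} [LinearOrder A] [OrderBot A] (α : ℕ) (c : A) (σ : Store A) : Store A :=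
  (Id.run (StateT.run (updateOp α c) (σ, 0))).2.1

/-- The number of steps that the update operation takes on the store `σ`. -/
def updateTime {A : Type} [LinearOrder A] [OrderBot A] (α : ℕ) (c : A) (σ : Store A) : ℕ :=
  (Id.run (StateT.run (updateOp α c) (σ, 0))).2.2

section

/-! ### The BWT and the LF function when a character is prepended. -/

section SuffixArray

variable {A : Type} [LinearOrder A]

/-! Let `S` be the current suffix and `c :: S` the next one. Prepending `c` adds a single suffix and
leaves the order of the others alone, so there is one new row `q`. In the BWT the old `$` becomes
`c`, and a new `$` appears in row `q`. The former `$` row is now sent to `q` by the LF function, row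
`q` is sent to `0`, and all other values are merely moved by `shiftAt q` (`exists_bwtStep`). Since
the LF function orders rows by character and then by row (`LF_lt_iff`), the keys of the B-tree are
ordered like the F-intervals, and the search for the key `(c, u_i)` finds the last F-interval that
begins before `q` (`AHolds.key_lt_iff`).

Hence the same thing happens on both sides of the graph. In the tiling of the rows by intervals, one
interval of length one is renamed in place (that of `u_i`, and on the side of `V` the interval at
`0`), one interval of length one is put in at `q`, and everything from `q` on moves up by one. No
F-interval has `q` in its interior, because it is the image of a run that does not extend across the
`$` row (`AHolds.cutV`). A repetition may have `q` in its interior. This shows in the positive label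
of the edge that leaves the F-interval starting at `q`, and the repetition is then split at `q`
together with its partner. After that nothing straddles `q`, so a pair of a node and an offset
describing an old position becomes a description of the shifted position by mere renaming
(`Upd.Ctx.redir_loc`). So the old edges can be reused: only those at the few removed nodes have to
be touched.

For the degrees, observe that tails of edges stand for starting positions. The two inserted nodes
point to each other with label `0`. Among the remaining nodes only the second half `hi` of a split
node starts at a position where nothing started before. So the tails pointing to a node, with `hi`
left out, inject into the tails that pointed to the node it arose from, and of those there were
fewer than `α` (`Upd.Ctx.inn_length_aux`). In-degrees are therefore at most `α`, with equality only
at the head of the edge leaving `hi`. The new DBWT is thus even `(α + 1)`-balanced with at most one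
`α`-heavy node on each side, and the stated bounds follow.

The cost is bounded because a constant number of incoming lists is traversed, each with fewer than
`α` entries before the update, and because a constant number of operations is carried out in a tree
of logarithmic depth.

Technically, `Tri` is a Hoare triple with a step count. `AHolds` describes a store by addresses and
treats the two sides alike; `AHolds.of_holdsAt` and `AHolds.exists_holdsAt` translate between it and
the indexed graph. Between the initial and the final store, `Relinked` follows the creation of
nodes, `EdgeInv` the edges and `TreeInv` the B-tree, and `Upd.Created.holds` puts the results
together. -/

theorem sufArr_perm (S : List A) : (sufArr S).Perm (List.range S.length) :=
  List.perm_insertionSort _ _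

theorem sufArr_length (S : List A) : (sufArr S).length = S.length := by
  simpa using (sufArr_perm S).length_eq

theorem sufArr_nodup (S : List A) : (sufArr S).Nodup :=
  (sufArr_perm S).nodup_iff.2 List.nodup_range

theorem mem_sufArr {S : List A} {x : ℕ} : x ∈ sufArr S ↔ x < S.length := by
  simpa using (sufArr_perm S).mem_iff (a := x)

theorem idxOf_sufArr_lt {S : List A} {x : ℕ} (hx : x < S.length) :
    (sufArr S).idxOf x < S.length := by
  have := List.idxOf_lt_length_of_mem (mem_sufArr.2 hx)
  rwa [sufArr_length] at this

theorem sufArr_getD_lt {S : List A} {i : ℕ} (hi : i < S.length) :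
    (sufArr S).getD i 0 < S.length := by
  rw [List.getD_eq_getElem _ _ (by rwa [sufArr_length])]
  exact mem_sufArr.1 (List.getElem_mem _)

theorem sufArr_idxOf_getD {S : List A} {i : ℕ} (hi : i < S.length) :
    (sufArr S).idxOf ((sufArr S).getD i 0) = i := by
  rw [List.getD_eq_getElem _ _ (by rwa [sufArr_length])]
  exact (sufArr_nodup S).idxOf_getElem i _

theorem sufArr_getD_idxOf {S : List A} {x : ℕ} (hx : x < S.length) :
    (sufArr S).getD ((sufArr S).idxOf x) 0 = x := by
  have h := idxOf_sufArr_lt hx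
  rw [List.getD_eq_getElem _ _ (by rwa [sufArr_length])]
  exact List.getElem_idxOf _

omit [LinearOrder A] in
theorem drop_injOn {S : List A} {x y : ℕ} (hx : x < S.length) (hy : y < S.length)
    (h : S.drop x = S.drop y) : x = y := by
  have := congrArg List.length h
  simp only [List.length_drop] at this
  omega

theorem sufArr_pairwise (S : List A) :
    (sufArr S).Pairwise fun i j => S.drop i ≤ S.drop j := by
  have : Std.Total (fun i j : ℕ => S.drop i ≤ S.drop j) := ⟨fun a b => le_total _ _⟩
  have : IsTrans ℕ (fun i j : ℕ => S.drop i ≤ S.drop j) := ⟨fun a b c => le_trans⟩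
  exact List.pairwise_insertionSort _ _

/-- Suffixes at distinct positions have distinct lengths, so the weak order left by sorting is
strict. -/
theorem drop_getD_lt_iff {S : List A} {i j : ℕ} (hi : i < S.length) (hj : j < S.length) :
    S.drop ((sufArr S).getD i 0) < S.drop ((sufArr S).getD j 0) ↔ i < j := by
  have key : ∀ i j, i < S.length → j < S.length → i < j →
      S.drop ((sufArr S).getD i 0) < S.drop ((sufArr S).getD j 0) := by
    intro i j hi hj hij
    have h := List.pairwise_iff_getElem.1 (sufArr_pairwise S) i j
      (by rwa [sufArr_length]) (by rwa [sufArr_length]) hij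
    rw [← List.getD_eq_getElem _ 0, ← List.getD_eq_getElem _ 0] at h
    refine lt_of_le_of_ne h fun h' => ?_
    have := drop_injOn (sufArr_getD_lt hi) (sufArr_getD_lt hj) h'
    have := congrArg (sufArr S).idxOf this
    rw [sufArr_idxOf_getD hi, sufArr_idxOf_getD hj] at this
    omega
  refine ⟨fun h => ?_, key i j hi hj⟩
  by_contra hn
  rcases (not_lt.1 hn).lt_or_eq with h' | rfl
  · exact lt_asymm h (key j i hj hi h')
  · exact lt_irrefl _ h

theorem idxOf_lt_iff {S : List A} {x y : ℕ} (hx : x < S.length) (hy : y < S.length) :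
    (sufArr S).idxOf x < (sufArr S).idxOf y ↔ S.drop x < S.drop y := by
  rw [← drop_getD_lt_iff (idxOf_sufArr_lt hx) (idxOf_sufArr_lt hy), sufArr_getD_idxOf hx,
    sufArr_getD_idxOf hy]

/-- The cyclic predecessor of a position of a string of length `n`. -/
def prevPos (n x : ℕ) : ℕ := if x = 0 then n - 1 else x - 1

theorem prevPos_lt {n x : ℕ} (hx : x < n) : prevPos n x < n := by
  unfold prevPos; split <;> omega

theorem LF_eq (S : List A) (i : ℕ) :
    LF S i = (sufArr S).idxOf (prevPos S.length ((sufArr S).getD i 0)) := rfl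

theorem LF_lt {S : List A} {i : ℕ} (hi : i < S.length) : LF S i < S.length :=
  idxOf_sufArr_lt (prevPos_lt (sufArr_getD_lt hi))

/-- The LF function is conjugate to the cyclic predecessor map on positions, so a preimage is the
row of the cyclic successor. -/
theorem exists_LF_eq {S : List A} {f : ℕ} (hf : f < S.length) :
    ∃ i, i < S.length ∧ LF S i = f := by
  have hx := sufArr_getD_lt hf
  set x := (sufArr S).getD f 0 with hxd
  let y := if x = S.length - 1 then 0 else x + 1
  have hy : y < S.length := by simp only [y]; split <;> omega
  refine ⟨(sufArr S).idxOf y, idxOf_sufArr_lt hy, ?_⟩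
  have : prevPos S.length y = x := by
    simp only [y, prevPos]; split <;> split <;> omega
  rw [LF_eq, sufArr_getD_idxOf hy, this, hxd, sufArr_idxOf_getD hf]

variable [OrderBot A]

theorem bwt_length (S : List A) : (bwt S).length = S.length := by
  simp [bwt, sufArr_length]

theorem bwt_getD {S : List A} {i : ℕ} (hi : i < S.length) :
    (bwt S).getD i ⊥ = S.getD (prevPos S.length ((sufArr S).getD i 0)) ⊥ := by
  have hi' : i < (sufArr S).length := by rwa [sufArr_length]
  rw [List.getD_eq_getElem _ _ (by rwa [bwt_length]), List.getD_eq_getElem _ _ hi']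
  simp only [bwt, List.getElem_map, prevPos]
  split <;> rfl

/-- The row reached belongs to the suffix that begins with the preceding character. This is why
`v_i` carries the same character as `u_i`. -/
theorem firstCol_getD_LF {S : List A} {i : ℕ} (hi : i < S.length) :
    (firstCol S).getD (LF S i) ⊥ = (bwt S).getD i ⊥ := by
  have h : LF S i < (sufArr S).length := by rw [sufArr_length]; exact LF_lt hi
  rw [bwt_getD hi, List.getD_eq_getElem _ _ (by simpa [firstCol] using h)]
  simp only [firstCol, List.getElem_map]
  congr 1
  rw [← List.getD_eq_getElem _ 0, LF_eq, sufArr_getD_idxOf (prevPos_lt (sufArr_getD_lt hi))]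

theorem EndMarked.length_pos {S : List A} (h : EndMarked S) : 0 < S.length := by
  obtain ⟨w, rfl, -⟩ := h; simp

theorem EndMarked.getD_eq_bot_iff {S : List A} (h : EndMarked S) {x : ℕ} (hx : x < S.length) :
    S.getD x ⊥ = ⊥ ↔ x = S.length - 1 := by
  obtain ⟨w, rfl, hw⟩ := h
  rw [List.getD_eq_getElem _ _ hx]
  simp only [List.length_append, List.length_singleton, Nat.add_sub_cancel] at hx ⊢
  rw [List.getElem_append]
  split
  · rename_i h
    refine ⟨fun e => absurd (e ▸ List.getElem_mem h) hw, fun e => by omega⟩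
  · simp; omega

theorem EndMarked.cons {S : List A} (h : EndMarked S) {c : A} (hc : c ≠ ⊥) :
    EndMarked (c :: S) := by
  obtain ⟨w, rfl, hw⟩ := h
  exact ⟨c :: w, rfl, by simp [hw, hc.symm]⟩

theorem drop_eq_getD_cons {S : List A} {x : ℕ} (hx : x < S.length) :
    S.drop x = S.getD x ⊥ :: S.drop (x + 1) := by
  rw [List.getD_eq_getElem _ _ hx, List.drop_eq_getElem_cons hx]

/-- The only `$` is the last character of `S`, and only the whole string is cyclically preceded by
it. -/
theorem bwt_getD_eq_bot_iff {S : List A} (h : EndMarked S) {i : ℕ} (hi : i < S.length) :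
    (bwt S).getD i ⊥ = ⊥ ↔ i = (sufArr S).idxOf 0 := by
  have hx := sufArr_getD_lt hi
  rw [bwt_getD hi, h.getD_eq_bot_iff (prevPos_lt hx)]
  constructor
  · intro h'
    have : (sufArr S).getD i 0 = 0 := by
      unfold prevPos at h'; split at h' <;> omega
    rw [← this, sufArr_idxOf_getD hi]
  · rintro rfl
    rw [sufArr_getD_idxOf h.length_pos]
    rfl

/-- Peeling off the first characters of the two suffixes leaves, on a tie, the suffixes one place
further on, which are those of the rows `i` and `j`. Going one place on wraps around only for the
character `$`, and then its uniqueness forces `i = j`. -/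
theorem LF_lt_iff {S : List A} (h : EndMarked S) {i j : ℕ} (hi : i < S.length)
    (hj : j < S.length) :
    LF S i < LF S j ↔ (bwt S).getD i ⊥ < (bwt S).getD j ⊥ ∨
      (bwt S).getD i ⊥ = (bwt S).getD j ⊥ ∧ i < j := by
  have hx := sufArr_getD_lt hi
  have hy := sufArr_getD_lt hj
  have hx' := prevPos_lt hx
  have hy' := prevPos_lt hy
  rw [LF_eq, LF_eq, idxOf_lt_iff hx' hy', drop_eq_getD_cons hx', drop_eq_getD_cons hy',
    List.cons_lt_cons_iff, ← bwt_getD hi, ← bwt_getD hj]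
  refine or_congr Iff.rfl (and_congr_right fun e => ?_)
  by_cases hi0 : (bwt S).getD i ⊥ = ⊥
  · have hi1 := (bwt_getD_eq_bot_iff h hi).1 hi0
    have hj1 := (bwt_getD_eq_bot_iff h hj).1 (e ▸ hi0)
    subst hi1; subst hj1
    simp
  · have hj0 := e ▸ hi0
    rw [← drop_getD_lt_iff hi hj]
    have hs : ∀ k, k < S.length → (bwt S).getD k ⊥ ≠ ⊥ →
        prevPos S.length ((sufArr S).getD k 0) + 1 = (sufArr S).getD k 0 := by
      intro k hk hk0
      have : (sufArr S).getD k 0 ≠ 0 := fun e0 => hk0 <| (bwt_getD_eq_bot_iff h hk).2 <| by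
        rw [← e0, sufArr_idxOf_getD hk]
      unfold prevPos; rw [if_neg this]; omega
    rw [hs i hi hi0, hs j hj hj0]

omit [OrderBot A] in
theorem LF_inj {S : List A} {i j : ℕ} (hi : i < S.length)
    (hj : j < S.length) (h : LF S i = LF S j) : i = j := by
  have hx := sufArr_getD_lt hi
  have hy := sufArr_getD_lt hj
  have h1 := congrArg (fun k => (sufArr S).getD k 0) h
  simp only [LF_eq, sufArr_getD_idxOf (prevPos_lt hx), sufArr_getD_idxOf (prevPos_lt hy)] at h1
  have : (sufArr S).getD i 0 = (sufArr S).getD j 0 := by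
    unfold prevPos at h1; split at h1 <;> split at h1 <;> omega
  rw [← sufArr_idxOf_getD hi, this, sufArr_idxOf_getD hj]

/-- The row of the `$` in the first column is the first one. -/
theorem LF_idxOf_zero {S : List A} (h : EndMarked S) : LF S ((sufArr S).idxOf 0) = 0 := by
  by_contra hne
  have h0 : (sufArr S).idxOf 0 < S.length := idxOf_sufArr_lt h.length_pos
  obtain ⟨i, hi, e⟩ := exists_LF_eq (S := S) h.length_pos
  have hb := (bwt_getD_eq_bot_iff h h0).2 rfl
  have hlt : LF S i < LF S ((sufArr S).idxOf 0) := by omega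
  rw [LF_lt_iff h hi h0, hb] at hlt
  rcases hlt with hlt | ⟨e', hlt⟩
  · exact not_lt_bot hlt
  · have := (bwt_getD_eq_bot_iff h hi).1 e'
    omega

/-- Inside a run of the BWT the LF function is a translation. -/
theorem LF_succ {S : List A} (h : EndMarked S) {i : ℕ} (hi : i + 1 < S.length)
    (e : (bwt S).getD i ⊥ = (bwt S).getD (i + 1) ⊥) : LF S (i + 1) = LF S i + 1 := by
  have hi' : i < S.length := by omega
  have h1 : LF S i < LF S (i + 1) := (LF_lt_iff h hi' hi).2 (.inr ⟨e, by omega⟩)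
  -- A row between the two images would have a preimage strictly between `i` and `i + 1` in the
  -- order by character and then row.
  by_contra hne
  have hf : LF S i + 1 < S.length := by have := LF_lt hi; omega
  obtain ⟨j, hj, ej⟩ := exists_LF_eq hf
  have a1 := (LF_lt_iff h hi' hj).1 (by omega)
  have a2 := (LF_lt_iff h hj hi).1 (by omega)
  rcases a1 with a1 | ⟨a1, b1⟩
  · rcases a2 with a2 | ⟨a2, b2⟩
    · exact lt_asymm a1 (e ▸ a2)
    · exact absurd a1 (by rw [a2, e]; exact lt_irrefl _)
  · rcases a2 with a2 | ⟨a2, b2⟩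
    · exact absurd a2 (by rw [← a1, e]; exact lt_irrefl _)
    · omega

theorem LF_add {S : List A} (h : EndMarked S) {i : ℕ} (a : A) (m : ℕ) (hm : i + m ≤ S.length)
    (e : ∀ j < m, (bwt S).getD (i + j) ⊥ = a) (j : ℕ) (hj : j < m) :
    LF S (i + j) = LF S i + j := by
  induction j with
  | zero => rfl
  | succ j ih =>
    rw [← add_assoc, LF_succ h (by omega), ih (by omega), add_assoc]
    rw [e j (by omega), add_assoc, e (j + 1) hj]

/-- The shift of positions caused by inserting a row at position `q`. -/
def shiftAt (q i : ℕ) : ℕ := if i < q then i else i + 1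

omit [OrderBot A] in
-- Insertion sort inserts the head of its input after everything else is sorted. Here the head is
-- position `0`, and the order of the other positions does not depend on `c`.
theorem sufArr_cons (c : A) (S : List A) :
    ∃ X Y, sufArr S = X ++ Y ∧
      sufArr (c :: S) = X.map Nat.succ ++ 0 :: Y.map Nat.succ := by
  have e : sufArr (c :: S) = List.orderedInsert
      (fun i j => (c :: S).drop i ≤ (c :: S).drop j) 0 ((sufArr S).map Nat.succ) := by
    unfold sufArr
    rw [List.length_cons, List.range_succ_eq_map, List.insertionSort_cons,
      List.map_insertionSort (r := fun i j => S.drop i ≤ S.drop j)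
        (s := fun i j => (c :: S).drop i ≤ (c :: S).drop j)]
    intro a _ b _
    simp
  rw [List.orderedInsert_eq_take_drop, List.takeWhile_map, List.dropWhile_map] at e
  exact ⟨_, _, (List.takeWhile_append_dropWhile).symm, e⟩

/-- The BWT of `c :: S` arises from that of `S` by replacing `$` by `c` and by inserting `$` at
position `q`; the corresponding statement holds for the LF function. -/
structure BwtStep (S : List A) (c : A) (q : ℕ) : Prop where
  q_pos : 1 ≤ q
  q_le : q ≤ S.length
  kept : ∀ i < S.length, (bwt S).getD i ⊥ ≠ ⊥ →
    (bwt (c :: S)).getD (shiftAt q i) ⊥ = (bwt S).getD i ⊥ ∧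
    LF (c :: S) (shiftAt q i) = shiftAt q (LF S i)
  replaced : ∀ i < S.length, (bwt S).getD i ⊥ = ⊥ →
    (bwt (c :: S)).getD (shiftAt q i) ⊥ = c ∧ LF (c :: S) (shiftAt q i) = q ∧ LF S i = 0
  inserted : (bwt (c :: S)).getD q ⊥ = ⊥ ∧ LF (c :: S) q = 0

/-- `q` is the number of old suffixes that precede the whole new string. Positions move by one and
rows by `shiftAt q`, and these two shifts carry the old LF function to the new one except in the row
of the old whole string, whose predecessor is now the new position `0`. -/
theorem exists_bwtStep {S : List A} (h : EndMarked S) {c : A} (hc : c ≠ ⊥) :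
    ∃ q, BwtStep S c q := by
  have h' := h.cons hc
  obtain ⟨X, Y, e, e'⟩ := sufArr_cons c S
  have hlen : X.length + Y.length = S.length := by
    rw [← sufArr_length S, e, List.length_append]
  set q := X.length with hq
  -- An old row keeps its suffix, whose starting position is now one larger.
  have hsa : ∀ i < S.length, (sufArr (c :: S)).getD (shiftAt q i) 0 = (sufArr S).getD i 0 + 1 := by
    intro i hi
    rw [e', e]
    unfold shiftAt
    split
    · rename_i hiq
      rw [List.getD_append _ _ _ _ (by simpa using hiq), List.getD_append _ _ _ _ hiq,
        List.getD_eq_getElem _ _ (by simpa using hiq), List.getD_eq_getElem _ _ hiq]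
      simp
    · rename_i hiq
      push Not at hiq
      rw [List.getD_append_right _ _ _ _ (by simp; omega), List.getD_append_right _ _ _ _ hiq,
        List.length_map, show i + 1 - X.length = (i - X.length) + 1 by omega, List.getD_cons_succ,
        List.getD_eq_getElem _ _ (by simp; omega), List.getD_eq_getElem _ _ (by omega)]
      simp
  have hsq : (sufArr (c :: S)).getD q 0 = 0 := by
    rw [e', List.getD_append_right _ _ _ _ (by simp [hq])]
    simp [hq]
  have hsh : ∀ i, i < S.length → shiftAt q i < (c :: S).length := by
    intro i hi; unfold shiftAt; simp only [List.length_cons]; split <;> omega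
  have hrk : ∀ x < S.length, (sufArr (c :: S)).idxOf (x + 1) = shiftAt q ((sufArr S).idxOf x) := by
    intro x hx
    have h1 := hsa _ (idxOf_sufArr_lt hx)
    rw [sufArr_getD_idxOf hx] at h1
    rw [← h1, sufArr_idxOf_getD (hsh _ (idxOf_sufArr_lt hx))]
  have hqlt : q < (c :: S).length := by simp; omega
  have hrq : (sufArr (c :: S)).idxOf 0 = q := by
    conv_lhs => rw [← hsq]
    exact sufArr_idxOf_getD hqlt
  have hLFq : LF (c :: S) q = 0 := by
    conv_lhs => rw [← hrq]
    exact LF_idxOf_zero h'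
  have hbq : (bwt (c :: S)).getD q ⊥ = ⊥ := (bwt_getD_eq_bot_iff h' hqlt).2 hrq.symm
  have hpos := h.length_pos
  refine ⟨q, ?_, by omega, ?_, ?_, ⟨hbq, hLFq⟩⟩
  -- Row `0` belongs to the suffix `$`. If it were the row of the whole string, `S` would be empty.
  · by_contra hq0
    have hq0 : q = 0 := by omega
    have h1 : LF (c :: S) q = (sufArr (c :: S)).idxOf (c :: S).length.pred := by
      rw [LF_eq, hsq]; rfl
    have h2 : (sufArr (c :: S)).idxOf 0 = (sufArr (c :: S)).idxOf (c :: S).length.pred := by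
      rw [hrq, ← h1, hLFq, hq0]
    have h3 := sufArr_getD_idxOf (S := c :: S) (x := 0) (by simp)
    rw [h2, sufArr_getD_idxOf (by simp)] at h3
    simp at h3
    simp [h3] at hpos
  · intro i hi hb
    have hx := sufArr_getD_lt hi
    have hx0 : (sufArr S).getD i 0 ≠ 0 := fun e0 => hb <| (bwt_getD_eq_bot_iff h hi).2 <| by
      rw [← e0, sufArr_idxOf_getD hi]
    have hp : prevPos (c :: S).length ((sufArr S).getD i 0 + 1) =
        prevPos S.length ((sufArr S).getD i 0) + 1 := by
      unfold prevPos; rw [if_neg (by omega), if_neg hx0]; omega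
    constructor
    · rw [bwt_getD (hsh i hi), bwt_getD hi, hsa i hi, hp, List.getD_cons_succ]
    · rw [LF_eq, hsa i hi, hp, hrk _ (prevPos_lt hx), LF_eq]
  · intro i hi hb
    have hi0 := (bwt_getD_eq_bot_iff h hi).1 hb
    have hx0 : (sufArr S).getD i 0 = 0 := by rw [hi0, sufArr_getD_idxOf hpos]
    refine ⟨?_, ?_, hi0 ▸ LF_idxOf_zero h⟩
    · rw [bwt_getD (hsh i hi), hsa i hi, hx0]
      rfl
    · rw [LF_eq, hsa i hi, hx0, ← hrq]
      rfl

theorem shiftAt_lt_shiftAt {q i j : ℕ} : shiftAt q i < shiftAt q j ↔ i < j := by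
  unfold shiftAt; split <;> split <;> omega

theorem shiftAt_lt {q i : ℕ} : shiftAt q i < q ↔ i < q := by
  unfold shiftAt; split <;> omega

theorem shiftAt_lt_length {q i n : ℕ} (hi : i < n) : shiftAt q i < n + 1 := by
  unfold shiftAt; split <;> omega

/-- The shift acts as a translation on an interval unless `q` lies in its interior; this is why a
straddling repetition has to be split. -/
theorem shiftAt_add {q b n j : ℕ} (h : b < q → b + n ≤ q) (hj : j < n) :
    shiftAt q (b + j) = shiftAt q b + j := by
  unfold shiftAt; split <;> split <;> omega

/-- The rows before the inserted one. -/
theorem BwtStep.LF_lt_iff {S : List A} (h : EndMarked S) {c : A} (hc : c ≠ ⊥) {q : ℕ}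
    (hq : BwtStep S c q) {i i₀ : ℕ} (hi : i < S.length) (hi₀ : i₀ < S.length)
    (hb : (bwt S).getD i₀ ⊥ = ⊥) :
    LF S i < q ↔ (bwt S).getD i ⊥ < c ∨ (bwt S).getD i ⊥ = c ∧ i < i₀ := by
  have hq1 := hq.q_pos
  by_cases hbi : (bwt S).getD i ⊥ = ⊥
  · rw [(hq.replaced i hi hbi).2.2, hbi]
    simp [bot_lt_iff_ne_bot.2 hc]
    omega
  · obtain ⟨h1, h2⟩ := hq.kept i hi hbi
    obtain ⟨h3, h4, -⟩ := hq.replaced i₀ hi₀ hb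
    have := _root_.LF_lt_iff (h.cons hc) (i := shiftAt q i) (j := shiftAt q i₀)
      (shiftAt_lt_length hi) (shiftAt_lt_length hi₀)
    rwa [h1, h2, h3, h4, shiftAt_lt, shiftAt_lt_shiftAt] at this

end SuffixArray

end

section

/-! ### Consecutive intervals -/

/-- The intervals `[pos y, pos y + len y)`, for `y` in the list, follow one another without gaps
from `b` to `e`. -/
def Tile (len pos : ℕ → ℕ) : ℕ → List ℕ → ℕ → Prop
  | b, [], e => b = e
  | b, y :: l, e => pos y = b ∧ Tile len pos (b + len y) l e

namespace Tile

variable {len pos : ℕ → ℕ} {l l₁ l₂ : List ℕ} {b e : ℕ}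

theorem le (h : Tile len pos b l e) : b ≤ e := by
  induction l generalizing b with
  | nil => exact le_of_eq h
  | cons y l ih => have := ih h.2; omega

theorem append_iff : Tile len pos b (l₁ ++ l₂) e ↔
    ∃ m, Tile len pos b l₁ m ∧ Tile len pos m l₂ e := by
  induction l₁ generalizing b with
  | nil => simp [Tile]
  | cons y l ih => simp [Tile, ih, and_assoc]

theorem congr {len' pos' : ℕ → ℕ} (h : Tile len pos b l e)
    (hl : ∀ y ∈ l, len' y = len y) (hp : ∀ y ∈ l, pos' y = pos y) : Tile len' pos' b l e := by
  induction l generalizing b with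
  | nil => exact h
  | cons y l ih =>
    refine ⟨(hp y (by simp)).trans h.1, ?_⟩
    rw [hl y (by simp)]
    exact ih h.2 (fun z hz => hl z (by simp [hz])) (fun z hz => hp z (by simp [hz]))

theorem add_one (h : Tile len pos b l e) : Tile len (fun y => pos y + 1) (b + 1) l (e + 1) := by
  induction l generalizing b with
  | nil => exact congrArg (· + 1) h
  | cons y l ih =>
    refine ⟨congrArg (· + 1) h.1, ?_⟩
    have := ih h.2
    rwa [show b + 1 + len y = b + len y + 1 by omega]

theorem flatMap {len' pos' : ℕ → ℕ} {g : ℕ → List ℕ} (h : Tile len pos b l e)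
    (hg : ∀ y ∈ l, Tile len' pos' (pos y) (g y) (pos y + len y)) :
    Tile len' pos' b (l.flatMap g) e := by
  induction l generalizing b with
  | nil => exact h
  | cons y l ih =>
    rw [List.flatMap_cons, append_iff]
    refine ⟨b + len y, ?_, ih h.2 fun z hz => hg z (by simp [hz])⟩
    have := hg y (by simp)
    rwa [h.1] at this

theorem bounds (h : Tile len pos b l e) {y : ℕ} (hy : y ∈ l) : b ≤ pos y ∧ pos y + len y ≤ e := by
  induction l generalizing b with
  | nil => simp at hy
  | cons z l ih =>
    have h1 := h.1
    have h2 := h.2.le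
    rcases List.mem_cons.1 hy with rfl | hy
    · omega
    · have := ih h.2 hy
      omega

theorem pairwise (h : Tile len pos b l e) : l.Pairwise fun y z => pos y + len y ≤ pos z := by
  induction l generalizing b with
  | nil => simp
  | cons y l ih =>
    refine List.pairwise_cons.2 ⟨fun z hz => ?_, ih h.2⟩
    have := (h.2.bounds hz).1
    rw [h.1]; exact this

theorem pairwise_lt (h : Tile len pos b l e) (hl : ∀ y ∈ l, 0 < len y) :
    l.Pairwise fun y z => pos y < pos z := by
  refine (h.pairwise.imp_of_mem ?_)
  intro y z hy _ hyz
  have := hl y hy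
  omega

theorem cover (h : Tile len pos b l e) {f : ℕ} (hb : b ≤ f) (he : f < e) :
    ∃ y ∈ l, pos y ≤ f ∧ f < pos y + len y := by
  induction l generalizing b with
  | nil => have : b = e := h; omega
  | cons y l ih =>
    have h1 := h.1
    by_cases hf : f < b + len y
    · exact ⟨y, by simp, by omega, by omega⟩
    · obtain ⟨z, hz, h'⟩ := ih h.2 (by omega)
      exact ⟨z, by simp [hz], h'⟩

theorem unique (h : Tile len pos b l e) {y z f : ℕ} (hy : y ∈ l) (hz : z ∈ l)
    (h1 : pos y ≤ f) (h2 : f < pos y + len y) (h3 : pos z ≤ f) (h4 : f < pos z + len z) :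
    y = z := by
  induction l generalizing b with
  | nil => simp at hy
  | cons w l ih =>
    have hw := h.1
    rcases List.mem_cons.1 hy with rfl | hy' <;> rcases List.mem_cons.1 hz with rfl | hz'
    · rfl
    · have := (h.2.bounds hz').1; omega
    · have := (h.2.bounds hy').1; omega
    · exact ih h.2 hy' hz'

theorem of_getElem (f : ℕ → ℕ) (h0 : f 0 = b) (he : f l.length = e)
    (hs : ∀ i (hi : i < l.length), pos l[i] = f i ∧ f (i + 1) = f i + len l[i]) :
    Tile len pos b l e := by
  induction l generalizing b f with
  | nil => exact h0.symm.trans he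
  | cons y l ih =>
    have := hs 0 (by simp)
    simp only [List.getElem_cons_zero] at this
    refine ⟨this.1.trans h0, ih (fun i => f (i + 1)) ?_ ?_ ?_⟩
    · simp only [this.2, h0, zero_add]
    · simpa using he
    · intro i hi
      exact hs (i + 1) (by simpa using hi)

/-- For families known to be disjoint and covering but lacking a formula for the next starting
position; the F-intervals are of this kind. -/
theorem of_cover (hp : l.Pairwise fun y z => pos y < pos z)
    (hl : ∀ y ∈ l, 0 < len y) (hb : ∀ y ∈ l, b ≤ pos y ∧ pos y + len y ≤ e) (hbe : b ≤ e)
    (hc : ∀ f, b ≤ f → f < e → ∃ y ∈ l, pos y ≤ f ∧ f < pos y + len y)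
    (hu : ∀ y ∈ l, ∀ z ∈ l, pos y < pos z → pos y + len y ≤ pos z) : Tile len pos b l e := by
  induction l generalizing b with
  | nil =>
    by_contra hne
    have : b ≠ e := hne
    obtain ⟨y, hy, -⟩ := hc b le_rfl (by omega)
    simp at hy
  | cons y l ih =>
    rw [List.pairwise_cons] at hp
    have hy1 := hl y (by simp)
    have hy2 := hb y (by simp)
    have hyb : pos y = b := by
      obtain ⟨z, hz, h1, h2⟩ := hc b le_rfl (by omega)
      rcases List.mem_cons.1 hz with rfl | hz
      · omega
      · have := hp.1 z hz
        omega
    refine ⟨hyb, ih hp.2 (fun z hz => hl z (by simp [hz])) ?_ (by omega) ?_ ?_⟩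
    · intro z hz
      have h1 := hb z (by simp [hz])
      have h2 := hu y (by simp) z (by simp [hz]) (hp.1 z hz)
      omega
    · intro f h1 h2
      obtain ⟨z, hz, h3, h4⟩ := hc f (by omega) h2
      rcases List.mem_cons.1 hz with rfl | hz
      · omega
      · exact ⟨z, hz, h3, h4⟩
    · exact fun z hz w hw => hu z (by simp [hz]) w (by simp [hw])

theorem getElem_eq (h : Tile len pos b l e) {i : ℕ} (hi : i < l.length) :
    pos l[i] = b + ((l.take i).map len).sum := by
  induction l generalizing b i with
  | nil => simp at hi
  | cons y l ih =>
    cases i with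
    | zero => simpa using h.1
    | succ i =>
      have := ih h.2 (i := i) (by simpa using hi)
      simp [this, add_assoc]

theorem sum_eq (h : Tile len pos b l e) : b + (l.map len).sum = e := by
  induction l generalizing b with
  | nil => exact h
  | cons y l ih =>
    have := ih h.2
    simp only [List.map_cons, List.sum_cons]
    omega

end Tile

/-- Serves to exchange the order by starting positions for the order by index in the order
maintenance list. -/
theorem lt_iff_lt_of_pairwise {l : List ℕ} {f g : ℕ → ℕ} (hf : l.Pairwise fun y z => f y < f z)
    (hg : l.Pairwise fun y z => g y < g z) {y z : ℕ} (hy : y ∈ l) (hz : z ∈ l) :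
    f y < f z ↔ g y < g z := by
  induction l with
  | nil => simp at hy
  | cons w l ih =>
    rw [List.pairwise_cons] at hf hg
    rcases List.mem_cons.1 hy with rfl | hy' <;> rcases List.mem_cons.1 hz with rfl | hz'
    · simp
    · exact ⟨fun _ => hg.1 z hz', fun _ => hf.1 z hz'⟩
    · have h1 := hf.1 y hy'
      have h2 := hg.1 y hy'
      omega
    · exact ih hf.2 hg.2 hy' hz'

theorem pairwise_idxOf {l : List ℕ} (h : l.Nodup) :
    l.Pairwise fun y z => l.idxOf y < l.idxOf z := by
  rw [List.pairwise_iff_getElem]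
  intro i j hi hj hij
  rwa [h.idxOf_getElem, h.idxOf_getElem]

/-! ### Doubly linked lists -/

variable {A : Type}

/-- The doubly linked list of side `s` runs through `l`. -/
def DLL (σ : Store A) (s : Side) (l : List ℕ) : Prop :=
  σ.first s = l.head? ∧ σ.last s = l.getLast? ∧
  ∀ l₁ y l₂, l = l₁ ++ y :: l₂ →
    (σ.mem s y).next = l₂.head? ∧ (σ.mem s y).prev = l₁.getLast?

theorem linked_iff_dll {σ : Store A} {s : Side} {k : ℕ} {x : Fin k → ℕ} :
    Linked σ s x ↔ DLL σ s (List.ofFn x) := by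
  unfold Linked DLL
  rw [List.head?_eq_getElem?]
  refine and_congr Iff.rfl (and_congr Iff.rfl ⟨fun h l₁ y l₂ e => ?_, fun h i => ?_⟩)
  · have hlen := congrArg List.length e
    simp only [List.length_ofFn, List.length_append, List.length_cons] at hlen
    have hy : x ⟨l₁.length, by omega⟩ = y := by
      have h1 : (List.ofFn x)[l₁.length]? = some y := by simp [e]
      rw [List.getElem?_ofFn] at h1
      simpa [show l₁.length < k by omega] using h1
    have h2 := h ⟨l₁.length, by omega⟩
    rw [hy, e] at h2
    refine ⟨by rw [h2.1, List.head?_eq_getElem?]; simp [List.getElem?_append_right], ?_⟩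
    rw [h2.2]
    simp only
    split
    · rename_i h0
      rw [List.length_eq_zero_iff.1 h0]; rfl
    · rename_i h0
      rw [List.getLast?_eq_getElem?, List.getElem?_append_left (by omega)]
  · have hi : (i : ℕ) < (List.ofFn x).length := by simp
    have e : List.ofFn x = (List.ofFn x).take i ++ x i :: (List.ofFn x).drop (i + 1) := by
      conv_lhs => rw [← List.take_append_drop i (List.ofFn x), List.drop_eq_getElem_cons hi]
      simp
    obtain ⟨h1, h2⟩ := h _ _ _ e
    refine ⟨by rw [h1, List.head?_drop], ?_⟩
    rw [h2]
    split
    · rename_i h0; simp [h0]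
    · rename_i h0
      rw [List.getLast?_take]
      have : (List.ofFn x)[(i : ℕ) - 1]? = some (x ⟨i - 1, by omega⟩) := by
        rw [List.getElem?_ofFn, dif_pos (by omega)]
      rw [this]; simp [h0]

/-! ### Address-based description of a store -/

variable [LinearOrder A] [OrderBot A]

/-- The entry of the B-tree for the node `y` of `V`. -/
def entryOf (σ : Store A) (y : ℕ) : Entry A := ⟨y, (σ.mem .V y).lf, (σ.mem .V y).chr⟩

/-- The store `σ` holds an LF-interval graph of the BWT of `S` whose nodes on side `s`, in the order
of the positions, have the addresses `l s`; the intervals of the nodes start at the positions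
`pos s`. -/
structure AHolds (α : ℕ) (S : List A) (σ : Store A) (l : Side → List ℕ)
    (pos : Side → ℕ → ℕ) : Prop where
  nodup : ∀ s, (l s).Nodup
  lt_fresh : ∀ s, ∀ y ∈ l s, y < σ.fresh
  blank : ∀ s y, y ∉ l s → σ.mem s y = Cell.blank
  lf_mem : ∀ s, ∀ y ∈ l s, (σ.mem s y).lf ∈ l s.other
  lf_lf : ∀ s, ∀ y ∈ l s, (σ.mem s.other (σ.mem s y).lf).lf = y
  chr_lf : ∀ s, ∀ y ∈ l s, (σ.mem s.other (σ.mem s y).lf).chr = (σ.mem s y).chr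
  len_lf : ∀ s, ∀ y ∈ l s, (σ.mem s.other (σ.mem s y).lf).len = (σ.mem s y).len
  len_pos : ∀ s, ∀ y ∈ l s, 0 < (σ.mem s y).len
  run : ∀ y ∈ l .U, ∀ j < (σ.mem .U y).len,
    (bwt S).getD (pos .U y + j) ⊥ = (σ.mem .U y).chr ∧
    LF S (pos .U y + j) = pos .V (σ.mem .U y).lf + j
  tile : ∀ s, Tile (fun y => (σ.mem s y).len) (pos s) 0 (l s) S.length
  head : ∀ s, ∀ y ∈ l s, (σ.mem s y).head ∈ l s.other ∧
    pos s y = pos s.other (σ.mem s y).head + (σ.mem s y).off ∧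
    (σ.mem s y).off < (σ.mem s.other (σ.mem s y).head).len
  inn_nodup : ∀ s, ∀ y ∈ l s, (σ.mem s y).inn.Nodup
  inn : ∀ s, ∀ y ∈ l s.other, ∀ x, x ∈ (σ.mem s.other y).inn ↔ x ∈ l s ∧ (σ.mem s x).head = y
  dll : ∀ s, DLL σ s (l s)
  dollar : σ.dollar ∈ l .U ∧ (σ.mem .U σ.dollar).chr = ⊥
  om : σ.om = l .U
  tree_shape : ∃ h, σ.tree.Uniform h
  tree_entries : σ.tree.inorder = (l .V).map (entryOf σ)
  heavy_nodup : ∀ s, (σ.heavy s).Nodup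
  heavy : ∀ s x, x ∈ σ.heavy s ↔ x ∈ l s ∧ α ≤ (σ.mem s x).inn.length

end

/-! ### From the indexed graph to the description by addresses. -/

section

@[simp] theorem Side.other_other (s : Side) : s.other.other = s := by cases s <;> rfl

theorem Side.other_ne (s : Side) : s.other ≠ s := by cases s <;> simp [Side.other]

/-- A function on the two sides. -/
def Side.pick {β : Type} (a b : β) : Side → β
  | .U => a
  | .V => b

section Positions

variable {A : Type}

theorem posOf_zero (D : List (List A)) : posOf D 0 = 0 := by simp [posOf]

theorem posOf_succ (D : List (List A)) {i : ℕ} (hi : i < D.length) :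
    posOf D (i + 1) = posOf D i + D[i].length := by
  unfold posOf
  rw [List.take_succ_eq_append_getElem hi, List.flatten_append, List.length_append,
    List.flatten_singleton]

theorem posOf_length (D : List (List A)) : posOf D D.length = D.flatten.length := by
  simp [posOf]

theorem flatten_getD (D : List (List A)) {i : ℕ} (hi : i < D.length) {j : ℕ}
    (hj : j < D[i].length) (d : A) : D.flatten.getD (posOf D i + j) d = D[i][j] := by
  have e : D.flatten = (D.take i).flatten ++ (D[i] ++ (D.drop (i + 1)).flatten) := by
    conv_lhs => rw [← List.take_append_drop i D, List.drop_eq_getElem_cons hi,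
      List.flatten_append, List.flatten_cons]
  rw [e, posOf, List.getD_append_right _ _ _ _ (by omega), Nat.add_sub_cancel_left,
    List.getD_append _ _ _ _ hj, List.getD_eq_getElem _ _ hj]

end Positions

/-- An incoming list without duplicates enumerates the tails through an injective address map. So
heaviness, which is defined by counting, becomes a condition on the length of a list. -/
theorem card_filter_eq_length {n : ℕ} {f : Fin n → ℕ} (hf : Function.Injective f)
    {p : Fin n → Prop} [DecidablePred p] {l : List ℕ} (hl : l.Nodup)
    (h : ∀ x, x ∈ l ↔ ∃ i, f i = x ∧ p i) : (Finset.univ.filter p).card = l.length := by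
  rw [← List.toFinset_card_of_nodup hl, ← Finset.card_map ⟨f, hf⟩]
  congr 1
  ext x
  simp only [Finset.mem_map, Finset.mem_filter, Finset.mem_univ, true_and, List.mem_toFinset, h,
    Function.Embedding.coeFn_mk]
  exact exists_congr fun i => and_comm

variable {A : Type} [LinearOrder A] [OrderBot A]

section

variable {α : ℕ} {S : List A} {D : List (List A)} {σ : Store A} {u v : Fin D.length → ℕ}
  {π : Equiv.Perm (Fin D.length)}

theorem HoldsAt.heavyRep_iff (h : HoldsAt α S D σ u v π) (β : ℕ) (i : Fin D.length) :
    HeavyRep β S D i ↔ β ≤ (σ.mem .U (u i)).inn.length := by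
  unfold HeavyRep
  rw [card_filter_eq_length (p := fun j : Fin D.length => LF S (posOf D j) ∈ repInt D i)
    h.inj_v (h.ef_nodup i) (h.ef_head i)]

theorem HoldsAt.heavyFInt_iff (h : HoldsAt α S D σ u v π) (β : ℕ) (i : Fin D.length) :
    HeavyFInt β S D i ↔ β ≤ (σ.mem .V (v i)).inn.length := by
  unfold HeavyFInt
  rw [card_filter_eq_length (p := fun j : Fin D.length => posOf D j ∈ fInt S D i)
    h.inj_u (h.el_nodup i) (h.el_head i)]

theorem mem_ofFn_comp {n : ℕ} (v : Fin n → ℕ) (π : Equiv.Perm (Fin n)) {y : ℕ} :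
    y ∈ List.ofFn (v ∘ π) ↔ ∃ i, v i = y := by
  rw [List.mem_ofFn]
  exact ⟨fun ⟨i, e⟩ => ⟨π i, e⟩, fun ⟨i, e⟩ => ⟨π.symm i, by simpa using e⟩⟩

/-- Most fields are transported along the address maps. The substance is that the F-intervals tile
the rows, which rests on the LF function being a bijection of the rows and a translation on each
run. -/
theorem AHolds.of_holdsAt (hS : EndMarked S) (hD : IsDBWT (bwt S) D)
    (h : HoldsAt α S D σ u v π) :
    ∃ pos, AHolds α S σ (Side.pick (List.ofFn u) (List.ofFn (v ∘ π))) pos := by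
  have hn : D.flatten.length = S.length := by rw [hD.1, bwt_length]
  have hlenp : ∀ i : Fin D.length, 0 < D[i].length := fun i =>
    List.length_pos_of_ne_nil (hD.2 _ (List.getElem_mem _)).1
  have hps : ∀ i : Fin D.length, posOf D (i + 1) = posOf D i + D[i].length :=
    fun i => posOf_succ D i.2
  have hle : ∀ i : Fin D.length, posOf D i + D[i].length ≤ S.length := by
    intro i
    rw [← hps, ← hn, posOf]
    conv_rhs => rw [← List.take_append_drop (i + 1) D, List.flatten_append, List.length_append]
    omega
  have hchr : ∀ i : Fin D.length, ∀ j < D[i].length,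
      (bwt S).getD (posOf D i + j) ⊥ = (bwt S).getD (posOf D i) ⊥ := by
    intro i j hj
    obtain ⟨a, ha⟩ := (hD.2 _ (List.getElem_mem i.2)).2
    have h1 : ∀ j < D[i].length, (bwt S).getD (posOf D i + j) ⊥ = a := by
      intro j hj
      rw [← hD.1]
      rw [flatten_getD D i.2 hj]
      exact ha _ (List.getElem_mem _)
    rw [h1 j hj, ← h1 0 (hlenp i), add_zero]
  have hLF : ∀ i : Fin D.length, ∀ j < D[i].length,
      LF S (posOf D i + j) = LF S (posOf D i) + j :=
    fun i j hj => LF_add hS _ _ (hle i) (hchr i) j hj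
  have hlast : ∀ i : Fin D.length, posOf D (i + 1) - 1 = posOf D i + (D[i].length - 1) := by
    intro i; have := hps i; have := hlenp i; omega
  have hBU : ∀ i, (σ.mem .U (u i)).chr = (bwt S).getD (posOf D i) ⊥ ∧
      (σ.mem .U (u i)).len = D[i].length := by
    intro i
    have := h.label_u i
    simp only [Grp, Prod.mk.injEq] at this
    refine ⟨this.1, this.2.trans ?_⟩
    have := hps i
    omega
  have hposlt : ∀ i : Fin D.length, posOf D i < S.length := by
    intro i; have := hle i; have := hlenp i; omega
  have hBV : ∀ i, (σ.mem .V (v i)).chr = (bwt S).getD (posOf D i) ⊥ ∧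
      (σ.mem .V (v i)).len = D[i].length := by
    intro i
    have := h.label_v i
    simp only [Grp, Prod.mk.injEq] at this
    refine ⟨this.1.trans (firstCol_getD_LF (hposlt i)), this.2.trans ?_⟩
    rw [hlast, hLF i _ (by have := hlenp i; omega)]
    have := hlenp i
    omega
  have hrep : ∀ i : Fin D.length, ∀ f, f ∈ repInt D i ↔
      posOf D i ≤ f ∧ f < posOf D i + D[i].length := by
    intro i f
    rw [repInt, Finset.mem_Icc, hlast]
    have := hlenp i
    omega
  have hfint : ∀ i : Fin D.length, ∀ f, f ∈ fInt S D i ↔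
      LF S (posOf D i) ≤ f ∧ f < LF S (posOf D i) + D[i].length := by
    intro i f
    have := hlenp i
    rw [fInt, Finset.mem_Icc, hlast, hLF i _ (by omega)]
    omega
  -- Positions become functions of addresses; the value `0` outside the graph is never used.
  let pos : Side → ℕ → ℕ := Side.pick (Function.extend u (fun i => posOf D i) 0)
    (Function.extend v (fun i => LF S (posOf D i)) 0)
  have hpU : ∀ i, pos .U (u i) = posOf D i := fun i => h.inj_u.extend_apply (fun i : Fin D.length => posOf D i) 0 i
  have hpV : ∀ i, pos .V (v i) = LF S (posOf D i) := fun i => h.inj_v.extend_apply (fun i : Fin D.length => LF S (posOf D i)) 0 i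
  have hlfU : ∀ i, (σ.mem .U (u i)).lf = v i := fun i => (h.lf_u i i).1 rfl
  have hlfV : ∀ i, (σ.mem .V (v i)).lf = u i := fun i => (h.lf_v i i).1 rfl
  have hmU : ∀ y, y ∈ List.ofFn u ↔ ∃ i, u i = y := fun y => List.mem_ofFn
  have hmV : ∀ y, y ∈ List.ofFn (v ∘ π) ↔ ∃ i, v i = y := fun y => mem_ofFn_comp v π
  have htU : Tile (fun y => (σ.mem .U y).len) (pos .U) 0 (List.ofFn u) S.length := by
    refine Tile.of_getElem (posOf D) (posOf_zero D) ?_ ?_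
    · rw [List.length_ofFn, posOf_length, hn]
    · intro i hi
      rw [List.length_ofFn] at hi
      rw [List.getElem_ofFn, hpU, (hBU _).2]
      exact ⟨rfl, hps ⟨i, hi⟩⟩
  have htV : Tile (fun y => (σ.mem .V y).len) (pos .V) 0 (List.ofFn (v ∘ π)) S.length := by
    -- If the `j`-th F-interval began inside the `i`-th one, its first row would be the image of a
    -- row of the `i`-th repetition. By injectivity the `j`-th repetition would begin at that row,
    -- whence `i = j`.
    have hub : ∀ i j : Fin D.length, LF S (posOf D i) < LF S (posOf D j) →
        LF S (posOf D i) + D[i].length ≤ LF S (posOf D j) := by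
      intro i j hij
      by_contra hlt
      push Not at hlt
      obtain ⟨t, ht⟩ := Nat.exists_eq_add_of_lt hij
      have h1 := hLF i (t + 1) (by omega)
      have h2 := hle i
      have h3 : posOf D i + (t + 1) = posOf D j :=
        LF_inj (by omega) (hposlt j) (by omega)
      have h4 : u i = u j := htU.unique (f := posOf D j) ((hmU _).2 ⟨i, rfl⟩) ((hmU _).2 ⟨j, rfl⟩)
        (by rw [hpU]; omega) (by simp only [hpU, (hBU i).2]; omega) (by rw [hpU])
        (by simp only [hpU, (hBU j).2]; have := hlenp j; omega)
      rw [h.inj_u h4] at hij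
      omega
    refine Tile.of_cover ?_ ?_ ?_ (Nat.zero_le _) ?_ ?_
    · rw [List.pairwise_ofFn]
      intro i j hij
      simp only [Function.comp_apply, hpV]
      exact h.sorted hij
    · intro y hy
      obtain ⟨i, rfl⟩ := (hmV y).1 hy
      rw [(hBV i).2]; exact hlenp i
    · intro y hy
      obtain ⟨i, rfl⟩ := (hmV y).1 hy
      rw [hpV, (hBV i).2]
      refine ⟨Nat.zero_le _, ?_⟩
      have h0 := hlenp i
      have h1 := hLF i (D[i].length - 1) (by omega)
      have h2 := LF_lt (S := S) (i := posOf D i + (D[i].length - 1)) (by have := hle i; omega)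
      omega
    · intro f _ hf
      obtain ⟨p, hp, rfl⟩ := exists_LF_eq hf
      obtain ⟨y, hy, h1, h2⟩ := htU.cover (Nat.zero_le p) hp
      obtain ⟨i, rfl⟩ := (hmU y).1 hy
      rw [hpU] at h1 h2
      rw [(hBU i).2] at h2
      refine ⟨v i, (hmV _).2 ⟨i, rfl⟩, ?_⟩
      have h3 := hLF i (p - posOf D i) (by omega)
      rw [Nat.add_sub_cancel' h1] at h3
      rw [hpV, (hBV i).2]
      omega
    · intro y hy z hz
      obtain ⟨i, rfl⟩ := (hmV y).1 hy
      obtain ⟨j, rfl⟩ := (hmV z).1 hz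
      rw [hpV, hpV, (hBV i).2]
      exact hub i j
  refine ⟨pos, ?_⟩
  constructor
  case nodup =>
    rintro (_ | _)
    · exact List.nodup_ofFn.2 h.inj_u
    · exact List.nodup_ofFn.2 (h.inj_v.comp π.injective)
  case lt_fresh =>
    rintro (_ | _) y hy
    · obtain ⟨i, rfl⟩ := (hmU y).1 hy
      exact (h.lt_fresh i).1
    · obtain ⟨i, rfl⟩ := (hmV y).1 hy
      exact (h.lt_fresh i).2
  case blank =>
    rintro (_ | _) y hy
    · exact h.blank_u y fun i e => hy ((hmU y).2 ⟨i, e⟩)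
    · exact h.blank_v y fun i e => hy ((hmV y).2 ⟨i, e⟩)
  case lf_mem =>
    rintro (_ | _) y hy
    · obtain ⟨i, rfl⟩ := (hmU y).1 hy
      exact (hmV _).2 ⟨i, (hlfU i).symm⟩
    · obtain ⟨i, rfl⟩ := (hmV y).1 hy
      exact (hmU _).2 ⟨i, (hlfV i).symm⟩
  case lf_lf =>
    rintro (_ | _) y hy
    · obtain ⟨i, rfl⟩ := (hmU y).1 hy
      simp only [Side.other, hlfU, hlfV]
    · obtain ⟨i, rfl⟩ := (hmV y).1 hy
      simp only [Side.other, hlfU, hlfV]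
  case chr_lf =>
    rintro (_ | _) y hy
    · obtain ⟨i, rfl⟩ := (hmU y).1 hy
      simp only [Side.other, hlfU, hBU, hBV]
    · obtain ⟨i, rfl⟩ := (hmV y).1 hy
      simp only [Side.other, hlfV, hBU, hBV]
  case len_lf =>
    rintro (_ | _) y hy
    · obtain ⟨i, rfl⟩ := (hmU y).1 hy
      simp only [Side.other, hlfU, hBU, hBV]
    · obtain ⟨i, rfl⟩ := (hmV y).1 hy
      simp only [Side.other, hlfV, hBU, hBV]
  case len_pos =>
    rintro (_ | _) y hy
    · obtain ⟨i, rfl⟩ := (hmU y).1 hy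
      rw [(hBU i).2]; exact hlenp i
    · obtain ⟨i, rfl⟩ := (hmV y).1 hy
      rw [(hBV i).2]; exact hlenp i
  case run =>
    intro y hy j hj
    obtain ⟨i, rfl⟩ := (hmU y).1 hy
    rw [(hBU i).2] at hj
    rw [hpU, hlfU, hpV, (hBU i).1]
    exact ⟨hchr i j hj, hLF i j hj⟩
  case tile =>
    rintro (_ | _)
    · exact htU
    · exact htV
  case head =>
    rintro (_ | _) y hy
    · obtain ⟨i, rfl⟩ := (hmU y).1 hy
      obtain ⟨j, hj⟩ := h.el_tail i
      have he := (h.el i j).2 hj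
      have hb := h.bl i j he
      have he' := (hfint j _).1 he
      simp only [Grp] at hb
      simp only [Side.other, hj, hpU, hpV, (hBV j).2]
      exact ⟨(hmV _).2 ⟨j, rfl⟩, by omega, by omega⟩
    · obtain ⟨j, rfl⟩ := (hmV y).1 hy
      obtain ⟨i, hi⟩ := h.ef_tail j
      have he := (h.ef j i).2 hi
      have hb := h.bf j i he
      have he' := (hrep i _).1 he
      simp only [Grp] at hb
      simp only [Side.other, hi, hpU, hpV, (hBU i).2]
      exact ⟨(hmU _).2 ⟨i, rfl⟩, by omega, by omega⟩
  case inn_nodup =>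
    rintro (_ | _) y hy
    · obtain ⟨i, rfl⟩ := (hmU y).1 hy
      exact h.ef_nodup i
    · obtain ⟨i, rfl⟩ := (hmV y).1 hy
      exact h.el_nodup i
  case inn =>
    rintro (_ | _) y hy x
    · obtain ⟨j, rfl⟩ := (hmV y).1 hy
      refine (h.el_head j x).trans ⟨?_, ?_⟩
      · rintro ⟨i, rfl, he⟩
        exact ⟨(hmU _).2 ⟨i, rfl⟩, (h.el i j).1 he⟩
      · rintro ⟨hx, he⟩
        obtain ⟨i, rfl⟩ := (hmU x).1 hx
        exact ⟨i, rfl, (h.el i j).2 he⟩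
    · obtain ⟨j, rfl⟩ := (hmU y).1 hy
      refine (h.ef_head j x).trans ⟨?_, ?_⟩
      · rintro ⟨i, rfl, he⟩
        exact ⟨(hmV _).2 ⟨i, rfl⟩, (h.ef i j).1 he⟩
      · rintro ⟨hx, he⟩
        obtain ⟨i, rfl⟩ := (hmV x).1 hx
        exact ⟨i, rfl, (h.ef i j).2 he⟩
  case dll =>
    rintro (_ | _)
    · exact linked_iff_dll.1 h.list_u
    · exact linked_iff_dll.1 h.list_v
  case dollar =>
    obtain ⟨i, hi, hb⟩ := h.dollar
    refine ⟨(hmU _).2 ⟨i, hi⟩, ?_⟩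
    rw [← hi]
    have := h.label_u i
    rw [hb] at this
    exact congrArg Prod.fst this
  case om => exact h.om
  case tree_shape => exact h.tree_shape
  case tree_entries =>
    rw [h.tree_entries]
    simp only [Side.pick, List.map_ofFn]
    congr 1
    funext i
    simp only [Function.comp_apply, entryOf, hlfV, hBV]
    rfl
  case heavy_nodup =>
    rintro (_ | _)
    · exact h.heavy_u_nodup
    · exact h.heavy_v_nodup
  case heavy =>
    rintro (_ | _) x
    · refine (h.heavy_u x).trans ⟨?_, ?_⟩
      · rintro ⟨i, rfl, he⟩
        exact ⟨(hmU _).2 ⟨i, rfl⟩, (h.heavyRep_iff α i).1 he⟩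
      · rintro ⟨hx, he⟩
        obtain ⟨i, rfl⟩ := (hmU x).1 hx
        exact ⟨i, rfl, (h.heavyRep_iff α i).2 he⟩
    · refine (h.heavy_v x).trans ⟨?_, ?_⟩
      · rintro ⟨i, rfl, he⟩
        exact ⟨(hmV _).2 ⟨i, rfl⟩, (h.heavyFInt_iff α i).1 he⟩
      · rintro ⟨hx, he⟩
        obtain ⟨i, rfl⟩ := (hmV x).1 hx
        exact ⟨i, rfl, (h.heavyFInt_iff α i).2 he⟩

end

end

/-! ### From the description by addresses back to a DBWT and its graph. -/

section

variable {A : Type} [LinearOrder A] [OrderBot A]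

/-- The DBWT is read off the list of the `u` nodes, one constant block for each. The permutation
records at which index of that list the partner of the `i`-th F-interval stands. -/
theorem AHolds.exists_holdsAt {α : ℕ} {S : List A} {σ : Store A} {l : Side → List ℕ}
    {pos : Side → ℕ → ℕ} (hS : EndMarked S) (h : AHolds α S σ l pos) :
    ∃ D, IsDBWT (bwt S) D ∧ D.length = (l .U).length ∧ ∃ u v π, HoldsAt α S D σ u v π ∧
      (∀ i, u i ∈ l .U) ∧ ∀ i, v i ∈ l .V := by
  obtain ⟨rep, hrepd⟩ : ∃ rep : ℕ → List A, rep = fun y =>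
      List.replicate (σ.mem .U y).len (σ.mem .U y).chr := ⟨_, rfl⟩
  have hreplen : ∀ y, (rep y).length = (σ.mem .U y).len := by simp [hrepd]
  obtain ⟨D, hDd⟩ : ∃ D, D = (l .U).map rep := ⟨_, rfl⟩
  have hk : D.length = (l .U).length := by simp [hDd]
  have hmemlfV : ∀ y ∈ l .U, (σ.mem .U y).lf ∈ l .V := h.lf_mem .U
  have hmemlfU : ∀ y ∈ l .V, (σ.mem .V y).lf ∈ l .U := h.lf_mem .V
  have hlflfU : ∀ y ∈ l .U, (σ.mem .V (σ.mem .U y).lf).lf = y := h.lf_lf .U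
  have hlflfV : ∀ y ∈ l .V, (σ.mem .U (σ.mem .V y).lf).lf = y := h.lf_lf .V
  have hperm : ((l .U).map fun y => (σ.mem .U y).lf).Perm (l .V) := by
    rw [List.perm_ext_iff_of_nodup _ (h.nodup .V)]
    · intro y
      rw [List.mem_map]
      constructor
      · rintro ⟨x, hx, rfl⟩; exact hmemlfV x hx
      · intro hy; exact ⟨_, hmemlfU y hy, hlflfV y hy⟩
    · refine (h.nodup .U).map_on ?_
      intro x hx y hy e
      rw [← hlflfU x hx, ← hlflfU y hy, e]
  have hkV : D.length = (l .V).length := by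
    rw [hk, ← hperm.length_eq, List.length_map]
  let u : Fin D.length → ℕ := fun i => (l .U)[(i : ℕ)]'(hk ▸ i.2)
  let w : Fin D.length → ℕ := fun i => (l .V)[(i : ℕ)]'(hkV ▸ i.2)
  let v : Fin D.length → ℕ := fun i => (σ.mem .U (u i)).lf
  have hu : ∀ i, u i ∈ l .U := fun i => List.getElem_mem _
  have hw : ∀ i, w i ∈ l .V := fun i => List.getElem_mem _
  have hv : ∀ i, v i ∈ l .V := fun i => hmemlfV _ (hu i)
  have hui : Function.Injective u := by
    intro i j e
    exact Fin.ext (((h.nodup .U).getElem_inj_iff).1 e)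
  have hwi : Function.Injective w := by
    intro i j e
    exact Fin.ext (((h.nodup .V).getElem_inj_iff).1 e)
  have hvi : Function.Injective v := by
    intro i j e
    refine hui ?_
    rw [← hlflfU _ (hu i), ← hlflfU _ (hu j)]
    exact congrArg (fun z => (σ.mem .V z).lf) e
  have hus : ∀ y ∈ l .U, ∃ i, u i = y := by
    intro y hy
    obtain ⟨i, hi, e⟩ := List.mem_iff_getElem.1 hy
    exact ⟨⟨i, hk ▸ hi⟩, e⟩
  have hvs : ∀ y ∈ l .V, ∃ i, v i = y := by
    intro y hy
    obtain ⟨i, e⟩ := hus _ (hmemlfU y hy)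
    exact ⟨i, by simp only [v, e]; exact hlflfV y hy⟩
  have hwv : ∀ i, ∃ j, v j = w i := fun i => hvs _ (hw i)
  choose f hf using hwv
  have hfi : Function.Injective f := fun i j e => hwi <| by rw [← hf, ← hf, e]
  let π : Equiv.Perm (Fin D.length) := Equiv.ofBijective f (Finite.injective_iff_bijective.1 hfi)
  have hπ : ∀ i, v (π i) = w i := hf
  have hofu : List.ofFn u = l .U := by
    apply List.ext_getElem
    · simp [hk]
    · intro i h1 h2; simp [u]
  have hofw : List.ofFn (v ∘ π) = l .V := by
    apply List.ext_getElem
    · simp [hkV]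
    · intro i h1 h2; simp [hπ, w]
  have hDlen : ∀ i : Fin D.length, (D[(i : ℕ)]).length = (σ.mem .U (u i)).len := by
    intro i
    have : D[(i : ℕ)] = rep (u i) := by simp [hDd, u]
    rw [this, hreplen]
  have hsum : ∀ m, posOf D m = (((l .U).take m).map fun y => (σ.mem .U y).len).sum := by
    intro m
    rw [posOf, hDd, List.length_flatten, ← List.map_take, List.map_map]
    congr 2
    funext y
    simp [hreplen]
  have hpos : ∀ i : Fin D.length, posOf D i = pos .U (u i) := by
    intro i
    have := (h.tile .U).getElem_eq (i := i) (hk ▸ i.2)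
    rw [show u i = (l .U)[(i : ℕ)]'(hk ▸ i.2) from rfl, this, zero_add, hsum]
  have hps : ∀ i : Fin D.length, posOf D (i + 1) = pos .U (u i) + (σ.mem .U (u i)).len := by
    intro i; rw [posOf_succ D i.2, hpos, hDlen]
  have hlp : ∀ i, 0 < (σ.mem .U (u i)).len := fun i => h.len_pos .U _ (hu i)
  have hn : D.flatten.length = S.length := by
    have := (h.tile .U).sum_eq
    rw [zero_add] at this
    rw [← this, hDd, List.length_flatten, List.map_map]
    congr 2
    funext y
    simp [hreplen]
  have hlt : ∀ i, pos .U (u i) + (σ.mem .U (u i)).len ≤ S.length :=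
    fun i => ((h.tile .U).bounds (hu i)).2
  have hrun0 : ∀ i, (bwt S).getD (pos .U (u i)) ⊥ = (σ.mem .U (u i)).chr ∧
      LF S (pos .U (u i)) = pos .V (v i) := fun i => h.run _ (hu i) 0 (hlp i)
  have hLFlast : ∀ i : Fin D.length, LF S (posOf D (i + 1) - 1) =
      pos .V (v i) + ((σ.mem .U (u i)).len - 1) := by
    intro i
    have := hlp i
    rw [hps, ← (h.run _ (hu i) ((σ.mem .U (u i)).len - 1) (by omega)).2]
    congr 1
    omega
  have hvlen : ∀ i, (σ.mem .V (v i)).len = (σ.mem .U (u i)).len := fun i => h.len_lf .U _ (hu i)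
  have hrepm : ∀ (i : Fin D.length) p, p ∈ repInt D i ↔
      pos .U (u i) ≤ p ∧ p < pos .U (u i) + (σ.mem .U (u i)).len := by
    intro i p
    have := hlp i
    rw [repInt, Finset.mem_Icc, hps, hpos]
    omega
  have hfm : ∀ (i : Fin D.length) p, p ∈ fInt S D i ↔
      pos .V (v i) ≤ p ∧ p < pos .V (v i) + (σ.mem .V (v i)).len := by
    intro i p
    have := hlp i
    rw [fInt, Finset.mem_Icc, hLFlast, hpos, (hrun0 i).2, hvlen]
    omega
  have hEL : ∀ i j, (Grp S D).EL i j ↔ (σ.mem .U (u i)).head = v j := by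
    intro i j
    have hh := h.head .U _ (hu i)
    simp only [Side.other] at hh
    change posOf D i ∈ fInt S D j ↔ _
    rw [hfm, hpos]
    constructor
    · intro hp
      exact (h.tile .V).unique (f := pos .U (u i)) hh.1 (hv j) (by omega)
        (by have := hh.2.2; have := hh.2.1; omega) hp.1 hp.2
    · intro e
      rw [e] at hh
      omega
  have hEF : ∀ j i, (Grp S D).EF j i ↔ (σ.mem .V (v j)).head = u i := by
    intro j i
    have hh := h.head .V _ (hv j)
    simp only [Side.other] at hh
    change LF S (posOf D j) ∈ repInt D i ↔ _
    rw [hrepm, hpos, (hrun0 j).2]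
    constructor
    · intro hp
      exact (h.tile .U).unique (f := pos .V (v j)) hh.1 (hu i) (by omega)
        (by have := hh.2.2; have := hh.2.1; omega) hp.1 hp.2
    · intro e
      rw [e] at hh
      omega
  have hELh : ∀ j x, x ∈ (σ.mem .V (v j)).inn ↔ ∃ i, u i = x ∧ (Grp S D).EL i j := by
    intro j x
    refine (h.inn .U _ (hv j) x).trans ⟨?_, ?_⟩
    · rintro ⟨hx, e⟩
      obtain ⟨i, rfl⟩ := hus x hx
      exact ⟨i, rfl, (hEL i j).2 e⟩
    · rintro ⟨i, rfl, e⟩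
      exact ⟨hu i, (hEL i j).1 e⟩
  have hEFh : ∀ i x, x ∈ (σ.mem .U (u i)).inn ↔ ∃ j, v j = x ∧ (Grp S D).EF j i := by
    intro j x
    refine (h.inn .V _ (hu j) x).trans ⟨?_, ?_⟩
    · rintro ⟨hx, e⟩
      obtain ⟨i, rfl⟩ := hvs x hx
      exact ⟨i, rfl, (hEF i j).2 e⟩
    · rintro ⟨i, rfl, e⟩
      exact ⟨hv i, (hEF i j).1 e⟩
  have hBU : ∀ i, (Grp S D).BU i = ((σ.mem .U (u i)).chr, (σ.mem .U (u i)).len) := by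
    intro i
    simp only [Grp, hpos, hps, (hrun0 i).1, Nat.add_sub_cancel_left]
  have hRep : ∀ β i, HeavyRep β S D i ↔ β ≤ (σ.mem .U (u i)).inn.length := by
    intro β i
    unfold HeavyRep
    rw [card_filter_eq_length (p := fun j : Fin D.length => LF S (posOf D j) ∈ repInt D i)
      hvi (h.inn_nodup .U _ (hu i)) (hEFh i)]
  have hFInt : ∀ β i, HeavyFInt β S D i ↔ β ≤ (σ.mem .V (v i)).inn.length := by
    intro β i
    unfold HeavyFInt
    rw [card_filter_eq_length (p := fun j : Fin D.length => posOf D j ∈ fInt S D i)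
      hui (h.inn_nodup .V _ (hv i)) (hELh i)]
  refine ⟨D, ⟨?_, ?_⟩, hk, u, v, π, ?_, hu, hv⟩
  · apply List.ext_getElem
    · rw [hn, bwt_length]
    · intro p h1 h2
      rw [hn] at h1
      rw [← List.getD_eq_getElem _ ⊥, ← List.getD_eq_getElem _ ⊥]
      obtain ⟨y, hy, h3, h4⟩ := (h.tile .U).cover (Nat.zero_le p) h1
      obtain ⟨i, rfl⟩ := hus y hy
      have h5 := (h.run _ hy (p - pos .U (u i)) (by omega)).1
      rw [Nat.add_sub_cancel' h3] at h5
      have h6 : p = posOf D i + (p - pos .U (u i)) := by rw [hpos]; omega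
      rw [h5, h6, flatten_getD D i.2 (by rw [hDlen]; omega)]
      simp [hDd, hrepd, u]
  · intro P hP
    rw [hDd, List.mem_map] at hP
    obtain ⟨y, hy, rfl⟩ := hP
    constructor
    · have := h.len_pos .U y hy
      rw [← List.length_pos_iff, hreplen]
      exact this
    · exact ⟨(σ.mem .U y).chr, fun b hb => by
        rw [hrepd] at hb; exact List.eq_of_mem_replicate hb⟩
  constructor
  case inj_u => exact hui
  case inj_v => exact hvi
  case lt_fresh => exact fun i => ⟨h.lt_fresh .U _ (hu i), h.lt_fresh .V _ (hv i)⟩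
  case blank_u =>
    intro x hx
    refine h.blank .U x fun hm => ?_
    obtain ⟨i, e⟩ := hus x hm
    exact hx i e
  case blank_v =>
    intro x hx
    refine h.blank .V x fun hm => ?_
    obtain ⟨i, e⟩ := hvs x hm
    exact hx i e
  case label_u => exact fun i => (hBU i).symm
  case label_v =>
    intro i
    have := hlp i
    simp only [Grp]
    rw [hLFlast, firstCol_getD_LF (by rw [hpos]; have := hlt i; omega), hpos, (hrun0 i).2,
      (hrun0 i).1, hvlen, show (σ.mem .V (v i)).chr = (σ.mem .U (u i)).chr from h.chr_lf .U _ (hu i)]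
    congr 1
    omega
  case lf_u =>
    intro i j
    exact ⟨fun e => by cases e; rfl, fun e => hvi e⟩
  case lf_v =>
    intro i j
    have : (σ.mem .V (v j)).lf = u j := hlflfU _ (hu j)
    rw [this]
    exact ⟨fun e => by cases e; rfl, fun e => (hui e).symm⟩
  case el_tail =>
    intro i
    obtain ⟨j, e⟩ := hvs _ (h.head .U _ (hu i)).1
    exact ⟨j, e.symm⟩
  case el => exact hEL
  case bl =>
    intro i j e
    have e := (hEL i j).1 e
    have hh := h.head .U _ (hu i)
    simp only [Side.other, e] at hh
    simp only [Grp, hpos, (hrun0 j).2]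
    omega
  case el_nodup => exact fun j => h.inn_nodup .V _ (hv j)
  case el_head => exact hELh
  case ef_tail =>
    intro i
    obtain ⟨j, e⟩ := hus _ (h.head .V _ (hv i)).1
    exact ⟨j, e.symm⟩
  case ef => exact hEF
  case bf =>
    intro j i e
    have e := (hEF j i).1 e
    have hh := h.head .V _ (hv j)
    simp only [Side.other, e] at hh
    simp only [Grp, hpos, (hrun0 j).2]
    omega
  case ef_nodup => exact fun j => h.inn_nodup .U _ (hu j)
  case ef_head => exact hEFh
  case sorted =>
    intro i j hij
    simp only [hpos, (hrun0 _).2, hπ]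
    exact List.pairwise_iff_getElem.1 ((h.tile .V).pairwise_lt (h.len_pos .V)) i j
      (hkV ▸ i.2) (hkV ▸ j.2) hij
  case list_u => rw [linked_iff_dll, hofu]; exact h.dll .U
  case list_v => rw [linked_iff_dll, hofw]; exact h.dll .V
  case dollar =>
    obtain ⟨i, e⟩ := hus _ h.dollar.1
    refine ⟨i, e, ?_⟩
    have hc := h.dollar.2
    rw [← e] at hc
    rw [hBU, hc]
    congr 1
    -- A node with character `$` and length at least two would put `$` into two rows of the BWT.
    by_contra hne
    have h0 := hlp i
    have h1 := h.run _ (hu i) 0 h0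
    have h2 := h.run _ (hu i) 1 (by omega)
    have h3 := hlt i
    rw [hc, add_zero, bwt_getD_eq_bot_iff hS (by omega)] at h1
    rw [hc, bwt_getD_eq_bot_iff hS (by omega)] at h2
    omega
  case om => rw [hofu]; exact h.om
  case tree_shape => exact h.tree_shape
  case tree_entries =>
    rw [h.tree_entries, ← hofw, List.map_ofFn]
    congr 1
    funext i
    have h1 : (σ.mem .V (v (π i))).lf = u (π i) := hlflfU _ (hu _)
    have h2 : (σ.mem .V (v (π i))).chr = (σ.mem .U (u (π i))).chr := h.chr_lf .U _ (hu _)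
    simp only [Function.comp_apply, entryOf, hBU, h1, h2]
  case heavy_u_nodup => exact h.heavy_nodup .U
  case heavy_v_nodup => exact h.heavy_nodup .V
  case heavy_u =>
    intro x
    refine (h.heavy .U x).trans ⟨?_, ?_⟩
    · rintro ⟨hx, e⟩
      obtain ⟨i, rfl⟩ := hus x hx
      exact ⟨i, rfl, (hRep _ _).2 e⟩
    · rintro ⟨i, rfl, e⟩
      exact ⟨hu i, (hRep _ _).1 e⟩
  case heavy_v =>
    intro x
    refine (h.heavy .V x).trans ⟨?_, ?_⟩
    · rintro ⟨hx, e⟩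
      obtain ⟨i, rfl⟩ := hvs x hx
      exact ⟨i, rfl, (hFInt _ _).2 e⟩
    · rintro ⟨i, rfl, e⟩
      exact ⟨hv i, (hFInt _ _).1 e⟩

end

section

/-! ### Reasoning about programs -/

section Programs

variable {A : Type} {β γ : Type}

/-- Run on the store `σ`, the program `p` yields a result, a final store and a number of steps that
satisfy `Φ`. -/
def Tri (p : Prog A β) (σ : Store A) (Φ : β → Store A → ℕ → Prop) : Prop :=
  ∃ b σ' n, Φ b σ' n ∧ ∀ t, StateT.run p (σ, t) = (b, (σ', t + n))

namespace Tri

variable {σ : Store A}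

theorem pure {b : β} {Φ : β → Store A → ℕ → Prop} (h : Φ b σ 0) :
    Tri (Pure.pure b : Prog A β) σ Φ := ⟨b, σ, 0, h, fun _ => rfl⟩

theorem bind {p : Prog A β} {f : β → Prog A γ} {Φ : β → Store A → ℕ → Prop}
    {Ψ : γ → Store A → ℕ → Prop} (hp : Tri p σ Φ)
    (hf : ∀ b σ' n, Φ b σ' n → Tri (f b) σ' fun c σ'' m => Ψ c σ'' (n + m)) :
    Tri (p >>= f) σ Ψ := by
  obtain ⟨b, σ', n, h, e⟩ := hp
  obtain ⟨c, σ'', m, h', e'⟩ := hf b σ' n h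
  refine ⟨c, σ'', n + m, h', fun t => ?_⟩
  rw [StateT.run_bind, e]
  change StateT.run (f b) (σ', t + n) = _
  rw [e', add_assoc]

theorem mono {p : Prog A β} {Φ Ψ : β → Store A → ℕ → Prop} (hp : Tri p σ Φ)
    (h : ∀ b σ' n, Φ b σ' n → Ψ b σ' n) : Tri p σ Ψ := by
  obtain ⟨b, σ', n, h', e⟩ := hp
  exact ⟨b, σ', n, h _ _ _ h', e⟩

theorem tick {n : ℕ} {Φ : Unit → Store A → ℕ → Prop} (h : Φ () σ n) :
    Tri (_root_.tick n : Prog A Unit) σ Φ := ⟨(), σ, n, h, fun _ => rfl⟩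

theorem readS {f : Store A → β} {Φ : β → Store A → ℕ → Prop} (h : Φ (f σ) σ 1) :
    Tri (_root_.readS f) σ Φ := ⟨f σ, σ, 1, h, fun _ => rfl⟩

theorem writeS {f : Store A → Store A} {Φ : Unit → Store A → ℕ → Prop} (h : Φ () (f σ) 1) :
    Tri (_root_.writeS f) σ Φ := ⟨(), f σ, 1, h, fun _ => rfl⟩

/-- Continue after reading a component of the store. -/
theorem readS_bind {f : Store A → β} {g : β → Prog A γ} {Ψ : γ → Store A → ℕ → Prop}
    (h : Tri (g (f σ)) σ fun c σ' m => Ψ c σ' (1 + m)) : Tri (_root_.readS f >>= g) σ Ψ :=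
  bind (Φ := fun b σ' n => b = f σ ∧ σ' = σ ∧ n = 1) (readS ⟨rfl, rfl, rfl⟩) <| by
    rintro _ _ _ ⟨rfl, rfl, rfl⟩; exact h

theorem look_bind {s : Side} {x : ℕ} {g : Cell A → Prog A γ} {Ψ : γ → Store A → ℕ → Prop}
    (h : Tri (g (σ.mem s x)) σ fun c σ' m => Ψ c σ' (1 + m)) :
    Tri (_root_.look s x >>= g) σ Ψ := readS_bind h

theorem writeS_bind {f : Store A → Store A} {g : Unit → Prog A γ} {Ψ : γ → Store A → ℕ → Prop}
    (h : Tri (g ()) (f σ) fun c σ' m => Ψ c σ' (1 + m)) : Tri (_root_.writeS f >>= g) σ Ψ :=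
  bind (Φ := fun _ σ' n => σ' = f σ ∧ n = 1) (writeS ⟨rfl, rfl⟩) <| by
    rintro _ _ _ ⟨rfl, rfl⟩; exact h

theorem tick_bind {k : ℕ} {g : Unit → Prog A γ} {Ψ : γ → Store A → ℕ → Prop}
    (h : Tri (g ()) σ fun c σ' m => Ψ c σ' (k + m)) : Tri (_root_.tick k >>= g) σ Ψ :=
  bind (Φ := fun _ σ' n => σ' = σ ∧ n = k) (tick ⟨rfl, rfl⟩) <| by
    rintro _ _ _ ⟨rfl, rfl⟩; exact h

end Tri

end Programs

/-! ### The B-tree -/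

section Trees

variable {A : Type} [LinearOrder A]

/-- The order of the keys: by character, then by the place in the list `om`. -/
def KeyLt (om : List ℕ) (x y : Entry A) : Prop :=
  x.chr < y.chr ∨ x.chr = y.chr ∧ om.idxOf x.u < om.idxOf y.u

instance (om : List ℕ) : DecidableRel (KeyLt (A := A) om) := fun x y => by
  unfold KeyLt; infer_instance

theorem tri_keyLess (σ : Store A) (x y : Entry A) :
    Tri (keyLess x y) σ fun b σ' n => b = decide (KeyLt σ.om x y) ∧ σ' = σ ∧ n ≤ 2 := by
  unfold keyLess
  refine Tri.tick_bind ?_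
  split_ifs with h1 h2
  · exact Tri.pure ⟨by simp [KeyLt, h1], rfl, by omega⟩
  · exact Tri.pure ⟨by simp [KeyLt, h1, h2.ne'], rfl, by omega⟩
  · refine Tri.readS ⟨?_, rfl, by omega⟩
    have : x.chr = y.chr := le_antisymm (not_lt.1 h2) (not_lt.1 h1)
    simp [KeyLt, this]

/-- Branching on a comparison of keys. -/
theorem tri_keyLess_bind {β : Type} {σ : Store A} {x y : Entry A} {p q : Prog A β}
    {Ψ : β → Store A → ℕ → Prop}
    (hp : KeyLt σ.om x y → ∀ k ≤ 2, Tri p σ fun c σ' m => Ψ c σ' (k + m))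
    (hq : ¬ KeyLt σ.om x y → ∀ k ≤ 2, Tri q σ fun c σ' m => Ψ c σ' (k + m)) :
    Tri (keyLess x y >>= fun b => if b = true then p else q) σ Ψ := by
  refine Tri.bind (tri_keyLess σ x y) ?_
  rintro b σ' n ⟨rfl, rfl, hn⟩
  by_cases h : KeyLt σ'.om x y
  · simpa [h] using hp h n hn
  · simpa [h] using hq h n hn

/-- Full sortedness is not needed, only that the entries below `q` form a prefix. A failed
comparison then discards everything to the right, and after a successful one the best entry so far
is carried along in `acc`. Two comparisons of at most two steps give `4` per level. -/
theorem BTree.tri_pred {σ : Store A} (q : Entry A) (t : BTree (Entry A)) (h : ℕ)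
    (acc : Option (Entry A)) (hu : t.Uniform h)
    (hs : t.inorder.Pairwise fun a b => KeyLt σ.om b q → KeyLt σ.om a q) :
    Tri (t.pred q acc) σ fun r σ' n =>
      r = ((t.inorder.filter (KeyLt σ.om · q)).getLast?).or acc ∧ σ' = σ ∧ n ≤ 4 * h + 1 := by
  induction t generalizing h acc with
  | leaf =>
    unfold BTree.pred
    exact Tri.tick_bind (Tri.pure ⟨by simp [BTree.inorder], rfl, by omega⟩)
  | n2 l a r ihl ihr =>
    obtain _ | h := h
    · simp [BTree.Uniform] at hu
    unfold BTree.pred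
    simp only [BTree.inorder, List.pairwise_append, List.pairwise_cons] at hs
    obtain ⟨hl, ⟨har, hr⟩, hlr⟩ := hs
    refine tri_keyLess_bind (fun hk k hk2 => ?_) (fun hk k hk2 => ?_)
    · refine (ihr h (some a) hu.2 hr).mono ?_
      rintro b σ' n ⟨rfl, rfl, hn⟩
      refine ⟨?_, rfl, by omega⟩
      simp [BTree.inorder, hk, List.getLast?_append, List.getLast?_cons]
    · refine (ihl h acc hu.1 hl).mono ?_
      rintro b σ' n ⟨rfl, rfl, hn⟩
      refine ⟨?_, rfl, by omega⟩
      have : r.inorder.filter (KeyLt σ'.om · q) = [] := by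
        simp only [List.filter_eq_nil_iff, decide_eq_true_eq]
        exact fun b hb hb' => hk (har b hb hb')
      simp [BTree.inorder, hk, this]
  | n3 l a m b r ihl ihm ihr =>
    obtain _ | h := h
    · simp [BTree.Uniform] at hu
    unfold BTree.pred
    simp only [BTree.inorder, List.pairwise_append, List.pairwise_cons, List.mem_append,
      List.mem_cons] at hs
    obtain ⟨hl, ⟨hamr, hm, ⟨hbr, hr⟩, hmr⟩, hlr⟩ := hs
    refine tri_keyLess_bind (fun hk k hk2 => ?_) (fun hk k hk2 => ?_)
    · refine (ihr h (some b) hu.2.2 hr).mono ?_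
      rintro c σ' n ⟨rfl, rfl, hn⟩
      refine ⟨?_, rfl, by omega⟩
      have ha : KeyLt σ'.om a q := hamr b (by simp) hk
      simp [BTree.inorder, hk, ha, List.getLast?_append, List.getLast?_cons]
    · have hr0 : r.inorder.filter (KeyLt σ.om · q) = [] := by
        simp only [List.filter_eq_nil_iff, decide_eq_true_eq]
        exact fun b hb hb' => hk (hbr b hb hb')
      refine tri_keyLess_bind (fun hk' k' hk2' => ?_) (fun hk' k' hk2' => ?_)
      · refine (ihm h (some a) hu.2.1 hm).mono ?_
        rintro c σ' n ⟨rfl, rfl, hn⟩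
        refine ⟨?_, rfl, by omega⟩
        simp [BTree.inorder, hk, hk', hr0, List.getLast?_append, List.getLast?_cons]
      · refine (ihl h acc hu.1 hl).mono ?_
        rintro c σ' n ⟨rfl, rfl, hn⟩
        refine ⟨?_, rfl, by omega⟩
        have : m.inorder.filter (KeyLt σ'.om · q) = [] := by
          simp only [List.filter_eq_nil_iff, decide_eq_true_eq]
          exact fun b hb hb' => hk' (hamr b (by simp [hb]) hb')
        simp [BTree.inorder, hk, hk', this, hr0]

/-- The entries of the result of an insertion. -/
def InsRes.inorder {β : Type} : InsRes β → List β
  | .same t => t.inorder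
  | .over l a r => l.inorder ++ a :: r.inorder

/-- The trees of the result of an insertion have uniform depth `h`. -/
def InsRes.Uniform {β : Type} (h : ℕ) : InsRes β → Prop
  | .same t => t.Uniform h
  | .over l _ r => l.Uniform h ∧ r.Uniform h

/-- The entries above `x` form a suffix, and the descent ends between it and the remaining prefix.
An overflow hands two trees of the old height to the parent, so all leaves stay at the same depth.
-/
theorem BTree.tri_ins {σ : Store A} (x : Entry A) (t : BTree (Entry A)) (h : ℕ) (hu : t.Uniform h)
    (hs : t.inorder.Pairwise fun a b => KeyLt σ.om x a → KeyLt σ.om x b) :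
    Tri (t.ins x) σ fun r σ' n =>
      r.Uniform h ∧
      r.inorder = t.inorder.filter (fun a => ¬ KeyLt σ.om x a) ++
        x :: t.inorder.filter (fun a => KeyLt σ.om x a) ∧ σ' = σ ∧ n ≤ 4 * h + 1 := by
  induction t generalizing h with
  | leaf =>
    unfold BTree.ins
    obtain _ | h := h
    · exact Tri.tick_bind (Tri.pure ⟨⟨trivial, trivial⟩, rfl, rfl, by omega⟩)
    · simp [BTree.Uniform] at hu
  | n2 l a r ihl ihr =>
    obtain _ | h := h
    · simp [BTree.Uniform] at hu
    unfold BTree.ins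
    simp only [BTree.inorder, List.pairwise_append, List.pairwise_cons] at hs
    obtain ⟨hl, ⟨har, hr⟩, hlr⟩ := hs
    refine tri_keyLess_bind (fun hk k hk2 => ?_) (fun hk k hk2 => ?_)
    · have h1 : r.inorder.filter (fun a => KeyLt σ.om x a) = r.inorder := by
        simp only [List.filter_eq_self, decide_eq_true_eq]
        exact fun b hb => har b hb hk
      have h2 : r.inorder.filter (fun a => ¬ KeyLt σ.om x a) = [] := by
        simp only [List.filter_eq_nil_iff, decide_eq_true_eq, not_not]
        exact fun b hb => har b hb hk
      refine Tri.bind (ihl h hu.1 hl) ?_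
      rintro (t' | ⟨t1, e, t2⟩) σ' n ⟨hu', he, rfl, hn⟩ <;>
      · refine Tri.pure ⟨?_, ?_, rfl, by omega⟩
        · simpa [InsRes.Uniform, BTree.Uniform, hu.2, and_assoc] using hu'
        · simp only [InsRes.inorder, BTree.inorder] at he ⊢
          simp only [List.filter_append, List.filter_cons, hk, h1, h2]
          simpa using congrArg (· ++ a :: r.inorder) he
    · have h1 : l.inorder.filter (fun a => KeyLt σ.om x a) = [] := by
        simp only [List.filter_eq_nil_iff, decide_eq_true_eq]
        exact fun b hb hb' => hk (hlr b hb a (by simp) hb')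
      have h2 : l.inorder.filter (fun a => ¬ KeyLt σ.om x a) = l.inorder := by
        simp only [List.filter_eq_self, decide_eq_true_eq]
        exact fun b hb hb' => hk (hlr b hb a (by simp) hb')
      refine Tri.bind (ihr h hu.2 hr) ?_
      rintro (t' | ⟨t1, e, t2⟩) σ' n ⟨hu', he, rfl, hn⟩ <;>
      · refine Tri.pure ⟨?_, ?_, rfl, by omega⟩
        · simpa [InsRes.Uniform, BTree.Uniform, hu.1, and_assoc] using hu'
        · simp only [InsRes.inorder, BTree.inorder] at he ⊢
          simp only [List.filter_append, List.filter_cons, hk, h1, h2, he]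
          simp
  | n3 l a m b r ihl ihm ihr =>
    obtain _ | h := h
    · simp [BTree.Uniform] at hu
    unfold BTree.ins
    simp only [BTree.inorder, List.pairwise_append, List.pairwise_cons, List.mem_append,
      List.mem_cons] at hs
    obtain ⟨hl, ⟨hamr, hm, ⟨hbr, hr⟩, hmr⟩, hlr⟩ := hs
    obtain ⟨hul, hum, hur⟩ := hu
    refine tri_keyLess_bind (fun hk k hk2 => ?_) (fun hk k hk2 => ?_)
    · have hb : KeyLt σ.om x b := hamr b (by simp) hk
      have h1 : r.inorder.filter (fun a => KeyLt σ.om x a) = r.inorder := by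
        simp only [List.filter_eq_self, decide_eq_true_eq]
        exact fun c hc => hamr c (by simp [hc]) hk
      have h2 : r.inorder.filter (fun a => ¬ KeyLt σ.om x a) = [] := by
        simp only [List.filter_eq_nil_iff, decide_eq_true_eq, not_not]
        exact fun c hc => hamr c (by simp [hc]) hk
      have h3 : m.inorder.filter (fun a => KeyLt σ.om x a) = m.inorder := by
        simp only [List.filter_eq_self, decide_eq_true_eq]
        exact fun c hc => hamr c (by simp [hc]) hk
      have h4 : m.inorder.filter (fun a => ¬ KeyLt σ.om x a) = [] := by
        simp only [List.filter_eq_nil_iff, decide_eq_true_eq, not_not]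
        exact fun c hc => hamr c (by simp [hc]) hk
      refine Tri.bind (ihl h hul hl) ?_
      rintro (t' | ⟨t1, e, t2⟩) σ' n ⟨hu', he, rfl, hn⟩ <;>
      · refine Tri.pure ⟨?_, ?_, rfl, by omega⟩
        · simpa [InsRes.Uniform, BTree.Uniform, hum, hur, and_assoc] using hu'
        · simp only [InsRes.inorder, BTree.inorder] at he ⊢
          simp only [List.filter_append, List.filter_cons, hk, hb, h1, h2, h3, h4, he]
          simp
    · have hlk : ∀ c ∈ l.inorder, ¬ KeyLt σ.om x c := fun c hc hc' =>
        hk (hlr c hc a (by simp) hc')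
      have h1 : l.inorder.filter (fun a => KeyLt σ.om x a) = [] := by
        simp only [List.filter_eq_nil_iff, decide_eq_true_eq]
        exact hlk
      have h2 : l.inorder.filter (fun a => ¬ KeyLt σ.om x a) = l.inorder := by
        simp only [List.filter_eq_self, decide_eq_true_eq]
        exact hlk
      refine tri_keyLess_bind (fun hk' k' hk2' => ?_) (fun hk' k' hk2' => ?_)
      · have h3 : r.inorder.filter (fun a => KeyLt σ.om x a) = r.inorder := by
          simp only [List.filter_eq_self, decide_eq_true_eq]
          exact fun c hc => hbr c hc hk'
        have h4 : r.inorder.filter (fun a => ¬ KeyLt σ.om x a) = [] := by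
          simp only [List.filter_eq_nil_iff, decide_eq_true_eq, not_not]
          exact fun c hc => hbr c hc hk'
        refine Tri.bind (ihm h hum hm) ?_
        rintro (t' | ⟨t1, e, t2⟩) σ' n ⟨hu', he, rfl, hn⟩ <;>
        · refine Tri.pure ⟨?_, ?_, rfl, by omega⟩
          · simpa [InsRes.Uniform, BTree.Uniform, hul, hur, and_assoc] using hu'
          · simp only [InsRes.inorder, BTree.inorder] at he ⊢
            simp only [List.filter_append, List.filter_cons, hk, hk', h1, h2, h3, h4]
            simpa using congrArg (fun z => z ++ b :: r.inorder) he
      · have hmk : ∀ c ∈ m.inorder, ¬ KeyLt σ.om x c := fun c hc hc' =>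
          hk' (hmr c hc b (by simp) hc')
        have h3 : m.inorder.filter (fun a => KeyLt σ.om x a) = [] := by
          simp only [List.filter_eq_nil_iff, decide_eq_true_eq]
          exact hmk
        have h4 : m.inorder.filter (fun a => ¬ KeyLt σ.om x a) = m.inorder := by
          simp only [List.filter_eq_self, decide_eq_true_eq]
          exact hmk
        refine Tri.bind (ihr h hur hr) ?_
        rintro (t' | ⟨t1, e, t2⟩) σ' n ⟨hu', he, rfl, hn⟩ <;>
        · refine Tri.pure ⟨?_, ?_, rfl, by omega⟩
          · simpa [InsRes.Uniform, BTree.Uniform, hul, hum, and_assoc] using hu'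
          · simp only [InsRes.inorder, BTree.inorder] at he ⊢
            simp only [List.filter_append, List.filter_cons, hk, hk', h1, h2, h3, h4, he]
            simp

end Trees

end

/-! ### Deletion from the B-tree, and the tree as a sorted set. -/

section

section Trees

variable {A : Type} {β : Type}

/-- The result of a deletion from a tree of uniform depth `h` has the right shape. -/
def DelRes.Shape (h : ℕ) : DelRes β → Prop
  | .same t => t.Uniform h
  | .under t => ∃ h', h = h' + 1 ∧ t.Uniform h'

theorem DelRes.Shape.uniform {h : ℕ} {r : DelRes β} (hr : r.Shape h) :
    ∃ h' ≤ h, r.tree.Uniform h' := by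
  cases r with
  | same t => exact ⟨h, le_rfl, hr⟩
  | under t =>
    obtain ⟨h', rfl, hu⟩ := hr
    exact ⟨h', by omega, hu⟩

theorem node21_spec {h : ℕ} {l : DelRes β} {a : β} {r : BTree β} (hl : l.Shape h)
    (hr : r.Uniform h) : (node21 l a r).Shape (h + 1) ∧
      (node21 l a r).tree.inorder = l.tree.inorder ++ a :: r.inorder := by
  cases l with
  | same l => exact ⟨⟨hl, hr⟩, rfl⟩
  | under l =>
    obtain ⟨h, rfl, hl⟩ := hl
    cases r <;>
      simp_all [node21, DelRes.Shape, DelRes.tree, BTree.Uniform, BTree.inorder]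

theorem node22_spec {h : ℕ} {l : BTree β} {a : β} {r : DelRes β} (hl : l.Uniform h)
    (hr : r.Shape h) : (node22 l a r).Shape (h + 1) ∧
      (node22 l a r).tree.inorder = l.inorder ++ a :: r.tree.inorder := by
  cases r with
  | same r => cases l <;> exact ⟨⟨hl, hr⟩, rfl⟩
  | under r =>
    obtain ⟨h, rfl, hr⟩ := hr
    cases l <;>
      simp_all [node22, DelRes.Shape, DelRes.tree, BTree.Uniform, BTree.inorder]

theorem node31_spec {h : ℕ} {l : DelRes β} {a b : β} {m r : BTree β} (hl : l.Shape h)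
    (hm : m.Uniform h) (hr : r.Uniform h) : (node31 l a m b r).Shape (h + 1) ∧
      (node31 l a m b r).tree.inorder = l.tree.inorder ++ a :: (m.inorder ++ b :: r.inorder) := by
  cases l with
  | same l => exact ⟨⟨hl, hm, hr⟩, rfl⟩
  | under l =>
    obtain ⟨h, rfl, hl⟩ := hl
    cases m <;>
      simp_all [node31, DelRes.Shape, DelRes.tree, BTree.Uniform, BTree.inorder]

theorem node32_spec {h : ℕ} {l : BTree β} {a b : β} {m : DelRes β} {r : BTree β}
    (hl : l.Uniform h) (hm : m.Shape h) (hr : r.Uniform h) :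
    (node32 l a m b r).Shape (h + 1) ∧
      (node32 l a m b r).tree.inorder = l.inorder ++ a :: (m.tree.inorder ++ b :: r.inorder) := by
  cases m with
  | same m => exact ⟨⟨hl, hm, hr⟩, rfl⟩
  | under m =>
    obtain ⟨h, rfl, hm⟩ := hm
    cases r <;>
      simp_all [node32, DelRes.Shape, DelRes.tree, BTree.Uniform, BTree.inorder]

theorem node33_spec {h : ℕ} {l m : BTree β} {a b : β} {r : DelRes β}
    (hl : l.Uniform h) (hm : m.Uniform h) (hr : r.Shape h) :
    (node33 l a m b r).Shape (h + 1) ∧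
      (node33 l a m b r).tree.inorder = l.inorder ++ a :: (m.inorder ++ b :: r.tree.inorder) := by
  cases r with
  | same r => cases m <;> exact ⟨⟨hl, hm, hr⟩, rfl⟩
  | under r =>
    obtain ⟨h, rfl, hr⟩ := hr
    cases m <;>
      simp_all [node33, DelRes.Shape, DelRes.tree, BTree.Uniform, BTree.inorder]

/-- The answer `none` means that the left subtree is empty, and then the node gives up its own first
entry. The shape is asserted only if an entry was found, since the tree accompanying `none` is
discarded. -/
theorem BTree.tri_splitMin {σ : Store A} (t : BTree (Entry A)) (h : ℕ) (hu : t.Uniform h) :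
    Tri t.splitMin σ fun r σ' n =>
      r.1 = t.inorder.head? ∧ (r.1 ≠ none → r.2.Shape h ∧ r.2.tree.inorder = t.inorder.tail) ∧
        σ' = σ ∧ n ≤ h + 1 := by
  induction t generalizing h with
  | leaf =>
    unfold BTree.splitMin
    exact Tri.tick_bind (Tri.pure ⟨rfl, by simp, rfl, by omega⟩)
  | n2 l a r ihl _ =>
    obtain _ | h := h
    · simp [BTree.Uniform] at hu
    unfold BTree.splitMin
    refine Tri.tick_bind (Tri.bind (ihl h hu.1) ?_)
    rintro ⟨_ | x, l'⟩ σ' n ⟨h1, h2, rfl, hn⟩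
    · have h1 : l.inorder = [] := by simpa using h1.symm
      refine Tri.pure ⟨by simp [BTree.inorder, h1], fun _ => ⟨⟨h, rfl, hu.2⟩, ?_⟩, rfl, by omega⟩
      simp [BTree.inorder, h1, DelRes.tree]
    · obtain ⟨h3, h4⟩ := h2 (by simp)
      obtain ⟨h5, h6⟩ := node21_spec (a := a) h3 hu.2
      have h1 : l.inorder ≠ [] := by rintro e; simp [e] at h1
      refine Tri.pure ⟨?_, fun _ => ⟨h5, ?_⟩, rfl, by omega⟩
      · cases hl : l.inorder <;> simp_all [BTree.inorder]
      · rw [h6, h4]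
        cases hl : l.inorder <;> simp_all [BTree.inorder]
  | n3 l a m b r ihl _ _ =>
    obtain _ | h := h
    · simp [BTree.Uniform] at hu
    unfold BTree.splitMin
    refine Tri.tick_bind (Tri.bind (ihl h hu.1) ?_)
    rintro ⟨_ | x, l'⟩ σ' n ⟨h1, h2, rfl, hn⟩
    · have h1 : l.inorder = [] := by simpa using h1.symm
      refine Tri.pure ⟨by simp [BTree.inorder, h1], fun _ => ⟨hu.2, ?_⟩, rfl, by omega⟩
      simp [BTree.inorder, h1, DelRes.tree]
    · obtain ⟨h3, h4⟩ := h2 (by simp)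
      obtain ⟨h5, h6⟩ := node31_spec (a := a) (b := b) h3 hu.2.1 hu.2.2
      have h1 : l.inorder ≠ [] := by rintro e; simp [e] at h1
      refine Tri.pure ⟨?_, fun _ => ⟨h5, ?_⟩, rfl, by omega⟩
      · cases hl : l.inorder <;> simp_all [BTree.inorder]
      · rw [h6, h4]
        cases hl : l.inorder <;> simp_all [BTree.inorder]

variable [LinearOrder A]

/-- What the deletion of `x` uses about entries `a` before `b`. -/
def DelOrder (om : List ℕ) (x a b : Entry A) : Prop :=
  a.v ≠ b.v ∧ (KeyLt om x a → KeyLt om x b) ∧ (a.v = x.v → KeyLt om x b)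

omit [LinearOrder A] in
theorem filter_ne_self {x : Entry A} {l : List (Entry A)} (h : ∀ b ∈ l, b.v ≠ x.v) :
    l.filter (fun a => a.v ≠ x.v) = l := by
  simpa [List.filter_eq_self] using h

/-- The entry is recognised by its node, but the way to it is found by keys. `DelOrder` makes the
two agree: the side discarded by a comparison cannot contain the entry. An entry with a nonempty
subtree to its right is replaced by the first entry of that subtree. One charge and two comparisons
of at most two steps give `5` per level. -/
theorem BTree.tri_del {σ : Store A} (x : Entry A) (t : BTree (Entry A)) (h : ℕ) (hu : t.Uniform h)
    (hs : t.inorder.Pairwise (DelOrder σ.om x))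
    (hx : ∀ b ∈ t.inorder, b.v = x.v → ¬ KeyLt σ.om x b) :
    Tri (t.del x) σ fun r σ' n =>
      r.Shape h ∧ r.tree.inorder = t.inorder.filter (fun a => a.v ≠ x.v) ∧ σ' = σ ∧
        n ≤ 5 * h + 1 := by
  induction t generalizing h with
  | leaf =>
    unfold BTree.del
    exact Tri.tick_bind (Tri.pure ⟨hu, rfl, rfl, by omega⟩)
  | n2 l a r ihl ihr =>
    obtain _ | h := h
    · simp [BTree.Uniform] at hu
    obtain ⟨hul, hur⟩ := hu
    unfold BTree.del
    simp only [BTree.inorder, List.pairwise_append, List.pairwise_cons] at hs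
    obtain ⟨hl, ⟨har, hr⟩, hlr⟩ := hs
    have hla : ∀ b ∈ l.inorder, DelOrder σ.om x b a := fun b hb => hlr b hb a (by simp)
    refine Tri.tick_bind ?_
    split_ifs with hxa
    · have e1 : (BTree.n2 l a r).inorder.filter (fun a => a.v ≠ x.v) = l.inorder ++ r.inorder := by
        simp only [BTree.inorder, List.filter_append, List.filter_cons]
        rw [filter_ne_self fun b hb => hxa ▸ (hla b hb).1,
          filter_ne_self fun b hb => hxa ▸ (har b hb).1.symm]
        simp [hxa]
      refine Tri.bind (r.tri_splitMin h hur) ?_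
      rintro ⟨_ | a', r'⟩ σ' n ⟨h1, h2, rfl, hn⟩
      · have h1 : r.inorder = [] := by simpa using h1.symm
        refine Tri.pure ⟨⟨h, rfl, hul⟩, ?_, rfl, by omega⟩
        rw [e1, h1, List.append_nil]; rfl
      · obtain ⟨h3, h4⟩ := h2 (by simp)
        obtain ⟨h5, h6⟩ := node22_spec (a := a') hul h3
        refine Tri.pure ⟨h5, ?_, rfl, by omega⟩
        rw [e1, h6, h4]
        cases hr : r.inorder <;> simp_all
    · have hxa' : a.v ≠ x.v := fun e => hxa e.symm
      refine tri_keyLess_bind (fun hk k hk2 => ?_) (fun hk k hk2 => ?_)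
      · refine Tri.bind (ihl h hul hl fun b hb => hx b (by simp [BTree.inorder, hb])) ?_
        rintro l' σ' n ⟨h1, h2, rfl, hn⟩
        obtain ⟨h5, h6⟩ := node21_spec (a := a) h1 hur
        refine Tri.pure ⟨h5, ?_, rfl, by omega⟩
        rw [h6, h2]
        simp only [BTree.inorder, List.filter_append, List.filter_cons]
        rw [filter_ne_self (l := r.inorder) fun b hb e =>
          hx b (by simp [BTree.inorder, hb]) e ((har b hb).2.1 hk)]
        simp [hxa']
      · refine Tri.bind (ihr h hur hr fun b hb => hx b (by simp [BTree.inorder, hb])) ?_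
        rintro l' σ' n ⟨h1, h2, rfl, hn⟩
        obtain ⟨h5, h6⟩ := node22_spec (a := a) hul h1
        refine Tri.pure ⟨h5, ?_, rfl, by omega⟩
        rw [h6, h2]
        simp only [BTree.inorder, List.filter_append, List.filter_cons]
        rw [filter_ne_self (l := l.inorder) fun b hb e => hk ((hla b hb).2.2 e)]
        simp [hxa']
  | n3 l a m b r ihl ihm ihr =>
    obtain _ | h := h
    · simp [BTree.Uniform] at hu
    obtain ⟨hul, hum, hur⟩ := hu
    unfold BTree.del
    simp only [BTree.inorder, List.pairwise_append, List.pairwise_cons, List.mem_append,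
      List.mem_cons] at hs
    obtain ⟨hl, ⟨hamr, hm, ⟨hbr, hr⟩, hmr⟩, hlr⟩ := hs
    have hla : ∀ c ∈ l.inorder, DelOrder σ.om x c a := fun c hc => hlr c hc a (by simp)
    have hlb : ∀ c ∈ l.inorder, DelOrder σ.om x c b := fun c hc => hlr c hc b (by simp)
    have hmb : ∀ c ∈ m.inorder, DelOrder σ.om x c b := fun c hc => hmr c hc b (by simp)
    have ham : ∀ c ∈ m.inorder, DelOrder σ.om x a c := fun c hc => hamr c (by simp [hc])
    have har : ∀ c ∈ r.inorder, DelOrder σ.om x a c := fun c hc => hamr c (by simp [hc])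
    have hab : DelOrder σ.om x a b := hamr b (by simp)
    refine Tri.tick_bind ?_
    split_ifs with hxa hxb
    · have e1 : (BTree.n3 l a m b r).inorder.filter (fun a => a.v ≠ x.v) =
          l.inorder ++ (m.inorder ++ b :: r.inorder) := by
        simp only [BTree.inorder, List.filter_append, List.filter_cons]
        rw [filter_ne_self fun b hb => hxa ▸ (hla b hb).1,
          filter_ne_self fun b hb => hxa ▸ (ham b hb).1.symm,
          filter_ne_self fun b hb => hxa ▸ (har b hb).1.symm]
        simp [hxa, hab.1.symm]
      refine Tri.bind (m.tri_splitMin h hum) ?_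
      rintro ⟨_ | a', r'⟩ σ' n ⟨h1, h2, rfl, hn⟩
      · have h1 : m.inorder = [] := by simpa using h1.symm
        refine Tri.pure ⟨⟨hul, hur⟩, ?_, rfl, by omega⟩
        rw [e1, h1]; rfl
      · obtain ⟨h3, h4⟩ := h2 (by simp)
        obtain ⟨h5, h6⟩ := node32_spec (a := a') (b := b) hul h3 hur
        refine Tri.pure ⟨h5, ?_, rfl, by omega⟩
        rw [e1, h6, h4]
        cases hr : m.inorder <;> simp_all
    · have hxa' : a.v ≠ x.v := fun e => hxa e.symm
      have e1 : (BTree.n3 l a m b r).inorder.filter (fun a => a.v ≠ x.v) =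
          l.inorder ++ a :: (m.inorder ++ r.inorder) := by
        simp only [BTree.inorder, List.filter_append, List.filter_cons]
        rw [filter_ne_self fun b hb => hxb ▸ (hlb b hb).1,
          filter_ne_self fun b hb => hxb ▸ (hmb b hb).1,
          filter_ne_self fun b hb => hxb ▸ (hbr b hb).1.symm]
        simp [hxb, hab.1]
      refine Tri.bind (r.tri_splitMin h hur) ?_
      rintro ⟨_ | a', r'⟩ σ' n ⟨h1, h2, rfl, hn⟩
      · have h1 : r.inorder = [] := by simpa using h1.symm
        refine Tri.pure ⟨⟨hul, hum⟩, ?_, rfl, by omega⟩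
        rw [e1, h1, List.append_nil]; rfl
      · obtain ⟨h3, h4⟩ := h2 (by simp)
        obtain ⟨h5, h6⟩ := node33_spec (a := a) (b := a') hul hum h3
        refine Tri.pure ⟨h5, ?_, rfl, by omega⟩
        rw [e1, h6, h4]
        cases hr : r.inorder <;> simp_all
    · have hxa' : a.v ≠ x.v := fun e => hxa e.symm
      have hxb' : b.v ≠ x.v := fun e => hxb e.symm
      refine tri_keyLess_bind (fun hk k hk2 => ?_) (fun hk k hk2 => ?_)
      · refine Tri.bind (ihl h hul hl fun b hb => hx b (by simp [BTree.inorder, hb])) ?_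
        rintro l' σ' n ⟨h1, h2, rfl, hn⟩
        obtain ⟨h5, h6⟩ := node31_spec (a := a) (b := b) h1 hum hur
        refine Tri.pure ⟨h5, ?_, rfl, by omega⟩
        rw [h6, h2]
        simp only [BTree.inorder, List.filter_append, List.filter_cons]
        rw [filter_ne_self (l := r.inorder) fun b hb e =>
            hx b (by simp [BTree.inorder, hb]) e ((har b hb).2.1 hk),
          filter_ne_self (l := m.inorder) fun b hb e =>
            hx b (by simp [BTree.inorder, hb]) e ((ham b hb).2.1 hk)]
        simp [hxa', hxb']
      · have el : l.inorder.filter (fun a => a.v ≠ x.v) = l.inorder :=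
          filter_ne_self fun b hb e => hk ((hla b hb).2.2 e)
        refine tri_keyLess_bind (fun hk' k' hk2' => ?_) (fun hk' k' hk2' => ?_)
        · refine Tri.bind (ihm h hum hm fun b hb => hx b (by simp [BTree.inorder, hb])) ?_
          rintro l' σ' n ⟨h1, h2, rfl, hn⟩
          obtain ⟨h5, h6⟩ := node32_spec (a := a) (b := b) hul h1 hur
          refine Tri.pure ⟨h5, ?_, rfl, by omega⟩
          rw [h6, h2]
          simp only [BTree.inorder, List.filter_append, List.filter_cons]
          rw [el, filter_ne_self (l := r.inorder) fun b hb e =>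
            hx b (by simp [BTree.inorder, hb]) e ((hbr b hb).2.1 hk')]
          simp [hxa', hxb']
        · refine Tri.bind (ihr h hur hr fun b hb => hx b (by simp [BTree.inorder, hb])) ?_
          rintro l' σ' n ⟨h1, h2, rfl, hn⟩
          obtain ⟨h5, h6⟩ := node33_spec (a := a) (b := b) hul hum h1
          refine Tri.pure ⟨h5, ?_, rfl, by omega⟩
          rw [h6, h2]
          simp only [BTree.inorder, List.filter_append, List.filter_cons]
          rw [el, filter_ne_self (l := m.inorder) fun b hb e => hk' ((hmb b hb).2.2 e)]
          simp [hxa', hxb']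

/-- Each node has at least two subtrees, so the number of entries plus one at least doubles with
every level. -/
theorem BTree.Uniform.two_pow_le {t : BTree β} {h : ℕ} (hu : t.Uniform h) :
    2 ^ h ≤ t.inorder.length + 1 := by
  induction t generalizing h with
  | leaf => cases h <;> simp_all [BTree.Uniform, BTree.inorder]
  | n2 l a r ihl ihr =>
    obtain _ | h := h
    · simp [BTree.Uniform] at hu
    have h1 := ihl hu.1
    have h2 := ihr hu.2
    simp only [BTree.inorder, List.length_append, List.length_cons, pow_succ]
    omega
  | n3 l a m b r ihl ihm ihr =>
    obtain _ | h := h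
    · simp [BTree.Uniform] at hu
    have h1 := ihl hu.1
    have h2 := ihr hu.2.2
    simp only [BTree.inorder, List.length_append, List.length_cons, pow_succ]
    omega

theorem KeyLt.trans {om : List ℕ} {x y z : Entry A} (h : KeyLt om x y) (h' : KeyLt om y z) :
    KeyLt om x z := by
  rcases h with h | ⟨h, k⟩ <;> rcases h' with h' | ⟨h', k'⟩
  · exact .inl (h.trans h')
  · exact .inl (h' ▸ h)
  · exact .inl (h ▸ h')
  · exact .inr ⟨h.trans h', k.trans k'⟩

theorem KeyLt.irrefl {om : List ℕ} (x : Entry A) : ¬ KeyLt om x x := by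
  rintro (h | ⟨_, h⟩) <;> exact lt_irrefl _ h

/-- The B-tree of `σ` has depth at most `h` and contains, sorted by their keys, the entries
satisfying `P`. -/
structure TreeInv (σ : Store A) (h : ℕ) (P : Entry A → Prop) : Prop where
  shape : ∃ h' ≤ h, σ.tree.Uniform h'
  sorted : σ.tree.inorder.Pairwise (KeyLt σ.om)
  mem : ∀ e, e ∈ σ.tree.inorder ↔ P e

/-- It suffices that `x` is comparable with the entries present, whatever graph they belong to. The
depth bound grows by one, which is harmless for a constant number of insertions. -/
theorem TreeInv.tri_treeInsert {σ : Store A} {h : ℕ} {P : Entry A → Prop} (hi : TreeInv σ h P)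
    {x : Entry A} (hx : ∀ e, P e → KeyLt σ.om x e ∨ KeyLt σ.om e x) :
    Tri (treeInsert x) σ fun _ σ' n => (∃ t, σ' = { σ with tree := t }) ∧
      TreeInv σ' (h + 1) (fun e => P e ∨ e = x) ∧ n ≤ 4 * h + 3 := by
  obtain ⟨h', hh, hu⟩ := hi.shape
  unfold treeInsert
  refine Tri.readS_bind (Tri.bind (BTree.tri_ins x σ.tree h' hu
    (hi.sorted.imp fun hab hxa => hxa.trans hab)) ?_)
  have key : ∀ r : List (Entry A), r = σ.tree.inorder.filter (fun a => ¬ KeyLt σ.om x a) ++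
      x :: σ.tree.inorder.filter (fun a => KeyLt σ.om x a) →
      r.Pairwise (KeyLt σ.om) ∧ ∀ e, e ∈ r ↔ P e ∨ e = x := by
    rintro r rfl
    constructor
    · rw [List.pairwise_append, List.pairwise_cons]
      have hlt : ∀ a ∈ σ.tree.inorder.filter (fun a => ¬ KeyLt σ.om x a), KeyLt σ.om a x := by
        intro a ha
        simp only [List.mem_filter, decide_eq_true_eq] at ha
        exact (hx a ((hi.mem a).1 ha.1)).resolve_left ha.2
      have hgt : ∀ a ∈ σ.tree.inorder.filter (fun a => KeyLt σ.om x a), KeyLt σ.om x a := by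
        intro a ha
        simp only [List.mem_filter, decide_eq_true_eq] at ha
        exact ha.2
      refine ⟨hi.sorted.sublist List.filter_sublist, ⟨hgt,
        hi.sorted.sublist List.filter_sublist⟩, fun a ha b hb => ?_⟩
      rcases List.mem_cons.1 hb with rfl | hb
      · exact hlt a ha
      · exact (hlt a ha).trans (hgt b hb)
    · intro e
      simp only [List.mem_append, List.mem_cons, List.mem_filter, decide_eq_true_eq, hi.mem]
      by_cases hk : KeyLt σ.om x e <;> simp [hk, or_comm]
  rintro (t | ⟨l, a, r⟩) σ' n ⟨hu', he, rfl, hn⟩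
  · refine Tri.writeS ⟨⟨_, rfl⟩, ⟨⟨h', by omega, hu'⟩, (key _ he).1, (key _ he).2⟩, by omega⟩
  · refine Tri.writeS ⟨⟨_, rfl⟩, ⟨⟨h' + 1, by omega, hu'⟩, (key _ he).1, (key _ he).2⟩, by omega⟩

theorem TreeInv.tri_treeDelete {σ : Store A} {h : ℕ} {P : Entry A → Prop} (hi : TreeInv σ h P)
    (hP : ∀ e e', P e → P e' → e.v = e'.v → e = e') {x : Entry A} (hx : P x) :
    Tri (treeDelete x) σ fun _ σ' n => (∃ t, σ' = { σ with tree := t }) ∧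
      TreeInv σ' h (fun e => P e ∧ e.v ≠ x.v) ∧ n ≤ 5 * h + 3 := by
  obtain ⟨h', hh, hu⟩ := hi.shape
  unfold treeDelete
  refine Tri.readS_bind (Tri.bind (BTree.tri_del x σ.tree h' hu ?_ ?_) ?_)
  · refine hi.sorted.imp_of_mem fun {a b} ha hb hab => ⟨fun e => ?_, fun hxa => hxa.trans hab,
      fun e => ?_⟩
    · have := hP a b ((hi.mem a).1 ha) ((hi.mem b).1 hb) e
      exact KeyLt.irrefl b (this ▸ hab)
    · have := hP a x ((hi.mem a).1 ha) hx e
      exact this ▸ hab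
  · intro b hb e hk
    have := hP b x ((hi.mem b).1 hb) hx e
    exact KeyLt.irrefl x (this ▸ hk)
  · rintro r σ' n ⟨hr, he, rfl, hn⟩
    obtain ⟨h'', hle, hu'⟩ := hr.uniform
    refine Tri.writeS ⟨⟨_, rfl⟩, ⟨⟨h'', by omega, hu'⟩, ?_, ?_⟩, by omega⟩
    · simp only [he]
      exact hi.sorted.sublist List.filter_sublist
    · intro e
      simp only [he, List.mem_filter, hi.mem, decide_eq_true_eq]

theorem TreeInv.tri_treeSearch {σ : Store A} {h : ℕ} {P : Entry A → Prop} (hi : TreeInv σ h P)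
    (u : ℕ) (c : A) :
    Tri (treeSearch u c) σ fun r σ' n =>
      r = (((σ.tree.inorder.filter (KeyLt σ.om · ⟨0, u, c⟩)).getLast?).map Entry.v) ∧ σ' = σ ∧
        n ≤ 4 * h + 2 := by
  obtain ⟨h', hh, hu⟩ := hi.shape
  unfold treeSearch
  refine Tri.readS_bind (Tri.bind (BTree.tri_pred _ σ.tree h' none hu
    (hi.sorted.imp fun hab hb => hab.trans hb)) ?_)
  rintro r σ' n ⟨rfl, rfl, hn⟩
  exact Tri.pure ⟨by simp, rfl, by omega⟩

end Trees

end

section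

variable {A : Type}

/-! ### Doubly linked lists -/

/-- The links `nx`, `pv` run through the list `l`, with `p` before and `q` after it. -/
def Seg (nx pv : ℕ → Option ℕ) : Option ℕ → List ℕ → Option ℕ → Prop
  | _, [], _ => True
  | p, y :: l, q => pv y = p ∧ nx y = l.head?.or q ∧ Seg nx pv (some y) l q

theorem Seg.append_iff {nx pv : ℕ → Option ℕ} {p q : Option ℕ} {l₁ l₂ : List ℕ} :
    Seg nx pv p (l₁ ++ l₂) q ↔
      Seg nx pv p l₁ (l₂.head?.or q) ∧ Seg nx pv (l₁.getLast?.or p) l₂ q := by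
  induction l₁ generalizing p with
  | nil => simp [Seg]
  | cons y l ih =>
    simp only [List.cons_append, Seg, ih, List.head?_append, Option.or_assoc, and_assoc,
      List.getLast?_cons, Option.or_some]
    cases l.getLast? <;> simp

theorem Seg.congr {nx pv nx' pv' : ℕ → Option ℕ} {p q : Option ℕ} {l : List ℕ}
    (h : Seg nx pv p l q) (hn : ∀ y ∈ l, nx' y = nx y) (hp : ∀ y ∈ l, pv' y = pv y) :
    Seg nx' pv' p l q := by
  induction l generalizing p with
  | nil => trivial
  | cons y l ih =>
    refine ⟨(hp y (by simp)).trans h.1, (hn y (by simp)).trans h.2.1, ?_⟩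
    exact ih h.2.2 (fun z hz => hn z (by simp [hz])) (fun z hz => hp z (by simp [hz]))

theorem seg_iff {nx pv : ℕ → Option ℕ} {p q : Option ℕ} {l : List ℕ} :
    Seg nx pv p l q ↔ ∀ l₁ y l₂, l = l₁ ++ y :: l₂ →
      nx y = l₂.head?.or q ∧ pv y = l₁.getLast?.or p := by
  constructor
  · rintro h l₁ y l₂ rfl
    have := (Seg.append_iff.1 h).2
    exact ⟨this.2.1, this.1⟩
  · intro h
    induction l generalizing p with
    | nil => trivial
    | cons y l ih =>
      have h0 := h [] y l rfl
      refine ⟨by simpa using h0.2, h0.1, ih ?_⟩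
      rintro l₁ z l₂ rfl
      have := h (y :: l₁) z l₂ rfl
      refine ⟨this.1, ?_⟩
      rw [this.2, List.getLast?_cons]
      cases l₁.getLast? <;> simp

theorem dll_iff {σ : Store A} {s : Side} {l : List ℕ} :
    DLL σ s l ↔ σ.first s = l.head? ∧ σ.last s = l.getLast? ∧
      Seg (fun y => (σ.mem s y).next) (fun y => (σ.mem s y).prev) none l none := by
  unfold DLL
  rw [seg_iff]
  simp

/-- The store after changing a record. -/
def Store.upd (σ : Store A) (s : Side) (x : ℕ) (f : Cell A → Cell A) : Store A :=
  { σ with mem := fun s' y => if s' = s ∧ y = x then f (σ.mem s x) else σ.mem s' y }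

@[simp] theorem Store.upd_same (σ : Store A) (s : Side) (x : ℕ) (f : Cell A → Cell A) :
    (σ.upd s x f).mem s x = f (σ.mem s x) := by simp [Store.upd]

theorem Store.upd_of_ne (σ : Store A) {s s' : Side} {x y : ℕ} (f : Cell A → Cell A)
    (h : s' ≠ s ∨ y ≠ x) : (σ.upd s x f).mem s' y = σ.mem s' y := by
  simp only [Store.upd]
  rw [if_neg (by tauto)]

theorem Tri.change {σ : Store A} {s : Side} {x : ℕ} {f : Cell A → Cell A}
    {Φ : Unit → Store A → ℕ → Prop} (h : Φ () (σ.upd s x f) 1) : Tri (_root_.change s x f) σ Φ :=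
  Tri.writeS h

theorem Tri.change_bind {β : Type} {σ : Store A} {s : Side} {x : ℕ} {f : Cell A → Cell A}
    {g : Unit → Prog A β} {Ψ : β → Store A → ℕ → Prop}
    (h : Tri (g ()) (σ.upd s x f) fun c σ' m => Ψ c σ' (1 + m)) :
    Tri (_root_.change s x f >>= g) σ Ψ :=
  Tri.writeS_bind h

/-- The record without its links. -/
def Cell.body (c : Cell A) : Cell A := { c with prev := none, next := none }

/-- The stores differ only in the links of the nodes of `l` on side `s`. -/
structure LinkEq (s : Side) (l : List ℕ) (σ σ' : Store A) : Prop where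
  body : ∀ s' y, (σ'.mem s' y).body = (σ.mem s' y).body
  mem : ∀ s' y, (s' ≠ s ∨ y ∉ l) → σ'.mem s' y = σ.mem s' y
  first : ∀ s', s' ≠ s → σ'.first s' = σ.first s'
  last : ∀ s', s' ≠ s → σ'.last s' = σ.last s'
  dollar : σ'.dollar = σ.dollar
  fresh : σ'.fresh = σ.fresh
  om : σ'.om = σ.om
  tree : σ'.tree = σ.tree
  heavy : σ'.heavy = σ.heavy

theorem LinkEq.refl (s : Side) (l : List ℕ) (σ : Store A) : LinkEq s l σ σ := by
  constructor <;> intros <;> rfl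

theorem LinkEq.upd {s : Side} {l : List ℕ} {σ σ' : Store A} (h : LinkEq s l σ σ') {x : ℕ}
    (hx : x ∈ l) {f : Cell A → Cell A} (hf : ∀ c, (f c).body = c.body) :
    LinkEq s l σ (σ'.upd s x f) := by
  constructor
  case body =>
    intro s' y
    by_cases hy : s' = s ∧ y = x
    · obtain ⟨rfl, rfl⟩ := hy
      rw [Store.upd_same, hf, h.body]
    · rw [Store.upd_of_ne _ _ (by tauto), h.body]
  case mem =>
    intro s' y hy
    rw [Store.upd_of_ne, h.mem s' y hy]
    rcases hy with hy | hy
    · exact .inl hy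
    · exact .inr fun e => hy (e ▸ hx)
  all_goals first
    | exact h.first
    | exact h.last
    | exact h.dollar
    | exact h.fresh
    | exact h.om
    | exact h.tree
    | exact h.heavy

theorem LinkEq.setFirst {s : Side} {l : List ℕ} {σ σ' : Store A} (h : LinkEq s l σ σ')
    (x : Option ℕ) : LinkEq s l σ { σ' with first := Function.update σ'.first s x } := by
  constructor
  case first =>
    intro s' hs
    simp only [Function.update_of_ne hs, h.first s' hs]
  all_goals first
    | exact h.body
    | exact h.mem
    | exact h.last
    | exact h.dollar
    | exact h.fresh
    | exact h.om
    | exact h.tree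
    | exact h.heavy

theorem LinkEq.setLast {s : Side} {l : List ℕ} {σ σ' : Store A} (h : LinkEq s l σ σ')
    (x : Option ℕ) : LinkEq s l σ { σ' with last := Function.update σ'.last s x } := by
  constructor
  case last =>
    intro s' hs
    simp only [Function.update_of_ne hs, h.last s' hs]
  all_goals first
    | exact h.body
    | exact h.mem
    | exact h.first
    | exact h.dollar
    | exact h.fresh
    | exact h.om
    | exact h.tree
    | exact h.heavy

/-- The links of side `s` run through the list `l`. -/
abbrev Store.Seg (σ : Store A) (s : Side) : Option ℕ → List ℕ → Option ℕ → Prop :=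
  _root_.Seg (fun y => (σ.mem s y).next) (fun y => (σ.mem s y).prev)

theorem Store.Seg.congr {σ σ' : Store A} {s : Side} {p q : Option ℕ} {l : List ℕ}
    (h : σ.Seg s p l q) (hm : ∀ y ∈ l, σ'.mem s y = σ.mem s y) : σ'.Seg s p l q :=
  _root_.Seg.congr h (fun y hy => by rw [hm y hy]) (fun y hy => by rw [hm y hy])

/-- Nothing is assumed about the former links of `x`, as both are overwritten; only the two
neighbours change otherwise. -/
theorem tri_insertAfter {σ : Store A} {s : Side} {l₁ l₂ : List ℕ} {y x : ℕ}
    (h : DLL σ s (l₁ ++ y :: l₂)) (hn : (l₁ ++ y :: l₂).Nodup) (hx : x ∉ l₁ ++ y :: l₂) :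
    Tri (insertAfter s y x) σ fun _ σ' n =>
      LinkEq s (l₁ ++ y :: x :: l₂) σ σ' ∧ DLL σ' s (l₁ ++ y :: x :: l₂) ∧ n ≤ 4 := by
  obtain ⟨hf, hl, hs⟩ := dll_iff.1 h
  obtain ⟨hs1, hpy, hny, hs2⟩ := Seg.append_iff.1 hs
  simp only [Option.or_none] at hny hpy
  simp only [List.mem_append, List.mem_cons, not_or] at hx
  rw [List.nodup_append] at hn
  obtain ⟨hn1, hn2, hn3⟩ := hn
  rw [List.nodup_cons] at hn2
  unfold insertAfter
  refine Tri.look_bind (Tri.change_bind (Tri.change_bind ?_))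
  have hE : LinkEq s (l₁ ++ y :: x :: l₂) σ ((σ.upd s x fun d =>
      { d with prev := some y, next := (σ.mem s y).next }).upd s y fun d =>
      { d with next := some x }) :=
    ((LinkEq.refl s _ σ).upd (by simp) (f := _) (by intro c; rfl)).upd (by simp) (f := _)
      (by intro c; rfl)
  have hxy : x ≠ y := hx.2.1
  cases l₂ with
  | nil =>
    rw [hny]
    refine Tri.writeS ⟨hE.setLast _ |> fun h => by rwa [hny] at h, dll_iff.2 ⟨?_, ?_, ?_⟩, by omega⟩
    · change σ.first s = _
      rw [hf]; cases l₁ <;> simp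
    · simp
    · rw [Seg.append_iff]
      refine ⟨Store.Seg.congr hs1 ?_, ?_, ?_, ?_, ?_, trivial⟩
      · intro z hz
        have h1 : z ≠ y := hn3 z hz y (by simp)
        have h2 : z ≠ x := fun e => hx.1 (e ▸ hz)
        simp only [Store.upd_of_ne _ _ (Or.inr h1), Store.upd_of_ne _ _ (Or.inr h2)]
      · simp [Store.upd_of_ne _ _ (Or.inr hxy.symm), hpy]
      · simp
      · simp [Store.upd_of_ne _ _ (Or.inr hxy)]
      · simp [Store.upd_of_ne _ _ (Or.inr hxy)]
  | cons w l₂ =>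
    rw [hny]
    have hwy : w ≠ y := fun e => hn2.1 (by simp [e])
    have hwx : w ≠ x := fun e => hx.2.2 (by simp [e])
    obtain ⟨hpw, hnw, hs3⟩ := hs2
    have hwl := (List.nodup_cons.1 hn2.2).1
    rw [hny] at hE
    refine Tri.change ⟨hE.upd (by simp) fun _ => rfl, dll_iff.2 ⟨?_, ?_, ?_⟩, by omega⟩
    · change σ.first s = _
      rw [hf]; cases l₁ <;> simp
    · change σ.last s = _
      rw [hl]; simp [List.getLast?_append, List.getLast?_cons]
    · rw [Seg.append_iff]
      refine ⟨Store.Seg.congr hs1 ?_, ?_, ?_, ?_, ?_, ?_, ?_, Store.Seg.congr hs3 ?_⟩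
      · intro z hz
        have h1 : z ≠ y := hn3 z hz y (by simp)
        have h2 : z ≠ x := fun e => hx.1 (e ▸ hz)
        have h3 : z ≠ w := hn3 z hz w (by simp)
        simp only [Store.upd_of_ne _ _ (Or.inr h1), Store.upd_of_ne _ _ (Or.inr h2),
          Store.upd_of_ne _ _ (Or.inr h3)]
      · simp [Store.upd_of_ne _ _ (Or.inr hxy.symm), Store.upd_of_ne _ _ (Or.inr hwy.symm), hpy]
      · simp [Store.upd_of_ne _ _ (Or.inr hwy.symm)]
      · simp [Store.upd_of_ne _ _ (Or.inr hxy), Store.upd_of_ne _ _ (Or.inr hwx.symm)]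
      · simp [Store.upd_of_ne _ _ (Or.inr hxy), Store.upd_of_ne _ _ (Or.inr hwx.symm)]
      · simp
      · simp [Store.upd_of_ne _ _ (Or.inr hwy), Store.upd_of_ne _ _ (Or.inr hwx), hnw]
      · intro z hz
        have h1 : z ≠ y := fun e => hn2.1 (by simp [← e, hz])
        have h2 : z ≠ x := fun e => hx.2.2 (by simp [← e, hz])
        have h3 : z ≠ w := fun e => hwl (e ▸ hz)
        simp only [Store.upd_of_ne _ _ (Or.inr h1), Store.upd_of_ne _ _ (Or.inr h2),
          Store.upd_of_ne _ _ (Or.inr h3)]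

theorem tri_insertBefore {σ : Store A} {s : Side} {l₁ l₂ : List ℕ} {y x : ℕ}
    (h : DLL σ s (l₁ ++ y :: l₂)) (hn : (l₁ ++ y :: l₂).Nodup) (hx : x ∉ l₁ ++ y :: l₂) :
    Tri (insertBefore s y x) σ fun _ σ' n =>
      LinkEq s (l₁ ++ x :: y :: l₂) σ σ' ∧ DLL σ' s (l₁ ++ x :: y :: l₂) ∧ n ≤ 4 := by
  obtain ⟨hf, hl, hs⟩ := dll_iff.1 h
  obtain ⟨hs1, hpy, hny, hs2⟩ := Seg.append_iff.1 hs
  simp only [Option.or_none] at hny hpy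
  simp only [List.mem_append, List.mem_cons, not_or] at hx
  rw [List.nodup_append] at hn
  obtain ⟨hn1, hn2, hn3⟩ := hn
  rw [List.nodup_cons] at hn2
  have hxy : x ≠ y := hx.2.1
  unfold insertBefore
  refine Tri.look_bind (Tri.change_bind (Tri.change_bind ?_))
  have hE : LinkEq s (l₁ ++ x :: y :: l₂) σ ((σ.upd s x fun d =>
      { d with prev := (σ.mem s y).prev, next := some y }).upd s y fun d =>
      { d with prev := some x }) :=
    ((LinkEq.refl s _ σ).upd (by simp) (f := _) (by intro c; rfl)).upd (by simp) (f := _)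
      (by intro c; rfl)
  have h2' : ∀ z ∈ l₂, z ≠ y ∧ z ≠ x := fun z hz =>
    ⟨fun e => hn2.1 (e ▸ hz), fun e => hx.2.2 (e ▸ hz)⟩
  obtain rfl | ⟨l₁, w, rfl⟩ := l₁.eq_nil_or_concat'
  · rw [show (σ.mem s y).prev = none from hpy] at hE ⊢
    refine Tri.writeS ⟨hE.setFirst _, dll_iff.2 ⟨?_, ?_, ?_⟩, by omega⟩
    · simp
    · change σ.last s = _
      rw [hl]; simp [List.getLast?_cons]
    · refine ⟨?_, ?_, ?_, ?_, Store.Seg.congr hs2 ?_⟩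
      · simp [Store.upd_of_ne _ _ (Or.inr hxy)]
      · simp [Store.upd_of_ne _ _ (Or.inr hxy)]
      · simp
      · simp [Store.upd_of_ne _ _ (Or.inr hxy.symm), hny]
      · intro z hz
        simp only [Store.upd_of_ne _ _ (Or.inr (h2' z hz).1),
          Store.upd_of_ne _ _ (Or.inr (h2' z hz).2)]
  · have hpy' : (σ.mem s y).prev = some w := by rw [hpy]; simp
    rw [hpy'] at hE ⊢
    obtain ⟨hs0, hpw, hnw, -⟩ := Seg.append_iff.1 hs1
    have hwy : w ≠ y := hn3 w (by simp) y (by simp)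
    have hwx : w ≠ x := fun e => hx.1 (by simp [e])
    have hwl : w ∉ l₁ := fun e => (List.nodup_append.1 hn1).2.2 w e w (by simp) rfl
    refine Tri.change ⟨hE.upd (by simp) fun _ => rfl, dll_iff.2 ⟨?_, ?_, ?_⟩, by omega⟩
    · change σ.first s = _
      rw [hf]; cases l₁ <;> simp
    · change σ.last s = _
      rw [hl]; simp [List.getLast?_append, List.getLast?_cons]
    · rw [Seg.append_iff, Seg.append_iff]
      refine ⟨⟨Store.Seg.congr hs0 ?_, ?_, ?_, trivial⟩, ?_, ?_, ?_, ?_, Store.Seg.congr hs2 ?_⟩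
      · intro z hz
        have h1 : z ≠ y := hn3 z (by simp [hz]) y (by simp)
        have h2 : z ≠ x := fun e => hx.1 (by simp [← e, hz])
        have h3 : z ≠ w := fun e => hwl (e ▸ hz)
        simp only [Store.upd_of_ne _ _ (Or.inr h1), Store.upd_of_ne _ _ (Or.inr h2),
          Store.upd_of_ne _ _ (Or.inr h3)]
      · simpa [Store.upd_of_ne _ _ (Or.inr hwy), Store.upd_of_ne _ _ (Or.inr hwx)] using hpw
      · simp
      · simp [Store.upd_of_ne _ _ (Or.inr hxy), Store.upd_of_ne _ _ (Or.inr hwx.symm)]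
      · simp [Store.upd_of_ne _ _ (Or.inr hxy), Store.upd_of_ne _ _ (Or.inr hwx.symm)]
      · simp [Store.upd_of_ne _ _ (Or.inr hwy.symm)]
      · simp [Store.upd_of_ne _ _ (Or.inr hxy.symm), Store.upd_of_ne _ _ (Or.inr hwy.symm), hny]
      · intro z hz
        have h3 : z ≠ w := (hn3 w (by simp) z (by simp [hz])).symm
        simp only [Store.upd_of_ne _ _ (Or.inr (h2' z hz).1),
          Store.upd_of_ne _ _ (Or.inr (h2' z hz).2), Store.upd_of_ne _ _ (Or.inr h3)]

/-- With the two case distinctions as separate programs, predecessor and successor can be treated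
one after the other. -/
theorem unlink_eq (s : Side) (y : ℕ) : (unlink s y : Prog A Unit) = look s y >>= fun c =>
    (match c.prev with
      | some z => change s z fun d => { d with next := c.next }
      | none => setFirst s c.next) >>= fun _ =>
    (match c.next with
      | some z => change s z fun d => { d with prev := c.prev }
      | none => setLast s c.prev) := by
  unfold unlink
  congr 1
  funext c
  cases c.prev <;> rfl

/-- The record of `y` is left as it is and merely drops out of the list; the later steps still read
it. -/
theorem tri_unlink {σ : Store A} {s : Side} {l₁ l₂ : List ℕ} {y : ℕ}
    (h : DLL σ s (l₁ ++ y :: l₂)) (hn : (l₁ ++ y :: l₂).Nodup) :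
    Tri (unlink s y) σ fun _ σ' n =>
      LinkEq s (l₁ ++ l₂) σ σ' ∧ DLL σ' s (l₁ ++ l₂) ∧ n ≤ 3 := by
  obtain ⟨hf, hl, hs⟩ := dll_iff.1 h
  obtain ⟨hs1, hpy, hny, hs2⟩ := Seg.append_iff.1 hs
  simp only [Option.or_none] at hny hpy
  rw [List.nodup_append] at hn
  obtain ⟨hn1, hn2, hn3⟩ := hn
  rw [List.nodup_cons] at hn2
  rw [unlink_eq]
  refine Tri.look_bind ?_
  rw [hpy, hny]
  -- the predecessor
  refine Tri.bind (Φ := fun _ σ' n => LinkEq s (l₁ ++ l₂) σ σ' ∧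
    σ'.first s = (l₁ ++ l₂).head? ∧ σ'.last s = σ.last s ∧ σ'.Seg s none l₁ l₂.head? ∧
    (∀ z ∈ l₂, σ'.mem s z = σ.mem s z) ∧ n = 1) ?_ ?_
  · have hE := LinkEq.refl s (l₁ ++ l₂) σ
    obtain rfl | ⟨l₁, w, rfl⟩ := l₁.eq_nil_or_concat'
    · exact Tri.writeS ⟨hE.setFirst _, by simp, rfl, trivial, fun _ _ => rfl, rfl⟩
    · obtain ⟨hs0, hpw, hnw, -⟩ := Seg.append_iff.1 hs1
      have hwl : w ∉ l₁ := fun e => (List.nodup_append.1 hn1).2.2 w e w (by simp) rfl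
      simp only [List.getLast?_append, List.getLast?_singleton, Option.some_or]
      refine Tri.change ⟨hE.upd (by simp) fun _ => rfl, ?_, rfl, ?_, ?_, rfl⟩
      · change σ.first s = _
        rw [hf]; cases l₁ <;> simp
      · refine Seg.append_iff.2 ⟨Store.Seg.congr hs0 ?_, ?_, ?_, trivial⟩
        · intro z hz
          have h3 : z ≠ w := fun e => hwl (e ▸ hz)
          simp only [Store.upd_of_ne _ _ (Or.inr h3)]
        · simpa using hpw
        · simp
      · intro z hz
        have h3 : z ≠ w := (hn3 w (by simp) z (by simp [hz])).symm
        simp only [Store.upd_of_ne _ _ (Or.inr h3)]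
  · rintro _ σ' n ⟨hE, hf', hl', hs1', hm, rfl⟩
    have hs2' : σ'.Seg s (some y) l₂ none := Store.Seg.congr hs2 hm
    cases l₂ with
    | nil =>
      refine Tri.writeS ⟨hE.setLast _, dll_iff.2 ⟨hf', by simp, ?_⟩, by omega⟩
      rw [List.append_nil]
      exact hs1'
    | cons w l₂ =>
      obtain ⟨hpw, hnw, hs3⟩ := hs2'
      have hwl := (List.nodup_cons.1 hn2.2).1
      refine Tri.change ⟨hE.upd (by simp) fun _ => rfl, dll_iff.2 ⟨hf', ?_, ?_⟩, by omega⟩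
      · change σ'.last s = _
        rw [hl', hl]; simp [List.getLast?_append, List.getLast?_cons]
      · refine Seg.append_iff.2 ⟨Store.Seg.congr (l := l₁) hs1' ?_, ?_, ?_, Store.Seg.congr hs3 ?_⟩
        · intro z hz
          have h3 : z ≠ w := hn3 z hz w (by simp)
          simp only [Store.upd_of_ne _ _ (Or.inr h3)]
        · simp
        · simpa using hnw
        · intro z hz
          have h3 : z ≠ w := fun e => hwl (e ▸ hz)
          simp only [Store.upd_of_ne _ _ (Or.inr h3)]

end

/-! ### Creating and relinking nodes. -/

section

variable {A : Type} [LinearOrder A] [OrderBot A]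

/-- The record of a new node `y` with label `p`. -/
def newCell (y : ℕ) (p : A × ℕ) : Cell A :=
  { (Cell.blank : Cell A) with chr := p.1, len := p.2, lf := y }

/-- Add the label of a new node. -/
def addLabel (N : Side → ℕ → Option (A × ℕ)) (s : Side) (x : ℕ) (p : A × ℕ) :
    Side → ℕ → Option (A × ℕ) :=
  fun s' y => if s' = s ∧ y = x then some p else N s' y

/-- The store `σ` arises from `σ₀`, whose lists are `l₀`, by creating the new nodes with the labels
`N` and by changing the lists to `l`. -/
structure Relinked (σ₀ : Store A) (l₀ : Side → List ℕ) (fr dl : ℕ) (σ : Store A)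
    (l : Side → List ℕ) (N : Side → ℕ → Option (A × ℕ)) : Prop where
  fresh : σ.fresh = fr
  dollar : σ.dollar = dl
  om : σ.om = σ₀.om
  tree : σ.tree = σ₀.tree
  heavy : σ.heavy = σ₀.heavy
  body : ∀ s y, (σ.mem s y).body = ((N s y).elim (σ₀.mem s y) (newCell y)).body
  mem : ∀ s y, N s y = none → y ∉ l₀ s → σ.mem s y = σ₀.mem s y
  nodup : ∀ s, (l s).Nodup
  sub : ∀ s, ∀ y ∈ l s, y ∈ l₀ s ∨ N s y ≠ none
  dll : ∀ s, DLL σ s (l s)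

theorem Side.eq_or_eq_other (s t : Side) : t = s ∨ t = s.other := by
  cases s <;> cases t <;> simp [Side.other]

omit [LinearOrder A] [OrderBot A] in
theorem Store.Seg.dll {σ σ' : Store A} {s : Side} {l : List ℕ} (h : DLL σ s l)
    (hf : σ'.first s = σ.first s) (hl : σ'.last s = σ.last s)
    (hm : ∀ y ∈ l, σ'.mem s y = σ.mem s y) : DLL σ' s l := by
  obtain ⟨h1, h2, h3⟩ := dll_iff.1 h
  exact dll_iff.2 ⟨hf.trans h1, hl.trans h2, Store.Seg.congr h3 hm⟩

namespace Relinked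

variable {σ₀ σ σ' : Store A} {l₀ l : Side → List ℕ} {fr dl : ℕ}
  {N : Side → ℕ → Option (A × ℕ)}

/-- A change of links affects neither labels nor edges, so only the new list of the one side has to
be supplied. -/
theorem of_linkEq (h : Relinked σ₀ l₀ fr dl σ l N) {s : Side} {m : List ℕ} (hE : LinkEq s m σ σ')
    (hm : ∀ y ∈ m, y ∈ l₀ s ∨ N s y ≠ none) (hd : DLL σ' s m) (hn : m.Nodup)
    {l' : Side → List ℕ} (h1 : l' s = m) (h2 : l' s.other = l s.other) :
    Relinked σ₀ l₀ fr dl σ' l' N := by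
  constructor
  case fresh => rw [hE.fresh, h.fresh]
  case dollar => rw [hE.dollar, h.dollar]
  case om => rw [hE.om, h.om]
  case tree => rw [hE.tree, h.tree]
  case heavy => rw [hE.heavy, h.heavy]
  case body => intro s' y; rw [hE.body, h.body]
  case mem =>
    intro s' y hN hy
    rw [hE.mem, h.mem s' y hN hy]
    by_cases hs : s' = s
    · subst hs
      refine .inr fun hy' => ?_
      rcases hm y hy' with h' | h'
      · exact hy h'
      · exact h' hN
    · exact .inl hs
  case nodup =>
    intro s'
    rcases s.eq_or_eq_other s' with rfl | rfl
    · rwa [h1]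
    · rw [h2]; exact h.nodup _
  case sub =>
    intro s' y hy
    rcases s.eq_or_eq_other s' with rfl | rfl
    · exact hm y (h1 ▸ hy)
    · exact h.sub _ y (h2 ▸ hy)
  case dll =>
    intro s'
    rcases s.eq_or_eq_other s' with rfl | rfl
    · rwa [h1]
    · rw [h2]
      have hs := s.other_ne
      exact Store.Seg.dll (h.dll _) (hE.first _ hs) (hE.last _ hs) fun y _ => hE.mem _ y (.inl hs)

theorem tri_newAddr (h : Relinked σ₀ l₀ fr dl σ l N) :
    Tri newAddr σ fun r σ' n => r = fr ∧ Relinked σ₀ l₀ (fr + 1) dl σ' l N ∧ n = 2 := by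
  unfold newAddr
  refine Tri.readS_bind (Tri.writeS_bind (Tri.pure ⟨h.fresh, ?_, by omega⟩))
  constructor
  case fresh => simp [h.fresh]
  all_goals first
    | exact h.dollar
    | exact h.om
    | exact h.tree
    | exact h.heavy
    | exact h.body
    | exact h.mem
    | exact h.nodup
    | exact h.sub
    | exact h.dll

theorem tri_newNode (h : Relinked σ₀ l₀ fr dl σ l N) {s : Side} {x : ℕ} (hx : x ∉ l s) (c : A)
    (n : ℕ) : Tri (newNode s x c n) σ fun _ σ' k =>
      Relinked σ₀ l₀ fr dl σ' l (addLabel N s x (c, n)) ∧ k = 1 := by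
  unfold newNode
  refine Tri.change ⟨?_, rfl⟩
  constructor
  case fresh => exact h.fresh
  case dollar => exact h.dollar
  case om => exact h.om
  case tree => exact h.tree
  case heavy => exact h.heavy
  case nodup => exact h.nodup
  case body =>
    intro s' y
    unfold addLabel
    split_ifs with hs
    · obtain ⟨rfl, rfl⟩ := hs
      rw [Store.upd_same]; rfl
    · rw [Store.upd_of_ne _ _ (by tauto), h.body]
  case mem =>
    intro s' y hN hy
    unfold addLabel at hN
    split_ifs at hN with hs
    rw [Store.upd_of_ne _ _ (by tauto), h.mem s' y hN hy]
  case sub =>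
    intro s' y hy
    unfold addLabel
    split_ifs with hs
    · simp
    · exact h.sub s' y hy
  case dll =>
    intro s'
    refine Store.Seg.dll (h.dll s') rfl rfl fun y hy => Store.upd_of_ne _ _ ?_
    by_cases hs : s' = s
    · subst hs
      exact .inr fun e => hx (e ▸ hy)
    · exact .inl hs

theorem tri_insertAfter (h : Relinked σ₀ l₀ fr dl σ l N) {s : Side} {l₁ l₂ : List ℕ} {y x : ℕ}
    (hl : l s = l₁ ++ y :: l₂) (hx : x ∉ l s) (hN : N s x ≠ none) {l' : Side → List ℕ}
    (h1 : l' s = l₁ ++ y :: x :: l₂) (h2 : l' s.other = l s.other) :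
    Tri (insertAfter s y x) σ fun _ σ' n => Relinked σ₀ l₀ fr dl σ' l' N ∧ n ≤ 4 := by
  have hd := h.dll s
  have hn := h.nodup s
  have hs := h.sub s
  rw [hl] at hd hn hx hs
  refine (_root_.tri_insertAfter hd hn hx).mono ?_
  rintro _ σ' n ⟨hE, hd', hn'⟩
  have hp : (l₁ ++ y :: x :: l₂).Perm (x :: (l₁ ++ y :: l₂)) := by
    have := List.perm_middle (a := x) (l₁ := l₁ ++ [y]) (l₂ := l₂)
    simpa using this
  refine ⟨h.of_linkEq hE ?_ hd' ?_ h1 h2, hn'⟩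
  · intro z hz
    rcases List.mem_cons.1 (hp.mem_iff.1 hz) with rfl | hz
    · exact .inr hN
    · exact hs z hz
  · rw [hp.nodup_iff, List.nodup_cons]
    exact ⟨hx, hn⟩

theorem tri_insertBefore (h : Relinked σ₀ l₀ fr dl σ l N) {s : Side} {l₁ l₂ : List ℕ} {y x : ℕ}
    (hl : l s = l₁ ++ y :: l₂) (hx : x ∉ l s) (hN : N s x ≠ none) {l' : Side → List ℕ}
    (h1 : l' s = l₁ ++ x :: y :: l₂) (h2 : l' s.other = l s.other) :
    Tri (insertBefore s y x) σ fun _ σ' n => Relinked σ₀ l₀ fr dl σ' l' N ∧ n ≤ 4 := by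
  have hd := h.dll s
  have hn := h.nodup s
  have hs := h.sub s
  rw [hl] at hd hn hx hs
  refine (_root_.tri_insertBefore hd hn hx).mono ?_
  rintro _ σ' n ⟨hE, hd', hn'⟩
  have hp : (l₁ ++ x :: y :: l₂).Perm (x :: (l₁ ++ y :: l₂)) := List.perm_middle
  refine ⟨h.of_linkEq hE ?_ hd' ?_ h1 h2, hn'⟩
  · intro z hz
    rcases List.mem_cons.1 (hp.mem_iff.1 hz) with rfl | hz
    · exact .inr hN
    · exact hs z hz
  · rw [hp.nodup_iff, List.nodup_cons]
    exact ⟨hx, hn⟩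

theorem tri_unlink (h : Relinked σ₀ l₀ fr dl σ l N) {s : Side} {l₁ l₂ : List ℕ} {y : ℕ}
    (hl : l s = l₁ ++ y :: l₂) {l' : Side → List ℕ}
    (h1 : l' s = l₁ ++ l₂) (h2 : l' s.other = l s.other) :
    Tri (unlink s y) σ fun _ σ' n => Relinked σ₀ l₀ fr dl σ' l' N ∧ n ≤ 3 := by
  have hd := h.dll s
  have hn := h.nodup s
  have hs := h.sub s
  rw [hl] at hd hn hs
  refine (_root_.tri_unlink hd hn).mono ?_
  rintro _ σ' n ⟨hE, hd', hn'⟩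
  have hp : (l₁ ++ y :: l₂).Perm (y :: (l₁ ++ l₂)) := List.perm_middle
  refine ⟨h.of_linkEq hE (fun z hz => hs z (hp.mem_iff.2 (by simp [hz]))) hd' ?_ h1 h2, hn'⟩
  exact (List.nodup_cons.1 (hp.nodup_iff.1 hn)).2

theorem tri_splitOne (h : Relinked σ₀ l₀ fr dl σ l N) {s : Side} {l₁ l₂ : List ℕ} {x lo hi : ℕ}
    (hl : l s = l₁ ++ x :: l₂) (hlo : lo ∉ l s) (hhi : hi ∉ l s) (hne : lo ≠ hi) (c : A)
    (n m : ℕ) {l' : Side → List ℕ} (h1 : l' s = l₁ ++ lo :: hi :: l₂)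
    (h2 : l' s.other = l s.other) :
    Tri (splitOne s x lo hi c n m) σ fun _ σ' k =>
      Relinked σ₀ l₀ fr dl σ' l' (addLabel (addLabel N s lo (c, n)) s hi (c, m)) ∧ k ≤ 13 := by
  unfold splitOne
  refine Tri.bind (h.tri_newNode hlo c n) ?_
  rintro _ σ₁ k₁ ⟨H1, hk₁⟩
  refine Tri.bind (H1.tri_newNode hhi c m) ?_
  rintro _ σ₂ k₂ ⟨H2, hk₂⟩
  refine Tri.bind (H2.tri_insertAfter (l' := Function.update l s (l₁ ++ x :: lo :: l₂)) hl hlo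
    (by simp [addLabel, hne]) (by simp) (by simp [s.other_ne])) ?_
  rintro _ σ₃ k₃ ⟨H3, hk₃⟩
  have hhi' : hi ∉ l₁ ++ x :: lo :: l₂ := by
    rw [hl] at hhi
    simp only [List.mem_append, List.mem_cons, not_or] at hhi ⊢
    exact ⟨hhi.1, hhi.2.1, hne.symm, hhi.2.2⟩
  refine Tri.bind (H3.tri_insertAfter (s := s) (l₁ := l₁ ++ [x]) (l₂ := l₂) (y := lo) (x := hi)
    (l' := Function.update l s (l₁ ++ x :: lo :: hi :: l₂))
    (by simp) (by simpa using hhi') (by simp [addLabel]) (by simp) (by simp [s.other_ne])) ?_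
  rintro _ σ₄ k₄ ⟨H4, hk₄⟩
  refine (H4.tri_unlink (s := s) (l₁ := l₁) (l₂ := lo :: hi :: l₂) (y := x) (l' := l') (by simp)
    h1 (by simp [s.other_ne, h2])).mono ?_
  rintro _ σ₅ k₅ ⟨H5, hk₅⟩
  exact ⟨H5, by omega⟩

end Relinked

theorem AHolds.relinked {α : ℕ} {S : List A} {σ : Store A} {l : Side → List ℕ}
    {pos : Side → ℕ → ℕ} (h : AHolds α S σ l pos) :
    Relinked σ l σ.fresh σ.dollar σ l fun _ _ => none := by
  constructor
  case nodup => exact h.nodup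
  case dll => exact h.dll
  case sub => exact fun s y hy => .inl hy
  all_goals intros; rfl

end

section

/-! ### The data of an update -/

/-- The nodes that take part in an update: `ui`, `vi` are replaced by nodes at the addresses `a` and
`x`, further nodes are created at `x` and `a`, and `sp` describes the split. -/
structure Upd where
  ui : ℕ
  vi : ℕ
  a : ℕ
  x : ℕ
  sp : Option Split

/-- The node of side `s` that is split. -/
def Split.oj (p : Split) (s : Side) : ℕ := Side.pick p.uj p.vj s

namespace Upd

variable {A : Type} [LinearOrder A] [OrderBot A] (d : Upd)

/-- The node that is replaced. -/
def old (s : Side) : ℕ := Side.pick d.ui d.vi s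

/-- The node that replaces `d.old s`. -/
def rep (s : Side) : ℕ := Side.pick d.a d.x s

/-- The inserted node. -/
def new (s : Side) : ℕ := Side.pick d.x d.a s

/-- The nodes that replace the node `y`. -/
def refine (s : Side) (y : ℕ) : List ℕ :=
  if y = d.old s then [d.rep s]
  else match d.sp with
    | none => [y]
    | some p => if y = p.oj s then [p.lo, p.hi] else [y]

/-- The starting positions of the nodes after replacement and split. -/
def rpos (pos : Side → ℕ → ℕ) (s : Side) (z : ℕ) : ℕ :=
  if z = d.rep s then pos s (d.old s)
  else match d.sp with
    | none => pos s z
    | some p => if z = p.lo then pos s (p.oj s)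
      else if z = p.hi then pos s (p.oj s) + p.cut else pos s z

/-- The labels of the new nodes. -/
def label (σ : Store A) (c : A) (y : ℕ) : Option (A × ℕ) :=
  if y = d.a then some (c, 1)
  else if y = d.x then some (⊥, 1)
  else match d.sp with
    | none => none
    | some p => if y = p.lo then some ((σ.mem .U p.uj).chr, p.cut)
      else if y = p.hi then some ((σ.mem .U p.uj).chr, (σ.mem .U p.uj).len - p.cut) else none

/-- The records of the nodes after the creation of the new nodes. -/
def cell (σ : Store A) (c : A) (s : Side) (y : ℕ) : Cell A :=
  (d.label σ c y).elim (σ.mem s y) (newCell y)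

/-- The removed nodes. -/
def Removed (s : Side) (y : ℕ) : Prop := y = d.old s ∨ ∃ p, d.sp = some p ∧ y = p.oj s

/-- The redirection of edges with heads on side `s`. -/
def redir (s : Side) : ℕ × ℕ → ℕ × ℕ := redirect (d.old s) (d.rep s) d.sp (Split.oj · s)

/-- The data `d` of an update fit the graph, where `q` is the position of the inserted row. -/
structure Ctx (α : ℕ) (S : List A) (σ : Store A) (l : Side → List ℕ) (pos : Side → ℕ → ℕ) (q : ℕ) :
    Prop where
  holds : AHolds α S σ l pos
  old_mem : ∀ s, d.old s ∈ l s
  old_lf : ∀ s, (σ.mem s (d.old s)).lf = d.old s.other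
  old_len : ∀ s, (σ.mem s (d.old s)).len = 1
  pos_vi : pos .V d.vi = 0
  q_pos : 1 ≤ q
  q_le : q ≤ S.length
  fresh_a : σ.fresh ≤ d.a
  fresh_x : σ.fresh ≤ d.x
  a_ne_x : d.a ≠ d.x
  cutV : ∀ y ∈ l .V, pos .V y < q → pos .V y + (σ.mem .V y).len ≤ q
  cutU : d.sp = none → ∀ y ∈ l .U, pos .U y < q → pos .U y + (σ.mem .U y).len ≤ q
  oj_mem : ∀ p, d.sp = some p → ∀ s, p.oj s ∈ l s
  oj_lf : ∀ p, d.sp = some p → ∀ s, (σ.mem s (p.oj s)).lf = p.oj s.other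
  oj_ne : ∀ p, d.sp = some p → ∀ s, p.oj s ≠ d.old s
  cut_pos : ∀ p, d.sp = some p → 0 < p.cut
  cut_lt : ∀ p, d.sp = some p → ∀ s, p.cut < (σ.mem s (p.oj s)).len
  cut_eq : ∀ p, d.sp = some p → pos .U p.uj + p.cut = q
  fresh_lo : ∀ p, d.sp = some p → σ.fresh ≤ p.lo ∧ p.lo ≠ d.a ∧ p.lo ≠ d.x
  fresh_hi : ∀ p, d.sp = some p → σ.fresh ≤ p.hi ∧ p.hi ≠ d.a ∧ p.hi ≠ d.x
  lo_ne_hi : ∀ p, d.sp = some p → p.lo ≠ p.hi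
  gnext_mem : ∀ p, d.sp = some p → p.gnext ∈ l .V
  gnext_pos : ∀ p, d.sp = some p → pos .V p.gnext = q

variable {d} {α : ℕ} {S : List A} {σ : Store A} {l : Side → List ℕ} {pos : Side → ℕ → ℕ} {q : ℕ}

theorem rep_other (s : Side) : d.rep s.other = d.new s := by cases s <;> rfl

namespace Ctx

variable (h : d.Ctx α S σ l pos q) (c : A)

include h

theorem fresh_rep (s : Side) : σ.fresh ≤ d.rep s := by
  cases s
  · exact h.fresh_a
  · exact h.fresh_x

theorem fresh_new (s : Side) : σ.fresh ≤ d.new s := by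
  cases s
  · exact h.fresh_x
  · exact h.fresh_a

theorem rep_ne_new (s : Side) : d.rep s ≠ d.new s := by
  cases s
  · exact h.a_ne_x
  · exact h.a_ne_x.symm

theorem lt {s : Side} {y : ℕ} (hy : y ∈ l s) : y < σ.fresh := h.holds.lt_fresh s y hy

theorem ne_new {s : Side} (t : Side) {y : ℕ} (hy : y ∈ l s) : y ≠ d.new t := by
  have := h.lt hy; have := h.fresh_new t; omega

theorem ne_rep {s : Side} (t : Side) {y : ℕ} (hy : y ∈ l s) : y ≠ d.rep t := by
  have := h.lt hy; have := h.fresh_rep t; omega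

theorem ne_lo {s : Side} {y : ℕ} (hy : y ∈ l s) {p : Split} (hp : d.sp = some p) : y ≠ p.lo := by
  have := h.lt hy; have := (h.fresh_lo p hp).1; omega

theorem ne_hi {s : Side} {y : ℕ} (hy : y ∈ l s) {p : Split} (hp : d.sp = some p) : y ≠ p.hi := by
  have := h.lt hy; have := (h.fresh_hi p hp).1; omega

theorem lo_ne_rep (s : Side) {p : Split} (hp : d.sp = some p) : p.lo ≠ d.rep s := by
  cases s
  · exact (h.fresh_lo p hp).2.1
  · exact (h.fresh_lo p hp).2.2

theorem hi_ne_rep (s : Side) {p : Split} (hp : d.sp = some p) : p.hi ≠ d.rep s := by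
  cases s
  · exact (h.fresh_hi p hp).2.1
  · exact (h.fresh_hi p hp).2.2

theorem lo_ne_new (s : Side) {p : Split} (hp : d.sp = some p) : p.lo ≠ d.new s := by
  rw [← rep_other]; exact h.lo_ne_rep _ hp

theorem hi_ne_new (s : Side) {p : Split} (hp : d.sp = some p) : p.hi ≠ d.new s := by
  rw [← rep_other]; exact h.hi_ne_rep _ hp

theorem label_kept {y : ℕ} (hy : y < σ.fresh) : d.label σ c y = none := by
  have h1 := h.fresh_a
  have h2 := h.fresh_x
  unfold label
  rw [if_neg (by omega), if_neg (by omega)]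
  cases hp : d.sp with
  | none => rfl
  | some p =>
    have h3 := (h.fresh_lo p hp).1
    have h4 := (h.fresh_hi p hp).1
    simp only
    rw [if_neg (by omega), if_neg (by omega)]

theorem cell_kept (s : Side) {y : ℕ} (hy : y < σ.fresh) : d.cell σ c s y = σ.mem s y := by
  rw [cell, h.label_kept c hy]; rfl

omit h in
theorem cell_a (s : Side) : d.cell σ c s d.a = newCell d.a (c, 1) := by
  simp [cell, label]

theorem cell_x (s : Side) : d.cell σ c s d.x = newCell d.x (⊥, 1) := by
  simp [cell, label, h.a_ne_x.symm]

theorem cell_lo (s : Side) {p : Split} (hp : d.sp = some p) :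
    d.cell σ c s p.lo = newCell p.lo ((σ.mem .U p.uj).chr, p.cut) := by
  simp [cell, label, hp, (h.fresh_lo p hp).2]

theorem cell_hi (s : Side) {p : Split} (hp : d.sp = some p) :
    d.cell σ c s p.hi =
      newCell p.hi ((σ.mem .U p.uj).chr, (σ.mem .U p.uj).len - p.cut) := by
  simp [cell, label, hp, (h.fresh_hi p hp).2, (h.lo_ne_hi p hp).symm]

theorem cell_rep_len (s : Side) : (d.cell σ c s (d.rep s)).len = 1 := by
  cases s
  · exact congrArg Cell.len (cell_a c Side.U)
  · exact congrArg Cell.len (h.cell_x c Side.V)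

theorem cell_new_len (s : Side) : (d.cell σ c s (d.new s)).len = 1 := by
  cases s
  · exact congrArg Cell.len (h.cell_x c Side.U)
  · exact congrArg Cell.len (cell_a c Side.V)

omit h in
theorem rpos_rep (s : Side) : d.rpos pos s (d.rep s) = pos s (d.old s) := by simp [rpos]

theorem rpos_kept {s : Side} {y : ℕ} (hy : y ∈ l s) : d.rpos pos s y = pos s y := by
  unfold rpos
  rw [if_neg (h.ne_rep s hy)]
  cases hp : d.sp with
  | none => rfl
  | some p => simp only [h.ne_lo hy hp, h.ne_hi hy hp, if_false]

theorem rpos_lo (s : Side) {p : Split} (hp : d.sp = some p) :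
    d.rpos pos s p.lo = pos s (p.oj s) := by
  simp [rpos, hp, h.lo_ne_rep s hp]

theorem rpos_hi (s : Side) {p : Split} (hp : d.sp = some p) :
    d.rpos pos s p.hi = pos s (p.oj s) + p.cut := by
  simp [rpos, hp, h.hi_ne_rep s hp, (h.lo_ne_hi p hp).symm]

theorem oj_len (s : Side) {p : Split} (hp : d.sp = some p) :
    (σ.mem s (p.oj s)).len = (σ.mem .U p.uj).len := by
  cases s
  · rfl
  · rw [← show (σ.mem .U p.uj).lf = p.oj .V from h.oj_lf p hp .U]
    exact h.holds.len_lf .U _ (h.oj_mem p hp .U)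

theorem oj_chr (s : Side) {p : Split} (hp : d.sp = some p) :
    (σ.mem s (p.oj s)).chr = (σ.mem .U p.uj).chr := by
  cases s
  · rfl
  · rw [← show (σ.mem .U p.uj).lf = p.oj .V from h.oj_lf p hp .U]
    exact h.holds.chr_lf .U _ (h.oj_mem p hp .U)

/-- Renaming preserves an interval and splitting cuts it at `cut`, so each interval is tiled by the
nodes that replace it. -/
theorem tile_refine (s : Side) {m : List ℕ} {b e : ℕ}
    (ht : Tile (fun y => (σ.mem s y).len) (pos s) b m e) (hm : ∀ y ∈ m, y ∈ l s) :
    Tile (fun y => (d.cell σ c s y).len) (d.rpos pos s) b (m.flatMap (d.refine s)) e := by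
  refine ht.flatMap fun y hy => ?_
  have hy := hm y hy
  unfold Upd.refine
  split_ifs with h1
  · subst h1
    exact ⟨rpos_rep s, by simp only [h.cell_rep_len, h.old_len]; rfl⟩
  · have key : Tile (fun y => (d.cell σ c s y).len) (d.rpos pos s) (pos s y) [y]
        (pos s y + (σ.mem s y).len) :=
      ⟨h.rpos_kept hy, by simp only [h.cell_kept c s (h.lt hy)]; rfl⟩
    cases hp : d.sp with
    | none => exact key
    | some p =>
      simp only
      split_ifs with h2
      · subst h2
        refine ⟨h.rpos_lo s hp, ?_, ?_⟩
        · simp only [h.rpos_hi s hp, h.cell_lo c s hp]; rfl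
        · simp only [h.cell_lo c s hp, h.cell_hi c s hp, newCell]
          have h1 := h.cut_lt p hp s
          have h2 := h.oj_len s hp
          change _ + p.cut + ((σ.mem .U p.uj).len - p.cut) = _
          omega
      · exact key

theorem mem_refine {s : Side} {z : ℕ} : z ∈ (l s).flatMap (d.refine s) ↔
    z = d.rep s ∨ (∃ p, d.sp = some p ∧ (z = p.lo ∨ z = p.hi)) ∨ z ∈ l s ∧ ¬ d.Removed s z := by
  rw [List.mem_flatMap]
  constructor
  · rintro ⟨y, hy, hz⟩
    unfold Upd.refine at hz
    split_ifs at hz with h1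
    · exact .inl (by simpa using hz)
    · cases hp : d.sp with
      | none =>
        simp only [hp, List.mem_singleton] at hz
        subst hz
        exact .inr (.inr ⟨hy, by simp [Removed, h1, hp]⟩)
      | some p =>
        simp only [hp] at hz
        split_ifs at hz with h2
        · exact .inr (.inl ⟨p, rfl, by simpa using hz⟩)
        · simp only [List.mem_singleton] at hz
          subst hz
          exact .inr (.inr ⟨hy, by simp [Removed, h1, h2, hp]⟩)
  · rintro (rfl | ⟨p, hp, hz⟩ | ⟨hz, hr⟩)
    · exact ⟨_, h.old_mem s, by simp [Upd.refine]⟩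
    · refine ⟨_, h.oj_mem p hp s, ?_⟩
      unfold Upd.refine
      rw [if_neg (h.oj_ne p hp s), hp]
      simpa using hz
    · refine ⟨z, hz, ?_⟩
      simp only [Removed, not_or, not_exists, not_and] at hr
      unfold Upd.refine
      rw [if_neg hr.1]
      cases hp : d.sp with
      | none => simp
      | some p => simp [hr.2 p hp]

theorem new_not_mem_refine (s : Side) : d.new s ∉ (l s).flatMap (d.refine s) := by
  rw [h.mem_refine]
  rintro (e | ⟨p, hp, e | e⟩ | ⟨e, _⟩)
  · exact h.rep_ne_new s e.symm
  · exact h.lo_ne_new s hp e.symm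
  · exact h.hi_ne_new s hp e.symm
  · exact h.ne_new s e rfl

end Ctx

end Upd

end

/-! ### Positions, locations and runs after the update. -/

section

namespace Upd

variable {A : Type} [LinearOrder A] [OrderBot A] {d : Upd}

/-- The starting positions of the nodes after the update. -/
def npos (d : Upd) (pos : Side → ℕ → ℕ) (q : ℕ) (s : Side) (z : ℕ) : ℕ :=
  if z = d.new s then q else shiftAt q (d.rpos pos s z)

variable {α : ℕ} {S : List A} {σ : Store A} {l : Side → List ℕ} {pos : Side → ℕ → ℕ} {q : ℕ}

theorem npos_new (s : Side) : d.npos pos q s (d.new s) = q := by simp [npos]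

theorem npos_of_ne {s : Side} {z : ℕ} (hz : z ≠ d.new s) :
    d.npos pos q s z = shiftAt q (d.rpos pos s z) := by simp [npos, hz]

namespace Ctx

variable (h : d.Ctx α S σ l pos q) (c : A)

include h

theorem rep_not_removed (s : Side) : ¬ d.Removed s (d.rep s) := by
  rintro (e | ⟨p, hp, e⟩)
  · exact h.ne_rep s (h.old_mem s) e.symm
  · exact h.ne_rep s (h.oj_mem p hp s) e.symm

theorem new_not_removed (s : Side) : ¬ d.Removed s (d.new s) := by
  rintro (e | ⟨p, hp, e⟩)
  · exact h.ne_new s (h.old_mem s) e.symm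
  · exact h.ne_new s (h.oj_mem p hp s) e.symm

theorem lo_not_removed (s : Side) {p : Split} (hp : d.sp = some p) : ¬ d.Removed s p.lo := by
  rintro (e | ⟨p', hp', e⟩)
  · exact h.ne_lo (h.old_mem s) hp e.symm
  · exact h.ne_lo (h.oj_mem p' hp' s) hp e.symm

theorem hi_not_removed (s : Side) {p : Split} (hp : d.sp = some p) : ¬ d.Removed s p.hi := by
  rintro (e | ⟨p', hp', e⟩)
  · exact h.ne_hi (h.old_mem s) hp e.symm
  · exact h.ne_hi (h.oj_mem p' hp' s) hp e.symm

theorem cell_len_pos (s : Side) {z : ℕ} (hz : z ∈ (l s).flatMap (d.refine s)) :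
    0 < (d.cell σ c s z).len := by
  rcases h.mem_refine.1 hz with rfl | ⟨p, hp, rfl | rfl⟩ | ⟨hz, -⟩
  · rw [h.cell_rep_len]; omega
  · rw [h.cell_lo c s hp]; exact h.cut_pos p hp
  · rw [h.cell_hi c s hp]
    have := h.cut_lt p hp .U
    exact Nat.sub_pos_of_lt this
  · rw [h.cell_kept c s (h.lt hz)]
    exact h.holds.len_pos s z hz

/-- No interval straddles the position `q` after the split. -/
theorem refine_cut (s : Side) {z : ℕ} (hz : z ∈ (l s).flatMap (d.refine s)) :
    d.rpos pos s z < q → d.rpos pos s z + (d.cell σ c s z).len ≤ q := by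
  rcases h.mem_refine.1 hz with rfl | ⟨p, hp, rfl | rfl⟩ | ⟨hz, hr⟩
  · rw [h.cell_rep_len]; omega
  · rw [h.cell_lo c s hp, h.rpos_lo s hp]
    intro hlt
    change pos s (p.oj s) + p.cut ≤ q
    cases s
    · exact (h.cut_eq p hp).le
    · have h1 := h.cutV _ (h.oj_mem p hp .V) hlt
      have h2 := h.cut_lt p hp .V
      omega
  · rw [h.cell_hi c s hp, h.rpos_hi s hp]
    intro hlt
    change _ + p.cut + ((σ.mem .U p.uj).len - p.cut) ≤ q
    cases s
    · exact absurd (h.cut_eq p hp) (ne_of_lt hlt)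
    · have h1 := h.cutV _ (h.oj_mem p hp .V) (by omega)
      have h2 := h.cut_lt p hp .V
      rw [← h.oj_len .V hp]
      omega
  · rw [h.cell_kept c s (h.lt hz), h.rpos_kept hz]
    intro hlt
    cases s
    · cases hp : d.sp with
      | none => exact h.cutU hp z hz hlt
      | some p =>
        -- A repetition with `q` in its interior contains row `q`, as does the split one. So the two
        -- coincide, and the node has been removed.
        by_contra hgt
        have h1 := h.cut_eq p hp
        have h2 := h.cut_lt p hp .U
        refine hr (.inr ⟨p, hp, (h.holds.tile .U).unique (f := q) hz (h.oj_mem p hp .U)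
          (by omega) (by omega) ?_ ?_⟩)
        · change pos .U p.uj ≤ q
          omega
        · change q < pos .U p.uj + (σ.mem .U p.uj).len
          have : (σ.mem .U (p.oj .U)).len = (σ.mem .U p.uj).len := rfl
          omega
    · exact h.cutV z hz hlt

/-- Intervals before `q` stay, those from `q` on move up by one, and the gap is filled by the
inserted node of length one. -/
theorem tile_new (s : Side) {X Y : List ℕ} (he : X ++ Y = (l s).flatMap (d.refine s))
    (hX : Tile (fun y => (d.cell σ c s y).len) (d.rpos pos s) 0 X q)
    (hY : Tile (fun y => (d.cell σ c s y).len) (d.rpos pos s) q Y S.length) :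
    Tile (fun y => (d.cell σ c s y).len) (d.npos pos q s) 0 (X ++ d.new s :: Y)
      (S.length + 1) := by
  have hnew := h.new_not_mem_refine s
  rw [← he] at hnew
  refine Tile.append_iff.2 ⟨q, hX.congr (fun _ _ => rfl) ?_, npos_new s, ?_⟩
  · intro y hy
    have h1 := (hX.bounds hy).2
    have h2 := h.cell_len_pos c s (z := y) (by rw [← he]; simp [hy])
    rw [npos_of_ne fun e => hnew (by simp [← e, hy]), shiftAt, if_pos (by omega)]
  · simp only [h.cell_new_len]
    refine hY.add_one.congr (fun _ _ => rfl) ?_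
    intro y hy
    have h1 := (hY.bounds hy).1
    rw [npos_of_ne fun e => hnew (by simp [← e, hy]), shiftAt, if_neg (by omega)]

/-- Redirection turns the location of a position into the location of the shifted position. -/
theorem redir_loc (s : Side) {e : ℕ × ℕ} {p : ℕ} (h1 : e.1 ∈ l s) (h2 : p = pos s e.1 + e.2)
    (h3 : e.2 < (σ.mem s e.1).len) :
    (d.redir s e).1 ∈ (l s).flatMap (d.refine s) ∧
    shiftAt q p = d.npos pos q s (d.redir s e).1 + (d.redir s e).2 ∧
    (d.redir s e).2 < (d.cell σ c s (d.redir s e).1).len := by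
  -- It is enough to locate the unshifted position among the pieces: none of them straddles `q`, so
  -- the shift is a translation on each.
  have key : ∀ e' : ℕ × ℕ, e'.1 ∈ (l s).flatMap (d.refine s) → p = d.rpos pos s e'.1 + e'.2 →
      e'.2 < (d.cell σ c s e'.1).len → e'.1 ∈ (l s).flatMap (d.refine s) ∧
      shiftAt q p = d.npos pos q s e'.1 + e'.2 ∧ e'.2 < (d.cell σ c s e'.1).len := by
    intro e' hm hp hl
    refine ⟨hm, ?_, hl⟩
    rw [npos_of_ne fun e0 => h.new_not_mem_refine s (e0 ▸ hm), hp]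
    exact shiftAt_add (h.refine_cut c s hm) hl
  apply key
  · rw [h.mem_refine]
    unfold redir redirect
    split_ifs with he
    · exact .inl rfl
    · cases hp : d.sp with
      | none => exact .inr (.inr ⟨h1, by simp [Removed, he, hp]⟩)
      | some p =>
        simp only
        split_ifs with h4 h5
        · exact .inr (.inl ⟨p, rfl, .inl rfl⟩)
        · exact .inr (.inl ⟨p, rfl, .inr rfl⟩)
        · exact .inr (.inr ⟨h1, by simp [Removed, he, h4, hp]⟩)
  · rw [h2]
    unfold redir redirect
    split_ifs with he
    · rw [rpos_rep, he]
    · cases hp : d.sp with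
      | none => simp only [h.rpos_kept h1]
      | some p =>
        simp only
        split_ifs with h4 h5
        · simp only [h.rpos_lo s hp, h4]
        · simp only [h.rpos_hi s hp, h4]; omega
        · simp only [h.rpos_kept h1]
  · unfold redir redirect
    split_ifs with he
    · rw [h.cell_rep_len]
      rw [he, h.old_len] at h3
      exact h3
    · cases hp : d.sp with
      | none => simpa only [h.cell_kept c s (h.lt h1)] using h3
      | some p =>
        simp only
        split_ifs with h4 h5
        · rw [h.cell_lo c s hp]; exact h5
        · rw [h.cell_hi c s hp]
          rw [h4, h.oj_len s hp] at h3
          change e.2 - p.cut < (σ.mem .U p.uj).len - p.cut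
          omega
        · simpa only [h.cell_kept c s (h.lt h1)] using h3

theorem redir_not_removed (s : Side) (e : ℕ × ℕ) : ¬ d.Removed s (d.redir s e).1 := by
  unfold redir redirect
  split_ifs with he
  · exact h.rep_not_removed s
  · cases hp : d.sp with
    | none => simp [Removed, he, hp]
    | some p =>
      simp only
      split_ifs with h4 h5
      · exact h.lo_not_removed s hp
      · exact h.hi_not_removed s hp
      · simp [Removed, he, h4, hp]

omit h in
theorem redir_of_not_removed (s : Side) {e : ℕ × ℕ} (he : ¬ d.Removed s e.1) :
    d.redir s e = e := by
  simp only [Removed, not_or, not_exists, not_and] at he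
  unfold redir redirect
  rw [if_neg he.1]
  cases hp : d.sp with
  | none => rfl
  | some p => simp [he.2 p hp]

theorem pos_ui_of_bot {i : ℕ} (hS : EndMarked S) (hi : i < S.length)
    (hc : (σ.mem .U d.ui).chr = ⊥) (hb : (bwt S).getD i ⊥ = ⊥) : i = pos .U d.ui := by
  have h0 : 0 < (σ.mem .U d.ui).len := h.holds.len_pos .U _ (h.old_mem .U)
  have h1 := (h.holds.run d.ui (h.old_mem .U) 0 h0).1
  have h2 := ((h.holds.tile .U).bounds (h.old_mem .U)).2
  have h3 : pos .U d.ui + (σ.mem .U d.ui).len ≤ S.length := h2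
  rw [hc, add_zero, bwt_getD_eq_bot_iff hS (by omega)] at h1
  rw [bwt_getD_eq_bot_iff hS hi] at hb
  omega

/-- On a piece of an old repetition everything is inherited through the shift. The two exceptional
nodes belong to the two exceptional rows: `u_a` occupies the former `$` row, which is sent to `q`,
where `v_a` was inserted; `u_x` occupies row `q`, which is sent to `0`, where `v_x` has taken the
place of `v_i`. -/
theorem run_new (hS : EndMarked S) (hq : BwtStep S c q) (hui : (σ.mem .U d.ui).chr = ⊥) {z : ℕ}
    (hz : z = d.x ∨ z ∈ (l .U).flatMap (d.refine .U)) {j : ℕ} (hj : j < (d.cell σ c .U z).len) :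
    (bwt (c :: S)).getD (d.npos pos q .U z + j) ⊥ = (d.cell σ c .U z).chr ∧
    LF (c :: S) (d.npos pos q .U z + j) = d.npos pos q .V (d.cell σ c .U z).lf + j := by
  have hxn : d.x = d.new .U := rfl
  have han : d.a = d.new .V := rfl
  have hshift : z ∈ (l .U).flatMap (d.refine .U) →
      d.npos pos q .U z + j = shiftAt q (d.rpos pos .U z + j) := by
    intro hz
    rw [npos_of_ne fun e => h.new_not_mem_refine .U (e ▸ hz), shiftAt_add (h.refine_cut c .U hz) hj]
  -- a piece of the interval of an old node other than `ui`
  have piece : ∀ y ∈ l .U, y ≠ d.ui → ∀ b : ℕ, d.rpos pos .U z = pos .U y + b →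
      z ∈ (l .U).flatMap (d.refine .U) → b + j < (σ.mem .U y).len →
      (d.cell σ c .U z).chr = (σ.mem .U y).chr →
      (d.cell σ c .U z).lf ∈ (l .V).flatMap (d.refine .V) →
      d.rpos pos .V (d.cell σ c .U z).lf = pos .V (σ.mem .U y).lf + b →
      j < (d.cell σ c .V (d.cell σ c .U z).lf).len →
      (bwt (c :: S)).getD (d.npos pos q .U z + j) ⊥ = (d.cell σ c .U z).chr ∧
      LF (c :: S) (d.npos pos q .U z + j) = d.npos pos q .V (d.cell σ c .U z).lf + j := by
    intro y hy hne b hb hzm hlt hchr hlf hv hjv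
    have hrun := h.holds.run y hy (b + j) hlt
    have hlen := ((h.holds.tile .U).bounds hy).2
    have hlen' : pos .U y + (σ.mem .U y).len ≤ S.length := hlen
    have hbot : (bwt S).getD (pos .U y + (b + j)) ⊥ ≠ ⊥ := by
      intro hbot
      have := h.pos_ui_of_bot hS (by omega) hui hbot
      have h0 := h.holds.len_pos .U _ (h.old_mem .U)
      have h0' : 0 < (σ.mem .U d.ui).len := h0
      exact hne ((h.holds.tile .U).unique (f := pos .U d.ui) hy (h.old_mem .U) (by omega) (by omega)
        le_rfl (Nat.lt_add_of_pos_right h0'))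
    obtain ⟨h1, h2⟩ := hq.kept _ (by omega) hbot
    rw [hshift hzm, hb, add_assoc, h1, h2, hchr, hrun.1, hrun.2]
    refine ⟨rfl, ?_⟩
    rw [npos_of_ne fun e => h.new_not_mem_refine .V (e ▸ hlf), hv, ← add_assoc, ← hv]
    exact shiftAt_add (h.refine_cut c .V hlf) hjv
  rcases hz with rfl | hz
  · rw [h.cell_x] at hj ⊢
    have hj : j < 1 := hj
    obtain rfl : j = 0 := by omega
    rw [hxn, npos_new, ← hxn]
    refine ⟨hq.inserted.1, ?_⟩
    rw [add_zero, hq.inserted.2]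
    change 0 = d.npos pos q .V d.x + 0
    rw [npos_of_ne (show d.x ≠ d.new .V from h.a_ne_x.symm)]
    have : d.rpos pos .V d.x = pos .V d.vi := rpos_rep .V
    rw [this, h.pos_vi, shiftAt, if_pos (by have := h.q_pos; omega)]
  · rcases h.mem_refine.1 hz with rfl | ⟨p, hp, rfl | rfl⟩ | ⟨hzl, hr⟩
    · have e : d.cell σ c .U (d.rep .U) = newCell d.a (c, 1) := cell_a c .U
      rw [hshift hz]
      rw [e] at hj ⊢
      have hj : j < 1 := hj
      obtain rfl : j = 0 := by omega
      have h0 : 0 < (σ.mem .U d.ui).len := h.holds.len_pos .U _ (h.old_mem .U)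
      have h1 := (h.holds.run d.ui (h.old_mem .U) 0 h0).1
      have h2 : pos .U d.ui + (σ.mem .U d.ui).len ≤ S.length :=
        ((h.holds.tile .U).bounds (h.old_mem .U)).2
      obtain ⟨h3, h4, -⟩ := hq.replaced (pos .U d.ui) (by omega) (h1.trans hui)
      have : d.rpos pos .U (d.rep .U) = pos .U d.ui := rpos_rep .U
      rw [add_zero, this]
      refine ⟨h3, h4.trans ?_⟩
      change q = d.npos pos q .V d.a + 0
      rw [han, npos_new, add_zero]
    · have e := h.cell_lo c .U hp
      have e' := h.cell_lo c .V hp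
      have elf : (d.cell σ c .U p.lo).lf = p.lo := by rw [e]; rfl
      refine piece p.uj (h.oj_mem p hp .U) (h.oj_ne p hp .U) 0 (h.rpos_lo .U hp) hz ?_ ?_ ?_ ?_ ?_
      · rw [e] at hj
        have h1 : j < p.cut := hj
        have h2 : p.cut < (σ.mem .U p.uj).len := h.cut_lt p hp .U
        omega
      · rw [e]; rfl
      · rw [elf, h.mem_refine]; exact .inr (.inl ⟨p, hp, .inl rfl⟩)
      · rw [elf, h.rpos_lo .V hp, add_zero]
        congr 1
        exact (h.oj_lf p hp .U).symm
      · rw [elf, e']; rw [e] at hj; exact hj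
    · have e := h.cell_hi c .U hp
      have e' := h.cell_hi c .V hp
      have elf : (d.cell σ c .U p.hi).lf = p.hi := by rw [e]; rfl
      refine piece p.uj (h.oj_mem p hp .U) (h.oj_ne p hp .U) p.cut (h.rpos_hi .U hp) hz ?_ ?_ ?_ ?_ ?_
      · rw [e] at hj
        have h1 : j < (σ.mem .U p.uj).len - p.cut := hj
        omega
      · rw [e]; rfl
      · rw [elf, h.mem_refine]; exact .inr (.inl ⟨p, hp, .inr rfl⟩)
      · rw [elf, h.rpos_hi .V hp]
        congr 2
        exact (h.oj_lf p hp .U).symm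
      · rw [elf, e']; rw [e] at hj; exact hj
    · have e := h.cell_kept c .U (h.lt hzl)
      have hne : z ≠ d.ui := fun e => hr (.inl e)
      have hm : (σ.mem .U z).lf ∈ l .V := h.holds.lf_mem .U z hzl
      have hlflf : (σ.mem .V (σ.mem .U z).lf).lf = z := h.holds.lf_lf .U z hzl
      refine piece z hzl hne 0 (h.rpos_kept hzl) hz ?_ ?_ ?_ ?_ ?_
      · rw [e] at hj; omega
      · rw [e]
      · rw [e, h.mem_refine]
        refine .inr (.inr ⟨hm, ?_⟩)
        rintro (e1 | ⟨p, hp, e1⟩)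
        · rw [e1, h.old_lf .V] at hlflf
          exact hne hlflf.symm
        · rw [e1, h.oj_lf p hp .V] at hlflf
          exact hr (.inr ⟨p, hp, hlflf.symm⟩)
      · rw [e, h.rpos_kept hm, add_zero]
      · rw [e, h.cell_kept c .V (h.lt hm)]
        rw [e] at hj
        rw [show (σ.mem .V (σ.mem .U z).lf).len = (σ.mem .U z).len from h.holds.len_lf .U z hzl]
        exact hj

end Ctx

end Upd

end

section

variable {A : Type} [LinearOrder A] [OrderBot A]

/-! ### Creation of the new nodes -/

/-- Replace `x` by `lo`, `hi` in a list, using `List.flatMap`. -/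
def splitAt (x lo hi y : ℕ) : List ℕ := if y = x then [lo, hi] else [y]

theorem flatMap_eq_self_of {g : ℕ → List ℕ} {l : List ℕ} (h : ∀ y ∈ l, g y = [y]) :
    l.flatMap g = l := by
  induction l with
  | nil => rfl
  | cons y l ih =>
    rw [List.flatMap_cons, h y (by simp), ih fun z hz => h z (by simp [hz])]
    rfl

theorem flatMap_splitAt {l₁ l₂ : List ℕ} {x lo hi : ℕ} (hn : (l₁ ++ x :: l₂).Nodup) :
    (l₁ ++ x :: l₂).flatMap (splitAt x lo hi) = l₁ ++ lo :: hi :: l₂ := by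
  rw [List.nodup_append, List.nodup_cons] at hn
  rw [List.flatMap_append, List.flatMap_cons,
    flatMap_eq_self_of (g := splitAt x lo hi) fun y hy => if_neg (hn.2.2 y hy x (by simp)),
    flatMap_eq_self_of (g := splitAt x lo hi) fun y hy => if_neg (ne_of_mem_of_not_mem hy hn.2.1.1)]
  simp [splitAt]

/-- The last of the nodes before `l₂` in the list. -/
theorem eq_dropLast_append {l₁ : List ℕ} {y : ℕ} (h : l₁.getLast? = some y) :
    l₁ = l₁.dropLast ++ [y] := (List.dropLast_append_getLast? y h).symm

section

variable {α : ℕ} {S : List A} {σ : Store A} {l : Side → List ℕ} {pos : Side → ℕ → ℕ}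

/-- The node found may be `vi` itself. This needs no special treatment, because the new node is
inserted before `vi` is unlinked. The fallback `vi` for an unsuccessful search is not used either,
as `vi :: X` has a last element. -/
theorem tri_replaceNode (h : AHolds α S σ l pos) {c : A} {ui vi : ℕ} {M₁ M₂ X Y : List ℕ} {ht : ℕ}
    {P : Entry A → Prop} (hT : TreeInv σ ht P) (hU : l .U = M₁ ++ ui :: M₂)
    (hV : l .V = vi :: X ++ Y)
    (hkey : ((σ.tree.inorder.filter (KeyLt σ.om · ⟨0, ui, c⟩)).getLast?).map Entry.v =
      (vi :: X).getLast?) :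
    Tri (replaceNode c ui vi) σ fun r σ' n => r = (σ.fresh, Y.head?) ∧
      Relinked σ l (σ.fresh + 1) σ.dollar σ'
        (Side.pick (M₁ ++ σ.fresh :: M₂) (X ++ σ.fresh :: Y))
        (fun _ y => if y = σ.fresh then some (c, 1) else none) ∧ n ≤ 4 * ht + 25 := by
  have hfU : σ.fresh ∉ l .U := fun e => lt_irrefl _ (h.lt_fresh .U _ e)
  have hfV : σ.fresh ∉ l .V := fun e => lt_irrefl _ (h.lt_fresh .V _ e)
  obtain ⟨vg, hvg⟩ : ∃ vg, (vi :: X).getLast? = some vg := ⟨_, List.getLast?_cons⟩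
  have hX := eq_dropLast_append hvg
  generalize (vi :: X).dropLast = Z at hX
  have hV' : l .V = Z ++ vg :: Y := by rw [hV, hX]; simp
  have hnext : (σ.mem .V vg).next = Y.head? := ((h.dll .V).2.2 _ _ _ hV').1
  unfold replaceNode
  refine Tri.bind (hT.tri_treeSearch ui c) ?_
  rintro r σ₁ n₁ ⟨rfl, rfl, hn₁⟩
  rw [hkey, hvg]
  simp only [Option.getD_some]
  refine Tri.look_bind ?_
  refine Tri.bind h.relinked.tri_newAddr ?_
  rintro a σ₂ n₂ ⟨rfl, H2, rfl⟩
  refine Tri.bind (H2.tri_newNode hfU c 1) ?_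
  rintro _ σ₃ n₃ ⟨H3, rfl⟩
  refine Tri.bind (H3.tri_insertAfter (l' := Side.pick (M₁ ++ ui :: σ₁.fresh :: M₂) (l .V)) hU hfU
    (by simp [addLabel]) rfl rfl) ?_
  rintro _ σ₄ n₄ ⟨H4, hn₄⟩
  refine Tri.bind (H4.tri_unlink (s := .U) (l' := Side.pick (M₁ ++ σ₁.fresh :: M₂) (l .V)) rfl
    rfl rfl) ?_
  rintro _ σ₅ n₅ ⟨H5, hn₅⟩
  refine Tri.bind (H5.tri_newNode (s := .V) hfV c 1) ?_
  rintro _ σ₆ n₆ ⟨H6, rfl⟩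
  refine Tri.bind (H6.tri_insertAfter (s := .V) (l₁ := Z) (y := vg) (l₂ := Y)
    (l' := Side.pick (M₁ ++ σ₁.fresh :: M₂) (Z ++ vg :: σ₁.fresh :: Y)) hV' hfV
    (by simp [addLabel]) rfl rfl) ?_
  rintro _ σ₇ n₇ ⟨H7, hn₇⟩
  refine Tri.bind (H7.tri_unlink (s := .V) (l₁ := []) (y := vi) (l₂ := X ++ σ₁.fresh :: Y)
    (l' := Side.pick (M₁ ++ σ₁.fresh :: M₂) (X ++ σ₁.fresh :: Y)) ?_ rfl rfl) ?_
  · change Z ++ vg :: σ₁.fresh :: Y = _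
    rw [show Z ++ vg :: σ₁.fresh :: Y = (Z ++ [vg]) ++ σ₁.fresh :: Y by simp, ← hX]
    rfl
  rintro _ σ₈ n₈ ⟨H8, hn₈⟩
  refine Tri.pure ⟨by rw [hnext], ?_, by omega⟩
  convert H8 using 1
  funext s y
  cases s <;> simp [addLabel]

theorem Relinked.mem_body {l₀ l : Side → List ℕ} {fr dl : ℕ} {σ₀ σ : Store A}
    {N : Side → ℕ → Option (A × ℕ)} (H : Relinked σ₀ l₀ fr dl σ l N) {s : Side} {y : ℕ}
    (hy : N s y = none) : (σ.mem s y).body = (σ₀.mem s y).body := by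
  rw [H.body, hy]; rfl

/-- All records consulted belong to old nodes. Only their links have changed so far, so the other
fields can be evaluated in the original store. -/
theorem tri_splitNode (h : AHolds α S σ l pos) {l₁ : Side → List ℕ} {fr dl : ℕ} {σ₁ : Store A}
    {N : ℕ → Option (A × ℕ)} (H : Relinked σ l fr dl σ₁ l₁ fun _ => N)
    (hN : ∀ y < σ.fresh, N y = none) (hfr : ∀ s, ∀ y ∈ l₁ s, y < fr) {gnext : Option ℕ}
    (hw : ∀ w, gnext = some w → w ∈ l .V)
    (hj : ∀ w, gnext = some w → (σ.mem .V w).off ≠ 0 →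
      (σ.mem .V w).head ∈ l₁ .U ∧ (σ.mem .U (σ.mem .V w).head).lf ∈ l₁ .V) :
    Tri (splitNode gnext) σ₁ fun sp σ₂ n => n ≤ 40 ∧
      ((sp = none ∧ σ₂ = σ₁ ∧ ∀ w, gnext = some w → (σ.mem .V w).off = 0) ∨
      ∃ w p, gnext = some w ∧ sp = some p ∧
        p = ⟨(σ.mem .V w).head, (σ.mem .U (σ.mem .V w).head).lf, (σ.mem .V w).off, fr, fr + 1, w⟩ ∧
        (σ.mem .V w).off ≠ 0 ∧
        Relinked σ l (fr + 2) dl σ₂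
          (fun s => (l₁ s).flatMap (splitAt (p.oj s) fr (fr + 1)))
          (fun _ y => if y = fr + 1 then
            some ((σ.mem .U p.uj).chr, (σ.mem .U p.uj).len - p.cut)
            else if y = fr then some ((σ.mem .U p.uj).chr, p.cut) else N y)) := by
  unfold splitNode
  cases gnext with
  | none => exact Tri.pure ⟨by omega, .inl ⟨rfl, rfl, by simp⟩⟩
  | some w =>
    have hwl := hw w rfl
    have hwb : (σ₁.mem .V w).body = (σ.mem .V w).body :=
      H.mem_body (hN w (h.lt_fresh .V w hwl))
    have hwo : (σ₁.mem .V w).off = (σ.mem .V w).off := (congrArg Cell.off hwb :)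
    have hwh : (σ₁.mem .V w).head = (σ.mem .V w).head := (congrArg Cell.head hwb :)
    refine Tri.look_bind ?_
    rw [hwo, hwh]
    split_ifs with h0
    · refine Tri.pure ⟨by omega, .inl ⟨rfl, rfl, ?_⟩⟩
      rintro _ ⟨rfl⟩; exact h0
    · obtain ⟨hju, hjv⟩ := hj w rfl h0
      have hul : (σ.mem .V w).head ∈ l .U := (h.head .V w hwl).1
      obtain ⟨uj, huj⟩ : ∃ uj, (σ.mem .V w).head = uj := ⟨_, rfl⟩
      rw [huj] at hju hjv hul ⊢
      have hub : (σ₁.mem .U uj).body = (σ.mem .U uj).body :=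
        H.mem_body (hN uj (h.lt_fresh .U uj hul))
      have hue : (σ₁.mem .U uj).lf = (σ.mem .U uj).lf := (congrArg Cell.lf hub :)
      have huc : (σ₁.mem .U uj).chr = (σ.mem .U uj).chr := (congrArg Cell.chr hub :)
      have hun : (σ₁.mem .U uj).len = (σ.mem .U uj).len := (congrArg Cell.len hub :)
      refine Tri.look_bind (Tri.bind H.tri_newAddr ?_)
      rintro lo σ₂ n₂ ⟨rfl, H2, rfl⟩
      refine Tri.bind H2.tri_newAddr ?_
      rintro hi σ₃ n₃ ⟨rfl, H3, rfl⟩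
      rw [hue, huc, hun]
      obtain ⟨vj, hvj⟩ : ∃ vj, (σ.mem .U uj).lf = vj := ⟨_, rfl⟩
      rw [hvj] at hjv ⊢
      obtain ⟨m₁, m₂, hm⟩ := List.append_of_mem hju
      obtain ⟨k₁, k₂, hk⟩ := List.append_of_mem hjv
      have f1 : ∀ s, lo ∉ l₁ s := fun s e => lt_irrefl _ (hfr s _ e)
      have f2 : ∀ s, lo + 1 ∉ l₁ s := fun s e => by have := hfr s _ e; omega
      have hnU := H.nodup .U
      have hnV := H.nodup .V
      refine Tri.bind (H3.tri_splitOne (l' := Side.pick (m₁ ++ lo :: (lo + 1) :: m₂) (l₁ .V))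
        hm (f1 _) (f2 _) (by omega) _ _ _ rfl rfl) ?_
      rintro _ σ₄ n₄ ⟨H4, hn₄⟩
      refine Tri.bind (H4.tri_splitOne (s := .V) (l' := Side.pick (m₁ ++ lo :: (lo + 1) :: m₂)
        (k₁ ++ lo :: (lo + 1) :: k₂)) hk (f1 _) (f2 _) (by omega) _ _ _ rfl rfl) ?_
      rintro _ σ₅ n₅ ⟨H5, hn₅⟩
      refine Tri.pure ⟨by omega, .inr ⟨w, _, rfl, rfl, by rw [huj, hvj], h0, ?_⟩⟩
      convert H5 using 1
      · funext s
        cases s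
        · change (l₁ .U).flatMap (splitAt uj lo (lo + 1)) = _
          rw [hm] at hnU ⊢
          exact flatMap_splitAt hnU
        · change (l₁ .V).flatMap (splitAt vj lo (lo + 1)) = _
          rw [hk] at hnV ⊢
          exact flatMap_splitAt hnV
      · funext s y
        cases s <;> simp only [addLabel, true_and, false_and, reduceCtorEq, if_false]

/-- The last part of the insertion: the partner of the new node. -/
theorem Relinked.tri_insertFront {l₀ l₂ : Side → List ℕ} {fr dl : ℕ} {σ₀ σ₂ : Store A}
    {N : ℕ → Option (A × ℕ)} {LU : List ℕ} {v₀ : ℕ} {R : List ℕ} (hV : l₂ .V = v₀ :: R)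
    {x : ℕ} (hx : x ∉ l₂ .V) (hU : l₂ .U = LU)
    (H : Relinked σ₀ l₀ fr dl σ₂ l₂ (addLabel (fun _ => N) .U x (⊥, 1))) :
    Tri (do
        newNode Side.V x ⊥ 1
        let __do_lift ← readS fun σ => σ.first Side.V
        match __do_lift with
          | some y => do
            insertBefore Side.V y x
            writeS fun σ => { σ with dollar := x }
            pure x
          | none => pure x : Prog A ℕ) σ₂ fun r σ₃ n => r = x ∧ n ≤ 7 ∧
      Relinked σ₀ l₀ fr x σ₃ (Side.pick LU (x :: l₂ .V))
        (fun _ y => if y = x then some (⊥, 1) else N y) := by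
  refine Tri.bind (H.tri_newNode hx ⊥ 1) ?_
  rintro _ σ₃ n₃ ⟨H3, rfl⟩
  refine Tri.readS_bind ?_
  have hf := (H3.dll .V).1
  rw [hV] at hf
  rw [hf]
  simp only [List.head?_cons]
  refine Tri.bind (H3.tri_insertBefore (l₁ := []) (l₂ := R) (l' := Side.pick LU (x :: l₂ .V)) hV hx
    (by simp [addLabel]) (by rw [hV]; rfl) hU.symm) ?_
  rintro _ σ₄ n₄ ⟨H4, hn₄⟩
  refine Tri.writeS_bind (Tri.pure ⟨rfl, by omega, ?_⟩)
  have hN : (fun _ y => if y = x then some (⊥, 1) else N y) =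
      addLabel (addLabel (fun _ => N) Side.U x (⊥, 1)) Side.V x (⊥, 1) := by
    funext s y
    cases s <;> simp [addLabel]
  rw [hN]
  exact ⟨H4.fresh, rfl, H4.om, H4.tree, H4.heavy, H4.body, H4.mem, H4.nodup, H4.sub, H4.dll⟩

/-- The hypothesis `hcut` lists the ways in which the cut between `X` and `Y` is known to the
program: behind the first half of a split node, at the end, or before the head of the edge of
`gnext`. In the last case the stored head may still be `ui`, which has already been replaced by `a`.
-/
theorem tri_insertNode {l₀ l₂ : Side → List ℕ} {fr dl : ℕ} {σ₀ σ₂ : Store A}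
    {N : ℕ → Option (A × ℕ)} (H : Relinked σ₀ l₀ fr dl σ₂ l₂ fun _ => N)
    (hfr : ∀ s, ∀ y ∈ l₂ s, y < fr) {X Y : List ℕ} (hU : l₂ .U = X ++ Y) (hV : l₂ .V ≠ [])
    {ui a : ℕ} {gnext : Option ℕ} {sp : Option Split}
    (hcut : (∃ p, sp = some p ∧ X.getLast? = some p.lo) ∨
      (sp = none ∧ gnext = none ∧ Y = [] ∧ X ≠ []) ∨
      (sp = none ∧ ∃ w, gnext = some w ∧
        Y.head? = some (if (σ₂.mem .V w).head = ui then a else (σ₂.mem .V w).head))) :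
    Tri (insertNode ui a gnext sp) σ₂ fun r σ₃ n => r = fr ∧ n ≤ 20 ∧
      Relinked σ₀ l₀ (fr + 1) fr σ₃ (Side.pick (X ++ fr :: Y) (fr :: l₂ .V))
        (fun _ y => if y = fr then some (⊥, 1) else N y) := by
  have f1 : ∀ s, fr ∉ l₂ s := fun s e => lt_irrefl _ (hfr s _ e)
  obtain ⟨v₀, R, hR⟩ : ∃ v₀ R, l₂ .V = v₀ :: R := by
    cases hl : l₂ .V with
    | nil => exact absurd hl hV
    | cons v R => exact ⟨v, R, rfl⟩
  unfold insertNode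
  rcases hcut with ⟨p, rfl, hX⟩ | ⟨rfl, rfl, rfl, hX⟩ | ⟨rfl, w, rfl, hY⟩
  · simp only
    refine Tri.bind H.tri_newAddr ?_
    rintro x σ₃ n₃ ⟨rfl, H3, rfl⟩
    refine Tri.bind (H3.tri_newNode (f1 .U) ⊥ 1) ?_
    rintro _ σ₄ n₄ ⟨H4, rfl⟩
    have hX' := eq_dropLast_append hX
    refine Tri.bind (H4.tri_insertAfter (s := .U) (l₁ := X.dropLast) (y := p.lo) (l₂ := Y)
      (l' := Side.pick (X ++ x :: Y) (l₂ .V)) (by rw [hU]; conv_lhs => rw [hX']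
                                                  simp) (f1 .U)
      (by simp [addLabel]) ?_ rfl) ?_
    · change X ++ x :: Y = _
      conv_lhs => rw [hX']
      simp
    rintro _ σ₅ n₅ ⟨H5, hn₅⟩
    refine (Relinked.tri_insertFront (l₂ := Side.pick _ (l₂ .V)) hR (f1 .V) rfl H5).mono ?_
    rintro _ σ₆ n₆ ⟨rfl, hn₆, H6⟩
    exact ⟨rfl, by omega, H6⟩
  · simp only
    refine Tri.bind H.tri_newAddr ?_
    rintro x σ₃ n₃ ⟨rfl, H3, rfl⟩
    refine Tri.bind (H3.tri_newNode (f1 .U) ⊥ 1) ?_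
    rintro _ σ₄ n₄ ⟨H4, rfl⟩
    obtain ⟨y, hy⟩ : ∃ y, X.getLast? = some y := by
      rw [← Option.isSome_iff_exists]; simpa using hX
    have hX' := eq_dropLast_append hy
    refine Tri.readS_bind ?_
    have hl := (H4.dll .U).2.1
    rw [hU, List.append_nil, hy] at hl
    rw [hl]
    simp only
    refine Tri.bind (H4.tri_insertAfter (s := .U) (l₁ := X.dropLast) (y := y) (l₂ := [])
      (l' := Side.pick (X ++ [x]) (l₂ .V)) (by rw [hU]; conv_lhs => rw [hX']
                                               simp) (f1 .U)
      (by simp [addLabel]) ?_ rfl) ?_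
    · change X ++ [x] = _
      conv_lhs => rw [hX']
      simp
    rintro _ σ₅ n₅ ⟨H5, hn₅⟩
    refine (Relinked.tri_insertFront (l₂ := Side.pick _ (l₂ .V)) hR (f1 .V) rfl H5).mono ?_
    rintro _ σ₆ n₆ ⟨rfl, hn₆, H6⟩
    exact ⟨rfl, by omega, H6⟩
  · simp only
    refine Tri.bind H.tri_newAddr ?_
    rintro x σ₃ n₃ ⟨rfl, H3, rfl⟩
    refine Tri.bind (H3.tri_newNode (f1 .U) ⊥ 1) ?_
    rintro _ σ₄ n₄ ⟨H4, rfl⟩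
    refine Tri.look_bind ?_
    have hh : (σ₄.mem .V w).head = (σ₂.mem .V w).head := by
      have h1 := congrArg Cell.head (H4.body .V w)
      have h2 := congrArg Cell.head (H.body .V w)
      simp only [addLabel, reduceCtorEq, false_and, if_false] at h1
      exact h1.trans h2.symm
    rw [hh]
    generalize (if (σ₂.mem .V w).head = ui then a else (σ₂.mem .V w).head) = z at *
    obtain ⟨Y', rfl⟩ : ∃ Y', Y = z :: Y' := by
      cases Y with
      | nil => simp at hY
      | cons y Y => exact ⟨Y, by simpa using hY⟩
    refine Tri.bind (H4.tri_insertBefore (s := .U) (l₁ := X) (y := z) (l₂ := Y')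
      (l' := Side.pick (X ++ x :: z :: Y') (l₂ .V)) hU (f1 .U) (by simp [addLabel]) rfl rfl) ?_
    rintro _ σ₅ n₅ ⟨H5, hn₅⟩
    refine (Relinked.tri_insertFront (l₂ := Side.pick _ (l₂ .V)) hR (f1 .V) rfl H5).mono ?_
    rintro _ σ₆ n₆ ⟨rfl, hn₆, H6⟩
    exact ⟨rfl, by omega, H6⟩

end

end

/-! ### The place of the inserted row among keys and F-intervals. -/

section

variable {A : Type} [LinearOrder A] [OrderBot A]

theorem Tile.exists_split {len pos : ℕ → ℕ} {l : List ℕ} {b e q : ℕ} (h : Tile len pos b l e)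
    (hb : b ≤ q) (he : q ≤ e) (hc : ∀ y ∈ l, pos y < q → pos y + len y ≤ q) :
    ∃ X Y, l = X ++ Y ∧ Tile len pos b X q ∧ Tile len pos q Y e := by
  induction l generalizing b with
  | nil =>
    have : b = e := h
    obtain rfl : b = q := by omega
    exact ⟨[], [], rfl, rfl, h⟩
  | cons y l ih =>
    by_cases hbq : b = q
    · subst hbq
      exact ⟨[], y :: l, rfl, rfl, h⟩
    · have h1 := h.1
      have h2 := hc y (by simp) (by omega)
      obtain ⟨X, Y, rfl, hX, hY⟩ := ih h.2 (by omega) fun z hz => hc z (by simp [hz])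
      exact ⟨y :: X, Y, rfl, ⟨h1, hX⟩, hY⟩

/-- A key consists of a character and the rank of a repetition, and by `LF_lt_iff` this pair decides
the order of the images. The statement is used for the tree before the update and again for the tree
after it. -/
theorem keyLt_iff_pos {S : List A} (hS : EndMarked S) {om : List ℕ} {e e' : Entry A}
    {i i' p p' : ℕ} (hi : i < S.length) (hi' : i' < S.length)
    (hc : (bwt S).getD i ⊥ = e.chr) (hc' : (bwt S).getD i' ⊥ = e'.chr)
    (hp : LF S i = p) (hp' : LF S i' = p')
    (ho : om.idxOf e.u < om.idxOf e'.u ↔ i < i') : KeyLt om e e' ↔ p < p' := by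
  rw [← hp, ← hp', LF_lt_iff hS hi hi', KeyLt, hc, hc', ho]

section

variable {α : ℕ} {S : List A} {σ : Store A} {l : Side → List ℕ} {pos : Side → ℕ → ℕ}
  (h : AHolds α S σ l pos)

include h

theorem AHolds.pos_lt {s : Side} {y : ℕ} (hy : y ∈ l s) : pos s y + (σ.mem s y).len ≤ S.length :=
  ((h.tile s).bounds hy).2

theorem AHolds.idxOf_om_lt_iff {x y : ℕ} (hx : x ∈ l .U) (hy : y ∈ l .U) :
    σ.om.idxOf x < σ.om.idxOf y ↔ pos .U x < pos .U y := by
  rw [h.om]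
  exact lt_iff_lt_of_pairwise (pairwise_idxOf (h.nodup .U))
    ((h.tile .U).pairwise_lt (h.len_pos .U)) hx hy

/-- The interval of a node of `V`, in terms of its partner. -/
theorem AHolds.run_lf {y : ℕ} (hy : y ∈ l .V) {j : ℕ} (hj : j < (σ.mem .V y).len) :
    (σ.mem .V y).lf ∈ l .U ∧ pos .U (σ.mem .V y).lf + j < S.length ∧
    (bwt S).getD (pos .U (σ.mem .V y).lf + j) ⊥ = (σ.mem .V y).chr ∧
    LF S (pos .U (σ.mem .V y).lf + j) = pos .V y + j := by
  have h1 : (σ.mem .V y).lf ∈ l .U := h.lf_mem .V y hy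
  have h2 : (σ.mem .U (σ.mem .V y).lf).lf = y := h.lf_lf .V y hy
  have h3 : (σ.mem .U (σ.mem .V y).lf).chr = (σ.mem .V y).chr := h.chr_lf .V y hy
  have h4 : (σ.mem .U (σ.mem .V y).lf).len = (σ.mem .V y).len := h.len_lf .V y hy
  have h5 := h.run _ h1 j (by omega)
  have h6 := h.pos_lt h1
  rw [h2, h3] at h5
  exact ⟨h1, by omega, h5.1, h5.2⟩

/-- The depth is bounded through the number of entries, which is the number of F-intervals and
hence, by the partner maps, that of repetitions. -/
theorem AHolds.treeInv (hS : EndMarked S) :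
    ∃ ht, 2 ^ ht ≤ (l .U).length + 1 ∧
      TreeInv σ ht fun e => ∃ y ∈ l .V, e = entryOf σ y := by
  obtain ⟨ht, hu⟩ := h.tree_shape
  have hlen : (l .V).length = (l .U).length := by
    have h1 : ((l .U).map fun y => (σ.mem .U y).lf).Subperm (l .V) := by
      refine List.subperm_of_subset ((h.nodup .U).map_on ?_) ?_
      · intro x hx y hy e
        rw [← h.lf_lf .U x hx, ← h.lf_lf .U y hy]
        simp only [e]
      · intro y hy
        obtain ⟨x, hx, rfl⟩ := List.mem_map.1 hy
        exact h.lf_mem .U x hx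
    have h2 : ((l .V).map fun y => (σ.mem .V y).lf).Subperm (l .U) := by
      refine List.subperm_of_subset ((h.nodup .V).map_on ?_) ?_
      · intro x hx y hy e
        rw [← h.lf_lf .V x hx, ← h.lf_lf .V y hy]
        simp only [e]
      · intro y hy
        obtain ⟨x, hx, rfl⟩ := List.mem_map.1 hy
        exact h.lf_mem .V x hx
    have h1 := h1.length_le
    have h2 := h2.length_le
    simp only [List.length_map] at h1 h2
    omega
  refine ⟨ht, ?_, ⟨ht, le_rfl, hu⟩, ?_, ?_⟩
  · have := hu.two_pow_le
    rwa [h.tree_entries, List.length_map, hlen] at this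
  · rw [h.tree_entries, List.pairwise_map]
    refine ((h.tile .V).pairwise_lt (h.len_pos .V)).imp_of_mem ?_
    intro y z hy hz hyz
    obtain ⟨hy1, hy2, hy3, hy4⟩ := h.run_lf hy (h.len_pos .V y hy)
    obtain ⟨hz1, hz2, hz3, hz4⟩ := h.run_lf hz (h.len_pos .V z hz)
    exact (keyLt_iff_pos hS hy2 hz2 hy3 hz3 hy4 hz4 (h.idxOf_om_lt_iff hy1 hz1)).2 hyz
  · intro e
    rw [h.tree_entries, List.mem_map]
    simp only [eq_comm]

theorem AHolds.dollar_len (hS : EndMarked S) : (σ.mem .U σ.dollar).len = 1 := by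
  obtain ⟨h1, h2⟩ := h.dollar
  by_contra hne
  have h0 := h.len_pos .U _ h1
  have h3 := h.run _ h1 0 h0
  have h4 := h.run _ h1 1 (by omega)
  have h5 := h.pos_lt h1
  rw [h2, add_zero, bwt_getD_eq_bot_iff hS (by omega)] at h3
  rw [h2, bwt_getD_eq_bot_iff hS (by omega)] at h4
  omega

theorem AHolds.pos_partner {c : A} {q : ℕ} (hq : BwtStep S c q) :
    pos .V (σ.mem .U σ.dollar).lf = 0 := by
  obtain ⟨h1, h2⟩ := h.dollar
  have h0 := h.len_pos .U _ h1
  have h3 := h.run _ h1 0 h0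
  have h5 := h.pos_lt h1
  rw [h2] at h3
  have := (hq.replaced _ (by omega) h3.1).2.2
  rw [h3.2] at this
  simpa using this

/-- Row `q` is the image of the former `$` row, now carrying `c`, so a comparison with the query is
a comparison with `q`. The node `0` in the query is a dummy: it is not part of the key. -/
theorem AHolds.key_lt_iff (hS : EndMarked S) {c : A} (hc : c ≠ ⊥) {q : ℕ} (hq : BwtStep S c q)
    {y : ℕ} (hy : y ∈ l .V) : KeyLt σ.om (entryOf σ y) ⟨0, σ.dollar, c⟩ ↔ pos .V y < q := by
  obtain ⟨h1, h2⟩ := h.dollar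
  have h0 := h.len_pos .U _ h1
  have h3 := h.run _ h1 0 h0
  have h5 := h.pos_lt h1
  obtain ⟨hy1, hy2, hy3, hy4⟩ := h.run_lf hy (h.len_pos .V y hy)
  have := hq.LF_lt_iff hS hc hy2 (i₀ := pos .U σ.dollar) (by omega) (h3.1.trans h2)
  rw [hy3, hy4, add_zero, add_zero] at this
  rw [this, KeyLt, ← h.idxOf_om_lt_iff hy1 h1]
  rfl

/-- All rows of a run carry the same character. Their images can lie on both sides of `q` only if
the `$` row lies after the first and not after the last row of the run, but the `$` row belongs to a
different repetition or is the first of its own. -/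
theorem AHolds.cutV (hS : EndMarked S) {c : A} (hc : c ≠ ⊥) {q : ℕ} (hq : BwtStep S c q) {y : ℕ}
    (hy : y ∈ l .V) (hlt : pos .V y < q) : pos .V y + (σ.mem .V y).len ≤ q := by
  obtain ⟨h1, h2⟩ := h.dollar
  have h0 := h.len_pos .U _ h1
  have h3 := h.run _ h1 0 h0
  have h5 := h.pos_lt h1
  have hl := h.len_pos .V y hy
  obtain ⟨hy1, hy2, hy3, hy4⟩ := h.run_lf hy hl
  obtain ⟨-, hz2, hz3, hz4⟩ := h.run_lf hy (j := (σ.mem .V y).len - 1) (by omega)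
  have hlen : (σ.mem .U (σ.mem .V y).lf).len = (σ.mem .V y).len := h.len_lf .V y hy
  have e1 := hq.LF_lt_iff hS hc hy2 (i₀ := pos .U σ.dollar) (by omega) (h3.1.trans h2)
  have e2 := hq.LF_lt_iff hS hc hz2 (i₀ := pos .U σ.dollar) (by omega) (h3.1.trans h2)
  rw [hy3, hy4, add_zero, add_zero] at e1
  rw [hz3, hz4] at e2
  have : pos .V y + ((σ.mem .V y).len - 1) < q := by
    rw [e2]
    refine (e1.1 hlt).imp id fun ⟨a1, a2⟩ => ⟨a1, ?_⟩
    by_contra hge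
    have := (h.tile .U).unique (f := pos .U σ.dollar) hy1 h1 a2.le (by omega) le_rfl (by omega)
    rw [this] at a2
    omega
  omega

/-- The partner of the `$` node occupies position `0`, so it heads the list, and `1 ≤ q` puts it
before the cut. Hence the search always finds an entry. -/
theorem AHolds.exists_splitV (hS : EndMarked S) {c : A} (hc : c ≠ ⊥) {q : ℕ}
    (hq : BwtStep S c q) : ∃ X Y, l .V = (σ.mem .U σ.dollar).lf :: X ++ Y ∧
      Tile (fun y => (σ.mem .V y).len) (pos .V) 0 ((σ.mem .U σ.dollar).lf :: X) q ∧
      Tile (fun y => (σ.mem .V y).len) (pos .V) q Y S.length ∧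
      ((σ.tree.inorder.filter (KeyLt σ.om · ⟨0, σ.dollar, c⟩)).getLast?).map Entry.v =
        ((σ.mem .U σ.dollar).lf :: X).getLast? := by
  obtain ⟨X, Y, e, hX, hY⟩ := (h.tile .V).exists_split (Nat.zero_le q) hq.q_le
    fun y hy => h.cutV hS hc hq hy
  have hfil : (σ.tree.inorder.filter (KeyLt σ.om · ⟨0, σ.dollar, c⟩)) = X.map (entryOf σ) := by
    rw [h.tree_entries, e, List.map_append, List.filter_append]
    have e1 : (X.map (entryOf σ)).filter (KeyLt σ.om · ⟨0, σ.dollar, c⟩) = X.map (entryOf σ) := by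
      rw [List.filter_eq_self]
      intro a ha
      obtain ⟨y, hy, rfl⟩ := List.mem_map.1 ha
      have hyl : y ∈ l .V := by rw [e]; simp [hy]
      rw [decide_eq_true_eq, h.key_lt_iff hS hc hq hyl]
      have h1 := (hX.bounds hy).2
      have h2 := h.len_pos .V y hyl
      omega
    have e2 : (Y.map (entryOf σ)).filter (KeyLt σ.om · ⟨0, σ.dollar, c⟩) = [] := by
      rw [List.filter_eq_nil_iff]
      intro a ha
      obtain ⟨y, hy, rfl⟩ := List.mem_map.1 ha
      have hyl : y ∈ l .V := by rw [e]; simp [hy]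
      rw [decide_eq_true_eq, h.key_lt_iff hS hc hq hyl]
      have h1 := (hY.bounds hy).1
      omega
    rw [e1, e2, List.append_nil]
  have hne : X ≠ [] := by
    rintro rfl
    have : 0 = q := hX
    have := hq.q_pos
    omega
  obtain ⟨y, X, rfl⟩ := List.exists_cons_of_ne_nil hne
  have hv : (σ.mem .U σ.dollar).lf ∈ l .V := h.lf_mem .U _ h.dollar.1
  have hy : y = (σ.mem .U σ.dollar).lf := by
    have hyl : y ∈ l .V := by rw [e]; simp
    have h1 := hX.1
    have h2 := h.pos_partner hq
    exact (h.tile .V).unique (f := 0) hyl hv (by omega)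
      (by have := h.len_pos .V y hyl; omega) (by omega)
      (by have := h.len_pos .V _ hv; omega)
  subst hy
  refine ⟨X, Y, e, hX, hY, ?_⟩
  rw [hfil, List.getLast?_map, Option.map_map]
  exact Option.map_id'

end

end

/-! ### The store after replacing, splitting and inserting nodes. -/

section

variable {A : Type} [LinearOrder A] [OrderBot A]

/-- The store `σ'` with lists `l'` arises from `σ` by the creation of the nodes described by `d`. -/
structure Upd.Created (d : Upd) (α : ℕ) (S : List A) (σ : Store A) (l : Side → List ℕ)
    (pos : Side → ℕ → ℕ) (q : ℕ) (c : A) (σ' : Store A) (l' : Side → List ℕ) : Prop where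
  ctx : d.Ctx α S σ l pos q
  relinked : ∃ fr, σ.fresh ≤ fr ∧ (∀ y, d.label σ c y ≠ none → y < fr) ∧
    Relinked σ l fr d.x σ' l' fun _ => d.label σ c
  lists : ∀ s, ∃ X Y, l' s = X ++ d.new s :: Y ∧ X ++ Y = (l s).flatMap (d.refine s) ∧
    Tile (fun y => (d.cell σ c s y).len) (d.rpos pos s) 0 X q ∧
    Tile (fun y => (d.cell σ c s y).len) (d.rpos pos s) q Y S.length

namespace Upd.Ctx

variable {d : Upd} {α : ℕ} {S : List A} {σ : Store A} {l : Side → List ℕ} {pos : Side → ℕ → ℕ}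
  {q : ℕ} (h : d.Ctx α S σ l pos q)

include h

omit h in
theorem label_lt (c : A) {fr : ℕ} (ha : d.a < fr) (hx : d.x < fr)
    (hp : ∀ p, d.sp = some p → p.lo < fr ∧ p.hi < fr) {y : ℕ} (hy : d.label σ c y ≠ none) :
    y < fr := by
  unfold label at hy
  split_ifs at hy with h1 h2
  · omega
  · omega
  · cases hsp : d.sp with
    | none => simp [hsp] at hy
    | some p =>
      have := hp p hsp
      simp only [hsp] at hy
      split_ifs at hy with h3 h4
      · omega
      · omega
      · exact absurd rfl hy

theorem redir_mem (s : Side) {e : ℕ × ℕ} (h1 : e.1 ∈ l s) (h3 : e.2 < (σ.mem s e.1).len) :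
    (d.redir s e).1 ∈ (l s).flatMap (d.refine s) :=
  (h.redir_loc ⊥ s h1 rfl h3).1

/-- The position of the inserted row in the list of `U`. -/
theorem exists_splitU (c : A) {X Y : List ℕ} (hV : l .V = d.vi :: X ++ Y)
    (hY : Tile (fun y => (σ.mem .V y).len) (pos .V) q Y S.length)
    (hoff : d.sp = none → ∀ w, Y.head? = some w → (σ.mem .V w).off = 0) :
    ∃ X' Y', (l .U).flatMap (d.refine .U) = X' ++ Y' ∧
      Tile (fun y => (d.cell σ c .U y).len) (d.rpos pos .U) 0 X' q ∧
      Tile (fun y => (d.cell σ c .U y).len) (d.rpos pos .U) q Y' S.length ∧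
      ((∃ p, d.sp = some p ∧ X'.getLast? = some p.lo) ∨
      (d.sp = none ∧ Y.head? = none ∧ Y' = [] ∧ X' ≠ []) ∨
      (d.sp = none ∧ ∃ w, Y.head? = some w ∧
        Y'.head? = some (if (σ.mem .V w).head = d.ui then d.a else (σ.mem .V w).head))) := by
  have htile := h.tile_refine c .U (h.holds.tile .U) fun _ hy => hy
  obtain ⟨X', Y', he, hX', hY'⟩ := htile.exists_split (Nat.zero_le q) h.q_le
    fun z hz => h.refine_cut c .U hz
  have hlen : ∀ z, z ∈ X' ∨ z ∈ Y' → 0 < (d.cell σ c .U z).len := fun z hz =>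
    h.cell_len_pos c .U (by rw [he]; simpa using hz)
  have hq := h.q_pos
  have hX0 : X' ≠ [] := by
    rintro rfl
    have : 0 = q := hX'
    omega
  refine ⟨X', Y', he, hX', hY', ?_⟩
  cases hsp : d.sp with
  | some p =>
    refine .inl ⟨p, rfl, ?_⟩
    have hlo : p.lo ∈ X' ++ Y' := by
      rw [← he, h.mem_refine]; exact .inr (.inl ⟨p, hsp, .inl rfl⟩)
    have hr := h.rpos_lo .U hsp
    have hcut := h.cut_eq p hsp
    have hcp := h.cut_pos p hsp
    have hloc : (d.cell σ c .U p.lo).len = p.cut := by rw [h.cell_lo c .U hsp]; rfl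
    have hr' : d.rpos pos .U p.lo + p.cut = q := by rw [hr]; exact hcut
    have hlX : p.lo ∈ X' := by
      rcases List.mem_append.1 hlo with hl | hl
      · exact hl
      · have := (hY'.bounds hl).1
        omega
    obtain ⟨z, hz⟩ : ∃ z, X'.getLast? = some z := by
      rw [← Option.isSome_iff_exists]; simpa using hX0
    have hX2 := eq_dropLast_append hz
    have hzX : z ∈ X' := by rw [hX2]; simp
    have hX3 := hX'
    rw [hX2, Tile.append_iff] at hX3
    obtain ⟨m, hm, hm1, hm2⟩ := hX3
    have hm2 : m + (d.cell σ c .U z).len = q := hm2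
    have := hlen z (.inl hzX)
    rw [hz, Option.some_inj]
    -- The last interval before the cut and the first half of the split node both end at `q`, so
    -- both contain `q - 1`.
    refine hX'.unique (f := q - 1) hzX hlX ?_ ?_ ?_ ?_
    · omega
    · omega
    · omega
    · omega
  | none =>
    refine .inr ?_
    cases hYh : Y.head? with
    | none =>
      refine .inl ⟨rfl, rfl, ?_, hX0⟩
      rw [List.head?_eq_none_iff] at hYh
      subst hYh
      have : q = S.length := hY
      by_contra hne
      obtain ⟨z, Y', rfl⟩ := List.exists_cons_of_ne_nil hne
      have h1 := hY'.bounds (y := z) (by simp)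
      have h2 := hlen z (by simp)
      omega
    | some w =>
      refine .inr ⟨rfl, w, rfl, ?_⟩
      have h0 := hoff hsp w hYh
      obtain ⟨Y₀, rfl⟩ : ∃ Y₀, Y = w :: Y₀ := by
        cases Y with
        | nil => simp at hYh
        | cons y Y => exact ⟨Y, by simpa using hYh⟩
      have hw : w ∈ l .V := by rw [hV]; simp
      obtain ⟨hh1, hh2, hh3⟩ := h.holds.head .V w hw
      have hz := h.redir_loc c .U (e := ((σ.mem .V w).head, (σ.mem .V w).off)) hh1 hh2 hh3
      -- Without a split, redirection can only rename `ui` to `a`, which is the test made by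
      -- `insertNode`; the label `0` says that the repetition begins at `q`.
      have hzz : (d.redir .U ((σ.mem .V w).head, (σ.mem .V w).off)) =
          (if (σ.mem .V w).head = d.ui then d.a else (σ.mem .V w).head, 0) := by
        unfold redir redirect
        rw [hsp, h0]
        change (if (σ.mem .V w).head = d.ui then _ else _) = _
        split_ifs <;> rfl
      rw [hzz] at hz
      generalize (if (σ.mem .V w).head = d.ui then d.a else (σ.mem .V w).head) = z at hz
      obtain ⟨hz1, hz2, hz3⟩ := hz
      rw [npos_of_ne fun e => h.new_not_mem_refine .U (e ▸ hz1)] at hz2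
      have hrz : d.rpos pos .U z = q := by
        have e1 : pos .V w = q := hY.1
        rw [e1] at hz2
        simp only [shiftAt] at hz2
        split_ifs at hz2 <;> omega
      rw [he] at hz1
      have hl := hlen z (List.mem_append.1 hz1)
      have hzY : z ∈ Y' := by
        rcases List.mem_append.1 hz1 with hz | hz
        · have := (hX'.bounds hz).2
          simp only at this
          omega
        · exact hz
      obtain ⟨y, Y₁, rfl⟩ : ∃ y Y₁, Y' = y :: Y₁ :=
        List.exists_cons_of_ne_nil (List.ne_nil_of_mem hzY)
      have hl' := hlen y (by simp)
      have hy : d.rpos pos .U y = q := hY'.1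
      rw [List.head?_cons, Option.some_inj]
      exact hY'.unique (f := q) (by simp) hzY (by omega) (by omega) (by omega)
        (by omega)

/-- On the side of `V` the node put in front takes over the place of `vi`, which was the first of
the list. So this step completes the replacement of `vi` by `d.x`, while `d.a`, placed earlier,
plays the part of the inserted node. -/
theorem tri_insertNode {c : A} {X Y : List ℕ} (hV : l .V = d.vi :: X ++ Y)
    (hX : Tile (fun y => (σ.mem .V y).len) (pos .V) 0 (d.vi :: X) q)
    (hY : Tile (fun y => (σ.mem .V y).len) (pos .V) q Y S.length)
    (hoff : d.sp = none → ∀ w, Y.head? = some w → (σ.mem .V w).off = 0)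
    {dl : ℕ} {σ₂ : Store A} {l₂ : Side → List ℕ} {N : ℕ → Option (A × ℕ)}
    (H : Relinked σ l d.x dl σ₂ l₂ fun _ => N)
    (hN : ∀ y, d.label σ c y = if y = d.x then some (⊥, 1) else N y)
    (ha : d.a < d.x) (hp : ∀ p, d.sp = some p → p.lo < d.x ∧ p.hi < d.x)
    (hU₂ : l₂ .U = (l .U).flatMap (d.refine .U))
    (hV₂ : l₂ .V = X.flatMap (d.refine .V) ++ d.a :: Y.flatMap (d.refine .V)) :
    Tri (insertNode d.ui d.a Y.head? d.sp) σ₂ fun r σ₃ n => r = d.x ∧ n ≤ 20 ∧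
      ∃ l', d.Created α S σ l pos q c σ₃ l' := by
  obtain ⟨X', Y', he, hX', hY', hcut⟩ := h.exists_splitU c hV hY hoff
  have hnodup := h.holds.nodup .V
  have hvi : d.vi ∉ X ++ Y := by
    rw [hV] at hnodup
    exact (List.nodup_cons.1 hnodup).1
  have href : d.refine .V d.vi = [d.x] := by
    unfold Upd.refine
    exact if_pos rfl
  have hVr : (l .V).flatMap (d.refine .V) =
      d.x :: X.flatMap (d.refine .V) ++ Y.flatMap (d.refine .V) := by
    rw [hV, List.flatMap_append, List.flatMap_cons, href]; rfl
  have hlt : ∀ s, ∀ z ∈ (l s).flatMap (d.refine s), z = d.x ∨ z < d.x := by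
    intro s z hz
    rcases h.mem_refine.1 hz with rfl | ⟨p, hsp, rfl | rfl⟩ | ⟨hz, -⟩
    · cases s
      · exact .inr ha
      · exact .inl rfl
    · exact .inr (hp p hsp).1
    · exact .inr (hp p hsp).2
    · exact .inr ((h.lt hz).trans_le h.fresh_x)
  -- The refined list already names `d.x` as the replacement of `vi`, although the node is created
  -- only now; the rest of the list has to avoid this address.
  have hxV : ∀ z ∈ X.flatMap (d.refine .V) ++ Y.flatMap (d.refine .V), z < d.x := by
    intro z hz
    rw [← List.flatMap_append] at hz
    obtain ⟨y, hy, hz⟩ := List.mem_flatMap.1 hz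
    have hyl : y ∈ l .V := by
      rw [hV, List.cons_append]; exact List.mem_cons_of_mem _ hy
    have hne : y ≠ d.old .V := fun e => hvi (by rw [e] at hy; exact hy)
    unfold Upd.refine at hz
    rw [if_neg hne] at hz
    have := (h.lt hyl).trans_le h.fresh_x
    cases hsp : d.sp with
    | none =>
      simp only [hsp, List.mem_singleton] at hz
      omega
    | some p =>
      have := hp p hsp
      simp only [hsp] at hz
      split_ifs at hz <;> simp only [List.mem_cons, List.not_mem_nil, or_false] at hz <;> omega
  have hfr : ∀ s, ∀ y ∈ l₂ s, y < d.x := by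
    intro s z hz
    cases s
    · rw [hU₂] at hz
      rcases hlt .U z hz with rfl | hz'
      · exact absurd hz (h.new_not_mem_refine .U)
      · exact hz'
    · rw [hV₂] at hz
      rcases List.mem_append.1 hz with hz | hz
      · exact hxV z (by simp only [List.mem_append]; exact .inl hz)
      · rcases List.mem_cons.1 hz with rfl | hz
        · exact ha
        · exact hxV z (by simp only [List.mem_append]; exact .inr hz)
  have hU' : l₂ .U = X' ++ Y' := by rw [hU₂, he]
  have hcut' : (∃ p, d.sp = some p ∧ X'.getLast? = some p.lo) ∨
      (d.sp = none ∧ Y.head? = none ∧ Y' = [] ∧ X' ≠ []) ∨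
      (d.sp = none ∧ ∃ w, Y.head? = some w ∧ Y'.head? =
        some (if (σ₂.mem .V w).head = d.ui then d.a else (σ₂.mem .V w).head)) := by
    refine hcut.imp id (Or.imp id ?_)
    rintro ⟨h1, w, hw, h2⟩
    refine ⟨h1, w, hw, ?_⟩
    have hwl : w ∈ l .V := by
      rw [hV, List.mem_append]; exact .inr (List.mem_of_mem_head? hw)
    have hNw : N w = none := by
      have h1 := hN w
      rw [h.label_kept c (h.lt hwl), if_neg (show w ≠ d.x from h.ne_rep .V hwl)] at h1
      exact h1.symm
    have := congrArg Cell.head (H.mem_body (s := .V) hNw)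
    rw [show (σ₂.mem .V w).head = (σ.mem .V w).head from this]
    exact h2
  refine (_root_.tri_insertNode H hfr hU' (by rw [hV₂]; simp) hcut').mono ?_
  rintro r σ₃ n ⟨rfl, hn, H3⟩
  refine ⟨rfl, hn, Side.pick (X' ++ d.x :: Y') (d.x :: l₂ .V), h, ⟨d.x + 1, ?_, ?_, ?_⟩, ?_⟩
  · exact h.fresh_x.trans (Nat.le_succ _)
  · intro y hy
    refine label_lt c ?_ ?_ ?_ hy
    · omega
    · omega
    · intro p hsp
      have := hp p hsp
      omega
  · rw [show (fun _ : Side => d.label σ c) = fun _ y => if y = d.x then some (⊥, 1) else N y from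
      funext fun _ => funext hN]
    exact H3
  · intro s
    cases s
    · exact ⟨X', Y', rfl, he.symm, hX', hY'⟩
    · refine ⟨d.x :: X.flatMap (d.refine .V), Y.flatMap (d.refine .V), ?_, hVr.symm, ?_, ?_⟩
      · change d.x :: l₂ .V = _
        rw [hV₂]; rfl
      · have := h.tile_refine c .V hX fun y hy => by
          rw [hV]; exact List.mem_append_left _ hy
        rwa [List.flatMap_cons, href] at this
      · exact h.tile_refine c .V hY fun y hy => by rw [hV]; exact List.mem_append_right _ hy

end Upd.Ctx

section

variable {α : ℕ} {S : List A} {σ : Store A} {l : Side → List ℕ} {pos : Side → ℕ → ℕ}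
  (h : AHolds α S σ l pos)

include h

/-- The fields of `Upd.Ctx` that concern the replaced nodes. -/
theorem AHolds.dollar_partner (hS : EndMarked S) {c : A} {q : ℕ} (hq : BwtStep S c q) :
    (σ.mem .U σ.dollar).lf ∈ l .V ∧ (σ.mem .V (σ.mem .U σ.dollar).lf).lf = σ.dollar ∧
    (σ.mem .V (σ.mem .U σ.dollar).lf).len = 1 ∧ pos .V (σ.mem .U σ.dollar).lf = 0 :=
  ⟨h.lf_mem .U _ h.dollar.1, h.lf_lf .U _ h.dollar.1,
    (h.len_lf .U _ h.dollar.1).trans (h.dollar_len hS), h.pos_partner hq⟩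

/-- The rest of the operation enters as a continuation `k`, because the data `d` of the update are
known only when the three steps have returned their addresses. -/
theorem AHolds.tri_create (hS : EndMarked S) {c : A} (hc : c ≠ ⊥) {q : ℕ} (hq : BwtStep S c q)
    {ht : ℕ} {P : Entry A → Prop} (hT : TreeInv σ ht P) {β : Type}
    {k : ℕ → Option Split → ℕ → Prog A β} {Φ : β → Store A → ℕ → Prop}
    (hk : ∀ (d : Upd) (σ' : Store A) (l' : Side → List ℕ) (n : ℕ),
      d.Created α S σ l pos q c σ' l' → d.ui = σ.dollar → d.vi = (σ.mem .U σ.dollar).lf →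
      n ≤ 4 * ht + 85 → Tri (k d.a d.sp d.x) σ' fun b σ'' m => Φ b σ'' (n + m)) :
    Tri (do
      let r ← replaceNode c σ.dollar (σ.mem .U σ.dollar).lf
      let sp ← splitNode r.2
      let x ← insertNode σ.dollar r.1 r.2 sp
      k r.1 sp x) σ Φ := by
  obtain ⟨hvm, hvlf, hvlen, hvpos⟩ := h.dollar_partner hS hq
  obtain ⟨X, Y, hV, hX, hY, hkey⟩ := h.exists_splitV hS hc hq
  obtain ⟨M₁, M₂, hU⟩ := List.append_of_mem h.dollar.1
  have hulen := h.dollar_len hS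
  have hdol := h.dollar.1
  have hcutV : ∀ y ∈ l .V, pos .V y < q → pos .V y + (σ.mem .V y).len ≤ q :=
    fun y hy => h.cutV hS hc hq hy
  obtain ⟨ui, hui⟩ : ∃ ui, σ.dollar = ui := ⟨_, rfl⟩
  obtain ⟨vi, hvi⟩ : ∃ vi, (σ.mem .U σ.dollar).lf = vi := ⟨_, rfl⟩
  rw [hvi] at hvm hvlf hvlen hvpos hV hX hkey hk ⊢
  rw [hui] at hk hkey hU hulen hdol hvi hvlf ⊢
  have hnU := h.nodup .U
  have hnV := h.nodup .V
  have huiM : ∀ y ∈ M₁ ++ M₂, y ≠ ui := by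
    rw [hU] at hnU
    rintro y hy rfl
    exact (List.nodup_cons.1 (List.perm_middle.nodup_iff.1 hnU)).1 hy
  have hviM : ∀ y ∈ X ++ Y, y ≠ vi := by
    rw [hV] at hnV
    rintro y hy rfl
    exact (List.nodup_cons.1 hnV).1 hy
  have hXY : ∀ y ∈ X ++ Y, y ∈ l .V := fun y hy => by
    rw [hV, List.cons_append]; exact List.mem_cons_of_mem _ hy
  have hM : ∀ y ∈ M₁ ++ M₂, y ∈ l .U := fun y hy => by
    rw [hU]; simp only [List.mem_append, List.mem_cons] at hy ⊢; tauto
  refine Tri.bind (tri_replaceNode h hT hU hV hkey) ?_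
  rintro r σ₁ n₁ ⟨rfl, H1, hn₁⟩
  simp only
  have hwY : ∀ w, Y.head? = some w → w ∈ l .V := fun w hw =>
    hXY w (List.mem_append_right _ (List.mem_of_mem_head? hw))
  have hwq : ∀ w, Y.head? = some w → pos .V w = q := by
    intro w hw
    cases Y with
    | nil => simp at hw
    | cons y Y =>
      obtain rfl : y = w := by simpa using hw
      exact hY.1
  -- `ui` has length one, so an edge into it has label `0` and `ui` is never split.
  have hujne : ∀ w, Y.head? = some w → (σ.mem .V w).off ≠ 0 → (σ.mem .V w).head ≠ ui := by
    intro w hw h0 e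
    have := (h.head .V w (hwY w hw)).2.2
    change _ < (σ.mem .U (σ.mem .V w).head).len at this
    rw [e, hulen] at this
    omega
  have hvjne : ∀ w, Y.head? = some w → (σ.mem .V w).off ≠ 0 →
      (σ.mem .U (σ.mem .V w).head).lf ≠ vi := by
    intro w hw h0 e
    have := h.lf_lf .U _ (h.head .V w (hwY w hw)).1
    change (σ.mem .V (σ.mem .U (σ.mem .V w).head).lf).lf = _ at this
    rw [e, hvlf] at this
    exact hujne w hw h0 this.symm
  refine Tri.bind (tri_splitNode h H1 (fun y hy => if_neg (by omega)) ?_ hwY ?_) ?_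
  · rintro (_ | _) y hy
    · rcases (List.perm_middle.mem_iff.1 hy : y ∈ σ.fresh :: (M₁ ++ M₂)) with _ | ⟨_, hy⟩
      · omega
      · have := h.lt_fresh .U y (hM y hy)
        omega
    · rcases (List.perm_middle.mem_iff.1 hy : y ∈ σ.fresh :: (X ++ Y)) with _ | ⟨_, hy⟩
      · omega
      · have := h.lt_fresh .V y (hXY y hy)
        omega
  · intro w hw h0
    have h1 : (σ.mem .V w).head ∈ l .U := (h.head .V w (hwY w hw)).1
    have h2 : (σ.mem .U (σ.mem .V w).head).lf ∈ l .V := h.lf_mem .U _ h1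
    have h3 := hujne w hw h0
    have h4 := hvjne w hw h0
    rw [hU] at h1
    rw [hV] at h2
    simp only [List.mem_append, List.mem_cons, List.cons_append] at h1 h2
    constructor
    · change _ ∈ M₁ ++ σ.fresh :: M₂
      simp only [List.mem_append, List.mem_cons]
      tauto
    · change _ ∈ X ++ σ.fresh :: Y
      simp only [List.mem_append, List.mem_cons]
      tauto
  rintro sp σ₂ n₂ ⟨hn₂, ⟨rfl, rfl, hoff⟩ | ⟨w, p, hw, rfl, hp, h0, H2⟩⟩
  · have hctx : Upd.Ctx ⟨ui, vi, σ.fresh, σ.fresh + 1, none⟩ α S σ l pos q := by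
      constructor
      case holds => exact h
      case old_mem => rintro (_ | _); exacts [hdol, hvm]
      case old_lf => rintro (_ | _); exacts [hvi, hvlf]
      case old_len => rintro (_ | _); exacts [hulen, hvlen]
      case pos_vi => exact hvpos
      case q_pos => exact hq.q_pos
      case q_le => exact hq.q_le
      case fresh_a => exact le_rfl
      case fresh_x => exact Nat.le_succ _
      case a_ne_x => exact (Nat.succ_ne_self _).symm
      case cutV => exact hcutV
      case cutU =>
        intro _ y hy hlt
        by_contra hgt
        -- Without a split, either `q` is the number of rows or some repetition begins at `q`; in
        -- neither case can a repetition straddle it.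
        cases hYh : Y.head? with
        | none =>
          rw [List.head?_eq_none_iff] at hYh
          subst hYh
          have : q = S.length := hY
          have := h.pos_lt hy
          omega
        | some w =>
          obtain ⟨h1, h2, h3⟩ := h.head .V w (hwY w hYh)
          rw [hwq w hYh, hoff w hYh] at h2
          rw [hoff w hYh] at h3
          have h2 : q = pos .U (σ.mem .V w).head + 0 := h2
          have h3 : 0 < (σ.mem .U (σ.mem .V w).head).len := h3
          have := (h.tile .U).unique (f := q) hy h1 hlt.le (by omega) (by omega) (by omega)
          rw [this] at hlt
          omega
      all_goals exact fun p hp => absurd hp (by simp)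
    refine Tri.bind (hctx.tri_insertNode (c := c) hV hX hY (fun _ => hoff) H1 ?_ ?_ ?_ ?_ ?_) ?_
    · intro y
      simp only [Upd.label]
      split_ifs <;> first | rfl | omega
    · exact Nat.lt_succ_self _
    · exact fun p hp => absurd hp (by simp)
    · rw [hU, List.flatMap_append, List.flatMap_cons]
      change M₁ ++ _ = _
      rw [flatMap_eq_self_of fun y hy => ?_, flatMap_eq_self_of fun y hy => ?_]
      · simp [Upd.refine, Upd.old, Upd.rep, Side.pick]
      · simp [Upd.refine, Upd.old, Side.pick, huiM y (List.mem_append_right _ hy)]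
      · simp [Upd.refine, Upd.old, Side.pick, huiM y (List.mem_append_left _ hy)]
    · change X ++ _ = _
      rw [flatMap_eq_self_of fun y hy => ?_, flatMap_eq_self_of fun y hy => ?_]
      · simp [Upd.refine, Upd.old, Side.pick, hviM y (List.mem_append_right _ hy)]
      · simp [Upd.refine, Upd.old, Side.pick, hviM y (List.mem_append_left _ hy)]
    · rintro x σ₃ n₃ ⟨rfl, hn₃, l', hcr⟩
      refine (hk _ _ l' (n₁ + n₂ + n₃) hcr rfl rfl (by omega)).mono ?_
      intro b σ'' m hΦ
      simpa only [add_assoc] using hΦ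
  · have hpu : p.uj = (σ.mem .V w).head := by rw [hp]
    have hpv : p.vj = (σ.mem .U (σ.mem .V w).head).lf := by rw [hp]
    have hpc : p.cut = (σ.mem .V w).off := by rw [hp]
    have hplo : p.lo = σ.fresh + 1 := by rw [hp]
    have hphi : p.hi = σ.fresh + 2 := by rw [hp]
    have hpg : p.gnext = w := by rw [hp]
    have hoj : ∀ s, p.oj s ≠ Side.pick ui vi s := by
      rintro (_ | _)
      · change p.uj ≠ ui; rw [hpu]; exact hujne w hw h0
      · change p.vj ≠ vi; rw [hpv]; exact hvjne w hw h0
    obtain ⟨g1, g2, g3⟩ := h.head .V w (hwY w hw)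
    have g1 : (σ.mem .V w).head ∈ l .U := g1
    have g2 : pos .V w = pos .U (σ.mem .V w).head + (σ.mem .V w).off := g2
    have g3 : (σ.mem .V w).off < (σ.mem .U (σ.mem .V w).head).len := g3
    have hctx : Upd.Ctx ⟨ui, vi, σ.fresh, σ.fresh + 1 + 2, some p⟩ α S σ l pos q := by
      constructor
      case holds => exact h
      case old_mem => rintro (_ | _); exacts [hdol, hvm]
      case old_lf => rintro (_ | _); exacts [hvi, hvlf]
      case old_len => rintro (_ | _); exacts [hulen, hvlen]
      case pos_vi => exact hvpos
      case q_pos => exact hq.q_pos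
      case q_le => exact hq.q_le
      case fresh_a => exact le_rfl
      case fresh_x => simp only; omega
      case a_ne_x => simp only; omega
      case cutV => exact hcutV
      case cutU => intro hp; cases hp
      all_goals
        intro p' hp'
        obtain rfl : p = p' := by simpa using hp'
      case oj_mem =>
        rintro (_ | _)
        · change p.uj ∈ _; rw [hpu]; exact g1
        · change p.vj ∈ _; rw [hpv]; exact h.lf_mem .U _ g1
      case oj_lf =>
        rintro (_ | _)
        · change (σ.mem .U p.uj).lf = p.vj; rw [hpu, hpv]
        · change (σ.mem .V p.vj).lf = p.uj; rw [hpu, hpv]; exact h.lf_lf .U _ g1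
      case oj_ne => exact hoj
      case cut_pos => omega
      case cut_lt =>
        rintro (_ | _)
        · change _ < (σ.mem .U p.uj).len; rw [hpu, hpc]; exact g3
        · change _ < (σ.mem .V p.vj).len
          rw [hpv, hpc]
          exact g3.trans_eq (h.len_lf .U _ g1).symm
      case cut_eq => rw [hpu, hpc, ← g2, hwq w hw]
      case fresh_lo => simp only; omega
      case fresh_hi => simp only; omega
      case lo_ne_hi => omega
      case gnext_mem => rw [hpg]; exact hwY w hw
      case gnext_pos => rw [hpg]; exact hwq w hw
    have e1 : ∀ s : Side, ∀ y, y ≠ Side.pick ui vi s →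
        Upd.refine ⟨ui, vi, σ.fresh, σ.fresh + 1 + 2, some p⟩ s y =
          splitAt (p.oj s) (σ.fresh + 1) (σ.fresh + 1 + 1) y := by
      intro s y hy
      simp only [Upd.refine, Upd.old, if_neg hy, splitAt, hplo, hphi]
    have e2 : ∀ s : Side, splitAt (p.oj s) (σ.fresh + 1) (σ.fresh + 1 + 1) σ.fresh = [σ.fresh] := by
      intro s
      refine if_neg fun e => ?_
      have := h.lt_fresh s _ (hctx.oj_mem p rfl s)
      omega
    refine Tri.bind (hctx.tri_insertNode (c := c) hV hX hY (fun e => by cases e) H2 ?_ ?_ ?_ ?_ ?_) ?_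
    · intro y
      simp only [Upd.label, hplo, hphi]
      split_ifs <;> first | rfl | omega
    · simp only; omega
    · intro p' hp'
      obtain rfl : p = p' := by simpa using hp'
      simp only; omega
    · change (M₁ ++ σ.fresh :: M₂).flatMap _ = _
      rw [hU, List.flatMap_append, List.flatMap_cons, List.flatMap_append, List.flatMap_cons, e2]
      congr 1
      · exact List.flatMap_congr fun y hy => (e1 .U y (huiM y (List.mem_append_left _ hy))).symm
      · congr 1
        · simp [Upd.refine, Upd.old, Upd.rep, Side.pick]
        · exact List.flatMap_congr fun y hy => (e1 .U y (huiM y (List.mem_append_right _ hy))).symm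
    · change (X ++ σ.fresh :: Y).flatMap _ = _
      rw [List.flatMap_append, List.flatMap_cons, e2]
      congr 1
      · exact List.flatMap_congr fun y hy => (e1 .V y (hviM y (List.mem_append_left _ hy))).symm
      · refine congrArg _ (List.flatMap_congr fun y hy => ?_)
        exact (e1 .V y (hviM y (List.mem_append_right _ hy))).symm
    · rintro x σ₃ n₃ ⟨rfl, hn₃, l', hcr⟩
      refine (hk _ _ l' (n₁ + n₂ + n₃) hcr rfl rfl (by omega)).mono ?_
      intro b σ'' m hΦ
      simpa only [add_assoc] using hΦ

end

end

section

variable {A : Type}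

/-! ### The directed edges -/

/-- The record without the data of the directed edges. -/
def Cell.core (c : Cell A) : Cell A := { c with head := 0, off := 0, inn := [] }

/-- The head and the label of the edge that starts at a node. -/
def Cell.edge (c : Cell A) : ℕ × ℕ := (c.head, c.off)

/-- The store `σ` arises from `σ₀` by changes of directed edges; `H` gives the heads and labels stored
at the tails, and the nodes outside `Rem` list those of their incoming edges whose tails are in
`R`. -/
structure EdgeInv (Rem : Side → ℕ → Prop) (σ₀ σ : Store A) (R : Side → ℕ → Prop)
    (H : Side → ℕ → ℕ × ℕ) : Prop where
  frame : σ = { σ₀ with mem := σ.mem }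
  core : ∀ s y, (σ.mem s y).core = (σ₀.mem s y).core
  edge : ∀ s y, (σ.mem s y).edge = H s y
  nodup : ∀ s y, ¬ Rem s y → (σ.mem s y).inn.Nodup
  inn : ∀ s y, ¬ Rem s.other y → ∀ x, x ∈ (σ.mem s.other y).inn ↔ R s x ∧ (H s x).1 = y

namespace EdgeInv

variable {Rem : Side → ℕ → Prop} {σ₀ σ : Store A} {R : Side → ℕ → Prop} {H : Side → ℕ → ℕ × ℕ}

/-- The head and label stored at the tail are not touched; the node just ceases to be registered in
`R`. -/
theorem tri_eraseIn (h : EdgeInv Rem σ₀ σ R H) {s : Side} {x z : ℕ} {m : ℕ}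
    (hz : (H s x).1 = z) (hm : (σ.mem s.other z).inn.length ≤ m) :
    Tri (eraseIn s.other z x) σ fun _ σ' n =>
      EdgeInv Rem σ₀ σ' (fun s' y => R s' y ∧ ¬ (s' = s ∧ y = x)) H ∧
      (∀ s' y, (σ'.mem s' y).inn.length ≤ (σ.mem s' y).inn.length) ∧ n ≤ m + 2 := by
  unfold eraseIn
  refine Tri.look_bind (Tri.tick_bind (Tri.change ⟨?_, ?_, by omega⟩))
  · constructor
    case frame => rw [h.frame]; rfl
    case core =>
      intro s' y
      rw [← h.core]
      by_cases hy : s' = s.other ∧ y = z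
      · obtain ⟨rfl, rfl⟩ := hy
        rw [Store.upd_same]; rfl
      · rw [Store.upd_of_ne _ _ (by tauto)]
    case edge =>
      intro s' y
      rw [← h.edge]
      by_cases hy : s' = s.other ∧ y = z
      · obtain ⟨rfl, rfl⟩ := hy
        rw [Store.upd_same]; rfl
      · rw [Store.upd_of_ne _ _ (by tauto)]
    case nodup =>
      intro s' y hr
      by_cases hy : s' = s.other ∧ y = z
      · obtain ⟨rfl, rfl⟩ := hy
        rw [Store.upd_same]
        exact (h.nodup _ _ hr).erase _
      · rw [Store.upd_of_ne _ _ (by tauto)]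
        exact h.nodup _ _ hr
    case inn =>
      intro s' y hr x'
      by_cases hy : s'.other = s.other ∧ y = z
      · obtain ⟨hs, rfl⟩ := hy
        obtain rfl : s' = s := by simpa using congrArg Side.other hs
        rw [Store.upd_same]
        simp only
        rw [(h.nodup _ _ hr).mem_erase_iff, h.inn _ _ hr]
        tauto
      · rw [Store.upd_of_ne _ _ (by tauto), h.inn _ _ hr]
        constructor
        · rintro ⟨h1, h2⟩
          refine ⟨⟨h1, ?_⟩, h2⟩
          rintro ⟨rfl, rfl⟩
          exact hy ⟨rfl, h2.symm.trans hz⟩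
        · rintro ⟨⟨h1, -⟩, h2⟩
          exact ⟨h1, h2⟩
  · intro s' y
    by_cases hy : s' = s.other ∧ y = z
    · obtain ⟨rfl, rfl⟩ := hy
      rw [Store.upd_same]
      exact List.length_erase_le
    · rw [Store.upd_of_ne _ _ (by tauto)]

/-- If the tail is still registered, its former head has to be a removed node. Lists of removed
nodes are no longer maintained, so no stale entry is left behind in a list that matters. -/
theorem tri_addEdge (h : EdgeInv Rem σ₀ σ R H) {s : Side} {x : ℕ} {e : ℕ × ℕ}
    (he : ¬ Rem s.other e.1) (hx : R s x → Rem s.other (H s x).1) :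
    Tri (addEdge s x e) σ fun _ σ' n =>
      EdgeInv Rem σ₀ σ' (fun s' y => R s' y ∨ s' = s ∧ y = x)
        (fun s' y => if s' = s ∧ y = x then e else H s' y) ∧ n = 2 := by
  unfold addEdge
  refine Tri.change_bind (Tri.change ⟨?_, rfl⟩)
  have hso := s.other_ne
  -- the tail and the head lie on different sides
  have tail : ∀ f g : Cell A → Cell A, ((σ.upd s x f).upd s.other e.1 g).mem s x = f (σ.mem s x) := by
    intro f g
    rw [Store.upd_of_ne _ _ (.inl hso.symm), Store.upd_same]
  have hd : ∀ f g : Cell A → Cell A,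
      ((σ.upd s x f).upd s.other e.1 g).mem s.other e.1 = g (σ.mem s.other e.1) := by
    intro f g
    rw [Store.upd_same, Store.upd_of_ne _ _ (.inl hso)]
  have rest : ∀ (f g : Cell A → Cell A) (s' : Side) (y : ℕ), ¬ (s' = s ∧ y = x) →
      ¬ (s' = s.other ∧ y = e.1) → ((σ.upd s x f).upd s.other e.1 g).mem s' y = σ.mem s' y := by
    intro f g s' y h1 h2
    rw [Store.upd_of_ne _ _ (by tauto), Store.upd_of_ne _ _ (by tauto)]
  constructor
  case frame => rw [h.frame]; rfl
  case core =>
    intro s' y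
    rw [← h.core]
    by_cases h1 : s' = s ∧ y = x
    · obtain ⟨rfl, rfl⟩ := h1
      rw [tail]; rfl
    by_cases h2 : s' = s.other ∧ y = e.1
    · obtain ⟨rfl, rfl⟩ := h2
      rw [hd]; rfl
    rw [rest _ _ _ _ h1 h2]
  case edge =>
    intro s' y
    by_cases h1 : s' = s ∧ y = x
    · obtain ⟨rfl, rfl⟩ := h1
      rw [tail, if_pos ⟨rfl, rfl⟩]; rfl
    rw [if_neg h1, ← h.edge]
    by_cases h2 : s' = s.other ∧ y = e.1
    · obtain ⟨rfl, rfl⟩ := h2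
      rw [hd]; rfl
    rw [rest _ _ _ _ h1 h2]
  case nodup =>
    intro s' y hr
    by_cases h1 : s' = s ∧ y = x
    · obtain ⟨rfl, rfl⟩ := h1
      rw [tail]; exact h.nodup _ _ hr
    by_cases h2 : s' = s.other ∧ y = e.1
    · obtain ⟨rfl, rfl⟩ := h2
      rw [hd]
      refine List.nodup_cons.2 ⟨?_, h.nodup _ _ hr⟩
      rw [h.inn _ _ he]
      rintro ⟨h3, h4⟩
      exact he (h4 ▸ hx h3)
    rw [rest _ _ _ _ h1 h2]
    exact h.nodup _ _ hr
  case inn =>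
    intro s' y hr x'
    rcases s.eq_or_eq_other s' with rfl | rfl
    · by_cases h2 : y = e.1
      · subst h2
        rw [hd, List.mem_cons, h.inn _ _ hr]
        by_cases h3 : x' = x
        · simp [h3]
        · simp [h3]
      · rw [rest _ _ _ _ (by tauto) (by tauto), h.inn _ _ hr]
        by_cases h3 : x' = x
        · subst h3
          simp only [and_self, or_true, if_true, true_and]
          constructor
          · rintro ⟨h4, rfl⟩
            exact absurd (hx h4) hr
          · intro h4; exact absurd h4.symm h2
        · simp [h3]
    · rw [Side.other_other] at hr ⊢
      have hinn : (((σ.upd s x fun d => { d with head := e.1, off := e.2 }).upd s.other e.1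
          fun d => { d with inn := x :: d.inn }).mem s y).inn = (σ.mem s y).inn := by
        by_cases h1 : y = x
        · subst h1; rw [tail]
        · rw [rest _ _ _ _ (by tauto) (fun h => hso h.1.symm)]
      have := h.inn s.other y (by rwa [Side.other_other]) x'
      rw [Side.other_other] at this
      rw [hinn, this]
      simp [hso]

theorem congr {R' : Side → ℕ → Prop} {H' : Side → ℕ → ℕ × ℕ} (h : EdgeInv Rem σ₀ σ R H)
    (hR : ∀ s y, R' s y ↔ R s y) (hH : ∀ s y, H' s y = H s y) : EdgeInv Rem σ₀ σ R' H' := by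
  obtain rfl : R' = R := funext fun s => funext fun y => propext (hR s y)
  obtain rfl : H' = H := funext fun s => funext fun y => hH s y
  exact h

/-- The list is a snapshot taken before the erasures and may still contain removed tails, which are
skipped. As it has no duplicates, each edge is redirected only once. -/
theorem tri_redirectTails {s : Side} {removed : ℕ → Bool} {f : ℕ × ℕ → ℕ × ℕ}
    (hrem : ∀ x, removed x = true ↔ Rem s x) (hf : ∀ e, ¬ Rem s.other (f e).1) {L : List ℕ}
    (h : EdgeInv Rem σ₀ σ R H) (hn : L.Nodup)
    (hL : ∀ x ∈ L, ¬ Rem s x → R s x ∧ Rem s.other (H s x).1) {H' : Side → ℕ → ℕ × ℕ}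
    (hH : ∀ y ∈ L, ¬ Rem s y → H' s y = f (H s y))
    (hH' : ∀ s' y, ¬ (s' = s ∧ y ∈ L ∧ ¬ Rem s y) → H' s' y = H s' y) :
    Tri (redirectTails s removed f L) σ fun _ σ' n =>
      EdgeInv Rem σ₀ σ' R H' ∧ n ≤ 3 * L.length := by
  induction L generalizing σ H with
  | nil =>
    unfold redirectTails
    exact Tri.pure ⟨h.congr (fun _ _ => Iff.rfl) fun s' y => hH' s' y (by simp), by simp⟩
  | cons x L ih =>
    rw [List.nodup_cons] at hn
    unfold redirectTails
    refine Tri.look_bind ?_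
    by_cases hx : Rem s x
    · rw [if_pos ((hrem x).2 hx)]
      refine (ih h hn.2 (fun y hy => hL y (List.mem_cons_of_mem _ hy))
        (fun y hy => hH y (List.mem_cons_of_mem _ hy)) ?_).mono ?_
      · intro s' y hy
        refine hH' s' y ?_
        rintro ⟨rfl, hy1, hy2⟩
        rcases List.mem_cons.1 hy1 with rfl | hy1
        · exact hy2 hx
        · exact hy ⟨rfl, hy1, hy2⟩
      · rintro _ σ' n ⟨h', hn'⟩
        exact ⟨h', by rw [List.length_cons]; omega⟩
    · rw [if_neg (by rw [hrem]; exact hx)]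
      obtain ⟨h1, h2⟩ := hL x (by simp) hx
      have he : ((σ.mem s x).head, (σ.mem s x).off) = H s x := h.edge s x
      rw [he]
      refine Tri.bind (h.tri_addEdge (hf _) fun _ => h2) ?_
      rintro _ σ' n ⟨h', rfl⟩
      have h' := h'.congr (R' := R) (H' := _) (fun s' y => by
        constructor
        · exact .inl
        · rintro (h5 | ⟨rfl, rfl⟩)
          · exact h5
          · exact h1) fun _ _ => rfl
      refine (ih h' hn.2 ?_ ?_ ?_).mono ?_
      · intro y hy hr
        have hyx : y ≠ x := fun e => hn.1 (e ▸ hy)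
        obtain ⟨h3, h4⟩ := hL y (List.mem_cons_of_mem _ hy) hr
        exact ⟨h3, by simpa [hyx] using h4⟩
      · intro y hy hr
        have hyx : y ≠ x := fun e => hn.1 (e ▸ hy)
        rw [hH y (List.mem_cons_of_mem _ hy) hr, if_neg (by tauto)]
      · intro s' y hy
        split_ifs with hc
        · obtain ⟨rfl, rfl⟩ := hc
          exact hH _ (by simp) hx
        · refine hH' s' y ?_
          rintro ⟨rfl, hy1, hy2⟩
          rcases List.mem_cons.1 hy1 with rfl | hy1
          · exact hc ⟨rfl, rfl⟩
          · exact hy ⟨rfl, hy1, hy2⟩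
      · rintro _ σ'' n ⟨h'', hn'⟩
        exact ⟨h'', by rw [List.length_cons]; omega⟩

end EdgeInv

section

variable [LinearOrder A] [OrderBot A]

namespace Upd

/-- The heads and labels of the edges before the update. -/
def edge₀ (d : Upd) (σ : Store A) (c : A) (s : Side) (y : ℕ) : ℕ × ℕ := (d.cell σ c s y).edge

open Classical in
/-- The heads and labels of the edges when those edges that point to nodes in `done` are
redirected. -/
noncomputable def moved (d : Upd) (σ : Store A) (l : Side → List ℕ) (c : A) (done : Side → ℕ → Prop)
    (s : Side) (y : ℕ) : ℕ × ℕ :=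
  if y ∈ l s ∧ ¬ d.Removed s y ∧ done s.other (d.edge₀ σ c s y).1 then
    d.redir s.other (d.edge₀ σ c s y) else d.edge₀ σ c s y

theorem isRemoved_iff (d : Upd) (s : Side) (x : ℕ) :
    isRemoved (d.old s) d.sp (Split.oj · s) x = true ↔ d.Removed s x := by
  unfold isRemoved Removed
  cases d.sp with
  | none => simp
  | some p => simp [@eq_comm _ (p.oj s)]

variable {d : Upd} {α : ℕ} {S : List A} {σ : Store A} {l : Side → List ℕ} {pos : Side → ℕ → ℕ}
  {q : ℕ} {c : A} {σ₁ : Store A} {l' : Side → List ℕ}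

theorem Ctx.edge₀_kept (h : d.Ctx α S σ l pos q) {s : Side} {y : ℕ} (hy : y ∈ l s) :
    d.edge₀ σ c s y = ((σ.mem s y).head, (σ.mem s y).off) := by
  rw [edge₀, h.cell_kept c s (h.lt hy)]; rfl

theorem Created.body (h : d.Created α S σ l pos q c σ₁ l') (s : Side) (y : ℕ) :
    (σ₁.mem s y).body = (d.cell σ c s y).body := by
  obtain ⟨fr, -, -, H⟩ := h.relinked
  exact H.body s y

theorem Created.body_kept (h : d.Created α S σ l pos q c σ₁ l') {s : Side} {y : ℕ} (hy : y ∈ l s) :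
    (σ₁.mem s y).body = (σ.mem s y).body := by
  rw [h.body, h.ctx.cell_kept c s (h.ctx.lt hy)]

theorem Ctx.cell_inn (h : d.Ctx α S σ l pos q) (s : Side) (y x : ℕ) :
    x ∈ (d.cell σ c s.other y).inn ↔ x ∈ l s ∧ (d.edge₀ σ c s x).1 = y := by
  by_cases hy : y ∈ l s.other
  · rw [h.cell_kept c _ (h.lt hy), h.holds.inn s y hy]
    refine and_congr_right fun hx => ?_
    rw [h.edge₀_kept hx]
  · have h1 : (d.cell σ c s.other y).inn = [] := by
      unfold cell
      cases d.label σ c y with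
      | none =>
        rw [Option.elim_none, h.holds.blank _ y hy]; rfl
      | some p => rfl
    rw [h1]
    simp only [List.not_mem_nil, false_iff, not_and]
    intro hx
    rw [h.edge₀_kept hx]
    rintro rfl
    exact hy (h.holds.head s x hx).1

/-- The creation of nodes has left the directed edges alone and the new nodes have none yet, so the
stored edges are still those of the old graph. -/
theorem Created.edgeInv (h : d.Created α S σ l pos q c σ₁ l') :
    EdgeInv d.Removed σ₁ σ₁ (fun s y => y ∈ l s) (d.edge₀ σ c) := by
  have hinn : ∀ s y, (σ₁.mem s y).inn = (d.cell σ c s y).inn := fun s y =>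
    (congrArg Cell.inn (h.body s y) :)
  constructor
  case frame => rfl
  case core => exact fun _ _ => rfl
  case edge =>
    intro s y
    exact (congrArg (fun c : Cell A => (c.head, c.off)) (h.body s y) :)
  case nodup =>
    intro s y _
    rw [hinn]
    by_cases hy : y ∈ l s
    · rw [h.ctx.cell_kept c s (h.ctx.lt hy)]
      exact h.ctx.holds.inn_nodup s y hy
    · unfold cell
      cases d.label σ c y with
      | none => rw [Option.elim_none, h.ctx.holds.blank s y hy]; exact List.nodup_nil
      | some p => exact List.nodup_nil
  case inn =>
    intro s y _ x
    rw [hinn, h.ctx.cell_inn]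

/-- Redirection of the edges that point to the removed node `y`. -/
theorem Ctx.tri_redirect (h : d.Ctx α S σ l pos q) {done : Side → ℕ → Prop} {σ₂ : Store A}
    {R : Side → ℕ → Prop} (hR : ∀ s x, x ∈ l s → ¬ d.Removed s x → R s x)
    (hI : EdgeInv d.Removed σ₁ σ₂ R (d.moved σ l c done)) {s : Side} {y : ℕ} (hy : y ∈ l s.other)
    (hrem : d.Removed s.other y) (hd : ¬ done s.other y) :
    Tri (redirectTails s (isRemoved (d.old s) d.sp (Split.oj · s)) (d.redir s.other)
      (σ.mem s.other y).inn) σ₂ fun _ σ₃ n =>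
      EdgeInv d.Removed σ₁ σ₃ R
        (d.moved σ l c fun s' z => done s' z ∨ s' = s.other ∧ z = y) ∧
      n ≤ 3 * (σ.mem s.other y).inn.length := by
  have hm : ∀ x ∈ (σ.mem s.other y).inn, x ∈ l s ∧ (d.edge₀ σ c s x).1 = y := by
    intro x hx
    obtain ⟨h1, h2⟩ := (h.holds.inn s y hy x).1 hx
    exact ⟨h1, by rw [h.edge₀_kept h1]; exact h2⟩
  -- The edges into `y` have not been processed yet, so their tails still carry the original data.
  have hmv : ∀ x ∈ (σ.mem s.other y).inn, d.moved σ l c done s x = d.edge₀ σ c s x := by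
    intro x hx
    unfold moved
    rw [if_neg]
    rw [(hm x hx).2]
    tauto
  refine hI.tri_redirectTails (d.isRemoved_iff s) (h.redir_not_removed s.other)
    (h.holds.inn_nodup _ y hy) ?_ ?_ ?_
  · intro x hx hr
    refine ⟨hR s x (hm x hx).1 hr, ?_⟩
    rw [hmv x hx, (hm x hx).2]
    exact hrem
  · intro x hx hr
    rw [hmv x hx]
    unfold moved
    rw [if_pos ⟨(hm x hx).1, hr, .inr ⟨rfl, (hm x hx).2⟩⟩]
  · intro s' x hx
    unfold moved
    congr 1
    simp only [eq_iff_iff]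
    refine and_congr_right fun h1 => and_congr_right fun h2 => ⟨?_, .inl⟩
    rintro (h3 | ⟨h3, h4⟩)
    · exact h3
    · obtain rfl : s' = s := by simpa using congrArg Side.other h3
      refine absurd ⟨rfl, ?_, h2⟩ hx
      rw [h.edge₀_kept h1] at h4
      exact (h.holds.inn s' y hy x).2 ⟨h1, h4⟩

end Upd

end

end

/-! ### Finding the cut and redirecting the edges. -/

section

variable {A : Type}

theorem tri_scanTails {σ : Store A} {cut : ℕ} {L : List ℕ}
    (hL : ∃ m ∈ L, (σ.mem .U m).off ≤ cut ∧ cut < (σ.mem .U m).off + (σ.mem .U m).len) :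
    Tri (scanTails cut L) σ fun r σ' n => σ' = σ ∧ n ≤ L.length ∧ r.1 ∈ L ∧
      (σ.mem .U r.1).off ≤ cut ∧ cut < (σ.mem .U r.1).off + (σ.mem .U r.1).len ∧
      r.2 = cut - (σ.mem .U r.1).off := by
  induction L with
  | nil => simp at hL
  | cons m L ih =>
    unfold scanTails
    refine Tri.look_bind ?_
    split_ifs with hm
    · exact Tri.pure ⟨rfl, by simp, by simp, hm.1, hm.2, rfl⟩
    · obtain ⟨m', hm', h1⟩ := hL
      rcases List.mem_cons.1 hm' with rfl | hm'
      · exact absurd h1 hm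
      · refine (ih ⟨m', hm', h1⟩).mono ?_
        rintro r σ' n ⟨rfl, hn, h2, h3⟩
        exact ⟨rfl, by rw [List.length_cons]; omega, by simp [h2], h3⟩

variable [LinearOrder A] [OrderBot A]

namespace Upd

variable {d : Upd} {α : ℕ} {S : List A} {σ : Store A} {l : Side → List ℕ} {pos : Side → ℕ → ℕ}
  {q : ℕ} {c : A} {σ₁ : Store A} {l' : Side → List ℕ}

/-- The nodes after the update. -/
def Live (d : Upd) (l : Side → List ℕ) (s : Side) (y : ℕ) : Prop :=
  y ∈ (l s).flatMap (d.refine s) ∨ y = d.new s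

/-- The pair `e` of a node of side `s` and a distance describes position `p` before the update. -/
def IsLoc (σ : Store A) (l : Side → List ℕ) (pos : Side → ℕ → ℕ) (s : Side) (p : ℕ) (e : ℕ × ℕ) :
    Prop :=
  e.1 ∈ l s ∧ p = pos s e.1 + e.2 ∧ e.2 < (σ.mem s e.1).len

theorem Ctx.isLoc_unique (h : d.Ctx α S σ l pos q) {s : Side} {p : ℕ} {e e' : ℕ × ℕ}
    (he : IsLoc σ l pos s p e) (he' : IsLoc σ l pos s p e') : e = e' := by
  obtain ⟨h1, h2, h3⟩ := he
  obtain ⟨h1', h2', h3'⟩ := he'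
  have : e.1 = e'.1 :=
    (h.holds.tile s).unique (f := p) h1 h1' (by omega) (by omega) (by omega) (by omega)
  refine Prod.ext this ?_
  rw [this] at h2
  omega

theorem Ctx.isLoc_edge (h : d.Ctx α S σ l pos q) {s : Side} {y : ℕ} (hy : y ∈ l s) :
    IsLoc σ l pos s.other (pos s y) (d.edge₀ σ c s y) := by
  rw [h.edge₀_kept hy]
  exact h.holds.head s y hy

/-- The repetition containing the cut of `v_j` either contains the start of `v_j` too, and is then
the head of its edge, or starts inside the F-interval of `v_j`, and is then among the tails listed
there. -/
theorem Created.tri_locateCut (h : d.Created α S σ l pos q c σ₁ l') {p : Split}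
    (hp : d.sp = some p) : Tri (locateCut p.vj p.cut) σ₁ fun r σ' n => σ' = σ₁ ∧
      n ≤ 2 + (σ.mem .V p.vj).inn.length ∧ IsLoc σ l pos .U (pos .V p.vj + p.cut) r := by
  have hvj : p.vj ∈ l .V := h.ctx.oj_mem p hp .V
  have hcut : p.cut < (σ.mem .V p.vj).len := h.ctx.cut_lt p hp .V
  obtain ⟨hh1, hh2, hh3⟩ := h.ctx.holds.head .V _ hvj
  have hh1 : (σ.mem .V p.vj).head ∈ l .U := hh1
  have hh2 : pos .V p.vj = pos .U (σ.mem .V p.vj).head + (σ.mem .V p.vj).off := hh2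
  have hh3 : (σ.mem .V p.vj).off < (σ.mem .U (σ.mem .V p.vj).head).len := hh3
  have hb := h.body_kept hvj
  have e1 : (σ₁.mem .V p.vj).head = (σ.mem .V p.vj).head := (congrArg Cell.head hb :)
  have e2 : (σ₁.mem .V p.vj).off = (σ.mem .V p.vj).off := (congrArg Cell.off hb :)
  have e3 : (σ₁.mem .V p.vj).inn = (σ.mem .V p.vj).inn := (congrArg Cell.inn hb :)
  have e4 : (σ₁.mem .U (σ.mem .V p.vj).head).len = (σ.mem .U (σ.mem .V p.vj).head).len :=
    (congrArg Cell.len (h.body_kept hh1) :)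
  have f1 : ∀ m ∈ l .U, (σ₁.mem .U m).off = (σ.mem .U m).off := fun m hm =>
    (congrArg Cell.off (h.body_kept hm) :)
  have f2 : ∀ m ∈ l .U, (σ₁.mem .U m).len = (σ.mem .U m).len := fun m hm =>
    (congrArg Cell.len (h.body_kept hm) :)
  unfold locateCut
  refine Tri.look_bind (Tri.look_bind ?_)
  rw [e1, e2, e3, e4]
  split_ifs with hlt
  · exact Tri.pure ⟨rfl, by omega, hh1, by simp only; omega, hlt⟩
  · have hinn := h.ctx.holds.inn .U p.vj hvj
    change ∀ x, x ∈ (σ.mem .V p.vj).inn ↔ _ at hinn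
    have hend := h.ctx.holds.pos_lt hvj
    obtain ⟨m, hm, hm1, hm2⟩ := (h.ctx.holds.tile .U).cover (f := pos .V p.vj + p.cut)
      (Nat.zero_le _) (by omega)
    have hgt : pos .V p.vj < pos .U m := by
      by_contra hle
      have := (h.ctx.holds.tile .U).unique (f := pos .V p.vj) hm hh1 (by omega) (by omega)
        (by omega) (by omega)
      rw [this] at hm2
      omega
    obtain ⟨g1, g2, g3⟩ := h.ctx.holds.head .U m hm
    have g2 : pos .U m = pos .V (σ.mem .U m).head + (σ.mem .U m).off := g2
    have g3 : (σ.mem .U m).off < (σ.mem .V (σ.mem .U m).head).len := g3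
    have hmh : (σ.mem .U m).head = p.vj :=
      (h.ctx.holds.tile .V).unique (f := pos .U m) g1 hvj (by omega) (by omega) (by omega) (by omega)
    rw [hmh] at g2
    refine (tri_scanTails ⟨m, (hinn m).2 ⟨hm, hmh⟩, ?_⟩).mono ?_
    · rw [f1 m hm, f2 m hm]
      omega
    · rintro r σ' n ⟨rfl, hn, r1, r2, r3, r4⟩
      obtain ⟨r5, r6⟩ := (hinn _).1 r1
      obtain ⟨-, k2, k3⟩ := h.ctx.holds.head .U _ r5
      have k2 : pos .U r.1 = pos .V (σ.mem .U r.1).head + (σ.mem .U r.1).off := k2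
      rw [r6] at k2
      rw [f1 _ r5] at r2 r3 r4
      rw [f2 _ r5] at r3
      exact ⟨rfl, by omega, r5, by omega, by omega⟩

/-- The edges after the update. -/
structure Edges (d : Upd) (σ : Store A) (l : Side → List ℕ) (pos : Side → ℕ → ℕ) (c : A)
    (H : Side → ℕ → ℕ × ℕ) : Prop where
  loc : ∀ s, ∀ y ∈ (l s).flatMap (d.refine s), ∃ e, IsLoc σ l pos s.other (d.rpos pos s y) e ∧
    H s y = d.redir s.other e
  new : ∀ s, H s (d.new s) = (d.new s.other, 0)
  rest : ∀ s y, y ∉ l s → d.label σ c y = none → H s y = d.edge₀ σ c s y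

open Classical in
-- An edge with a surviving head is fixed by redirection. So once all removed heads have been
-- processed, each surviving tail carries the redirected edge.
theorem Ctx.moved_removed (h : d.Ctx α S σ l pos q) {done : Side → ℕ → Prop}
    (hd : ∀ s y, d.Removed s y → done s y) {s : Side} {y : ℕ} (hy : y ∈ l s)
    (hr : ¬ d.Removed s y) :
    IsLoc σ l pos s.other (d.rpos pos s y) (d.edge₀ σ c s y) ∧
      d.moved σ l c done s y = d.redir s.other (d.edge₀ σ c s y) := by
  refine ⟨by rw [h.rpos_kept hy]; exact h.isLoc_edge hy, ?_⟩
  unfold moved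
  split_ifs with hc
  · rfl
  · refine (redir_of_not_removed _ fun hr' => hc ⟨hy, hr, hd _ _ hr'⟩).symm

theorem moved_of_notMem {done : Side → ℕ → Prop} {s : Side} {y : ℕ} (hy : y ∉ l s) :
    d.moved σ l c done s y = d.edge₀ σ c s y := by
  unfold moved
  rw [if_neg (by tauto)]

/-- Removal of the edge that starts at a removed node. -/
theorem Created.tri_erase (h : d.Created α S σ l pos q c σ₁ l')
    (hb : ∀ s, ∀ y ∈ l s, (σ.mem s y).inn.length < α) {σ₂ : Store A} {R : Side → ℕ → Prop}
    (hI : EdgeInv d.Removed σ₁ σ₂ R (d.edge₀ σ c))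
    (hlen : ∀ s y, (σ₂.mem s y).inn.length ≤ (σ₁.mem s y).inn.length) {s : Side} {x : ℕ}
    (hx : x ∈ l s) :
    Tri (eraseIn s.other (σ.mem s x).head x) σ₂ fun _ σ₃ n =>
      EdgeInv d.Removed σ₁ σ₃ (fun s' y => R s' y ∧ ¬ (s' = s ∧ y = x)) (d.edge₀ σ c) ∧
      (∀ s y, (σ₃.mem s y).inn.length ≤ (σ₁.mem s y).inn.length) ∧ n ≤ α + 2 := by
  have hm := (h.ctx.holds.head s x hx).1
  have h1 := hb _ _ hm
  have h2 := hlen s.other (σ.mem s x).head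
  have h3 : (σ₁.mem s.other (σ.mem s x).head).inn = (σ.mem s.other (σ.mem s x).head).inn :=
    (congrArg Cell.inn (h.body_kept hm) :)
  rw [h3] at h2
  refine (hI.tri_eraseIn (m := α) (by rw [h.ctx.edge₀_kept hx]) (by omega)).mono ?_
  rintro _ σ₃ n ⟨g1, g2, g3⟩
  exact ⟨g1, fun s y => (g2 s y).trans (hlen s y), g3⟩

/-- Creation of the edges that start at the new nodes not created by the split. -/
theorem Ctx.tri_addNew (h : d.Ctx α S σ l pos q) {σ₂ : Store A} {R : Side → ℕ → Prop}
    {H : Side → ℕ → ℕ × ℕ} (hI : EdgeInv d.Removed σ₁ σ₂ R H)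
    (hR : ∀ s y, R s y ↔ (y ∈ l s ∧ ¬ d.Removed s y) ∨ ∃ p, d.sp = some p ∧ (y = p.lo ∨ y = p.hi))
    (hH : ∀ s y, R s y → ∃ e, IsLoc σ l pos s.other (d.rpos pos s y) e ∧ H s y = d.redir s.other e)
    (hrest : ∀ s y, y ∉ l s → d.label σ c y = none → H s y = d.edge₀ σ c s y) :
    Tri (do
      addEdge .U d.a (d.redir .V (d.edge₀ σ c .U d.ui))
      addEdge .V d.a (d.x, 0)
      addEdge .U d.x (d.a, 0)
      addEdge .V d.x (d.redir .U (d.edge₀ σ c .V d.vi)) : Prog A Unit) σ₂ fun _ σ₃ n => n = 8 ∧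
      ∃ H', d.Edges σ l pos c H' ∧ EdgeInv d.Removed σ₁ σ₃ (d.Live l) H' := by
  have hax := h.a_ne_x
  have hRa : ∀ s, ¬ R s d.a := by
    intro s hr
    rcases (hR s _).1 hr with ⟨h1, -⟩ | ⟨p, hp, h1 | h1⟩
    · exact h.ne_rep .U h1 rfl
    · exact (h.fresh_lo p hp).2.1 h1.symm
    · exact (h.fresh_hi p hp).2.1 h1.symm
  have hRx : ∀ s, ¬ R s d.x := by
    intro s hr
    rcases (hR s _).1 hr with ⟨h1, -⟩ | ⟨p, hp, h1 | h1⟩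
    · exact h.ne_new .U h1 rfl
    · exact (h.fresh_lo p hp).2.2 h1.symm
    · exact (h.fresh_hi p hp).2.2 h1.symm
  refine Tri.bind (hI.tri_addEdge (h.redir_not_removed .V _) fun hr => absurd hr (hRa _)) ?_
  rintro _ σ₃ n₃ ⟨I3, rfl⟩
  refine Tri.bind (I3.tri_addEdge (s := .V) (h.new_not_removed .U) fun hr => ?_) ?_
  · rcases hr with hr | ⟨hr, -⟩
    · exact absurd hr (hRa _)
    · cases hr
  rintro _ σ₄ n₄ ⟨I4, rfl⟩
  refine Tri.bind (I4.tri_addEdge (s := .U) (h.new_not_removed .V) fun hr => ?_) ?_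
  · rcases hr with (hr | ⟨-, hr⟩) | ⟨-, hr⟩
    · exact absurd hr (hRx _)
    · exact absurd hr.symm hax
    · exact absurd hr.symm hax
  rintro _ σ₅ n₅ ⟨I5, rfl⟩
  refine (I5.tri_addEdge (s := .V) (h.redir_not_removed .U _) fun hr => ?_).mono ?_
  · rcases hr with ((hr | ⟨-, hr⟩) | ⟨-, hr⟩) | ⟨hr, -⟩
    · exact absurd hr (hRx _)
    · exact absurd hr.symm hax
    · exact absurd hr.symm hax
    · cases hr
  rintro _ σ₆ n₆ ⟨I6, rfl⟩
  refine ⟨rfl, _, ?_, I6.congr (fun s y => ?_) fun _ _ => rfl⟩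
  · constructor
    case loc =>
      intro s y hy
      have hy' := h.mem_refine.1 hy
      by_cases hyr : y = d.rep s
      · subst hyr
        refine ⟨d.edge₀ σ c s (d.old s), ?_, ?_⟩
        · rw [rpos_rep]; exact h.isLoc_edge (h.old_mem s)
        · cases s <;> simp [rep, old, Side.pick, hax, Side.other]
      · have hr : R s y := by rw [hR]; exact (hy'.resolve_left hyr).symm
        obtain ⟨e, he, h1⟩ := hH s y hr
        refine ⟨e, he, ?_⟩
        have h2 : y ≠ d.a := fun e => hRa s (e ▸ hr)
        have h3 : y ≠ d.x := fun e => hRx s (e ▸ hr)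
        simp [h2, h3, h1]
    case new =>
      intro s
      cases s <;> simp [new, Side.pick, hax, Side.other]
    case rest =>
      intro s y hy hl
      have h2 : y ≠ d.a := by rintro rfl; simp [label] at hl
      have h3 : y ≠ d.x := by rintro rfl; simp [label, hax.symm] at hl
      simp [h2, h3, hrest s y hy hl]
  · unfold Live
    rw [h.mem_refine, hR]
    generalize (∃ p, d.sp = some p ∧ (y = p.lo ∨ y = p.hi)) = E
    generalize (y ∈ l s ∧ ¬ d.Removed s y) = K
    cases s <;> simp only [rep, new, Side.pick, true_and, reduceCtorEq, false_and, or_false] <;>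
      tauto

set_option maxHeartbeats 1000000 in
-- The bound comes from at most four erasures of `α + 2` steps, four redirections of `3 * α` steps
-- and one scan of at most `α` tails. All old records, and the location of the cut, are read while
-- the old edges are still complete; this is why removed nodes are freed only at the very end.
theorem Created.tri_updateEdges (h : d.Created α S σ l pos q c σ₁ l')
    (hb : ∀ s, ∀ y ∈ l s, (σ.mem s y).inn.length < α) :
    Tri (updateEdges d.ui d.vi d.a d.x d.sp) σ₁ fun _ σ₂ n => n ≤ 17 * α + 40 ∧
      ∃ H, d.Edges σ l pos c H ∧ EdgeInv d.Removed σ₁ σ₂ (d.Live l) H := by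
  have hui : d.ui ∈ l .U := h.ctx.old_mem .U
  have hvi : d.vi ∈ l .V := h.ctx.old_mem .V
  have hbu := h.body_kept hui
  have hbv := h.body_kept hvi
  have huh : (σ₁.mem .U d.ui).head = (σ.mem .U d.ui).head := (congrArg Cell.head hbu :)
  have hvh : (σ₁.mem .V d.vi).head = (σ.mem .V d.vi).head := (congrArg Cell.head hbv :)
  have huo : (σ₁.mem .U d.ui).off = (σ.mem .U d.ui).off := (congrArg Cell.off hbu :)
  have hvo : (σ₁.mem .V d.vi).off = (σ.mem .V d.vi).off := (congrArg Cell.off hbv :)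
  have huin : (σ₁.mem .U d.ui).inn = (σ.mem .U d.ui).inn := (congrArg Cell.inn hbu :)
  have hvin : (σ₁.mem .V d.vi).inn = (σ.mem .V d.vi).inn := (congrArg Cell.inn hbv :)
  have hlu := hb .U _ hui
  have hlv := hb .V _ hvi
  cases hsp : d.sp with
  | none =>
    unfold updateEdges
    simp only
    rw [← hsp]
    refine Tri.look_bind (Tri.look_bind ?_)
    rw [huh, hvh, huo, hvo, huin, hvin]
    refine Tri.bind (h.tri_erase hb h.edgeInv (fun _ _ => le_rfl) hui) ?_
    rintro _ σ₂ n₂ ⟨I2, L2, hn₂⟩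
    refine Tri.bind (h.tri_erase hb I2 L2 hvi) ?_
    rintro _ σ₃ n₃ ⟨I3, L3, hn₃⟩
    have I3 := I3.congr (R' := fun s y => y ∈ l s ∧ ¬ d.Removed s y)
      (H' := d.moved σ l c fun _ _ => False) (by
        intro s y
        cases s <;> simp [Removed, hsp, old, Side.pick]) (by simp [moved])
    refine Tri.bind (h.ctx.tri_redirect (s := .U) (fun _ _ h1 h2 => ⟨h1, h2⟩) I3 hvi (.inl rfl) id) ?_
    rintro _ σ₄ n₄ ⟨I4, hn₄⟩
    refine Tri.bind (h.ctx.tri_redirect (s := .V) (fun _ _ h1 h2 => ⟨h1, h2⟩) I4 hui (.inl rfl) ?_) ?_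
    · rintro (h1 | ⟨h1, -⟩)
      · exact h1
      · cases h1
    rintro _ σ₅ n₅ ⟨I5, hn₅⟩
    rw [show (((σ.mem .U d.ui).head, (σ.mem .U d.ui).off) : ℕ × ℕ) = d.edge₀ σ c .U d.ui from
      (h.ctx.edge₀_kept hui).symm,
      show (((σ.mem .V d.vi).head, (σ.mem .V d.vi).off) : ℕ × ℕ) = d.edge₀ σ c .V d.vi from
      (h.ctx.edge₀_kept hvi).symm]
    refine (h.ctx.tri_addNew I5 (fun s y => ?_) (fun s y hy => ?_) fun s y hy _ => ?_).mono ?_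
    · simp [hsp]
    · exact ⟨_, h.ctx.moved_removed (fun s y hr => by
        rcases hr with rfl | ⟨p, hp, -⟩
        · cases s
          · exact .inr ⟨rfl, rfl⟩
          · exact .inl (.inr ⟨rfl, rfl⟩)
        · rw [hsp] at hp; cases hp) hy.1 hy.2⟩
    · exact moved_of_notMem hy
    · rintro _ σ₆ n₆ ⟨rfl, hH⟩
      have hn₄ : n₄ ≤ 3 * (σ.mem .V d.vi).inn.length := hn₄
      have hn₅ : n₅ ≤ 3 * (σ.mem .U d.ui).inn.length := hn₅
      exact ⟨by omega, hH⟩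
  | some p =>
    have huj : p.uj ∈ l .U := h.ctx.oj_mem p hsp .U
    have hvj : p.vj ∈ l .V := h.ctx.oj_mem p hsp .V
    have hbuj := h.body_kept huj
    have hbvj := h.body_kept hvj
    have hujh : (σ₁.mem .U p.uj).head = (σ.mem .U p.uj).head := (congrArg Cell.head hbuj :)
    have hvjh : (σ₁.mem .V p.vj).head = (σ.mem .V p.vj).head := (congrArg Cell.head hbvj :)
    have hujo : (σ₁.mem .U p.uj).off = (σ.mem .U p.uj).off := (congrArg Cell.off hbuj :)
    have hvjo : (σ₁.mem .V p.vj).off = (σ.mem .V p.vj).off := (congrArg Cell.off hbvj :)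
    have hujin : (σ₁.mem .U p.uj).inn = (σ.mem .U p.uj).inn := (congrArg Cell.inn hbuj :)
    have hvjin : (σ₁.mem .V p.vj).inn = (σ.mem .V p.vj).inn := (congrArg Cell.inn hbvj :)
    have hluj := hb .U _ huj
    have hlvj := hb .V _ hvj
    have hnuj : p.uj ≠ d.ui := h.ctx.oj_ne p hsp .U
    have hnvj : p.vj ≠ d.vi := h.ctx.oj_ne p hsp .V
    have hloc := h.tri_locateCut hsp
    have hlh := h.ctx.lo_ne_hi p hsp
    unfold updateEdges
    simp only
    rw [← hsp]
    refine Tri.look_bind (Tri.look_bind (Tri.look_bind (Tri.look_bind ?_)))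
    refine Tri.bind hloc ?_
    rintro loc _ n₁ ⟨rfl, hn₁, hloc⟩
    rw [huh, hvh, huo, hvo, huin, hvin, hujh, hvjh, hujo, hvjo, hujin, hvjin]
    refine Tri.bind (h.tri_erase hb h.edgeInv (fun _ _ => le_rfl) hui) ?_
    rintro _ σ₂ n₂ ⟨I2, L2, hn₂⟩
    refine Tri.bind (h.tri_erase hb I2 L2 hvi) ?_
    rintro _ σ₃ n₃ ⟨I3, L3, hn₃⟩
    refine Tri.bind (h.tri_erase hb I3 L3 huj) ?_
    rintro _ σ₄ n₄ ⟨I4, L4, hn₄⟩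
    refine Tri.bind (h.tri_erase hb I4 L4 hvj) ?_
    rintro _ σ₅ n₅ ⟨I5, -, hn₅⟩
    have I5 := I5.congr (R' := fun s y => y ∈ l s ∧ ¬ d.Removed s y)
      (H' := d.moved σ l c fun _ _ => False) (by
        intro s y
        cases s <;> simp [Removed, hsp, old, Split.oj, Side.pick, and_assoc]) (by simp [moved])
    refine Tri.bind (h.ctx.tri_redirect (s := .U) (fun _ _ h1 h2 => ⟨h1, h2⟩) I5 hvi (.inl rfl) id) ?_
    rintro _ σ₆ n₆ ⟨I6, hn₆⟩
    refine Tri.bind (h.ctx.tri_redirect (s := .V) (fun _ _ h1 h2 => ⟨h1, h2⟩) I6 hui (.inl rfl) ?_) ?_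
    · rintro (h1 | ⟨h1, -⟩)
      · exact h1
      · cases h1
    rintro _ σ₇ n₇ ⟨I7, hn₇⟩
    refine Tri.bind (h.ctx.tri_redirect (s := .U) (fun _ _ h1 h2 => ⟨h1, h2⟩) I7 hvj
      (.inr ⟨p, hsp, rfl⟩) ?_) ?_
    · rintro ((h1 | ⟨-, h1⟩) | ⟨h1, -⟩)
      · exact h1
      · exact hnvj h1
      · cases h1
    rintro _ σ₈ n₈ ⟨I8, hn₈⟩
    refine Tri.bind (h.ctx.tri_redirect (s := .V) (fun _ _ h1 h2 => ⟨h1, h2⟩) I8 huj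
      (.inr ⟨p, hsp, rfl⟩) ?_) ?_
    · rintro (((h1 | ⟨h1, -⟩) | ⟨-, h1⟩) | ⟨h1, -⟩)
      · exact h1
      · cases h1
      · exact hnuj h1
      · cases h1
    rintro _ σ₉ n₉ ⟨I9, hn₉⟩
    -- The disjunction accumulates the processed heads in order; these four are all the removed
    -- nodes.
    have hdone : ∀ s y, d.Removed s y → ((((False ∨ s = Side.U.other ∧ y = d.vi) ∨
        s = Side.V.other ∧ y = d.ui) ∨ s = Side.U.other ∧ y = p.vj) ∨
        s = Side.V.other ∧ y = p.uj) := by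
      intro s y hr
      simp only [Removed, hsp, Option.some.injEq, exists_eq_left'] at hr
      rcases hr with rfl | rfl
      · cases s
        · exact .inl (.inl (.inr ⟨rfl, rfl⟩))
        · exact .inl (.inl (.inl (.inr ⟨rfl, rfl⟩)))
      · cases s
        · exact .inr ⟨rfl, rfl⟩
        · exact .inl (.inr ⟨rfl, rfl⟩)
    have hnl : ∀ s, p.lo ∉ l s := fun s hy => h.ctx.ne_lo hy hsp rfl
    have hnh : ∀ s, p.hi ∉ l s := fun s hy => h.ctx.ne_hi hy hsp rfl
    have hmv := fun s y => h.ctx.moved_removed (c := c) hdone (s := s) (y := y)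
    have hmv' := fun s y (hy : y ∉ l s) => moved_of_notMem (d := d) (σ := σ) (c := c)
      (done := fun s y => ((((False ∨ s = Side.U.other ∧ y = d.vi) ∨
        s = Side.V.other ∧ y = d.ui) ∨ s = Side.U.other ∧ y = p.vj) ∨
        s = Side.V.other ∧ y = p.uj)) hy
    generalize (d.moved σ l c fun s y => ((((False ∨ s = Side.U.other ∧ y = d.vi) ∨
        s = Side.V.other ∧ y = d.ui) ∨ s = Side.U.other ∧ y = p.vj) ∨
        s = Side.V.other ∧ y = p.uj)) = M at I9 hmv hmv'
    -- The second half of `u_j` begins at `q`, as does `gnext`, so its edge has label `0`. If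
    -- `gnext` is the split node, offset `0` lies before the cut and leads to `lo`. It is not `vi`,
    -- which begins at `0` whereas `1 ≤ q`.
    have hg : (if p.gnext = p.vj then p.lo else p.gnext, 0) = d.redir .V (p.gnext, 0) := by
      have h1 := h.ctx.gnext_pos p hsp
      have h2 := h.ctx.pos_vi
      have h3 := h.ctx.q_pos
      have h4 : p.gnext ≠ d.vi := by
        intro e
        rw [e] at h1
        omega
      unfold redir redirect
      rw [if_neg (show (p.gnext, 0).1 ≠ d.old .V from h4), hsp]
      simp only [h.ctx.cut_pos p hsp, if_true]
      change _ = if p.gnext = p.vj then _ else _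
      split_ifs <;> rfl
    rw [hg]
    rw [show (((σ.mem .U d.ui).head, (σ.mem .U d.ui).off) : ℕ × ℕ) = d.edge₀ σ c .U d.ui from
      (h.ctx.edge₀_kept hui).symm,
      show (((σ.mem .V d.vi).head, (σ.mem .V d.vi).off) : ℕ × ℕ) = d.edge₀ σ c .V d.vi from
      (h.ctx.edge₀_kept hvi).symm,
      show (((σ.mem .U p.uj).head, (σ.mem .U p.uj).off) : ℕ × ℕ) = d.edge₀ σ c .U p.uj from
      (h.ctx.edge₀_kept huj).symm,
      show (((σ.mem .V p.vj).head, (σ.mem .V p.vj).off) : ℕ × ℕ) = d.edge₀ σ c .V p.vj from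
      (h.ctx.edge₀_kept hvj).symm]
    refine Tri.bind (I9.tri_addEdge (h.ctx.redir_not_removed .V _) fun hr => absurd hr.1 (hnl _)) ?_
    rintro _ τ₁ m₁ ⟨J1, rfl⟩
    refine Tri.bind (J1.tri_addEdge (s := .U) (h.ctx.redir_not_removed .V _) fun hr => ?_) ?_
    · rcases hr with hr | ⟨-, hr⟩
      · exact absurd hr.1 (hnh _)
      · exact absurd hr.symm hlh
    rintro _ τ₂ m₂ ⟨J2, rfl⟩
    refine Tri.bind (J2.tri_addEdge (s := .V) (h.ctx.redir_not_removed .U _) fun hr => ?_) ?_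
    · rcases hr with (hr | ⟨hr, -⟩) | ⟨hr, -⟩
      · exact absurd hr.1 (hnl _)
      · cases hr
      · cases hr
    rintro _ τ₃ m₃ ⟨J3, rfl⟩
    refine Tri.bind (J3.tri_addEdge (s := .V) (h.ctx.redir_not_removed .U _) fun hr => ?_) ?_
    · rcases hr with ((hr | ⟨hr, -⟩) | ⟨hr, -⟩) | ⟨-, hr⟩
      · exact absurd hr.1 (hnh _)
      · cases hr
      · cases hr
      · exact absurd hr.symm hlh
    rintro _ τ₄ m₄ ⟨J4, rfl⟩
    refine (h.ctx.tri_addNew J4 (fun s y => ?_) (fun s y hy => ?_) fun s y hy hl => ?_).mono ?_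
    · simp only [hsp, Option.some.injEq, exists_eq_left']
      generalize (y ∈ l s ∧ ¬ d.Removed s y) = K
      cases s <;> simp only [true_and, reduceCtorEq, false_and, or_false, or_assoc]
    · by_cases h1 : y = p.lo
      · subst h1
        refine ⟨d.edge₀ σ c s (p.oj s), ?_, ?_⟩
        · rw [h.ctx.rpos_lo s hsp]; exact h.ctx.isLoc_edge (h.ctx.oj_mem p hsp s)
        · cases s <;> simp [hlh, Split.oj, Side.pick, Side.other] <;> rfl
      by_cases h2 : y = p.hi
      · subst h2
        cases s
        · refine ⟨(p.gnext, 0), ⟨h.ctx.gnext_mem p hsp, ?_, h.ctx.holds.len_pos .V _ (h.ctx.gnext_mem p hsp)⟩, ?_⟩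
          · rw [h.ctx.rpos_hi .U hsp]
            exact (h.ctx.cut_eq p hsp).trans (h.ctx.gnext_pos p hsp).symm
          · simp [Side.other]
        · refine ⟨loc, ?_, ?_⟩
          · rw [h.ctx.rpos_hi .V hsp]
            exact hloc
          · simp [Side.other]
            rfl
      · have hy : y ∈ l s ∧ ¬ d.Removed s y := by tauto
        refine ⟨_, (hmv s y hy.1 hy.2).1, ?_⟩
        simp [h1, h2, (hmv s y hy.1 hy.2).2]
    · have h1 : y ≠ p.lo := by
        rintro rfl
        simp [label, hsp, (h.ctx.fresh_lo p hsp).2] at hl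
      have h2 : y ≠ p.hi := by
        rintro rfl
        simp [label, hsp, (h.ctx.fresh_hi p hsp).2, hlh.symm] at hl
      simp [h1, h2, hmv' s y hy]
    · rintro _ τ₅ m₅ ⟨rfl, hH⟩
      have hn₆ : n₆ ≤ 3 * (σ.mem .V d.vi).inn.length := hn₆
      have hn₇ : n₇ ≤ 3 * (σ.mem .U d.ui).inn.length := hn₇
      have hn₈ : n₈ ≤ 3 * (σ.mem .V p.vj).inn.length := hn₈
      have hn₉ : n₉ ≤ 3 * (σ.mem .U p.uj).inn.length := hn₉
      exact ⟨by omega, hH⟩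

end Upd

end

/-! ### Partners, heads and in-degrees after the update. -/

section

variable {A : Type} [LinearOrder A] [OrderBot A]

namespace Upd

variable {d : Upd} {α : ℕ} {S : List A} {σ : Store A} {l : Side → List ℕ} {pos : Side → ℕ → ℕ}
  {q : ℕ} {c : A} {σ₁ : Store A} {l' : Side → List ℕ}

theorem label_ne_none {y : ℕ} : d.label σ c y ≠ none ↔
    y = d.a ∨ y = d.x ∨ ∃ p, d.sp = some p ∧ (y = p.lo ∨ y = p.hi) := by
  unfold label
  split_ifs with h1 h2
  · simp [h1]
  · simp [h2]
  · cases d.sp with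
    | none => simp [h1, h2]
    | some p =>
      simp only [Option.some.injEq, exists_eq_left', h1, h2, false_or]
      split_ifs with h3 h4 <;> simp [*]

/-- The node before the update that a node arises from. -/
def orig (d : Upd) (s : Side) (z : ℕ) : ℕ :=
  if z = d.rep s then d.old s
  else match d.sp with
    | none => z
    | some p => if z = p.lo ∨ z = p.hi then p.oj s else z

namespace Ctx

variable (h : d.Ctx α S σ l pos q)

include h

theorem live_iff {s : Side} {y : ℕ} :
    d.Live l s y ↔ d.label σ c y ≠ none ∨ y ∈ l s ∧ ¬ d.Removed s y := by
  unfold Live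
  rw [h.mem_refine, label_ne_none]
  generalize (∃ p, d.sp = some p ∧ (y = p.lo ∨ y = p.hi)) = E
  generalize (y ∈ l s ∧ ¬ d.Removed s y) = K
  cases s <;> simp only [rep, new, Side.pick] <;> tauto

theorem live_not_removed {s : Side} {y : ℕ} (hy : d.Live l s y) : ¬ d.Removed s y := by
  rcases hy with hy | rfl
  · rcases h.mem_refine.1 hy with rfl | ⟨p, hp, rfl | rfl⟩ | ⟨-, hr⟩
    · exact h.rep_not_removed s
    · exact h.lo_not_removed s hp
    · exact h.hi_not_removed s hp
    · exact hr
  · exact h.new_not_removed s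

/-- Partners of nodes after the update. -/
theorem cell_lf {s : Side} {y : ℕ} (hy : d.Live l s y) :
    d.Live l s.other (d.cell σ c s y).lf ∧
    (d.cell σ c s.other (d.cell σ c s y).lf).lf = y ∧
    (d.cell σ c s.other (d.cell σ c s y).lf).chr = (d.cell σ c s y).chr ∧
    (d.cell σ c s.other (d.cell σ c s y).lf).len = (d.cell σ c s y).len := by
  rcases (h.live_iff (c := c)).1 hy with hy | ⟨hy, hr⟩
  · obtain ⟨p, hp⟩ := Option.ne_none_iff_exists'.1 hy
    have e : ∀ s, d.cell σ c s y = newCell y p := fun s => by rw [cell, hp]; rfl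
    rw [e]
    change d.Live l s.other y ∧ _
    refine ⟨(h.live_iff (c := c)).2 (.inl hy), ?_⟩
    change (d.cell σ c s.other y).lf = _ ∧ (d.cell σ c s.other y).chr = _ ∧
      (d.cell σ c s.other y).len = _
    rw [e]
    exact ⟨rfl, rfl, rfl⟩
  · have hm := h.holds.lf_mem s y hy
    have hlf := h.holds.lf_lf s y hy
    rw [h.cell_kept c s (h.lt hy), h.cell_kept c _ (h.lt hm)]
    refine ⟨(h.live_iff (c := c)).2 (.inr ⟨hm, ?_⟩), hlf, h.holds.chr_lf s y hy,
      h.holds.len_lf s y hy⟩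
    rintro (e | ⟨p, hp, e⟩)
    · rw [e, h.old_lf, Side.other_other] at hlf
      exact hr (.inl hlf.symm)
    · rw [e, h.oj_lf p hp, Side.other_other] at hlf
      exact hr (.inr ⟨p, hp, hlf.symm⟩)

theorem live_len_pos {s : Side} {y : ℕ} (hy : d.Live l s y) : 0 < (d.cell σ c s y).len := by
  rcases hy with hy | rfl
  · exact h.cell_len_pos c s hy
  · rw [h.cell_new_len]; exact Nat.one_pos

/-- The edges after the update point to the right places. -/
theorem edges_head {H : Side → ℕ → ℕ × ℕ} (hH : d.Edges σ l pos c H) {s : Side} {y : ℕ}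
    (hy : d.Live l s y) : d.Live l s.other (H s y).1 ∧
      d.npos pos q s y = d.npos pos q s.other (H s y).1 + (H s y).2 ∧
      (H s y).2 < (d.cell σ c s.other (H s y).1).len := by
  rcases hy with hy | rfl
  · obtain ⟨e, ⟨h1, h2, h3⟩, he⟩ := hH.loc s y hy
    obtain ⟨g1, g2, g3⟩ := h.redir_loc c s.other h1 h2 h3
    rw [he]
    refine ⟨.inl g1, ?_, g3⟩
    rw [npos_of_ne fun e0 => h.new_not_mem_refine s (e0 ▸ hy), g2]
  · rw [hH.new s]
    refine ⟨.inr rfl, ?_, ?_⟩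
    · rw [npos_new, npos_new]; rfl
    · rw [h.cell_new_len]; exact Nat.one_pos

theorem orig_kept {s : Side} {z : ℕ} (hz : z ∈ l s) : d.orig s z = z := by
  unfold orig
  rw [if_neg (h.ne_rep s hz)]
  cases hp : d.sp with
  | none => rfl
  | some p => simp [h.ne_lo hz hp, h.ne_hi hz hp]

omit h in
theorem orig_rep (s : Side) : d.orig s (d.rep s) = d.old s := by simp [orig]

theorem orig_split (s : Side) {p : Split} (hp : d.sp = some p) {z : ℕ} (hz : z = p.lo ∨ z = p.hi) :
    d.orig s z = p.oj s := by
  unfold orig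
  rw [if_neg, hp]
  · simp [hz]
  · rcases hz with rfl | rfl
    · exact h.lo_ne_rep s hp
    · exact h.hi_ne_rep s hp

theorem orig_redir (s : Side) {e : ℕ × ℕ} (he : e.1 ∈ l s) : d.orig s (d.redir s e).1 = e.1 := by
  unfold redir redirect
  split_ifs with h1
  · rw [orig_rep, h1]
  · cases hp : d.sp with
    | none => exact h.orig_kept he
    | some p =>
      simp only
      split_ifs with h2 h3
      · rw [h.orig_split s hp (.inl rfl), h2]
      · rw [h.orig_split s hp (.inr rfl), h2]
      · exact h.orig_kept he

theorem orig_mem {s : Side} {z : ℕ} (hz : z ∈ (l s).flatMap (d.refine s)) : d.orig s z ∈ l s := by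
  rcases h.mem_refine.1 hz with rfl | ⟨p, hp, hz⟩ | ⟨hz, -⟩
  · rw [orig_rep]; exact h.old_mem s
  · rw [h.orig_split s hp hz]; exact h.oj_mem p hp s
  · rw [h.orig_kept hz]; exact hz

/-- Only the second part of a split node starts at a new position. -/
theorem pos_orig {s : Side} {z : ℕ} (hz : z ∈ (l s).flatMap (d.refine s))
    (hh : ∀ p, d.sp = some p → z ≠ p.hi) : d.rpos pos s z = pos s (d.orig s z) := by
  rcases h.mem_refine.1 hz with rfl | ⟨p, hp, rfl | rfl⟩ | ⟨hz, -⟩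
  · rw [orig_rep, rpos_rep]
  · rw [h.orig_split s hp (.inl rfl), h.rpos_lo s hp]
  · exact absurd rfl (hh p hp)
  · rw [h.orig_kept hz, h.rpos_kept hz]

/-- Apart from `hi`, a piece begins where its original begins, so pieces with the same original
contain a common row and are equal. -/
theorem orig_inj {s : Side} {z z' : ℕ} (hz : z ∈ (l s).flatMap (d.refine s))
    (hz' : z' ∈ (l s).flatMap (d.refine s)) (hh : ∀ p, d.sp = some p → z ≠ p.hi)
    (hh' : ∀ p, d.sp = some p → z' ≠ p.hi) (he : d.orig s z = d.orig s z') : z = z' := by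
  have h1 := h.pos_orig hz hh
  have h2 := h.pos_orig hz' hh'
  have ht := h.tile_refine ⊥ s (h.holds.tile s) fun _ hy => hy
  have l1 := h.cell_len_pos ⊥ s hz
  have l2 := h.cell_len_pos ⊥ s hz'
  rw [he] at h1
  exact ht.unique (f := d.rpos pos s z) hz hz' le_rfl (by omega) (by omega) (by omega)

/-- Each tail is sent to the node it arose from. With `hi` left out this is injective and preserves
starting positions; a position lies in only one interval, so the images are old tails of the
original of `y`, of which there are fewer than `α`. -/
theorem inn_length_aux {H : Side → ℕ → ℕ × ℕ} (hH : d.Edges σ l pos c H)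
    (hb : ∀ s, ∀ y ∈ l s, (σ.mem s y).inn.length < α) {s : Side} {y : ℕ}
    (hy : y ∈ (l s.other).flatMap (d.refine s.other)) {L : List ℕ} (hn : L.Nodup)
    (hL : ∀ x ∈ L, d.Live l s x ∧ (H s x).1 = y) (hh : ∀ p, d.sp = some p → p.hi ∉ L) :
    L.length < α := by
  have hL' : ∀ x ∈ L, x ∈ (l s).flatMap (d.refine s) := by
    intro x hx
    obtain ⟨h1 | rfl, h2⟩ := hL x hx
    · exact h1
    · rw [hH.new] at h2
      exact absurd hy (h2 ▸ h.new_not_mem_refine s.other)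
  have hhi : ∀ x ∈ L, ∀ p, d.sp = some p → x ≠ p.hi := fun x hx p hp e => hh p hp (e ▸ hx)
  have hsub : (L.map (d.orig s)).Subperm (σ.mem s.other (d.orig s.other y)).inn := by
    refine List.subperm_of_subset (hn.map_on ?_) ?_
    · intro x hx x' hx'
      exact h.orig_inj (hL' x hx) (hL' x' hx') (hhi x hx) (hhi x' hx')
    · intro z hz
      obtain ⟨x, hx, rfl⟩ := List.mem_map.1 hz
      have hom := h.orig_mem (hL' x hx)
      rw [h.holds.inn s _ (h.orig_mem hy)]
      refine ⟨hom, ?_⟩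
      obtain ⟨e, he1, he2⟩ := hH.loc s x (hL' x hx)
      rw [h.pos_orig (hL' x hx) (hhi x hx)] at he1
      have := h.isLoc_unique he1 (h.isLoc_edge (c := c) hom)
      rw [h.edge₀_kept hom] at this
      rw [← (hL x hx).2, he2, h.orig_redir _ he1.1, this]
  have := hsub.length_le
  rw [List.length_map] at this
  exact this.trans_lt (hb _ _ (h.orig_mem hy))

/-- The in-degrees after the update. -/
theorem inn_length {H : Side → ℕ → ℕ × ℕ} (hH : d.Edges σ l pos c H) (hα : 2 ≤ α)
    (hb : ∀ s, ∀ y ∈ l s, (σ.mem s y).inn.length < α) {s : Side} {y : ℕ}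
    (hy : d.Live l s.other y) {L : List ℕ} (hn : L.Nodup)
    (hL : ∀ x ∈ L, d.Live l s x ∧ (H s x).1 = y) :
    L.length ≤ α ∧ (α ≤ L.length → ∃ p, d.sp = some p ∧ (H s p.hi).1 = y) := by
  rcases hy with hy | rfl
  -- Without `hi` the list has fewer than `α` entries, so `hi` alone can bring the in-degree up to
  -- `α`.
  · by_cases hh : ∃ p, d.sp = some p ∧ p.hi ∈ L
    · obtain ⟨p, hp, hm⟩ := hh
      refine ⟨?_, fun _ => ⟨p, hp, (hL _ hm).2⟩⟩
      have := h.inn_length_aux hH hb hy (hn.erase p.hi)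
        (fun x hx => hL x (List.mem_of_mem_erase hx)) fun p' hp' => by
          obtain rfl : p = p' := by rw [hp] at hp'; simpa using hp'
          exact hn.not_mem_erase
      have := List.length_erase_add_one hm
      omega
    · have := h.inn_length_aux hH hb hy hn hL fun p hp hm => hh ⟨p, hp, hm⟩
      omega
  -- The only tail pointing to an inserted node is the inserted node of the other side, since all
  -- other edges arise by redirection and point to pieces. By `2 ≤ α`, a single tail does not make
  -- it heavy.
  · have hsub : L.Subperm [d.new s] := by
      refine List.subperm_of_subset hn fun x hx => ?_
      obtain ⟨h1 | rfl, h2⟩ := hL x hx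
      · obtain ⟨e, he1, he2⟩ := hH.loc s x h1
        rw [he2] at h2
        exact absurd (h.redir_mem s.other he1.1 he1.2.2) (h2 ▸ h.new_not_mem_refine s.other)
      · simp
    have := hsub.length_le
    rw [List.length_singleton] at this
    omega

end Ctx

theorem Created.mem_iff (h : d.Created α S σ l pos q c σ₁ l') {s : Side} {y : ℕ} :
    y ∈ l' s ↔ d.Live l s y := by
  obtain ⟨X, Y, h1, h2, -⟩ := h.lists s
  rw [h1, Live, ← h2]
  simp only [List.mem_append, List.mem_cons]
  tauto

end Upd

end

section

/-! ### The order maintenance structure -/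

/-- Insert `x` after `y` in a list, using `List.flatMap`. -/
def insAfter (y x z : ℕ) : List ℕ := if z = y then [z, x] else [z]

theorem flatMap_insAfter {L₁ L₂ : List ℕ} {y x : ℕ} (hn : (L₁ ++ y :: L₂).Nodup) :
    (L₁ ++ y :: L₂).flatMap (insAfter y x) = L₁ ++ y :: x :: L₂ := by
  rw [List.nodup_append, List.nodup_cons] at hn
  rw [List.flatMap_append, List.flatMap_cons,
    flatMap_eq_self_of (g := insAfter y x) fun z hz => if_neg (hn.2.2 z hz y (by simp)),
    flatMap_eq_self_of (g := insAfter y x) fun z hz => if_neg (ne_of_mem_of_not_mem hz hn.2.1.1)]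
  simp [insAfter]

theorem sublist_flatMap_insAfter (L : List ℕ) (y x : ℕ) : L.Sublist (L.flatMap (insAfter y x)) := by
  induction L with
  | nil => exact List.Sublist.refl _
  | cons z L ih =>
    rw [List.flatMap_cons, insAfter]
    split_ifs
    · exact (ih.cons x).cons_cons z
    · exact ih.cons_cons z

theorem mem_flatMap_insAfter {L : List ℕ} {y x z : ℕ} (hy : y ∈ L) :
    z ∈ L.flatMap (insAfter y x) ↔ z = x ∨ z ∈ L := by
  rw [List.mem_flatMap]
  constructor
  · rintro ⟨w, hw, hz⟩
    unfold insAfter at hz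
    split_ifs at hz
    · simp only [List.mem_cons, List.not_mem_nil, or_false] at hz
      rcases hz with rfl | rfl
      · exact .inr hw
      · exact .inl rfl
    · rw [List.mem_singleton] at hz
      exact .inr (hz ▸ hw)
  · rintro (rfl | hz)
    · exact ⟨y, hy, by simp [insAfter]⟩
    · refine ⟨z, hz, ?_⟩
      unfold insAfter
      split_ifs <;> simp

theorem nodup_flatMap_insAfter {L : List ℕ} {y x : ℕ} (hn : L.Nodup) (hy : y ∈ L) (hx : x ∉ L) :
    (L.flatMap (insAfter y x)).Nodup := by
  obtain ⟨L₁, L₂, rfl⟩ := List.append_of_mem hy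
  rw [flatMap_insAfter hn]
  have e : L₁ ++ y :: x :: L₂ = (L₁ ++ [y]) ++ x :: L₂ := by simp
  rw [e, List.perm_middle.nodup_iff, List.nodup_cons]
  simpa using ⟨by simpa using hx, hn⟩

/-- The order of a sublist. -/
theorem idxOf_lt_iff_of_sublist {L M : List ℕ} (hs : L.Sublist M) (hM : M.Nodup) {x y : ℕ}
    (hx : x ∈ L) (hy : y ∈ L) : M.idxOf x < M.idxOf y ↔ L.idxOf x < L.idxOf y :=
  lt_iff_lt_of_pairwise ((pairwise_idxOf hM).sublist hs) (pairwise_idxOf (hM.sublist hs)) hx hy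

variable {A : Type}

theorem tri_omInsertAfter {σ : Store A} {y : ℕ} (x : ℕ) (hn : σ.om.Nodup) (hy : y ∈ σ.om) :
    Tri (omInsertAfter y x) σ fun _ σ' n =>
      σ' = { σ with om := σ.om.flatMap (insAfter y x) } ∧ n = 1 := by
  unfold omInsertAfter
  refine Tri.writeS ⟨?_, rfl⟩
  congr 1
  obtain ⟨L₁, L₂, e⟩ := List.append_of_mem hy
  rw [e] at hn ⊢
  rw [flatMap_insAfter hn]
  have h1 : y ∉ L₁ := fun h => (List.nodup_append.1 hn).2.2 y h y (by simp) rfl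
  rw [List.idxOf_append_of_notMem h1, List.idxOf_cons_self, add_zero]
  have e2 : L₁ ++ y :: L₂ = (L₁ ++ [y]) ++ L₂ := by simp
  have e3 : L₁ ++ y :: x :: L₂ = (L₁ ++ [y]) ++ x :: L₂ := by simp
  have e4 : L₁.length + 1 = (L₁ ++ [y]).length := by simp
  rw [e2, e3, e4]
  generalize L₁ ++ [y] = L
  induction L with
  | nil => simp
  | cons z L ih => simpa using ih

variable [LinearOrder A] [OrderBot A]

namespace Upd

variable {d : Upd} {α : ℕ} {S : List A} {σ : Store A} {l : Side → List ℕ} {pos : Side → ℕ → ℕ}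
  {q : ℕ} {c : A} {σ₁ : Store A} {l' : Side → List ℕ}

/-- The list `L` with the new nodes next to the nodes that they replace. -/
def extend (d : Upd) (L : List ℕ) : List ℕ :=
  match d.sp with
  | none => L.flatMap (insAfter d.ui d.a)
  | some p =>
    ((L.flatMap (insAfter d.ui d.a)).flatMap (insAfter p.uj p.lo)).flatMap (insAfter p.lo p.hi)

/-- Boolean version of `Upd.Removed`. -/
def keep (d : Upd) (y : ℕ) : Bool := !isRemoved (d.old .U) d.sp (Split.oj · .U) y

theorem keep_iff {y : ℕ} : d.keep y = true ↔ ¬ d.Removed .U y := by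
  rw [keep, ← d.isRemoved_iff]; simp

/-- Old nodes remain in the order structure beside their replacements while the tree is being
updated, so that old and new keys can be compared. Dropping them at the end leaves the refined list.
-/
theorem Ctx.extend_filter (h : d.Ctx α S σ l pos q) :
    (d.extend (l .U)).filter d.keep = (l .U).flatMap (d.refine .U) := by
  have hui := h.old_mem .U
  have ha : d.keep d.a = true := keep_iff.2 (h.rep_not_removed .U)
  have hold : d.keep d.ui = false := by
    rw [← Bool.not_eq_true, keep_iff, not_not]; exact .inl rfl
  cases hsp : d.sp with
  | none =>
    simp only [extend, hsp, List.filter_flatMap]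
    refine List.flatMap_congr fun y hy => ?_
    unfold insAfter Upd.refine
    change _ = if y = d.ui then [d.a] else _
    by_cases hy1 : y = d.ui
    · subst hy1; simp [ha, hold]
    · have : d.keep y = true := keep_iff.2 (by
        rintro (e | ⟨p, hp, -⟩)
        · exact hy1 e
        · rw [hsp] at hp; cases hp)
      simp [hy1, this, hsp]
  | some p =>
    have hlo : d.keep p.lo = true := keep_iff.2 (h.lo_not_removed .U hsp)
    have hhi : d.keep p.hi = true := keep_iff.2 (h.hi_not_removed .U hsp)
    have huj : d.keep p.uj = false := by
      rw [← Bool.not_eq_true, keep_iff, not_not]; exact .inr ⟨p, hsp, rfl⟩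
    have h1 : p.uj ≠ d.ui := h.oj_ne p hsp .U
    have h2 : d.a ≠ p.uj := (h.ne_rep .U (h.oj_mem p hsp .U)).symm
    have h3 : d.a ≠ p.lo := (h.lo_ne_rep .U hsp).symm
    have h4 : p.uj ≠ p.lo := h.ne_lo (h.oj_mem p hsp .U) hsp
    have h5 : d.ui ≠ p.lo := h.ne_lo hui hsp
    simp only [extend, hsp, List.flatMap_assoc, List.filter_flatMap]
    refine List.flatMap_congr fun y hy => ?_
    unfold insAfter Upd.refine
    have h6 := h.ne_lo hy hsp
    change _ = if y = d.ui then [d.a] else _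
    by_cases hy1 : y = d.ui
    · subst hy1; simp [ha, hold, h1.symm, h2, h3, h5]
    · by_cases hy2 : y = p.uj
      · subst hy2; simp [hlo, hhi, huj, h1, h4, hsp, Split.oj, Side.pick]
      · have : d.keep y = true := keep_iff.2 (by
          rintro (e | ⟨p', hp, e⟩)
          · exact hy1 e
          · obtain rfl : p = p' := by rw [hsp] at hp; simpa using hp
            exact hy2 e)
        simp [hy1, hy2, this, hsp, h6, Split.oj, Side.pick]

theorem Ctx.extend_spec (h : d.Ctx α S σ l pos q) :
    (d.extend (l .U)).Nodup ∧ (l .U).Sublist (d.extend (l .U)) ∧ d.x ∉ d.extend (l .U) := by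
  have hui : d.ui ∈ l .U := h.old_mem .U
  have ha : d.a ∉ l .U := fun hm => h.ne_rep .U hm rfl
  have hx : d.x ∉ l .U := fun hm => h.ne_new .U hm rfl
  have n1 := nodup_flatMap_insAfter (h.holds.nodup .U) hui ha
  have m1 : ∀ z, z ∈ (l .U).flatMap (insAfter d.ui d.a) ↔ z = d.a ∨ z ∈ l .U := fun z =>
    mem_flatMap_insAfter hui
  have s1 := sublist_flatMap_insAfter (l .U) d.ui d.a
  cases hsp : d.sp with
  | none =>
    simp only [extend, hsp]
    refine ⟨n1, s1, ?_⟩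
    rw [m1]
    exact fun e => e.elim h.a_ne_x.symm hx
  | some p =>
    have huj : p.uj ∈ (l .U).flatMap (insAfter d.ui d.a) := (m1 _).2 (.inr (h.oj_mem p hsp .U))
    have hlo : p.lo ∉ (l .U).flatMap (insAfter d.ui d.a) := by
      rw [m1]
      rintro (e | e)
      · exact h.lo_ne_rep .U hsp e
      · exact h.ne_lo e hsp rfl
    have n2 := nodup_flatMap_insAfter n1 huj hlo
    have m2 := fun z => mem_flatMap_insAfter (x := p.lo) (z := z) huj
    have s2 := sublist_flatMap_insAfter ((l .U).flatMap (insAfter d.ui d.a)) p.uj p.lo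
    have hhi : p.hi ∉ ((l .U).flatMap (insAfter d.ui d.a)).flatMap (insAfter p.uj p.lo) := by
      rw [m2, m1]
      rintro (e | e | e)
      · exact h.lo_ne_hi p hsp e.symm
      · exact h.hi_ne_rep .U hsp e
      · exact h.ne_hi e hsp rfl
    have hlo2 := (m2 p.lo).2 (.inl rfl)
    have n3 := nodup_flatMap_insAfter n2 hlo2 hhi
    have s3 := sublist_flatMap_insAfter
      (((l .U).flatMap (insAfter d.ui d.a)).flatMap (insAfter p.uj p.lo)) p.lo p.hi
    simp only [extend, hsp]
    refine ⟨n3, (s1.trans s2).trans s3, ?_⟩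
    rw [mem_flatMap_insAfter hlo2, m2, m1]
    rintro (e | e | e | e)
    · exact h.hi_ne_new .U hsp e.symm
    · exact h.lo_ne_new .U hsp e.symm
    · exact h.a_ne_x e.symm
    · exact hx e

/-- The order maintained while the tree is updated. -/
theorem Created.exists_om (h : d.Created α S σ l pos q c σ₁ l') :
    ∃ y, (σ₁.mem .U d.x).prev = some y ∧ y ∈ d.extend (l .U) ∧
      ((d.extend (l .U)).flatMap (insAfter y d.x)).Nodup ∧
      (l .U).Sublist ((d.extend (l .U)).flatMap (insAfter y d.x)) ∧
      ((d.extend (l .U)).flatMap (insAfter y d.x)).filter d.keep = l' .U := by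
  obtain ⟨n1, s1, hx⟩ := h.ctx.extend_spec
  obtain ⟨fr, -, -, HR⟩ := h.relinked
  obtain ⟨X, Y, e1, e2, hX, -⟩ := h.lists .U
  -- As `1 ≤ q`, the inserted node has a predecessor, and the branch of `updateOrders` without one
  -- is never taken.
  have hX0 : X ≠ [] := by
    rintro rfl
    have : 0 = q := hX
    have := h.ctx.q_pos
    omega
  obtain ⟨y, hy⟩ : ∃ y, X.getLast? = some y := by
    rw [← Option.isSome_iff_exists]; simpa using hX0
  have hX1 := eq_dropLast_append hy
  have hf := h.ctx.extend_filter
  rw [← e2] at hf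
  have hyf : y ∈ (d.extend (l .U)).filter d.keep := by rw [hf, hX1]; simp
  obtain ⟨hye, hyk⟩ := List.mem_filter.1 hyf
  have hxk : d.keep d.x = true := keep_iff.2 (h.ctx.new_not_removed .U)
  refine ⟨y, ?_, hye, nodup_flatMap_insAfter n1 hye hx,
    s1.trans (sublist_flatMap_insAfter _ _ _), ?_⟩
  · exact ((HR.dll .U).2.2 X d.x Y e1).2.trans hy
  -- Filtering commutes with this insertion because neither `y` nor `d.x` is filtered out.
  · have e3 : ((d.extend (l .U)).flatMap (insAfter y d.x)).filter d.keep =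
        ((d.extend (l .U)).filter d.keep).flatMap (insAfter y d.x) := by
      generalize d.extend (l .U) = L
      induction L with
      | nil => rfl
      | cons z L ih =>
        rw [List.flatMap_cons, List.filter_append, ih, List.filter_cons]
        unfold insAfter
        by_cases hzy : z = y
        · subst hzy; simp [hyk, hxk]
        · by_cases hzk : d.keep z = true <;> simp [hzy, hzk]
    rw [e3, hf, e1]
    have hn : (X ++ Y).Nodup := hf ▸ n1.filter _
    rw [hX1, List.append_assoc, List.singleton_append] at hn
    have := flatMap_insAfter (x := d.x) hn
    conv_lhs => rw [hX1, List.append_assoc, List.singleton_append, this]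
    conv_rhs => rw [hX1]
    simp
    rfl

end Upd

end

/-! ### The order structure and the B-tree after the update. -/

section

variable {A : Type} [LinearOrder A]

/-- An address missing from the list has the length of the list as its index, so it suffices that
one of the two is present. -/
theorem KeyLt.total {om : List ℕ} {e e' : Entry A} (h : e.u ∈ om) (hne : e.u ≠ e'.u) :
    KeyLt om e e' ∨ KeyLt om e' e := by
  unfold KeyLt
  rcases lt_trichotomy e.chr e'.chr with h1 | h1 | h1
  · exact .inl (.inl h1)
  · have : om.idxOf e.u ≠ om.idxOf e'.u := fun h2 => hne ((List.idxOf_inj h).1 h2)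
    rcases lt_or_gt_of_ne this with h3 | h3
    · exact .inl (.inr ⟨h1, h3⟩)
    · exact .inr (.inr ⟨h1.symm, h3⟩)
  · exact .inr (.inl h1)

/-- A list that is sorted by key is determined by its entries. -/
theorem eq_of_pairwise_keyLt {om : List ℕ} {L M : List (Entry A)} (hL : L.Pairwise (KeyLt om))
    (hM : M.Pairwise (KeyLt om)) (h : ∀ e, e ∈ L ↔ e ∈ M) : L = M := by
  have nd : ∀ {L : List (Entry A)}, L.Pairwise (KeyLt om) → L.Nodup := by
    intro L hL
    refine List.Pairwise.imp ?_ hL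
    rintro a _ hab rfl
    exact KeyLt.irrefl a hab
  refine List.Perm.eq_of_pairwise (fun a b _ _ h1 h2 => ?_) hL hM
    ((List.perm_ext_iff_of_nodup (nd hL) (nd hM)).2 h)
  exact absurd (h1.trans h2) (KeyLt.irrefl a)

variable [OrderBot A]

namespace Upd

variable {d : Upd} {α : ℕ} {S : List A} {σ : Store A} {l : Side → List ℕ} {pos : Side → ℕ → ℕ}
  {q : ℕ} {c : A} {σ₁ : Store A} {l' : Side → List ℕ}

/-- The tree entries of old and new nodes. -/
def ent (d : Upd) (σ : Store A) (c : A) (y : ℕ) : Entry A :=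
  ⟨y, (d.cell σ c .V y).lf, (d.cell σ c .V y).chr⟩

theorem Ctx.ent_kept (h : d.Ctx α S σ l pos q) {y : ℕ} (hy : y ∈ l .V) :
    d.ent σ c y = entryOf σ y := by
  rw [ent, h.cell_kept c .V (h.lt hy)]; rfl

theorem Ctx.ent_u (h : d.Ctx α S σ l pos q) {y : ℕ} (hy : d.label σ c y ≠ none) :
    (d.ent σ c y).u = y ∧ σ.fresh ≤ y := by
  constructor
  · obtain ⟨p, hp⟩ := Option.ne_none_iff_exists'.1 hy
    rw [ent, cell, hp]; rfl
  · by_contra hlt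
    exact hy (h.label_kept c (by omega))

/-- The keys of a new node and of another node differ. -/
theorem Ctx.ent_u_ne (h : d.Ctx α S σ l pos q) {x y : ℕ} (hx : d.label σ c x ≠ none)
    (hy : y ∈ l .V ∨ d.label σ c y ≠ none) (hne : y ≠ x) :
    (d.ent σ c x).u ≠ (d.ent σ c y).u := by
  obtain ⟨h1, h2⟩ := h.ent_u hx
  rw [h1]
  rcases hy with hy | hy
  · rw [h.ent_kept hy]
    have : (σ.mem .V y).lf < σ.fresh := h.holds.lt_fresh .U _ (h.holds.lf_mem .V y hy)
    change x ≠ (σ.mem .V y).lf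
    omega
  · rw [(h.ent_u hy).1]
    exact hne.symm

/-- Insertion of a new node into the tree. -/
theorem Ctx.tri_treeInsert (h : d.Ctx α S σ l pos q) {τ : Store A} {ht : ℕ} {Q : ℕ → Prop}
    (hT : TreeInv τ ht fun e => ∃ y, Q y ∧ e = d.ent σ c y)
    (hQ : ∀ y, Q y → y ∈ l .V ∨ d.label σ c y ≠ none) {x : ℕ} (hx : d.label σ c x ≠ none)
    (hm : x ∈ τ.om) (hQx : ¬ Q x) :
    Tri (treeInsert (d.ent σ c x)) τ fun _ τ' n => (∃ t, τ' = { τ with tree := t }) ∧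
      TreeInv τ' (ht + 1) (fun e => ∃ y, (Q y ∨ y = x) ∧ e = d.ent σ c y) ∧ n ≤ 4 * ht + 3 := by
  refine (hT.tri_treeInsert ?_).mono ?_
  · rintro e ⟨y, hy, rfl⟩
    refine KeyLt.total ?_ (h.ent_u_ne hx (hQ y hy) fun e => hQx (e ▸ hy))
    rwa [(h.ent_u hx).1]
  · rintro _ τ' n ⟨h1, h2, h3⟩
    refine ⟨h1, ?_, h3⟩
    convert h2 using 2 with e
    constructor
    · rintro ⟨y, hy | rfl, rfl⟩
      · exact .inl ⟨y, hy, rfl⟩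
      · exact .inr rfl
    · rintro (⟨y, hy, rfl⟩ | rfl)
      · exact ⟨y, .inl hy, rfl⟩
      · exact ⟨x, .inr rfl, rfl⟩

/-- Deletion of a node from the tree. -/
theorem tri_treeDelete {τ : Store A} {ht : ℕ} {Q : ℕ → Prop}
    (hT : TreeInv τ ht fun e => ∃ y, Q y ∧ e = d.ent σ c y) {x : ℕ} (hx : Q x) :
    Tri (treeDelete (d.ent σ c x)) τ fun _ τ' n => (∃ t, τ' = { τ with tree := t }) ∧
      TreeInv τ' ht (fun e => ∃ y, (Q y ∧ y ≠ x) ∧ e = d.ent σ c y) ∧ n ≤ 5 * ht + 3 := by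
  refine (hT.tri_treeDelete ?_ ⟨x, hx, rfl⟩).mono ?_
  · rintro _ _ ⟨y, hy, rfl⟩ ⟨z, hz, rfl⟩ e
    have e : y = z := e
    rw [e]
  · rintro _ τ' n ⟨h1, h2, h3⟩
    refine ⟨h1, ?_, h3⟩
    convert h2 using 2 with e
    constructor
    · rintro ⟨y, ⟨hy, hne⟩, rfl⟩
      exact ⟨⟨y, hy, rfl⟩, hne⟩
    · rintro ⟨⟨y, hy, rfl⟩, hne⟩
      exact ⟨y, ⟨hy, hne⟩, rfl⟩

/-- The run condition in terms of a node of `V`. -/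
theorem Created.run_V (h : d.Created α S σ l pos q c σ₁ l') (hS : EndMarked S)
    (hq : BwtStep S c q) (hui : (σ.mem .U d.ui).chr = ⊥) {y : ℕ} (hy : y ∈ l' .V) :
    (d.ent σ c y).u ∈ l' .U ∧
    (bwt (c :: S)).getD (d.npos pos q .U (d.ent σ c y).u) ⊥ = (d.ent σ c y).chr ∧
    LF (c :: S) (d.npos pos q .U (d.ent σ c y).u) = d.npos pos q .V y := by
  have hy := h.mem_iff.1 hy
  obtain ⟨h1, h2, h3, h4⟩ := h.ctx.cell_lf (c := c) hy
  have hl := h.ctx.live_len_pos (c := c) h1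
  have h1' : d.Live l .U (d.cell σ c .V y).lf := h1
  have := h.ctx.run_new c hS hq hui (z := (d.cell σ c .V y).lf) (Or.comm.1 h1') (j := 0) hl
  rw [add_zero, add_zero] at this
  refine ⟨h.mem_iff.2 h1, this.1.trans h3, this.2.trans ?_⟩
  congr 1

/-- The positions of the lists after the update. -/
theorem Created.tile (h : d.Created α S σ l pos q c σ₁ l') (s : Side) :
    Tile (fun y => (d.cell σ c s y).len) (d.npos pos q s) 0 (l' s) (S.length + 1) := by
  obtain ⟨X, Y, e1, e2, hX, hY⟩ := h.lists s
  rw [e1]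
  exact h.ctx.tile_new c s e2 hX hY

theorem Created.len_pos (h : d.Created α S σ l pos q c σ₁ l') {s : Side} {y : ℕ} (hy : y ∈ l' s) :
    0 < (d.cell σ c s y).len := h.ctx.live_len_pos (h.mem_iff.1 hy)

/-- The entries of the nodes of the new list are sorted. -/
theorem Created.pairwise_ent (h : d.Created α S σ l pos q c σ₁ l') (hS : EndMarked S)
    (hc : c ≠ ⊥) (hq : BwtStep S c q) (hui : (σ.mem .U d.ui).chr = ⊥) {om : List ℕ}
    (hn : om.Nodup) (hs : (l' .U).Sublist om) :
    ((l' .V).map (d.ent σ c)).Pairwise (KeyLt om) := by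
  rw [List.pairwise_map]
  refine ((h.tile .V).pairwise_lt fun y hy => h.len_pos hy).imp_of_mem ?_
  intro y z hy hz hyz
  obtain ⟨y1, y2, y3⟩ := h.run_V hS hq hui hy
  obtain ⟨z1, z2, z3⟩ := h.run_V hS hq hui hz
  have hlt : ∀ w ∈ l' .U, d.npos pos q .U w < (c :: S).length := by
    intro w hw
    have := ((h.tile .U).bounds hw).2
    have := h.len_pos hw
    rw [List.length_cons]
    omega
  refine (keyLt_iff_pos (hS.cons hc) (hlt _ y1) (hlt _ z1) y2 z2 y3 z3 ?_).2 hyz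
  exact lt_iff_lt_of_pairwise ((pairwise_idxOf hn).sublist hs)
    ((h.tile .U).pairwise_lt fun y hy => h.len_pos hy) y1 z1

/-- The intermediate trees mix old and new entries and belong to no graph. They are controlled only
as sets sorted by the order `omF`, of which the old and the new list of `U` are both sublists. In
the end the set of entries is the right one, and a list sorted by key is determined by its entries.
At most two deletions at `5 * ht` and four insertions at `4 * ht` give the term `26 * ht`. -/
theorem Created.tri_updateOrders (h : d.Created α S σ l pos q c σ₁ l') (hS : EndMarked S)
    (hc : c ≠ ⊥) (hq : BwtStep S c q) (hui : (σ.mem .U d.ui).chr = ⊥) {ht : ℕ}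
    (hT : TreeInv σ ht fun e => ∃ y ∈ l .V, e = entryOf σ y) {σ₂ : Store A}
    {R : Side → ℕ → Prop} {H : Side → ℕ → ℕ × ℕ} (hI : EdgeInv d.Removed σ₁ σ₂ R H) :
    Tri (updateOrders c d.ui d.vi d.a d.x d.sp) σ₂ fun _ σ₃ n => n ≤ 26 * ht + 70 ∧
      ∃ t, σ₃ = { σ₂ with om := l' .U, tree := t } ∧ (∃ k, t.Uniform k) ∧
        t.inorder = (l' .V).map (d.ent σ c) := by
  obtain ⟨fr, -, -, HR⟩ := h.relinked
  have hom : σ₂.om = l .U := by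
    rw [hI.frame]
    exact HR.om.trans h.ctx.holds.om
  have htree : σ₂.tree = σ.tree := by
    rw [hI.frame]
    exact HR.tree
  obtain ⟨y, hprev, hye, hnF, hsF, hfF⟩ := h.exists_om
  have hprev₂ : (σ₂.mem .U d.x).prev = some y :=
    (congrArg Cell.prev (hI.core .U d.x) :).trans hprev
  generalize hoF : (d.extend (l .U)).flatMap (insAfter y d.x) = omF at *
  have hsF' : (l' .U).Sublist omF := hfF ▸ List.filter_sublist
  have hlab : ∀ z, d.label σ c z ≠ none → z ∈ omF := fun z hz =>
    hsF'.subset (h.mem_iff.2 ((h.ctx.live_iff (c := c)).2 (.inl hz)))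
  have la : d.label σ c d.a ≠ none := label_ne_none.2 (.inl rfl)
  have lx : d.label σ c d.x ≠ none := label_ne_none.2 (.inr (.inl rfl))
  have hnew : ∀ z, d.label σ c z ≠ none → z ∉ l .V := fun z hz hm =>
    hz (h.ctx.label_kept c (h.ctx.lt hm))
  have hvi : d.vi ∈ l .V := h.ctx.old_mem .V
  have hau := h.ctx.a_ne_x
  have evi : d.ent σ c d.vi = ⟨d.vi, d.ui, ⊥⟩ := by
    rw [h.ctx.ent_kept hvi, entryOf, show (σ.mem .V d.vi).lf = d.ui from h.ctx.old_lf .V]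
    have h1 : (σ.mem .V (σ.mem .U d.ui).lf).chr = (σ.mem .U d.ui).chr :=
      h.ctx.holds.chr_lf .U _ (h.ctx.old_mem .U)
    rw [show (σ.mem .U d.ui).lf = d.vi from h.ctx.old_lf .U, hui] at h1
    rw [h1]
  have ea : d.ent σ c d.a = ⟨d.a, d.a, c⟩ := by
    rw [ent, Ctx.cell_a]; rfl
  have ex : d.ent σ c d.x = ⟨d.x, d.x, ⊥⟩ := by
    rw [ent, h.ctx.cell_x]; rfl
  -- the tree before the update, with respect to the extended order
  have hT₀ : ∀ τ : Store A, τ.om = omF → τ.tree = σ.tree →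
      TreeInv τ ht fun e => ∃ y, y ∈ l .V ∧ e = d.ent σ c y := by
    intro τ h1 h2
    refine ⟨h2 ▸ hT.shape, ?_, fun e => ?_⟩
    · rw [h1, h2]
      refine hT.sorted.imp_of_mem ?_
      intro e e' he he' hlt
      obtain ⟨z, hz, rfl⟩ := (hT.mem e).1 he
      obtain ⟨z', hz', rfl⟩ := (hT.mem e').1 he'
      refine hlt.imp id (And.imp id ?_)
      rw [h.ctx.holds.om]
      exact (idxOf_lt_iff_of_sublist hsF hnF (h.ctx.holds.lf_mem .V z hz)
        (h.ctx.holds.lf_mem .V z' hz')).2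
    · rw [h2, hT.mem]
      constructor
      · rintro ⟨z, hz, rfl⟩
        exact ⟨z, hz, (h.ctx.ent_kept hz).symm⟩
      · rintro ⟨z, hz, rfl⟩
        exact ⟨z, hz, h.ctx.ent_kept hz⟩
  -- the tree after the update
  have hfin : ∀ (τ : Store A) (k : ℕ) (Q : ℕ → Prop), τ.om = omF → (∀ z, Q z ↔ z ∈ l' .V) →
      TreeInv τ k (fun e => ∃ y, Q y ∧ e = d.ent σ c y) → (∃ k, τ.tree.Uniform k) ∧
        τ.tree.inorder = (l' .V).map (d.ent σ c) := by
    intro τ k Q h1 h2 h3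
    obtain ⟨k', -, hk⟩ := h3.shape
    refine ⟨⟨k', hk⟩, eq_of_pairwise_keyLt (om := omF) (h1 ▸ h3.sorted)
      (h.pairwise_ent hS hc hq hui hnF hsF') fun e => ?_⟩
    rw [h3.mem, List.mem_map]
    simp only [h2, eq_comm]
  have hom₁ := h.ctx.extend_spec
  have hnU := h.ctx.holds.nodup .U
  have huiU : d.ui ∈ l .U := h.ctx.old_mem .U
  have n1 := nodup_flatMap_insAfter hnU huiU (fun hm => h.ctx.ne_rep .U hm rfl : d.a ∉ l .U)
  have live := fun z => (h.mem_iff (s := .V) (y := z)).trans (h.ctx.live_iff (c := c))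
  cases hsp : d.sp with
  | none =>
    have hext : d.extend (l .U) = (l .U).flatMap (insAfter d.ui d.a) := by
      simp only [extend, hsp]
    rw [hext] at hye hoF
    unfold updateOrders
    simp only
    refine Tri.bind (tri_omInsertAfter d.a (hom ▸ hnU) (by rw [hom]; exact huiU)) ?_
    rintro _ σ₃ n₃ ⟨rfl, rfl⟩
    rw [hom]
    refine Tri.look_bind ?_
    simp only [hprev₂]
    refine Tri.bind (tri_omInsertAfter d.x n1 hye) ?_
    rintro _ σ₄ n₄ ⟨rfl, rfl⟩
    simp only [hoF]
    rw [← evi, ← ea, ← ex]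
    refine Tri.bind (tri_treeDelete (hT₀ { σ₂ with om := omF } rfl htree) hvi) ?_
    rintro _ σ₅ n₅ ⟨⟨t₅, rfl⟩, T5, hn₅⟩
    refine Tri.bind (h.ctx.tri_treeInsert T5 (fun z hz => .inl hz.1) la (hlab _ la)
      fun hz => hnew _ la hz.1) ?_
    rintro _ σ₆ n₆ ⟨⟨t₆, rfl⟩, T6, hn₆⟩
    refine Tri.bind (h.ctx.tri_treeInsert T6 (fun z hz => ?_) lx (hlab _ lx) fun hz => ?_) ?_
    · rcases hz with hz | rfl
      · exact .inl hz.1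
      · exact .inr la
    · rcases hz with hz | hz
      · exact hnew _ lx hz.1
      · exact hau hz.symm
    rintro _ σ₇ n₇ ⟨⟨t₇, rfl⟩, T7, hn₇⟩
    unfold omDelete
    refine Tri.writeS ⟨by omega, t₇, ?_, hfin _ _ _ rfl (fun z => ?_) T7⟩
    · simp only
      congr 1
      rw [← hfF, hnF.erase_eq_filter]
      refine List.filter_congr fun z _ => ?_
      rw [Bool.eq_iff_iff, keep_iff]
      simp [Removed, hsp, old, Side.pick]
    · rw [live, label_ne_none]
      simp only [hsp, Removed, old, Side.pick]
      have h1 : z = d.a → z ∉ l .V := fun e => e ▸ hnew _ la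
      simp
      tauto
  | some p =>
    have hext : d.extend (l .U) = (((l .U).flatMap (insAfter d.ui d.a)).flatMap
        (insAfter p.uj p.lo)).flatMap (insAfter p.lo p.hi) := by
      simp only [extend, hsp]
    rw [hext] at hye hoF hom₁
    have hujU : p.uj ∈ l .U := h.ctx.oj_mem p hsp .U
    have hvjV : p.vj ∈ l .V := h.ctx.oj_mem p hsp .V
    have llo : d.label σ c p.lo ≠ none := label_ne_none.2 (.inr (.inr ⟨p, hsp, .inl rfl⟩))
    have lhi : d.label σ c p.hi ≠ none := label_ne_none.2 (.inr (.inr ⟨p, hsp, .inr rfl⟩))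
    have hlh := h.ctx.lo_ne_hi p hsp
    have hlo := (h.ctx.fresh_lo p hsp).2
    have hhi := (h.ctx.fresh_hi p hsp).2
    have hnv : p.vj ≠ d.vi := h.ctx.oj_ne p hsp .V
    have m1 : p.uj ∈ (l .U).flatMap (insAfter d.ui d.a) :=
      (mem_flatMap_insAfter huiU).2 (.inr hujU)
    have n2 : (((l .U).flatMap (insAfter d.ui d.a)).flatMap (insAfter p.uj p.lo)).Nodup :=
      hom₁.1.sublist (sublist_flatMap_insAfter _ _ _)
    have m2 : p.lo ∈ ((l .U).flatMap (insAfter d.ui d.a)).flatMap (insAfter p.uj p.lo) :=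
      (mem_flatMap_insAfter m1).2 (.inl rfl)
    have hchr : (σ₂.mem .U p.uj).chr = (σ.mem .U p.uj).chr :=
      (congrArg Cell.chr (hI.core .U p.uj) :).trans (congrArg Cell.chr (h.body_kept hujU) :)
    have evj : d.ent σ c p.vj = ⟨p.vj, p.uj, (σ.mem .U p.uj).chr⟩ := by
      rw [h.ctx.ent_kept hvjV, entryOf, show (σ.mem .V p.vj).lf = p.uj from h.ctx.oj_lf p hsp .V,
        show (σ.mem .V p.vj).chr = _ from h.ctx.oj_chr .V hsp]
    have elo : d.ent σ c p.lo = ⟨p.lo, p.lo, (σ.mem .U p.uj).chr⟩ := by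
      rw [ent, h.ctx.cell_lo c .V hsp]; rfl
    have ehi : d.ent σ c p.hi = ⟨p.hi, p.hi, (σ.mem .U p.uj).chr⟩ := by
      rw [ent, h.ctx.cell_hi c .V hsp]; rfl
    unfold updateOrders
    simp only
    refine Tri.bind (tri_omInsertAfter d.a (hom ▸ hnU) (by rw [hom]; exact huiU)) ?_
    rintro _ σ₃ n₃ ⟨rfl, rfl⟩
    rw [hom]
    refine Tri.bind (tri_omInsertAfter p.lo n1 m1) ?_
    rintro _ σ₄ n₄ ⟨rfl, rfl⟩
    refine Tri.bind (tri_omInsertAfter p.hi n2 m2) ?_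
    rintro _ σ₅ n₅ ⟨rfl, rfl⟩
    refine Tri.look_bind ?_
    simp only [hprev₂]
    refine Tri.bind (tri_omInsertAfter d.x hom₁.1 hye) ?_
    rintro _ σ₆ n₆ ⟨rfl, rfl⟩
    simp only [hoF]
    rw [← evi, ← ea, ← ex]
    refine Tri.bind (tri_treeDelete (hT₀ { σ₂ with om := omF } rfl htree) hvi) ?_
    rintro _ σ₇ n₇ ⟨⟨t₇, rfl⟩, T7, hn₇⟩
    refine Tri.bind (h.ctx.tri_treeInsert T7 (fun z hz => .inl hz.1) la (hlab _ la)
      fun hz => hnew _ la hz.1) ?_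
    rintro _ σ₈ n₈ ⟨⟨t₈, rfl⟩, T8, hn₈⟩
    refine Tri.bind (h.ctx.tri_treeInsert T8 (fun z hz => ?_) lx (hlab _ lx) fun hz => ?_) ?_
    · rcases hz with hz | rfl
      · exact .inl hz.1
      · exact .inr la
    · rcases hz with hz | hz
      · exact hnew _ lx hz.1
      · exact hau hz.symm
    rintro _ σ₉ n₉ ⟨⟨t₉, rfl⟩, T9, hn₉⟩
    refine Tri.look_bind ?_
    simp only [hchr]
    rw [← evj, ← elo, ← ehi]
    refine Tri.bind (tri_treeDelete T9 (.inl (.inl ⟨hvjV, hnv⟩))) ?_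
    rintro _ τ₁ k₁ ⟨⟨t₁, rfl⟩, T1, hk₁⟩
    refine Tri.bind (h.ctx.tri_treeInsert T1 (fun z hz => ?_) llo (hlab _ llo) fun hz => ?_) ?_
    · rcases hz.1 with (hz | rfl) | rfl
      · exact .inl hz.1
      · exact .inr la
      · exact .inr lx
    · rcases hz.1 with (hz | hz) | hz
      · exact hnew _ llo hz.1
      · exact hlo.1 hz
      · exact hlo.2 hz
    rintro _ τ₂ k₂ ⟨⟨t₂, rfl⟩, T2, hk₂⟩
    refine Tri.bind (h.ctx.tri_treeInsert T2 (fun z hz => ?_) lhi (hlab _ lhi) fun hz => ?_) ?_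
    · rcases hz with ⟨(hz | rfl) | rfl, -⟩ | rfl
      · exact .inl hz.1
      · exact .inr la
      · exact .inr lx
      · exact .inr llo
    · rcases hz with ⟨(hz | hz) | hz, -⟩ | hz
      · exact hnew _ lhi hz.1
      · exact hhi.1 hz
      · exact hhi.2 hz
      · exact hlh hz.symm
    rintro _ τ₃ k₃ ⟨⟨t₃, rfl⟩, T3, hk₃⟩
    unfold omDelete
    refine Tri.writeS_bind (Tri.writeS ⟨by omega, t₃, ?_, hfin _ _ _ rfl (fun z => ?_) T3⟩)
    · simp only
      congr 1
      rw [← hfF, hnF.erase_eq_filter, (hnF.filter _).erase_eq_filter, List.filter_filter]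
      refine List.filter_congr fun z _ => ?_
      rw [Bool.eq_iff_iff, keep_iff]
      simp [Removed, hsp, old, Split.oj, Side.pick]
    · rw [live, label_ne_none]
      simp only [hsp, Removed, old, Split.oj, Side.pick, Option.some.injEq, exists_eq_left']
      have h1 : d.a ≠ p.vj := fun e => hnew _ la (e ▸ hvjV)
      have h2 : d.x ≠ p.vj := fun e => hnew _ lx (e ▸ hvjV)
      have h3 : z = d.a → z ≠ p.vj := fun e => e ▸ h1
      have h4 : z = d.x → z ≠ p.vj := fun e => e ▸ h2
      constructor
      · rintro ((⟨(h5 | h5) | h5, h6⟩ | h5) | h5)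
        · exact .inr ⟨h5.1, fun e => e.elim h5.2 h6⟩
        · exact .inl (.inl h5)
        · exact .inl (.inr (.inl h5))
        · exact .inl (.inr (.inr (.inl h5)))
        · exact .inl (.inr (.inr (.inr h5)))
      · rintro ((h5 | h5 | h5 | h5) | ⟨h5, h6⟩)
        · exact .inl (.inl ⟨.inl (.inr h5), h3 h5⟩)
        · exact .inl (.inl ⟨.inr h5, h4 h5⟩)
        · exact .inl (.inr h5)
        · exact .inr h5
        · exact .inl (.inl ⟨.inl (.inl ⟨h5, fun e => h6 (.inl e)⟩), fun e => h6 (.inr e)⟩)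

end Upd

end

/-! ### The arrays of heavy nodes and the final store. -/

section

variable {A : Type} [LinearOrder A] [OrderBot A]

omit [LinearOrder A] in
theorem Cell.eq_of_core_edge_inn {x y : Cell A} (h1 : x.core = y.core) (h2 : x.edge = y.edge)
    (h3 : x.inn = y.inn) : x = y := by
  cases x
  cases y
  simp only [Cell.core, Cell.edge, Cell.mk.injEq, Prod.mk.injEq] at h1 h2 h3 ⊢
  obtain ⟨rfl, rfl, rfl, rfl, rfl, -⟩ := h1
  obtain ⟨rfl, rfl⟩ := h2
  obtain rfl := h3
  simp

namespace Upd

variable {d : Upd} {α : ℕ} {S : List A} {σ : Store A} {l : Side → List ℕ} {pos : Side → ℕ → ℕ}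
  {q : ℕ} {c : A} {σ₁ : Store A} {l' : Side → List ℕ}

omit [LinearOrder A] [OrderBot A] in
theorem tri_checkHeavy (τ : Store A) (α : ℕ) (s : Side) (x : ℕ) :
    Tri (checkHeavy α s x) τ fun _ τ' n => n ≤ α + 2 ∧
      τ' = { τ with
        heavy := Function.update τ.heavy s
          (if α ≤ (τ.mem s x).inn.length then x :: τ.heavy s else τ.heavy s) } := by
  unfold checkHeavy
  refine Tri.look_bind (Tri.tick_bind ?_)
  split_ifs with h
  · unfold pushHeavy
    exact Tri.writeS ⟨by omega, rfl⟩
  · exact Tri.pure ⟨by omega, by rw [Function.update_eq_self]⟩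

omit [LinearOrder A] [OrderBot A] in
-- The arrays are empty beforehand because the old graph has no heavy nodes. On each side only one
-- node is examined, the head of the edge leaving `hi`, so no duplicates can arise.
theorem tri_updateHeavy {τ : Store A} (h0 : ∀ s, τ.heavy s = []) (sp : Option Split) :
    Tri (updateHeavy α sp) τ fun _ τ' n => n ≤ 2 * α + 6 ∧ ∃ hv, τ' = { τ with heavy := hv } ∧
      ∀ s, (hv s).Nodup ∧ ∀ x, x ∈ hv s ↔
        ∃ p, sp = some p ∧ x = (τ.mem s.other p.hi).head ∧ α ≤ (τ.mem s x).inn.length := by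
  unfold updateHeavy
  cases sp with
  | none => exact Tri.pure ⟨by omega, τ.heavy, rfl, fun s => by simp [h0]⟩
  | some p =>
    simp only
    refine Tri.look_bind (Tri.bind (tri_checkHeavy τ α .U _) ?_)
    rintro _ τ₁ n₁ ⟨hn₁, rfl⟩
    refine Tri.look_bind ((tri_checkHeavy _ α .V _).mono ?_)
    rintro _ τ₂ n₂ ⟨hn₂, rfl⟩
    refine ⟨by omega, _, rfl, ?_⟩
    rintro (_ | _)
    · simp only [Function.update_apply, reduceCtorEq, if_false, if_true, h0, Side.other]
      constructor
      · split_ifs <;> simp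
      · intro x
        split_ifs with h1
        · simp only [List.mem_singleton]
          constructor
          · rintro rfl; exact ⟨p, rfl, rfl, h1⟩
          · rintro ⟨p', hp, rfl, -⟩
            obtain rfl : p = p' := by simpa using hp
            rfl
        · simp only [List.not_mem_nil, false_iff]
          rintro ⟨p', hp, rfl, h2⟩
          obtain rfl : p = p' := by simpa using hp
          exact h1 h2
    · simp only [Function.update_apply, reduceCtorEq, if_false, if_true, h0, Side.other]
      constructor
      · split_ifs <;> simp
      · intro x
        split_ifs with h1
        · simp only [List.mem_singleton]
          constructor
          · rintro rfl; exact ⟨p, rfl, rfl, h1⟩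
          · rintro ⟨p', hp, rfl, -⟩
            obtain rfl : p = p' := by simpa using hp
            rfl
        · simp only [List.not_mem_nil, false_iff]
          rintro ⟨p', hp, rfl, h2⟩
          obtain rfl : p = p' := by simpa using hp
          exact h1 h2

open Classical in
theorem tri_freeNodes (τ : Store A) :
    Tri (freeNodes d.ui d.vi d.sp) τ fun _ τ' n => n ≤ 4 ∧
      τ' = { τ with mem := fun s y => if d.Removed s y then Cell.blank else τ.mem s y } := by
  unfold freeNodes freeNode
  cases hsp : d.sp with
  | none =>
    simp only
    refine Tri.change_bind (Tri.change_bind (Tri.pure ⟨by omega, ?_⟩))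
    simp only [Store.upd]
    congr 1
    funext s y
    cases s <;> simp [Removed, hsp, old, Side.pick]
  | some p =>
    simp only
    refine Tri.change_bind (Tri.change_bind (Tri.change_bind (Tri.change ⟨by omega, ?_⟩)))
    simp only [Store.upd]
    congr 1
    funext s y
    by_cases h1 : y = d.old s <;> by_cases h2 : y = p.oj s <;>
      cases s <;> simp_all [Removed, old, Split.oj, Side.pick]

/-- The final state of an update. -/
theorem Created.holds (h : d.Created α S σ l pos q c σ₁ l') (hS : EndMarked S)
    (hq : BwtStep S c q) (hui : (σ.mem .U d.ui).chr = ⊥) (hα : 2 ≤ α)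
    (hb : ∀ s, ∀ y ∈ l s, (σ.mem s y).inn.length < α) {H : Side → ℕ → ℕ × ℕ}
    (hH : d.Edges σ l pos c H) {σ₂ : Store A} (hI : EdgeInv d.Removed σ₁ σ₂ (d.Live l) H)
    {t : BTree (Entry A)} (ht : ∃ k, t.Uniform k) (hto : t.inorder = (l' .V).map (d.ent σ c))
    {hv : Side → List ℕ} (hhv : ∀ s, (hv s).Nodup ∧ ∀ x, x ∈ hv s ↔
      ∃ p, d.sp = some p ∧ x = (σ₂.mem s.other p.hi).head ∧ α ≤ (σ₂.mem s x).inn.length)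
    {σ' : Store A} (hσ' : σ' = { σ₂ with om := l' .U, tree := t, heavy := hv, mem := σ'.mem })
    (hrem : ∀ s y, d.Removed s y → σ'.mem s y = Cell.blank)
    (hkept : ∀ s y, ¬ d.Removed s y → σ'.mem s y = σ₂.mem s y) :
    AHolds α (c :: S) σ' l' (d.npos pos q) ∧
      ∀ s, ∃ z, ∀ y ∈ l' s, (σ'.mem s y).inn.length ≤ α ∧
        (α ≤ (σ'.mem s y).inn.length → y = z) := by
  obtain ⟨fr, hfr, hlab, HR⟩ := h.relinked
  have live : ∀ {s y}, y ∈ l' s → d.Live l s y := fun hy => h.mem_iff.1 hy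
  have hm : ∀ {s y}, y ∈ l' s → σ'.mem s y = σ₂.mem s y := fun hy =>
    hkept _ _ (h.ctx.live_not_removed (live hy))
  have hlf : ∀ {s y}, y ∈ l' s → (σ'.mem s y).lf = (d.cell σ c s y).lf := fun {s y} hy => by
    rw [hm hy]
    exact (congrArg Cell.lf (hI.core s y) :).trans (congrArg Cell.lf (h.body s y) :)
  have hchr : ∀ {s y}, y ∈ l' s → (σ'.mem s y).chr = (d.cell σ c s y).chr := fun {s y} hy => by
    rw [hm hy]
    exact (congrArg Cell.chr (hI.core s y) :).trans (congrArg Cell.chr (h.body s y) :)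
  have hlen : ∀ {s y}, y ∈ l' s → (σ'.mem s y).len = (d.cell σ c s y).len := fun {s y} hy => by
    rw [hm hy]
    exact (congrArg Cell.len (hI.core s y) :).trans (congrArg Cell.len (h.body s y) :)
  have hhead : ∀ {s y}, y ∈ l' s → (σ'.mem s y).head = (H s y).1 := fun {s y} hy => by
    rw [hm hy, ← hI.edge]; rfl
  have hoff : ∀ {s y}, y ∈ l' s → (σ'.mem s y).off = (H s y).2 := fun {s y} hy => by
    rw [hm hy, ← hI.edge]; rfl
  have hlfm : ∀ {s y}, y ∈ l' s → (d.cell σ c s y).lf ∈ l' s.other := fun hy =>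
    h.mem_iff.2 (h.ctx.cell_lf (live hy)).1
  have hinn : ∀ s, ∀ y ∈ l' s.other, ∀ x, x ∈ (σ'.mem s.other y).inn ↔
      x ∈ l' s ∧ (H s x).1 = y := by
    intro s y hy x
    rw [hm hy, hI.inn s y (h.ctx.live_not_removed (live hy)), h.mem_iff]
  have hdeg : ∀ s, ∀ y ∈ l' s.other, (σ'.mem s.other y).inn.length ≤ α ∧
      (α ≤ (σ'.mem s.other y).inn.length → ∃ p, d.sp = some p ∧ (H s p.hi).1 = y) := by
    intro s y hy
    refine h.ctx.inn_length hH hα hb (live hy) ?_ fun x hx => ?_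
    · rw [hm hy]
      exact hI.nodup _ _ (h.ctx.live_not_removed (live hy))
    · obtain ⟨h1, h2⟩ := (hinn s y hy x).1 hx
      exact ⟨live h1, h2⟩
  have hhd : ∀ s x, (σ₂.mem s x).head = (H s x).1 := fun s x => by rw [← hI.edge]; rfl
  constructor
  · constructor
    case nodup => exact HR.nodup
    case lt_fresh =>
      intro s y hy
      have e : σ'.fresh = fr := by
        rw [hσ', hI.frame]; exact HR.fresh
      rw [e]
      rcases (h.ctx.live_iff (c := c)).1 (live hy) with h1 | ⟨h1, -⟩
      · exact hlab y h1
      · exact (h.ctx.lt h1).trans_le hfr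
    case blank =>
      intro s y hy
      by_cases hr : d.Removed s y
      · exact hrem s y hr
      have hnl : ¬ d.Live l s y := fun h1 => hy (h.mem_iff.2 h1)
      have hl : y ∉ l s := fun h1 => hnl ((h.ctx.live_iff (c := c)).2 (.inr ⟨h1, hr⟩))
      have hlb : d.label σ c y = none := by
        by_contra h1
        exact hnl ((h.ctx.live_iff (c := c)).2 (.inl h1))
      have hbl : σ.mem s y = Cell.blank := h.ctx.holds.blank s y hl
      have h1 : (σ₂.mem s y).core = (Cell.blank : Cell A).core := by
        rw [hI.core, HR.mem s y hlb hl, hbl]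
      have h2 : (σ₂.mem s y).edge = (Cell.blank : Cell A).edge := by
        rw [hI.edge, hH.rest s y hl hlb, edge₀, cell, hlb, Option.elim_none, hbl]
      -- Registered edges end at nodes of the new graph, so an address outside of it has an empty
      -- incoming list.
      have h3 : (σ₂.mem s y).inn = [] := by
        rw [List.eq_nil_iff_forall_not_mem]
        intro x hx
        have h4 := hI.inn s.other y (by rwa [Side.other_other]) x
        rw [Side.other_other] at h4
        obtain ⟨h5, h6⟩ := h4.1 hx
        have h7 := (h.ctx.edges_head hH h5).1
        rw [Side.other_other, h6] at h7
        exact hnl h7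
      rw [hkept s y hr]
      exact Cell.eq_of_core_edge_inn h1 h2 h3
    case lf_mem =>
      intro s y hy
      rw [hlf hy]
      exact hlfm hy
    case lf_lf =>
      intro s y hy
      rw [hlf hy, hlf (hlfm hy)]
      exact (h.ctx.cell_lf (live hy)).2.1
    case chr_lf =>
      intro s y hy
      rw [hlf hy, hchr (hlfm hy), hchr hy]
      exact (h.ctx.cell_lf (live hy)).2.2.1
    case len_lf =>
      intro s y hy
      rw [hlf hy, hlen (hlfm hy), hlen hy]
      exact (h.ctx.cell_lf (live hy)).2.2.2
    case len_pos =>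
      intro s y hy
      rw [hlen hy]
      exact h.len_pos hy
    case run =>
      intro y hy j hj
      rw [hlen hy] at hj
      rw [hchr hy, hlf hy]
      exact h.ctx.run_new c hS hq hui (Or.comm.1 (live hy)) hj
    case tile =>
      intro s
      exact (h.tile s).congr (fun y hy => hlen hy) fun _ _ => rfl
    case head =>
      intro s y hy
      obtain ⟨h1, h2, h3⟩ := h.ctx.edges_head hH (live hy)
      rw [hhead hy, hoff hy, hlen (h.mem_iff.2 h1)]
      exact ⟨h.mem_iff.2 h1, h2, h3⟩
    case inn_nodup =>
      intro s y hy
      rw [hm hy]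
      exact hI.nodup _ _ (h.ctx.live_not_removed (live hy))
    case inn =>
      intro s y hy x
      rw [hinn s y hy x]
      refine and_congr_right fun hx => ?_
      rw [hhead hx]
    case dll =>
      intro s
      obtain ⟨h1, h2, h3⟩ := HR.dll s
      refine ⟨?_, ?_, ?_⟩
      · rw [hσ', hI.frame]; exact h1
      · rw [hσ', hI.frame]; exact h2
      · intro l₁ y l₂ e
        have hy : y ∈ l' s := by rw [e]; simp
        rw [hm hy]
        obtain ⟨h4, h5⟩ := h3 l₁ y l₂ e
        exact ⟨(congrArg Cell.next (hI.core s y) :).trans h4,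
          (congrArg Cell.prev (hI.core s y) :).trans h5⟩
    case dollar =>
      have e : σ'.dollar = d.x := by
        rw [hσ', hI.frame]; exact HR.dollar
      have hx : d.x ∈ l' .U := h.mem_iff.2 (.inr rfl)
      rw [e]
      refine ⟨hx, ?_⟩
      rw [hchr hx, h.ctx.cell_x]
      rfl
    case om => rw [hσ']
    case tree_shape => rw [hσ']; exact ht
    case tree_entries =>
      rw [show σ'.tree = t by rw [hσ'], hto]
      refine List.map_congr_left fun y hy => ?_
      rw [ent, entryOf, hlf hy, hchr hy]
    case heavy_nodup =>
      intro s
      rw [show σ'.heavy = hv by rw [hσ']]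
      exact (hhv s).1
    case heavy =>
      intro s x
      rw [show σ'.heavy = hv by rw [hσ'], (hhv s).2]
      constructor
      · rintro ⟨p, hp, rfl, h1⟩
        have hhi : p.hi ∈ l' s.other := h.mem_iff.2 ((h.ctx.live_iff (c := c)).2
          (.inl (label_ne_none.2 (.inr (.inr ⟨p, hp, .inr rfl⟩)))))
        have h2 := (h.ctx.edges_head hH (live hhi)).1
        rw [Side.other_other, ← hhd] at h2
        have h3 := h.mem_iff.2 h2
        exact ⟨h3, by rw [hm h3]; exact h1⟩
      -- By the degree bound a heavy node is the head of the edge leaving `hi`, so the two tests of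
      -- `updateHeavy` miss none.
      · rintro ⟨h1, h2⟩
        obtain ⟨p, hp, h3⟩ := (hdeg s.other x (by rwa [Side.other_other])).2
          (by rwa [Side.other_other])
        exact ⟨p, hp, by rw [hhd, h3], by rw [← hm h1]; exact h2⟩
  · intro s
    -- The only candidate for a heavy node is the head of the edge leaving `hi`. The value `0` is
    -- arbitrary, since without a split no node is heavy.
    refine ⟨d.sp.elim 0 fun p => (H s.other p.hi).1, fun y hy => ?_⟩
    obtain ⟨h1, h2⟩ := hdeg s.other y (by rwa [Side.other_other])
    rw [Side.other_other] at h1 h2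
    refine ⟨h1, fun h3 => ?_⟩
    obtain ⟨p, hp, h4⟩ := h2 h3
    rw [hp, Option.elim_some, h4]

end Upd

end

/-! ### Cost and effect of the whole operation. -/

section

variable {A : Type} [LinearOrder A] [OrderBot A]

/-- Cost and effect of an update in terms of the lists of nodes. -/
theorem AHolds.tri_updateOp {α : ℕ} {S : List A} {σ : Store A} {l : Side → List ℕ}
    {pos : Side → ℕ → ℕ} {c : A} (h : AHolds α S σ l pos) (hS : EndMarked S) (hc : c ≠ ⊥)
    (hα : 2 ≤ α) (hb : ∀ s, ∀ y ∈ l s, (σ.mem s y).inn.length < α) :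
    ∃ ht, 2 ^ ht ≤ (l .U).length + 1 ∧
      Tri (updateOp α c) σ fun _ σ' n => n ≤ 19 * α + 30 * ht + 207 ∧
        ∃ l' pos', AHolds α (c :: S) σ' l' pos' ∧
          ∀ s, ∃ z, ∀ y ∈ l' s, (σ'.mem s y).inn.length ≤ α ∧
            (α ≤ (σ'.mem s y).inn.length → y = z) := by
  obtain ⟨q, hq⟩ := exists_bwtStep hS hc
  obtain ⟨ht, hht, hT⟩ := h.treeInv hS
  refine ⟨ht, hht, ?_⟩
  unfold updateOp
  refine Tri.readS_bind (Tri.look_bind ?_)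
  refine h.tri_create hS hc hq hT (k := fun a sp x => do
    updateEdges σ.dollar (σ.mem .U σ.dollar).lf a x sp
    updateOrders c σ.dollar (σ.mem .U σ.dollar).lf a x sp
    updateHeavy α sp
    freeNodes σ.dollar (σ.mem .U σ.dollar).lf sp) ?_
  intro d σ₁ l' n₁ hd hu hv hn₁
  obtain ⟨_, -, -, HR⟩ := hd.relinked
  have hui : (σ.mem .U d.ui).chr = ⊥ := by rw [hu]; exact h.dollar.2
  rw [← hv, ← hu]
  refine Tri.bind (hd.tri_updateEdges hb) ?_
  rintro _ σ₂ n₂ ⟨hn₂, H, hH, hI⟩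
  refine Tri.bind (hd.tri_updateOrders hS hc hq hui hT hI) ?_
  rintro _ σ₃ n₃ ⟨hn₃, t, rfl, htu, hto⟩
  have h0 : ∀ s, σ₂.heavy s = [] := by
    intro s
    rw [hI.frame]
    change σ₁.heavy s = []
    rw [HR.heavy, List.eq_nil_iff_forall_not_mem]
    intro x hx
    obtain ⟨hx, hx'⟩ := (h.heavy s x).1 hx
    exact absurd (hb s x hx) (by omega)
  refine Tri.bind (Upd.tri_updateHeavy (τ := { σ₂ with om := l' .U, tree := t }) h0 d.sp) ?_
  rintro _ σ₄ n₄ ⟨hn₄, hv', rfl, hhv⟩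
  refine (Upd.tri_freeNodes _).mono ?_
  rintro _ σ₅ n₅ ⟨hn₅, rfl⟩
  refine ⟨by omega, l', d.npos pos q, ?_⟩
  exact hd.holds hS hq hui hα hb hH hI htu hto hhv rfl (fun s y hr => if_pos hr)
    fun s y hr => if_neg hr

/-- As `1 ≤ δ`, the shorter suffix already contains the only `$`, so the next character differs from
it. -/
theorem EndMarked.sufOf_succ {T : List A} (hT : EndMarked T) {δ : ℕ} (h1 : 1 ≤ δ)
    (h2 : δ < T.length) {c : A} (hc : (sufOf T (δ + 1)).head? = some c) :
    EndMarked (sufOf T δ) ∧ c ≠ ⊥ ∧ sufOf T (δ + 1) = c :: sufOf T δ := by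
  obtain ⟨w, rfl, hw⟩ := hT
  rw [List.length_append, List.length_singleton] at h2
  have hs : ∀ ε, 1 ≤ ε → sufOf (w ++ [⊥]) ε = w.drop (w.length + 1 - ε) ++ [⊥] := by
    intro ε hε
    rw [sufOf, List.length_append, List.length_singleton, List.drop_append_of_le_length (by omega)]
  have hlt : w.length - δ < w.length := by omega
  have hd : w.drop (w.length + 1 - (δ + 1)) = w[w.length - δ] :: w.drop (w.length + 1 - δ) := by
    rw [show w.length + 1 - (δ + 1) = w.length - δ by omega,
      show w.length + 1 - δ = w.length - δ + 1 by omega]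
    exact List.drop_eq_getElem_cons hlt
  rw [hs (δ + 1) (by omega), hd] at hc ⊢
  obtain rfl : w[w.length - δ] = c := by simpa using hc
  rw [hs δ h1]
  exact ⟨⟨_, rfl, fun hm => hw (List.mem_of_mem_drop hm)⟩,
    fun e => hw (e ▸ List.getElem_mem hlt), rfl⟩

theorem Tri.run_updateOp {α : ℕ} {c : A} {σ : Store A}
    {Φ : Store A → ℕ → Prop} (h : Tri (updateOp α c) σ fun _ σ' n => Φ σ' n) :
    Φ (updateStore α c σ) (updateTime α c σ) := by
  obtain ⟨b, σ', n, hΦ, e⟩ := h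
  have h0 := e 0
  rw [zero_add] at h0
  unfold updateStore updateTime
  rw [h0]
  exact hΦ

end

theorem mainTheorem4 :
    ∃ C : ℝ, ∀ (A : Type) [LinearOrder A] [OrderBot A] (T : List A) (_ : EndMarked T)
      (α : ℕ) (_ : 2 ≤ α) (δ : ℕ) (_ : 1 ≤ δ) (_ : δ < T.length)
      (c : A) (_ : (sufOf T (δ + 1)).head? = some c)
      (D : List (List A)) (_ : IsDBWT (bwt (sufOf T δ)) D) (_ : IsBalanced α (sufOf T δ) D)
      (σ : Store A) (_ : Holds α (sufOf T δ) D σ),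
      (updateTime α c σ : ℝ) ≤ C * (α + Real.logb 2 D.length) ∧
      ∃ D' : List (List A),
        IsDBWT (bwt (sufOf T (δ + 1))) D' ∧
        Holds α (sufOf T (δ + 1)) D' (updateStore α c σ) ∧
        IsBalanced (2 * α + 1) (sufOf T (δ + 1)) D' ∧
        {i : Fin D'.length | HeavyRep α (sufOf T (δ + 1)) D' i}.ncard ≤ 2 ∧
        {i : Fin D'.length | HeavyFInt α (sufOf T (δ + 1)) D' i}.ncard ≤ 2 := by
  -- The count is at most `19 * α + 30 * ht + 207` with `ht ≤ 1 + log₂ k`. Since `α ≥ 2`, the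
  -- constant `237` is absorbed by the remaining `131 * α`.
  refine ⟨150, ?_⟩
  intro A _ _ T hT α hα δ h1 h2 c hc D hD hbal σ ⟨u, v, π, hσ⟩
  obtain ⟨hS, hc, hs⟩ := hT.sufOf_succ h1 h2 hc
  rw [hs]
  have hS' := hS.cons hc
  obtain ⟨pos, hA⟩ := AHolds.of_holdsAt hS hD hσ
  have hb : ∀ s, ∀ y ∈ Side.pick (List.ofFn u) (List.ofFn (v ∘ π)) s,
      (σ.mem s y).inn.length < α := by
    rintro (_ | _) y hy
    · obtain ⟨i, rfl⟩ := List.mem_ofFn.1 hy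
      exact not_le.1 fun h => (hbal i).1 ((hσ.heavyRep_iff α i).2 h)
    · obtain ⟨i, rfl⟩ := (mem_ofFn_comp v π).1 hy
      exact not_le.1 fun h => (hbal i).2 ((hσ.heavyFInt_iff α i).2 h)
  obtain ⟨ht, hht, htri⟩ := hA.tri_updateOp hS hc hα hb
  obtain ⟨hn, l', pos', hA', hz⟩ := htri.run_updateOp
  constructor
  · have hk : 1 ≤ D.length := by
      have := List.length_pos_of_mem hA.dollar.1
      simpa [Side.pick, Nat.one_le_iff_ne_zero, Nat.pos_iff_ne_zero] using this
    -- The depth bound `k + 1` is weakened to `2 * k`, so that the logarithm splits into `1 + log₂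
    -- k`.
    have hlen : 2 ^ ht ≤ 2 * D.length := by
      have : (Side.pick (List.ofFn u) (List.ofFn (v ∘ π)) Side.U).length = D.length := by
        simp [Side.pick]
      omega
    have hlog : (ht : ℝ) ≤ 1 + Real.logb 2 D.length := by
      have h3 : (2 : ℝ) ^ (ht : ℝ) ≤ 2 * D.length := by
        rw [Real.rpow_natCast]
        exact_mod_cast hlen
      have h4 := (Real.le_logb_iff_rpow_le (b := 2) one_lt_two (by positivity)).2 h3
      rwa [Real.logb_mul two_ne_zero (by positivity), Real.logb_self_eq_one one_lt_two] at h4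
    have hl0 : 0 ≤ Real.logb 2 D.length := Real.logb_nonneg one_lt_two (by exact_mod_cast hk)
    have hn' : (updateTime α c σ : ℝ) ≤ 19 * α + 30 * ht + 207 := by exact_mod_cast hn
    have hα' : (2 : ℝ) ≤ α := by exact_mod_cast hα
    linarith
  · obtain ⟨D', hD', -, u', v', π', hσ', hu', hv'⟩ := hA'.exists_holdsAt hS'
    refine ⟨D', hD', ⟨u', v', π', hσ'⟩, fun i => ⟨fun hi => ?_, fun hi => ?_⟩, ?_, ?_⟩
    · obtain ⟨z, hz⟩ := hz .U
      have := (hz _ (hu' i)).1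
      have := (hσ'.heavyRep_iff _ i).1 hi
      omega
    · obtain ⟨z, hz⟩ := hz .V
      have := (hz _ (hv' i)).1
      have := (hσ'.heavyFInt_iff _ i).1 hi
      omega
    · obtain ⟨z, hz⟩ := hz .U
      -- All heavy nodes of one side coincide with `z`, so there is in fact at most one.
      refine le_trans ((Set.ncard_le_one_iff (Set.toFinite _)).2 fun {i j} hi hj => ?_) one_le_two
      exact hσ'.inj_u (((hz _ (hu' i)).2 ((hσ'.heavyRep_iff _ i).1 hi)).trans
        ((hz _ (hu' j)).2 ((hσ'.heavyRep_iff _ j).1 hj)).symm)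
    · obtain ⟨z, hz⟩ := hz .V
      refine le_trans ((Set.ncard_le_one_iff (Set.toFinite _)).2 fun {i j} hi hj => ?_) one_le_two
      exact hσ'.inj_v (((hz _ (hv' i)).2 ((hσ'.heavyFInt_iff _ i).1 hi)).trans
        ((hz _ (hv' j)).2 ((hσ'.heavyFInt_iff _ j).1 hj)).symm)
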